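/- All links are unoriented links in $\mathbb{R}^3\subset S^3$, considered up to ambient isotopy. **Generalized Mazur patterns.** Let $m,n\ge 1$. The generalized Mazur pattern $Q_{m,n}\subset S^1\times D^2$ is the following knot. Starting at a point of the solid torus (the bottom endpoint), wind $m$ times around the $S^1$ direction, then turn around and wind $n$ times in the opposite direction, moving monotonically in the radial direction (of the annulus $S^1\times[-1,1]\subset S^1\times D^2$), so that this arc is embedded in the annulus. Then join the top endpoint of the arc to the bottom endpoint by an arc that crosses under the first $n$ strands it meets (those winding backwards) and over the next $m$ strands (those winding forwards), which produces a clasp where the pattern turns around. The winding direction is chosen such that the clasp of $Q_{1,1}$ is positive, i.e. $Q_{1,1}$ is the pattern of the untwisted positive Whitehead double. The link associated with $Q_{m,n}$ is the two-component link formed by $Q_{m,n}$ and the meridian $\{\mathrm{pt}\}\times\partial D^2$ of the solid torus, where $S^1\times D^2$ is embedded in $\mathbb{R}^3$ as the standard unknotted, untwisted solid torus. **Rational links.** $C(a_1,\dots,a_k)$ denotes the closure of the rational tangle with Conway coefficients $a_1,\dots,a_k\in\mathbb{Z}$, drawn as a four-plat on strands $1,2,3,4$: the coefficients $a_1,a_3,\dots$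 (resp. $a_2,a_4,\dots$) are realized by $|a_i|$ half twists of strands $2,3$ (resp. $1,2$), successively from left to right, the twists being right-handed in the first case and left-handed in the second for positive coefficients; strands $1,2$ and $3,4$ are joined on the left, and on the right the same pairs are joined if $k$ is odd, the pairs $2,3$ and $1,4$ if $k$ is even. **Schubert normal form.** Let $p,q$ be coprime integers with $p>0$ and $0<|q|<p/2$. Let $S=\mathbb{R}^2/\langle 2\pi\mathbb{Z}^2,\,-1\rangle$ be the pillowcase sphere, embedded in $\mathbb{R}^3$ by $[x,y]\mapsto(\cos x,\cos y,-\sin x\sin y)$; its four corners are the images of $\pi\mathbb{Z}^2$. The $2$-bridge link $b(p,q)$ is the union of the two disjoint arcs on $S$ that are the images of the lines of slope $p/q$ through the points of $\pi\mathbb{Z}^2$ (the underpasses), and of the two edges of $S$ given by second coordinate $\pm1$, with interiors pushed slightly outside of $S$ (the straight bridges). With this orientation convention $b(3,1)$ is the right-handed trefoil. A link has Schubert normal form $b(p,q)$ if $(p,q)$ is such a pair and the link is isotopic to $b(p,q)$. **Proposition.** For all integers $m,n\ge1$, the link associated with $Q_{m,n}$ is isotopic to the rational link $C(2n,1,2m)$,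 and it has Schubert normal form $$b(4mn+2n+2m,\;2m+1).$$ -/

import Mathlib

noncomputable section

/-- Euclidean three-space, with coordinates `(x, y, z)`. It is used only as a topological space and
as a real vector space (for straight segments). Links live in `ℝ³ ⊂ S³`. -/
abbrev R3 : Type := ℝ × ℝ × ℝ

/-- Two subsets of `ℝ³` are (ambient) isotopic: a continuous one-parameter family of homeomorphisms
of `ℝ³`, starting at the identity, carries the first onto the second. Links are neither oriented nor
are their components ordered. -/
def AmbientIsotopic (K L : Set R3) : Prop :=
  ∃ H : unitInterval → (R3 ≃ₜ R3),
    Continuous (fun p : unitInterval × R3 => H p.1 p.2) ∧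
    H 0 = Homeomorph.refl R3 ∧
    H 1 '' K = L

/-- The polygonal path through the listed vertices. -/
def polygonalPath : List R3 → Set R3
  | a :: b :: l => segment ℝ a b ∪ polygonalPath (b :: l)
  | _ => ∅

/-! ### Patterns in the solid torus -/

/-- The solid torus `S¹ × D²`. -/
abbrev SolidTorus : Type := Circle × Metric.closedBall (0 : ℂ) 1

/-- The standard (unknotted, untwisted) embedding of the solid torus: the disc coordinate `u + iv`
is sent to radial coordinate `2 + u` and height `v`. -/
def standardEmbedding (x : SolidTorus) : R3 :=
  ((2 + (x.2 : ℂ).re) * (x.1 : ℂ).re, (2 + (x.2 : ℂ).re) * (x.1 : ℂ).im, (x.2 : ℂ).im)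

/-- The meridian `{i} × ∂D²` of the solid torus. -/
def solidTorusMeridian : Set SolidTorus :=
  {x | x.1 = Circle.exp (Real.pi / 2) ∧ ‖(x.2 : ℂ)‖ = 1}

/-- The link in `ℝ³ ⊂ S³` made of a pattern together with the meridian of the solid torus. -/
def patternMeridianLink (P : Set SolidTorus) : Set R3 :=
  standardEmbedding '' (P ∪ solidTorusMeridian)

/-- The generalized Mazur pattern as a path in coordinates `(t, u, v)`: `t` is the number of turns
around the solid torus, `u` (in units of one strand spacing) the radial position, `v` the height.
At height `0` the path winds `m` times around, turns back at `t = m + 1/2`, and winds `n` times in the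
opposite direction, `u` increasing throughout, so that this arc is embedded. Its last point is at
`t = m - n`, an integer, as is `t = 0` for its first point. The path then returns from the top
`u = m + n + 1` to the bottom `u = 0` along this integral value of `t`, where it meets in succession the
`n` backward strands at `u = m + n, …, m + 1` and the `m` forward strands at `u = m, …, 1`: it passes
under the former (height `-1`) and over the latter (height `1`). -/
def mazurPath (m n : ℕ) : Set R3 :=
  polygonalPath
    [ (0, 0, 0),
      ((m : ℝ) + 1 / 2, (m : ℝ) + 1 / 2, 0),
      ((m : ℝ) - n, (m : ℝ) + n + 1, 0),
      ((m : ℝ) - n, (m : ℝ) + n + 1, -1),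
      ((m : ℝ) - n, (m : ℝ) + 1 / 2, -1),
      ((m : ℝ) - n, (m : ℝ) + 1 / 2, 1),
      ((m : ℝ) - n, 0, 1),
      ((m : ℝ) - n, 0, 0) ]

/-- The generalized Mazur pattern `Q_{m,n}` in `S¹ × D²`: the path above, closed up by reading `t`
modulo `1` and rescaled into the interior of the solid torus (`|u'| ≤ 1/2` and `|v'| ≤ 1/2` in the disc
coordinate `u' + i v'`). The winding direction is the one for which the clasp of `Q_{1,1}` is positive,
so `Q_{1,1}` is the positive untwisted Whitehead double pattern. -/
def generalizedMazurPattern (m n : ℕ) : Set SolidTorus :=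
  {x | ∃ c ∈ mazurPath m n,
    x.1 = Circle.exp (-(2 * Real.pi * c.1)) ∧
    (x.2 : ℂ) = ⟨c.2.1 / ((m : ℝ) + n + 1) - 1 / 2, c.2.2 / 2⟩}

/-! ### Closures of rational tangles in Conway's normal form -/

/-- Over `i ≤ x ≤ i + 1`, the strands at `y = j` and `y = j + 1` twist around each other by `a` half
twists (forming right-handed helices if `a > 0`). -/
def twistRegion (i j : ℕ) (a : ℤ) : Set R3 :=
  {p | ∃ s ∈ Set.Icc (0 : ℝ) 1, ∃ r : ℝ, (r = 1 / 2 ∨ r = -(1 / 2)) ∧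
    p = ((i : ℝ) + s,
         (j : ℝ) + 1 / 2 + r * Real.cos (Real.pi * a * s),
         r * Real.sin (Real.pi * a * s))}

/-- Over `i ≤ x ≤ i + 1`, the straight strand at `y = j`. -/
def straightStrand (i j : ℕ) : Set R3 :=
  segment ℝ ((i : ℝ), (j : ℝ), 0) ((i : ℝ) + 1, (j : ℝ), 0)

/-- The `i`-th slab (counted from `0`) of Conway's normal form on the four strands `y = 1, 2, 3, 4`:
the coefficients `a₁, a₃, …` twist the strands `2, 3`, the coefficients `a₂, a₄, …` twist the strands
`1, 2` in the opposite sense, so that the diagram is alternating if all coefficients are positive. -/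
def conwaySlab (i : ℕ) (a : ℤ) : Set R3 :=
  if Even i then twistRegion i 2 a ∪ straightStrand i 1 ∪ straightStrand i 4
  else twistRegion i 1 (-a) ∪ straightStrand i 3 ∪ straightStrand i 4

/-- The planar arc joining `(x, y₁, 0)` to `(x, y₂, 0)` through the vertical line at `x'`. -/
def planarCap (x x' y₁ y₂ : ℝ) : Set R3 :=
  polygonalPath [(x, y₁, 0), (x', y₁, 0), (x', y₂, 0), (x, y₂, 0)]

/-- The link `C(a₁, …, a_k)`, the closure of the rational tangle with these Conway coefficients, drawn
as a four-plat. On the left the strands `1, 2` and `3, 4` are joined; on the right these same pairs if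
`k` is odd, and the pairs `2, 3` and `1, 4` if `k` is even. -/
def conwayLink (a : List ℤ) : Set R3 :=
  planarCap 0 (-1) 1 2 ∪ planarCap 0 (-1) 3 4 ∪
  (⋃ i : Fin a.length, conwaySlab i (a.get i)) ∪
  (if Odd a.length then
    planarCap a.length (a.length + 1) 1 2 ∪ planarCap a.length (a.length + 1) 3 4
  else
    planarCap a.length (a.length + 1) 2 3 ∪ planarCap a.length (a.length + 2) 1 4)

/-! ### Schubert's normal form -/

/-- The quotient map from the plane onto the pillowcase sphere
`{|x|, |y| ≤ 1, z² = (1 - x²)(1 - y²)}`. Two points have the same image exactly when they differ by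
a translation in `2πℤ²`, up to the point reflection `v ↦ -v`; the four corners `(±1, ±1, 0)` are the
images of `πℤ²`. -/
def pillowMap (v : ℝ × ℝ) : R3 :=
  (Real.cos v.1, Real.cos v.2, -(Real.sin v.1 * Real.sin v.2))

/-- The underpasses of `b(p, q)`: the image on the sphere of all lines of slope `p / q` through the
points of `πℤ²`. For coprime `p, q` these are two disjoint arcs joining the four corners, and each of
the edges `y = ±1` of the pillowcase is crossed `p - 1` times in its interior. -/
def schubertUnderpasses (p q : ℤ) : Set R3 :=
  pillowMap '' {v | ∃ k : ℤ, (p : ℝ) * v.1 - (q : ℝ) * v.2 = k * Real.pi}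

/-- The two straight bridges: the edges `y = 1` and `y = -1` of the pillowcase, with their interiors
pushed off the sphere to the outside. -/
def schubertBridges : Set R3 :=
  polygonalPath [(-1, 1, 0), (-1, 2, 0), (1, 2, 0), (1, 1, 0)] ∪
  polygonalPath [(-1, -1, 0), (-1, -2, 0), (1, -2, 0), (1, -1, 0)]

/-- The `2`-bridge link `b(p, q)` given by its Schubert diagram on the sphere. With the orientation
chosen here `b(3, 1)` is the right-handed trefoil. -/
def schubertLink (p q : ℤ) : Set R3 :=
  schubertUnderpasses p q ∪ schubertBridges

/-- `L` has Schubert normal form `b(p, q)`: the pair `(p, q)` is admissible, that is `p` and `q` are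
coprime with `p > 0` and `0 < |q| < p / 2`, and `L` is isotopic to `b(p, q)`. -/
def HasSchubertNormalForm (L : Set R3) (p q : ℤ) : Prop :=
  0 < p ∧ IsCoprime p q ∧ 0 < |q| ∧ 2 * |q| < p ∧ AmbientIsotopic L (schubertLink p q)

end

open Set Filter Topology

/-! ### Ambient isotopy as an equivalence relation -/

/-! All three links are deformed to one model, `commonModel`. One component is an unknotted polygon
containing a segment of the first coordinate axis. The other winds around that segment along two
helices, with `2 * n` and `2 * m` half turns, joined by a frame that does not depend on `m` and `n`.
The theorem then follows from `isotopic_patternMeridianLink_commonModel`,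
`isotopic_conwayLink_commonModel`, `isotopic_schubertLink_claspModel` and
`isotopic_claspModel_commonModel`, because isotopy is an equivalence relation.

For the pattern, the inner arc of the meridian is pulled onto the axis of rotation of the solid
torus, around which the `m` forward strands already wind. A rotation by an angle depending on the
radius unwinds the `n` backward strands and makes the arc passing under them wind around the axis
instead. A shear along the axis and a change of radius turn both spirals into helices.

For the Conway form, the third strand returns to its place after each twist region, since `2 * n`
and `2 * m` are even. Contracting it to the common core of both regions leaves the second strand as
a helix around it. A flype turns the part of the link to the right of the single crossing over, and
a polygonal simplification gives the model.

For the Schubert form, put `q = 2 * m + 1` and `k = 2 * n + 1`, so that `q * k = p + 1` and `k`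
inverts `q` modulo `p`. The shear `(x, y) ↦ (x, y - k * x)` of the plane takes the lines of slope `p
/ q` to `x = -(q * y + j * π)`. It is induced by a homeomorphism of space, `pillowTwist`, which is
isotopic to the identity. Afterwards the two underpasses coil around each other with `q` half turns
and the two bridges with `k` half turns. The winding of the bridges is transferred to their legs,
and in each of the two pairs one strand is pulled to the core. This gives two clasped twist regions
on perpendicular axes, `claspModel`; a quarter turn of one of them leads to the common model.

Two kinds of isotopy are used. Some are explicit families of homeomorphisms: slides, twists, radial
maps, and maps that are linear on each plane `x = const`. The others move one strand, monotone in a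
linear functional, across a region that the rest of the link avoids (`isotopic_move`). Triangle
moves are a special case of the latter, and long sequences of them on integral polygons are verified
by evaluating `checkMoves`. The curves that depend on `m` and `n` enter such a computation only
through fixed boxes containing them, so one evaluation serves all `m` and `n`. -/

theorem AmbientIsotopic.refl (K : Set R3) : AmbientIsotopic K K :=
  ⟨fun _ => Homeomorph.refl R3, continuous_snd, rfl, by simp⟩

theorem AmbientIsotopic.of_eq {K L : Set R3} (h : K = L) : AmbientIsotopic K L :=
  h ▸ AmbientIsotopic.refl K

theorem AmbientIsotopic.trans {K L M : Set R3} (h : AmbientIsotopic K L)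
    (h' : AmbientIsotopic L M) : AmbientIsotopic K M := by
  obtain ⟨H, hc, h0, h1⟩ := h
  obtain ⟨G, gc, g0, g1⟩ := h'
  refine ⟨fun t => (H t).trans (G t), ?_, ?_, ?_⟩
  · exact gc.comp (continuous_fst.prodMk hc)
  · simp [h0, g0]; rfl
  · rw [← g1, ← h1, image_image]
    rfl

theorem AmbientIsotopic.symm {K L : Set R3} (h : AmbientIsotopic K L) : AmbientIsotopic L K := by
  obtain ⟨H, hc, h0, h1⟩ := h
  -- Running the isotopy backwards, preceded by the inverse of its final map, makes it start at the
  -- identity.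
  refine ⟨fun t => (H 1).symm.trans (H (unitInterval.symm t)), ?_, ?_, ?_⟩
  · exact hc.comp ((unitInterval.continuous_symm.comp continuous_fst).prodMk
      ((H 1).symm.continuous.comp continuous_snd))
  · ext x : 1
    simp
  · rw [← h1]
    simp [image_image, h0]

/-! ### Isotopies from families of maps -/

/-- The homeomorphism given by a continuous bijection of at least linear growth. -/
theorem exists_homeomorph_of_growth {f : R3 → R3} (hf : Continuous f)
    (hb : Function.Bijective f) (hp : ∃ c > 0, ∃ C : ℝ, ∀ p, c * ‖p‖ - C ≤ ‖f p‖) :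
    ∃ h : R3 ≃ₜ R3, ∀ p, h p = f p := by
  obtain ⟨c, hc, C, hC⟩ := hp
  have h1 : Tendsto f (cocompact R3) (cocompact R3) := by
    rw [← Metric.cobounded_eq_cocompact, ← tendsto_norm_atTop_iff_cobounded]
    refine tendsto_atTop_mono hC ?_
    have : Tendsto (fun p : R3 => ‖p‖) (Bornology.cobounded R3) atTop := tendsto_norm_cobounded_atTop
    exact tendsto_atTop_add_const_right _ _ (this.const_mul_atTop hc)
  -- Linear growth makes the map proper, hence closed; a closed continuous bijection is a
  -- homeomorphism.
  have h2 : IsProperMap f := isProperMap_iff_tendsto_cocompact.2 ⟨hf, h1⟩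
  exact ⟨(Equiv.ofBijective f hb).toHomeomorphOfContinuousClosed hf h2.isClosedMap, fun _ => rfl⟩

/-- Composing with the inverse of `F 0` normalises the family to start at the identity. Only that
one inverse occurs, so no continuity of the inverses in the parameter is needed. -/
theorem isotopic_of_family {F : ℝ → R3 → R3} (hF : Continuous fun p : ℝ × R3 => F p.1 p.2)
    (hb : ∀ t ∈ Icc (0 : ℝ) 1, Function.Bijective (F t))
    (hp : ∀ t ∈ Icc (0 : ℝ) 1, ∃ c > 0, ∃ C : ℝ, ∀ p, c * ‖p‖ - C ≤ ‖F t p‖) (K : Set R3) :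
    AmbientIsotopic (F 0 '' K) (F 1 '' K) := by
  have hc : ∀ t, Continuous (F t) := fun t => hF.comp (continuous_const.prodMk continuous_id)
  choose h hh using fun t : unitInterval =>
    exists_homeomorph_of_growth (hc t) (hb t t.2) (hp t t.2)
  refine ⟨fun t => (h 0).symm.trans (h t), ?_, ?_, ?_⟩
  · have : (fun p : unitInterval × R3 => ((h 0).symm.trans (h p.1)) p.2) =
        (fun p : ℝ × R3 => F p.1 p.2) ∘ fun p : unitInterval × R3 => ((p.1 : ℝ), (h 0).symm p.2) := by
      ext1 p
      simp [hh]
    rw [this]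
    exact hF.comp ((continuous_subtype_val.comp continuous_fst).prodMk
      ((h 0).symm.continuous.comp continuous_snd))
  · ext x : 1
    simp
  · have e0 : F 0 = h 0 := funext fun p => by simp [hh]
    have e1 : F 1 = h 1 := funext fun p => by simp [hh]
    rw [e0, e1, image_image]
    simp

theorem isotopic_image_of_family {F : ℝ → R3 → R3}
    (hF : Continuous fun p : ℝ × R3 => F p.1 p.2) (h0 : ∀ p, F 0 p = p)
    (hb : ∀ t ∈ Icc (0 : ℝ) 1, Function.Bijective (F t))
    (hp : ∀ t ∈ Icc (0 : ℝ) 1, ∃ c > 0, ∃ C : ℝ, ∀ p, c * ‖p‖ - C ≤ ‖F t p‖) (K : Set R3) :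
    AmbientIsotopic K (F 1 '' K) := by
  have := isotopic_of_family hF hb hp K
  rwa [show F 0 = id from funext h0, image_id] at this

/-- A continuous family of maps with explicit inverses. -/
theorem isotopic_of_inverse_family {F G : ℝ → R3 → R3}
    (hF : Continuous fun p : ℝ × R3 => F p.1 p.2) (hG : ∀ t, Continuous (G t))
    (h0 : ∀ p, F 0 p = p)
    (hl : ∀ t ∈ Icc (0 : ℝ) 1, ∀ p, G t (F t p) = p)
    (hr : ∀ t ∈ Icc (0 : ℝ) 1, ∀ p, F t (G t p) = p) (K : Set R3) :
    AmbientIsotopic K (F 1 '' K) := by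
  have hc : ∀ t, Continuous (F t) := fun t => hF.comp (continuous_const.prodMk continuous_id)
  refine ⟨fun t => ⟨⟨F t, G t, hl t t.2, hr t t.2⟩, hc t, hG t⟩, ?_, ?_, ?_⟩
  · exact hF.comp ((continuous_subtype_val.comp continuous_fst).prodMk continuous_snd)
  · ext x : 1
    simp [h0]
  · simp

/-! ### Moving one strand -/

/-- The displacement field at level `x` that carries `s` to `s + e` and is supported in the ball of
radius `2‖e‖` about `s`. -/
noncomputable def bumpField (s e p : R3) : R3 := max 0 (1 - ‖p - s‖ / (2 * ‖e‖)) • e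

theorem norm_bumpField_le (s e p : R3) : ‖bumpField s e p‖ ≤ ‖e‖ := by
  unfold bumpField
  rw [norm_smul, Real.norm_eq_abs, abs_of_nonneg (le_max_left _ _)]
  have h : max 0 (1 - ‖p - s‖ / (2 * ‖e‖)) ≤ 1 :=
    max_le zero_le_one (by linarith [show 0 ≤ ‖p - s‖ / (2 * ‖e‖) by positivity])
  nlinarith [norm_nonneg e]

theorem bumpField_self (s e : R3) : bumpField s e s = e := by simp [bumpField]

theorem bumpField_zero (s p : R3) : bumpField s 0 p = 0 := by simp [bumpField]

theorem bumpField_of_far {s e p : R3} (h : 2 * ‖e‖ ≤ ‖p - s‖) : bumpField s e p = 0 := by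
  by_cases he : e = 0
  · simp [bumpField, he]
  have : 0 < 2 * ‖e‖ := by positivity
  have h1 : 1 ≤ ‖p - s‖ / (2 * ‖e‖) := by rwa [one_le_div this]
  rw [bumpField, max_eq_left (by linarith), zero_smul]

/-- The profile has slope `1 / (2 * ‖e‖)` and multiplies a vector of length `‖e‖`. A Lipschitz
constant below `1` is what makes the identity plus this field bijective. -/
theorem norm_bumpField_sub_le (s e p q : R3) :
    ‖bumpField s e p - bumpField s e q‖ ≤ 1 / 2 * ‖p - q‖ := by
  by_cases he : e = 0
  · simp [bumpField, he]
  have h0 : 0 < ‖e‖ := by positivity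
  unfold bumpField
  rw [← sub_smul, norm_smul, Real.norm_eq_abs]
  have h1 : |max 0 (1 - ‖p - s‖ / (2 * ‖e‖)) - max 0 (1 - ‖q - s‖ / (2 * ‖e‖))| ≤
      ‖p - q‖ / (2 * ‖e‖) := by
    rw [max_comm 0, max_comm 0]
    refine (abs_max_sub_max_le_abs _ _ _).trans ?_
    rw [show (1 - ‖p - s‖ / (2 * ‖e‖)) - (1 - ‖q - s‖ / (2 * ‖e‖)) =
      (‖q - s‖ - ‖p - s‖) / (2 * ‖e‖) by ring, abs_div, abs_of_pos (show 0 < 2 * ‖e‖ by positivity)]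
    gcongr
    refine (abs_norm_sub_norm_le _ _).trans ?_
    rw [sub_sub_sub_cancel_right, norm_sub_rev]
  calc _ ≤ ‖p - q‖ / (2 * ‖e‖) * ‖e‖ := by gcongr
    _ = _ := by field_simp

/-- Only parameters with `e = 0` are delicate, where the formula divides by zero; there the bound by
`‖e‖` squeezes the field to `0`. -/
theorem continuous_bumpField {X : Type*} [TopologicalSpace X] {s e p : X → R3}
    (hs : Continuous s) (he : Continuous e) (hp : Continuous p) :
    Continuous fun x => bumpField (s x) (e x) (p x) := by
  rw [continuous_iff_continuousAt]
  intro x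
  by_cases hx : e x = 0
  · rw [ContinuousAt, hx, bumpField_zero]
    refine squeeze_zero_norm (fun y => norm_bumpField_le _ _ _) ?_
    have := he.norm.tendsto x
    rwa [hx, norm_zero] at this
  · have : 2 * ‖e x‖ ≠ 0 := by positivity
    unfold bumpField
    refine ContinuousAt.smul (M := ℝ) ?_ he.continuousAt
    refine continuousAt_const.max (continuousAt_const.sub ?_)
    exact (hp.sub hs).norm.continuousAt.div (continuous_const.mul he.norm).continuousAt this

/-- Each level of `lam` is pushed by its own bump field. The field is parallel to the levels, so
levels are preserved, and on each of them the map is the identity plus a contraction. The support at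
a level is a ball of radius twice the displacement, which `hK` keeps clear of `K`. -/
theorem isotopic_move_of_small {lam : R3 →L[ℝ] ℝ} {l r : ℝ} (hlr : l ≤ r) {σ d : ℝ → R3}
    (hσ : ContinuousOn σ (Icc l r)) (hd : ContinuousOn d (Icc l r))
    (hlσ : ∀ x ∈ Icc l r, lam (σ x) = x) (hld : ∀ x ∈ Icc l r, lam (d x) = 0)
    (hl : d l = 0) (hr : d r = 0) {K : Set R3}
    (hK : ∀ q ∈ K, lam q ∈ Icc l r → 2 * ‖d (lam q)‖ ≤ ‖q - σ (lam q)‖) :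
    AmbientIsotopic (K ∪ σ '' Icc l r) (K ∪ (fun x => σ x + d x) '' Icc l r) := by
  -- Both paths are extended by constants; since `d` vanishes at the ends, nothing moves at levels
  -- outside `[l, r]`.
  set s : ℝ → R3 := fun x => σ (projIcc l r hlr x)
  set e : ℝ → R3 := fun x => d (projIcc l r hlr x)
  have hs : Continuous s := hσ.comp_continuous (continuous_subtype_val.comp continuous_projIcc)
    fun x => (projIcc l r hlr x).2
  have he : Continuous e := hd.comp_continuous (continuous_subtype_val.comp continuous_projIcc)
    fun x => (projIcc l r hlr x).2
  have hle : ∀ x, lam (e x) = 0 := fun x => hld _ (projIcc l r hlr x).2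
  have hin : ∀ x ∈ Icc l r, s x = σ x ∧ e x = d x := fun x hx => by
    simp only [s, e, projIcc_of_mem hlr hx, and_self]
  have hout : ∀ x, x ∉ Icc l r → e x = 0 := by
    intro x hx
    rw [mem_Icc, not_and_or, not_le, not_le] at hx
    rcases hx with hx | hx
    · simp only [e, projIcc_of_le_left hlr hx.le, hl]
    · simp only [e, projIcc_of_right_le hlr hx.le, hr]
  obtain ⟨B, hB⟩ : ∃ B, ∀ x, ‖e x‖ ≤ B := by
    obtain ⟨B, hB⟩ := isCompact_Icc.exists_bound_of_continuousOn hd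
    exact ⟨B, fun x => hB _ (projIcc l r hlr x).2⟩
  set F : ℝ → R3 → R3 := fun t p => p + t • bumpField (s (lam p)) (e (lam p)) p
  have hlb : ∀ x p, lam (bumpField (s x) (e x) p) = 0 := fun x p => by simp [bumpField, hle]
  have hF : Continuous fun p : ℝ × R3 => F p.1 p.2 := by
    have hlam : Continuous fun p : ℝ × R3 => lam p.2 := lam.continuous.comp continuous_snd
    exact continuous_snd.add (continuous_fst.smul
      (continuous_bumpField (hs.comp hlam) (he.comp hlam) continuous_snd))
  have key : ∀ t ∈ Icc (0 : ℝ) 1, ∀ x p q, ‖t • bumpField (s x) (e x) p - t • bumpField (s x) (e x) q‖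
      ≤ 1 / 2 * ‖p - q‖ := by
    intro t ht x p q
    rw [← smul_sub, norm_smul, Real.norm_eq_abs, abs_of_nonneg ht.1]
    have := norm_bumpField_sub_le (s x) (e x) p q
    nlinarith [norm_nonneg (bumpField (s x) (e x) p - bumpField (s x) (e x) q), ht.1, ht.2]
  have main := isotopic_image_of_family hF (fun p => by simp [F]) ?_ ?_ (K ∪ σ '' Icc l r)
  · convert main using 1
    rw [image_union, image_image]
    congr 1
    · symm
      trans id '' K
      · refine image_congr fun q hq => ?_
        simp only [F, one_smul, id]
        by_cases hx : lam q ∈ Icc l r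
        · rw [bumpField_of_far, add_zero]
          rw [(hin _ hx).1, (hin _ hx).2]
          exact hK q hq hx
        · rw [hout _ hx, bumpField_zero, add_zero]
      · simp
    · refine image_congr fun x hx => ?_
      simp only [F, one_smul, hlσ x hx, (hin x hx).1, (hin x hx).2, bumpField_self]
  · intro t ht
    constructor
    · intro p q hpq
      have h1 : lam p = lam q := by
        have := congrArg lam hpq
        simpa [F, hlb] using this
      have h2 := key t ht (lam p) p q
      simp only [F, ← h1] at hpq
      have h3 : p - q = -(t • bumpField (s (lam p)) (e (lam p)) p -
          t • bumpField (s (lam p)) (e (lam p)) q) := by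
        rw [← sub_eq_zero] at hpq
        rw [← sub_eq_zero, ← hpq]; abel
      have h4 : ‖p - q‖ ≤ 1 / 2 * ‖p - q‖ := by
        nth_rewrite 1 [h3]
        rwa [norm_neg]
      have : ‖p - q‖ ≤ 0 := by linarith
      exact sub_eq_zero.1 (norm_le_zero_iff.1 this)
    · intro q
      -- A preimage of `q` is a fixed point of this contraction; its level is that of `q`, so the
      -- field may be taken at `lam q`.
      set G : R3 → R3 := fun p => q - t • bumpField (s (lam q)) (e (lam q)) p
      have hG : ContractingWith (1 / 2) G := by
        refine ⟨by rw [← NNReal.coe_lt_coe]; norm_num, LipschitzWith.of_dist_le_mul fun p p' => ?_⟩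
        rw [dist_eq_norm, dist_eq_norm]
        have := key t ht (lam q) p' p
        simp only [G, sub_sub_sub_cancel_left]
        rw [norm_sub_rev p p']
        simpa using this
      refine ⟨hG.fixedPoint, ?_⟩
      have h1 : G hG.fixedPoint = hG.fixedPoint := hG.fixedPoint_isFixedPt
      set p := hG.fixedPoint
      have h2 : lam p = lam q := by
        rw [← h1]; simp [G, hlb]
      simp only [F, h2]
      nth_rewrite 1 [← h1]
      simp [G]
  · intro t ht
    refine ⟨1, one_pos, B, fun p => ?_⟩
    have h1 : ‖t • bumpField (s (lam p)) (e (lam p)) p‖ ≤ B := by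
      rw [norm_smul, Real.norm_eq_abs, abs_of_nonneg ht.1]
      have := (norm_bumpField_le (s (lam p)) (e (lam p)) p).trans (hB _)
      nlinarith [norm_nonneg (bumpField (s (lam p)) (e (lam p)) p), ht.1, ht.2]
    have h2 : ‖p‖ ≤ ‖F t p‖ + ‖t • bumpField (s (lam p)) (e (lam p)) p‖ := by
      have := norm_sub_le (F t p) (t • bumpField (s (lam p)) (e (lam p)) p)
      simpa [F] using this
    linarith

/-- `K` keeps away, at every level of `lam` in `[l, r]`, from the segment swept by the strand `σ`
on its way to `τ`, by a distance comparable to the length of that segment. -/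
def Clear (lam : R3 →L[ℝ] ℝ) (l r : ℝ) (σ τ : ℝ → R3) (K : Set R3) : Prop :=
  ∃ c > 0, ∀ q ∈ K, lam q ∈ Icc l r → ∀ t ∈ Icc (0 : ℝ) 1,
    c * ‖τ (lam q) - σ (lam q)‖ ≤ ‖q - (σ (lam q) + t • (τ (lam q) - σ (lam q)))‖

theorem isotopic_move {lam : R3 →L[ℝ] ℝ} {l r : ℝ} (hlr : l ≤ r) {σ τ : ℝ → R3}
    (hσ : ContinuousOn σ (Icc l r)) (hτ : ContinuousOn τ (Icc l r))
    (hlσ : ∀ x ∈ Icc l r, lam (σ x) = x) (hlτ : ∀ x ∈ Icc l r, lam (τ x) = x)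
    (hl : σ l = τ l) (hr : σ r = τ r) {K : Set R3} (hK : Clear lam l r σ τ K) :
    AmbientIsotopic (K ∪ σ '' Icc l r) (K ∪ τ '' Icc l r) := by
  obtain ⟨c, hc, hK⟩ := hK
  -- Each of `N` equal steps displaces the strand by `1 / N` of the whole way and needs twice that
  -- as clearance, so `2 / N < c` suffices.
  obtain ⟨N, hN⟩ := exists_nat_gt (2 / c)
  have hN0 : (0 : ℝ) < N := lt_trans (by positivity) hN
  set ρ : ℕ → ℝ → R3 := fun j x => σ x + ((j : ℝ) / N) • (τ x - σ x)
  have step : ∀ j ≤ N, AmbientIsotopic (K ∪ σ '' Icc l r) (K ∪ ρ j '' Icc l r) := by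
    intro j
    induction j with
    | zero => intro _; simpa [ρ] using AmbientIsotopic.refl _
    | succ j ih =>
      intro hj
      refine (ih (by omega)).trans ?_
      have := isotopic_move_of_small (lam := lam) hlr (σ := ρ j)
        (d := fun x => (1 / (N : ℝ)) • (τ x - σ x)) (K := K) ?_ ?_ ?_ ?_ ?_ ?_ ?_
      · convert this using 2
        refine image_congr fun x _ => ?_
        simp only [ρ]
        push_cast
        module
      · simp only [ρ]; fun_prop
      · fun_prop
      · intro x hx; simp [ρ, hlσ x hx, hlτ x hx]
      · intro x hx; simp [hlσ x hx, hlτ x hx]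
      · simp [hl]
      · simp [hr]
      · intro q hq hx
        have hj' : (j : ℝ) ≤ N := by exact_mod_cast (by omega : j ≤ N)
        refine le_trans ?_ (hK q hq hx (j / N) ⟨by positivity, by rwa [div_le_one hN0]⟩)
        rw [norm_smul, ← mul_assoc]
        gcongr
        rw [Real.norm_eq_abs, abs_of_pos (by positivity)]
        rw [div_lt_iff₀ hc] at hN
        rw [mul_one_div, div_le_iff₀ hN0]
        linarith
  have := step N le_rfl
  convert this using 2
  refine image_congr fun x _ => ?_
  simp [ρ, div_self hN0.ne']

theorem Clear.union {lam : R3 →L[ℝ] ℝ} {l r : ℝ} {σ τ : ℝ → R3} {K L : Set R3}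
    (hK : Clear lam l r σ τ K) (hL : Clear lam l r σ τ L) : Clear lam l r σ τ (K ∪ L) := by
  obtain ⟨c, hc, hK⟩ := hK
  obtain ⟨c', hc', hL⟩ := hL
  refine ⟨min c c', lt_min hc hc', ?_⟩
  rintro q (hq | hq) hx t ht
  · exact le_trans (by gcongr; exact min_le_left _ _) (hK q hq hx t ht)
  · exact le_trans (by gcongr; exact min_le_right _ _) (hL q hq hx t ht)

theorem Clear.mono {lam : R3 →L[ℝ] ℝ} {l r : ℝ} {σ τ : ℝ → R3} {K L : Set R3}
    (hK : Clear lam l r σ τ K) (h : L ⊆ K) : Clear lam l r σ τ L := by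
  obtain ⟨c, hc, hK⟩ := hK
  exact ⟨c, hc, fun q hq => hK q (h hq)⟩

/-- At the end levels the two strands agree, so the required clearance is zero there and `K` may
even touch the strand. -/
theorem clear_of_outside {lam : R3 →L[ℝ] ℝ} {l r : ℝ} {σ τ : ℝ → R3} {K : Set R3}
    (hl : σ l = τ l) (hr : σ r = τ r) (h : ∀ q ∈ K, lam q ≤ l ∨ r ≤ lam q) :
    Clear lam l r σ τ K := by
  refine ⟨1, one_pos, fun q hq hx t _ => ?_⟩
  have : τ (lam q) - σ (lam q) = 0 := by
    rcases h q hq with h | h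
    · rw [le_antisymm h hx.1, hl, sub_self]
    · rw [le_antisymm hx.2 h, hr, sub_self]
  simp [this]

/-- A wall `{k = ℓ}` separating `K` from the swept region. -/
theorem clear_of_wall {lam : R3 →L[ℝ] ℝ} {l r : ℝ} {σ τ : ℝ → R3} {K : Set R3}
    (ℓ : R3 →L[ℝ] ℝ) (k : ℝ) {C : ℝ} (hC : 0 < C) (hK : ∀ q ∈ K, lam q ∈ Icc l r → ℓ q ≤ k)
    (hσ : ∀ x ∈ Icc l r, C * ‖τ x - σ x‖ ≤ ℓ (σ x) - k)
    (hτ : ∀ x ∈ Icc l r, C * ‖τ x - σ x‖ ≤ ℓ (τ x) - k) :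
    Clear lam l r σ τ K := by
  have hℓ : 0 < ‖ℓ‖ + 1 := by positivity
  refine ⟨C / (‖ℓ‖ + 1), by positivity, fun q hq hx t ht => ?_⟩
  have h1 := hσ _ hx
  have h2 := hτ _ hx
  have h3 := hK q hq hx
  set x := lam q
  set w := q - (σ x + t • (τ x - σ x))
  -- The height above the wall at parameter `t` is a convex combination of the heights of the two
  -- strands.
  have h4 : C * ‖τ x - σ x‖ ≤ -ℓ w := by
    have : -ℓ w = (1 - t) * (ℓ (σ x) - k) + t * (ℓ (τ x) - k) + (k - ℓ q) := by
      simp only [w, map_sub, map_add, map_smul, smul_eq_mul]; ring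
    rw [this]
    nlinarith [mul_nonneg (sub_nonneg.2 ht.2) (sub_nonneg.2 h1), mul_nonneg ht.1 (sub_nonneg.2 h2)]
  have h5 : -ℓ w ≤ (‖ℓ‖ + 1) * ‖w‖ := by
    have := (neg_le_abs (ℓ w)).trans (ℓ.le_opNorm w)
    linarith [norm_nonneg w]
  rw [div_mul_eq_mul_div, div_le_iff₀ hℓ]
  linarith

/-! ### Triangle moves -/

/-- The linear functional `⟪w, ·⟫` on `ℝ³`. -/
noncomputable def dotL (w : R3) : R3 →L[ℝ] ℝ :=
  w.1 • ContinuousLinearMap.fst ℝ ℝ (ℝ × ℝ) +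
    (w.2.1 • (ContinuousLinearMap.fst ℝ ℝ ℝ).comp (ContinuousLinearMap.snd ℝ ℝ (ℝ × ℝ)) +
      w.2.2 • (ContinuousLinearMap.snd ℝ ℝ ℝ).comp (ContinuousLinearMap.snd ℝ ℝ (ℝ × ℝ)))

@[simp] theorem dotL_apply (w p : R3) : dotL w p = w.1 * p.1 + (w.2.1 * p.2.1 + w.2.2 * p.2.2) := by
  simp [dotL]

/-- The point at parameter `x` of the edge from `a` to `c`. -/
noncomputable def edgePath (a c : R3) (x : ℝ) : R3 := a + x • (c - a)

/-- The point at parameter `x` of the path from `a` over `b` to `c`. -/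
noncomputable def tentPath (a b c : R3) (x : ℝ) : R3 :=
  a + x • (c - a) + (2 * min x (1 - x)) • (b - (1 / 2 : ℝ) • (a + c))

theorem image_edgePath (a c : R3) : edgePath a c '' Icc 0 1 = segment ℝ a c :=
  (segment_eq_image' ℝ a c).symm

theorem image_tentPath (a b c : R3) :
    tentPath a b c '' Icc 0 1 = segment ℝ a b ∪ segment ℝ b c := by
  rw [← Icc_union_Icc_eq_Icc (show (0 : ℝ) ≤ 1 / 2 by norm_num) (by norm_num), image_union,
    segment_eq_image', segment_eq_image']
  congr 1
  · have : Icc (0 : ℝ) 1 = (fun x => 2 * x) '' Icc 0 (1 / 2) := by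
      rw [image_mul_left_Icc (by norm_num) (by norm_num)]; norm_num
    rw [this, image_image]
    refine image_congr fun x hx => ?_
    rw [tentPath, min_eq_left (by linarith [hx.2])]
    module
  · have : Icc (0 : ℝ) 1 = (fun x => 2 * x + -1) '' Icc (1 / 2) 1 := by
      rw [image_affine_Icc' two_pos]
      norm_num
    rw [this, image_image]
    refine image_congr fun x hx => ?_
    rw [tentPath, min_eq_right (by linarith [hx.1])]
    module

/-- The triangle move replacing `ac` by `ab ∪ bc` is unobstructed by `K`. -/
def TriangleClear (a b c : R3) (K : Set R3) : Prop :=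
  ∀ lam : R3 →L[ℝ] ℝ, lam (c - a) = 1 → lam (b - (1 / 2 : ℝ) • (a + c)) = 0 →
    Clear lam (lam a) (lam a + 1) (fun x => edgePath a c (x - lam a))
      (fun x => tentPath a b c (x - lam a)) K

theorem TriangleClear.union {a b c : R3} {K L : Set R3} (hK : TriangleClear a b c K)
    (hL : TriangleClear a b c L) : TriangleClear a b c (K ∪ L) :=
  fun lam h1 h2 => (hK lam h1 h2).union (hL lam h1 h2)

theorem TriangleClear.mono {a b c : R3} {K L : Set R3} (hK : TriangleClear a b c K)
    (h : L ⊆ K) : TriangleClear a b c L := fun lam h1 h2 => (hK lam h1 h2).mono h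

theorem triangleClear_empty (a b c : R3) : TriangleClear a b c ∅ :=
  fun _ _ _ => ⟨1, one_pos, fun _ h => h.elim⟩

/-- The edge and the tent agree at `a` and `c`, so the clearance only has to grow like the distance
to the nearer end, and `a` or `c` may lie on the wall. They may not both do so, for then the edge
`ac` would lie in the wall. -/
theorem triangleClear_of_wall {a b c : R3} {K : Set R3} (ℓ : R3 →L[ℝ] ℝ) (k : ℝ)
    (hK : ∀ q ∈ K, ℓ q ≤ k) (ha : k ≤ ℓ a) (hb : k < ℓ b) (hc : k ≤ ℓ c)
    (hac : k < ℓ a ∨ k < ℓ c) : TriangleClear a b c K := by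
  intro lam h1 h2
  set v := b - (1 / 2 : ℝ) • (a + c) with hv
  -- A common lower bound for the rate at which edge and tent leave the wall, measured against `min
  -- x (1 - x)`.
  set A := min ((ℓ a - k) + (ℓ c - k)) (2 * (ℓ b - k))
  have hA : 0 < A := lt_min (by rcases hac with h | h <;> linarith) (by linarith)
  have hA1 : A ≤ (ℓ a - k) + (ℓ c - k) := min_le_left _ _
  have hA2 : A ≤ 2 * (ℓ b - k) := min_le_right _ _
  have hN : 0 < 2 * (‖v‖ + 1) := by positivity
  have hd : ∀ x ∈ Icc (lam a) (lam a + 1), A / (2 * (‖v‖ + 1)) *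
      ‖tentPath a b c (x - lam a) - edgePath a c (x - lam a)‖ ≤
        A * min (x - lam a) (1 - (x - lam a)) := by
    intro x hx
    have hm : 0 ≤ min (x - lam a) (1 - (x - lam a)) :=
      le_min (by linarith [hx.1]) (by linarith [hx.2])
    rw [tentPath, edgePath, add_sub_cancel_left, norm_smul, Real.norm_eq_abs,
      abs_of_nonneg (by positivity), div_mul_eq_mul_div, div_le_iff₀ hN, ← hv]
    nlinarith [norm_nonneg v, mul_nonneg hA.le hm]
  refine clear_of_wall ℓ k (C := A / (2 * (‖v‖ + 1))) (by positivity) (fun q hq _ => hK q hq) ?_ ?_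
  · intro x hx
    refine (hd x hx).trans ?_
    simp only [edgePath, map_add, map_smul, map_sub, smul_eq_mul]
    set τ := x - lam a with hτ
    have h0 : 0 ≤ τ := by linarith [hx.1]
    have h3 : τ ≤ 1 := by linarith [hx.2]
    have h4 := min_le_left τ (1 - τ)
    have h5 := min_le_right τ (1 - τ)
    have h6 : 0 ≤ min τ (1 - τ) := le_min h0 (by linarith)
    nlinarith [mul_nonneg (sub_nonneg.2 ha) (sub_nonneg.2 h5),
      mul_nonneg (sub_nonneg.2 hc) (sub_nonneg.2 h4), mul_nonneg h6 (sub_nonneg.2 hA1)]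
  · intro x hx
    refine (hd x hx).trans ?_
    simp only [tentPath, map_add, map_smul, map_sub, smul_eq_mul]
    set τ := x - lam a with hτ
    have h0 : 0 ≤ τ := by linarith [hx.1]
    have h3 : τ ≤ 1 := by linarith [hx.2]
    rcases le_total τ (1 - τ) with h | h
    · rw [min_eq_left h]
      nlinarith [mul_nonneg h0 (sub_nonneg.2 hA2), mul_nonneg (sub_nonneg.2 h) (sub_nonneg.2 ha)]
    · rw [min_eq_right h]
      nlinarith [mul_nonneg (sub_nonneg.2 h3) (sub_nonneg.2 hA2),
        mul_nonneg (sub_nonneg.2 h) (sub_nonneg.2 hc)]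

/-- The cross product. -/
def crossR (u v : R3) : R3 :=
  (u.2.1 * v.2.2 - u.2.2 * v.2.1, u.2.2 * v.1 - u.1 * v.2.2, u.1 * v.2.1 - u.2.1 * v.1)

/-- The vector `v × (u × v)` is orthogonal to `v` and pairs with `u` to `|u × v|²`, which is
nonzero; it remains to normalise. -/
theorem exists_level_functional {u v : R3} (h : crossR u v ≠ 0) :
    ∃ lam : R3 →L[ℝ] ℝ, lam u = 1 ∧ lam v = 0 := by
  set w := crossR v (crossR u v)
  have hw : dotL w u = (crossR u v).1 ^ 2 + (crossR u v).2.1 ^ 2 + (crossR u v).2.2 ^ 2 := by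
    simp only [w, dotL_apply, crossR]; ring
  have hv : dotL w v = 0 := by
    simp only [w, dotL_apply, crossR]; ring
  have h0 : dotL w u ≠ 0 := by
    rw [hw]
    contrapose! h
    have h1 : (crossR u v).1 = 0 := by nlinarith [sq_nonneg (crossR u v).1, sq_nonneg (crossR u v).2.1, sq_nonneg (crossR u v).2.2]
    have h2 : (crossR u v).2.1 = 0 := by nlinarith [sq_nonneg (crossR u v).1, sq_nonneg (crossR u v).2.1, sq_nonneg (crossR u v).2.2]
    have h3 : (crossR u v).2.2 = 0 := by nlinarith [sq_nonneg (crossR u v).1, sq_nonneg (crossR u v).2.1, sq_nonneg (crossR u v).2.2]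
    exact Prod.ext h1 (Prod.ext h2 h3)
  exact ⟨(dotL w u)⁻¹ • dotL w, by simp only [smul_apply, smul_eq_mul, inv_mul_cancel₀ h0], by simp only [smul_apply, smul_eq_mul, hv, mul_zero]⟩

/-- Nondegeneracy provides a functional that increases along `ac` and takes the same value at `b` as
at the midpoint of `ac`. Edge and tent are then both graphs over its levels and `isotopic_move`
applies. -/
theorem isotopic_triangle {a b c : R3} (h : crossR (b - a) (c - a) ≠ 0) {K : Set R3}
    (hK : TriangleClear a b c K) :
    AmbientIsotopic (K ∪ segment ℝ a c) (K ∪ (segment ℝ a b ∪ segment ℝ b c)) := by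
  obtain ⟨lam, h1, h2⟩ : ∃ lam : R3 →L[ℝ] ℝ, lam (c - a) = 1 ∧ lam (b - (1 / 2 : ℝ) • (a + c)) = 0 := by
    apply exists_level_functional
    contrapose! h
    rw [Prod.ext_iff, Prod.ext_iff] at h ⊢
    simp only [crossR, Prod.fst_sub, Prod.snd_sub, Prod.smul_fst, Prod.smul_snd, Prod.fst_add,
      Prod.snd_add, smul_eq_mul, Prod.fst_zero, Prod.snd_zero] at h ⊢
    obtain ⟨e1, e2, e3⟩ := h
    exact ⟨by linarith, by linarith, by linarith⟩
  have hI : Icc (lam a) (lam a + 1) = (fun x => x + lam a) '' Icc 0 1 := by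
    rw [image_add_const_Icc, zero_add, add_comm]
  have := isotopic_move (lam := lam) (l := lam a) (r := lam a + 1) (by linarith)
    (σ := fun x => edgePath a c (x - lam a)) (τ := fun x => tentPath a b c (x - lam a))
    (by unfold edgePath; fun_prop) (by unfold tentPath; fun_prop) ?_ ?_ ?_ ?_ (hK lam h1 h2)
  · rw [hI, image_image, image_image] at this
    simpa only [add_sub_cancel_right, image_edgePath, image_tentPath] using this
  · intro x _
    simp only [edgePath, map_add, map_smul, h1, smul_eq_mul]; ring
  · intro x _
    simp only [tentPath, map_add lam, map_smul lam, h1, h2, smul_eq_mul]; ring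
  · simp [edgePath, tentPath]
  · simp [edgePath, tentPath]

/-- The weights `i` and `j` stand for the distances from `b` to `a` and to `c`, up to a common
factor. This form lets the hypothesis be checked in integers. -/
theorem segment_eq_union_of_between {a b c : R3} {i j : ℝ} (hi : 0 ≤ i) (hj : 0 ≤ j)
    (hij : 0 < i + j) (h : j • (b - a) = i • (c - b)) :
    segment ℝ a c = segment ℝ a b ∪ segment ℝ b c := by
  set s := i / (i + j)
  have hs0 : 0 ≤ s := by positivity
  have hs1 : s ≤ 1 := by rw [div_le_one hij]; linarith
  have hb : b = a + s • (c - a) := by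
    have h1 : (i + j) • b = (i + j) • (a + s • (c - a)) := by
      rw [smul_add, smul_smul, mul_div_cancel₀ _ hij.ne']
      have : j • b - j • a = i • c - i • b := by simpa [smul_sub] using h
      rw [add_smul, add_smul, smul_sub]
      rw [sub_eq_iff_eq_add] at this
      rw [this]; abel
    exact smul_right_injective R3 hij.ne' h1
  rw [segment_eq_image', segment_eq_image', segment_eq_image', hb]
  ext p
  simp only [mem_union, mem_image]
  constructor
  · rintro ⟨x, hx, rfl⟩
    rcases le_total x s with h | h
    · left
      rcases hs0.eq_or_lt with h0 | h0
      · refine ⟨0, by simp, ?_⟩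
        have : x = 0 := le_antisymm (h.trans h0.ge) hx.1
        simp [this]
      · refine ⟨x / s, ⟨div_nonneg hx.1 hs0, by rwa [div_le_one h0]⟩, ?_⟩
        rw [add_sub_cancel_left, smul_smul, div_mul_cancel₀ _ h0.ne']
    · right
      rcases hs1.eq_or_lt with h0 | h0
      · refine ⟨1, by simp, ?_⟩
        have : x = 1 := le_antisymm hx.2 (h0.ge.trans h)
        rw [this]; module
      · have h1 : 0 < 1 - s := by linarith
        refine ⟨(x - s) / (1 - s), ⟨div_nonneg (by linarith) h1.le,
          by rw [div_le_one h1]; linarith [hx.2]⟩, ?_⟩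
        have : c - (a + s • (c - a)) = (1 - s) • (c - a) := by module
        rw [this, smul_smul, div_mul_cancel₀ _ h1.ne']
        module
  · rintro (⟨x, hx, rfl⟩ | ⟨x, hx, rfl⟩)
    · refine ⟨x * s, ⟨mul_nonneg hx.1 hs0, by nlinarith [hx.1, hx.2]⟩, by module⟩
    · refine ⟨s + x * (1 - s), ⟨by nlinarith [hx.1, hx.2], by nlinarith [hx.1, hx.2]⟩, by module⟩

/-! ### Integral polygonal moves, checked by computation -/

/-- Integral points. -/
abbrev ZPt : Type := ℤ × ℤ × ℤ

/-- Edges with integral vertices. -/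
abbrev ZEdge : Type := ZPt × ZPt

/-- The inclusion of the integral lattice. -/
def ZPt.toR (p : ZPt) : R3 := (p.1, p.2.1, p.2.2)

/-- The edge as a set of points. -/
def ZEdge.carrier (e : ZEdge) : Set R3 := segment ℝ e.1.toR e.2.toR

/-- The union of a list of edges. -/
def carrier (L : List ZEdge) : Set R3 := {p | ∃ e ∈ L, p ∈ ZEdge.carrier e}

/-- The integral box with the given extreme corners. -/
def ZEdge.box (b : ZEdge) : Set R3 :=
  {p | (b.1.1 ≤ p.1 ∧ p.1 ≤ b.2.1) ∧ (b.1.2.1 ≤ p.2.1 ∧ p.2.1 ≤ b.2.2.1) ∧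
    (b.1.2.2 ≤ p.2.2 ∧ p.2.2 ≤ b.2.2.2)}

/-- The union of a list of boxes. -/
def boxes (B : List ZEdge) : Set R3 := {p | ∃ b ∈ B, p ∈ ZEdge.box b}

/-! ### Integer vectors and the boolean test for unobstructed moves -/

namespace ZPt

def dot (u v : ZPt) : ℤ := u.1 * v.1 + (u.2.1 * v.2.1 + u.2.2 * v.2.2)

def sub (u v : ZPt) : ZPt := (u.1 - v.1, u.2.1 - v.2.1, u.2.2 - v.2.2)

def neg (u : ZPt) : ZPt := (-u.1, -u.2.1, -u.2.2)

def cross (u v : ZPt) : ZPt :=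
  (u.2.1 * v.2.2 - u.2.2 * v.2.1, u.2.2 * v.1 - u.1 * v.2.2, u.1 * v.2.1 - u.2.1 * v.1)

/-- Serves only to compare lengths of parallel vectors, for which the `ℓ¹` norm is as good as the
Euclidean one and stays integral. -/
def size (u : ZPt) : ℤ := |u.1| + (|u.2.1| + |u.2.2|)

end ZPt

/-- The wall `{ℓ = k}` separates the triangle `abc` from `{ℓ ≤ k}`. -/
def sepBy (a b c : ZPt) (k : ℤ) (ℓ : ZPt) : Bool :=
  decide (k < ℓ.dot b) && (decide (k ≤ ℓ.dot a) && (decide (k ≤ ℓ.dot c) &&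
    (decide (k < ℓ.dot a) || decide (k < ℓ.dot c))))

/-- Search for a separating wall among the candidate normals, up to sign. -/
def sepAny (a b c : ZPt) (mx : ZPt → ℤ) (cands : List ZPt) : Bool :=
  cands.any fun ℓ => sepBy a b c (mx ℓ) ℓ || sepBy a b c (mx ℓ.neg) ℓ.neg

def axisNormals : List ZPt := [(1, 0, 0), (0, 1, 0), (0, 0, 1)]

/-- Candidates for separating walls suggested by the triangle alone: coordinate planes, its own
plane, and the planes through its sides perpendicular to it. Every wall is tested before use, so the
list need not be complete for the check to be sound. -/
def triangleNormals (a b c : ZPt) : List ZPt :=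
  let n := (b.sub a).cross (c.sub a)
  axisNormals ++ [n, (b.sub a).cross n, (c.sub a).cross n, (c.sub b).cross n]

/-- Candidates adapted to an obstacle of direction `d`: three walls parallel to `d` and to a side of
the triangle, and one parallel to `d` and perpendicular to the plane of the triangle. -/
def edgeNormals (a b c d : ZPt) : List ZPt :=
  [(b.sub a).cross d, (c.sub a).cross d, (c.sub b).cross d,
    d.cross ((b.sub a).cross (c.sub a))]

/-- The support function of the edge: a linear functional attains its maximum over a segment at an
endpoint. -/
def edgeMax (e : ZEdge) (ℓ : ZPt) : ℤ := max (ℓ.dot e.1) (ℓ.dot e.2)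

/-- The support function of a box splits into one maximum per coordinate. -/
def boxMax (b : ZEdge) (ℓ : ZPt) : ℤ :=
  max (ℓ.1 * b.1.1) (ℓ.1 * b.2.1) + (max (ℓ.2.1 * b.1.2.1) (ℓ.2.1 * b.2.2.1) +
    max (ℓ.2.2 * b.1.2.2) (ℓ.2.2 * b.2.2.2))

def edgeOk (a b c : ZPt) (e : ZEdge) : Bool :=
  sepAny a b c (edgeMax e) (triangleNormals a b c) ||
    sepAny a b c (edgeMax e) (edgeNormals a b c (e.2.sub e.1))

def boxOk (a b c : ZPt) (e : ZEdge) : Bool :=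
  sepAny a b c (boxMax e) (triangleNormals a b c) ||
    axisNormals.any fun d => sepAny a b c (boxMax e) (edgeNormals a b c d)

/-- The point `b` lies on the segment from `a` to `c`. -/
def between (a b c : ZPt) : Bool :=
  let u := b.sub a
  let v := c.sub b
  let i := u.size
  let j := v.size
  decide (0 < i + j) && (decide (j * u.1 = i * v.1) && (decide (j * u.2.1 = i * v.2.1) &&
    decide (j * u.2.2 = i * v.2.2)))

/-- The two edges agree up to orientation. -/
def sameEdge (e f : ZEdge) : Bool :=
  (e.1 == f.1 && e.2 == f.2) || (e.1 == f.2 && e.2 == f.1)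

def removeEdge (e : ZEdge) (L : List ZEdge) : List ZEdge := L.filter fun f => !sameEdge e f

/-- An elementary move: insert (`true`) or remove (`false`) the vertex `b` between `a` and `c`. -/
structure Move where
  insert : Bool
  a : ZPt
  b : ZPt
  c : ZPt

/-- Subdividing an edge at a point on it does not change the set and needs no test. Otherwise the
triangle has to be nondegenerate and walled off from each remaining edge and from each box. -/
def moveOk (B : List ZEdge) (a b c : ZPt) (L : List ZEdge) : Bool :=
  between a b c || (!((b.sub a).cross (c.sub a) == (0, 0, 0)) &&
    (L.all (edgeOk a b c) && B.all (boxOk a b c)))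

/-- Perform moves on a list of edges, in the complement of the boxes `B`. -/
def runMoves (B : List ZEdge) : List Move → List ZEdge → Option (List ZEdge)
  | [], L => some L
  | m :: ms, L =>
    let ac : ZEdge := (m.a, m.c)
    let ab : ZEdge := (m.a, m.b)
    let bc : ZEdge := (m.b, m.c)
    bif m.insert then
      bif L.any (sameEdge ac) && moveOk B m.a m.b m.c (removeEdge ac L) then
        runMoves B ms (ab :: bc :: removeEdge ac L)
      else none
    else
      bif L.any (sameEdge ab) && (L.any (sameEdge bc) &&
          moveOk B m.a m.b m.c (removeEdge ab (removeEdge bc L))) then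
        runMoves B ms (ac :: removeEdge ab (removeEdge bc L))
      else none

def sameEdges (L M : List ZEdge) : Bool :=
  L.all (fun e => M.any (sameEdge e)) && M.all fun e => L.any (sameEdge e)

/-- Read a list of moves from a list of integers. -/
def readMoves : List ℤ → List Move
  | k :: a1 :: a2 :: a3 :: b1 :: b2 :: b3 :: c1 :: c2 :: c3 :: l =>
    ⟨k == 1, (a1, a2, a3), (b1, b2, b3), (c1, c2, c3)⟩ :: readMoves l
  | _ => []

/-- The edges of a polygonal path. -/
def pathEdges : List ZPt → List ZEdge
  | a :: b :: l => (a, b) :: pathEdges (b :: l)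
  | _ => []

/-- The moves lead from the union of the paths `P` to the union of the paths `Q`. -/
def checkMoves (B : List ZEdge) (ms : List ℤ) (P Q : List (List ZPt)) : Bool :=
  match runMoves B (readMoves ms) (P.flatMap pathEdges) with
  | some L => sameEdges L (Q.flatMap pathEdges)
  | none => false

/-- The union of integral polygonal paths. -/
def paths (P : List (List ZPt)) : Set R3 := carrier (P.flatMap pathEdges)

/-! ### Soundness of the computational check -/

theorem dotL_toR (u v : ZPt) : dotL u.toR v.toR = (u.dot v : ℤ) := by
  simp [ZPt.toR, ZPt.dot]

theorem triangleClear_of_sepBy {a b c : ZPt} {mx : ZPt → ℤ} {S : Set R3}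
    (hS : ∀ ℓ : ZPt, ∀ q ∈ S, dotL ℓ.toR q ≤ mx ℓ) {ℓ : ZPt} (h : sepBy a b c (mx ℓ) ℓ = true) :
    TriangleClear a.toR b.toR c.toR S := by
  simp only [sepBy, Bool.and_eq_true, Bool.or_eq_true, decide_eq_true_eq] at h
  obtain ⟨h1, h2, h3, h4⟩ := h
  refine triangleClear_of_wall (dotL ℓ.toR) (mx ℓ) (hS ℓ) ?_ ?_ ?_ ?_ <;>
    simp only [dotL_toR] <;> exact_mod_cast (by assumption)

theorem triangleClear_of_sepAny {a b c : ZPt} {mx : ZPt → ℤ} {S : Set R3}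
    (hS : ∀ ℓ : ZPt, ∀ q ∈ S, dotL ℓ.toR q ≤ mx ℓ) {l : List ZPt} (h : sepAny a b c mx l = true) :
    TriangleClear a.toR b.toR c.toR S := by
  simp only [sepAny, List.any_eq_true, Bool.or_eq_true] at h
  obtain ⟨ℓ, -, h | h⟩ := h
  · exact triangleClear_of_sepBy hS h
  · exact triangleClear_of_sepBy hS h

theorem dotL_le_edgeMax (e : ZEdge) (ℓ : ZPt) : ∀ q ∈ e.carrier, dotL ℓ.toR q ≤ edgeMax e ℓ := by
  intro q hq
  have h1 : dotL ℓ.toR e.1.toR ≤ edgeMax e ℓ := by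
    rw [dotL_toR]; exact_mod_cast le_max_left _ _
  have h2 : dotL ℓ.toR e.2.toR ≤ edgeMax e ℓ := by
    rw [dotL_toR]; exact_mod_cast le_max_right _ _
  obtain ⟨x, y, hx, hy, hxy, rfl⟩ := hq
  rw [map_add, map_smul, map_smul, smul_eq_mul, smul_eq_mul]
  calc _ ≤ x * (edgeMax e ℓ : ℝ) + y * (edgeMax e ℓ : ℝ) := by gcongr
    _ = _ := by rw [← add_mul, hxy, one_mul]

theorem mul_le_max_of_mem {l a b x : ℝ} (ha : a ≤ x) (hb : x ≤ b) : l * x ≤ max (l * a) (l * b) := by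
  rcases le_total 0 l with h | h
  · exact le_max_of_le_right (mul_le_mul_of_nonneg_left hb h)
  · exact le_max_of_le_left (mul_le_mul_of_nonpos_left ha h)

theorem dotL_le_boxMax (e : ZEdge) (ℓ : ZPt) : ∀ q ∈ e.box, dotL ℓ.toR q ≤ boxMax e ℓ := by
  rintro q ⟨⟨h1, h2⟩, ⟨h3, h4⟩, h5, h6⟩
  simp only [dotL_apply, ZPt.toR, boxMax]
  push_cast
  gcongr
  · exact mul_le_max_of_mem h1 h2
  · exact mul_le_max_of_mem h3 h4
  · exact mul_le_max_of_mem h5 h6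

theorem triangleClear_of_edgeOk {a b c : ZPt} {e : ZEdge} (h : edgeOk a b c e = true) :
    TriangleClear a.toR b.toR c.toR e.carrier := by
  simp only [edgeOk, Bool.or_eq_true] at h
  rcases h with h | h <;> exact triangleClear_of_sepAny (dotL_le_edgeMax e) h

theorem triangleClear_of_boxOk {a b c : ZPt} {e : ZEdge} (h : boxOk a b c e = true) :
    TriangleClear a.toR b.toR c.toR e.box := by
  simp only [boxOk, Bool.or_eq_true, List.any_eq_true] at h
  rcases h with h | ⟨_, -, h⟩ <;> exact triangleClear_of_sepAny (dotL_le_boxMax e) h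

theorem carrier_nil : carrier [] = ∅ := by ext; simp [carrier]

theorem carrier_cons (e : ZEdge) (L : List ZEdge) : carrier (e :: L) = e.carrier ∪ carrier L := by
  ext; simp [carrier]

theorem carrier_append (L M : List ZEdge) : carrier (L ++ M) = carrier L ∪ carrier M := by
  ext; simp [carrier, or_and_right, exists_or]

theorem boxes_cons (e : ZEdge) (L : List ZEdge) : boxes (e :: L) = e.box ∪ boxes L := by
  ext; simp [boxes]

theorem triangleClear_carrier {a b c : ZPt} {L : List ZEdge} (h : L.all (edgeOk a b c) = true) :
    TriangleClear a.toR b.toR c.toR (carrier L) := by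
  induction L with
  | nil => rw [carrier_nil]; exact triangleClear_empty _ _ _
  | cons e L ih =>
    simp only [List.all_cons, Bool.and_eq_true] at h
    rw [carrier_cons]
    exact (triangleClear_of_edgeOk h.1).union (ih h.2)

theorem triangleClear_boxes {a b c : ZPt} {L : List ZEdge} (h : L.all (boxOk a b c) = true) :
    TriangleClear a.toR b.toR c.toR (boxes L) := by
  induction L with
  | nil => exact (triangleClear_empty _ _ _).mono (by rintro p ⟨_, h, -⟩; simp at h)
  | cons e L ih =>
    simp only [List.all_cons, Bool.and_eq_true] at h
    rw [boxes_cons]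
    exact (triangleClear_of_boxOk h.1).union (ih h.2)

/-- The set `F` is the part of the link that is not an integral polygon. Only its inclusion in the
boxes is used, which is why one computation covers every number of twists. -/
theorem isotopic_of_moveOk {B : List ZEdge} {a b c : ZPt} {L : List ZEdge}
    (h : moveOk B a b c L = true) {F : Set R3} (hF : F ⊆ boxes B) :
    AmbientIsotopic (F ∪ (ZEdge.carrier (a, c) ∪ carrier L))
      (F ∪ (ZEdge.carrier (a, b) ∪ (ZEdge.carrier (b, c) ∪ carrier L))) := by
  rw [← union_assoc (ZEdge.carrier (a, b)), union_comm _ (carrier L), union_comm _ (carrier L),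
    ← union_assoc, ← union_assoc]
  simp only [moveOk, Bool.or_eq_true, Bool.and_eq_true, Bool.not_eq_true', beq_eq_false_iff_ne] at h
  rcases h with h | ⟨h, h1, h2⟩
  · refine AmbientIsotopic.of_eq ?_
    simp only [between, Bool.and_eq_true, decide_eq_true_eq] at h
    obtain ⟨h0, h1, h2, h3⟩ := h
    congr 1
    refine segment_eq_union_of_between (i := (b.sub a).size) (j := (c.sub b).size) ?_ ?_ ?_ ?_
    · simp only [ZPt.size]; positivity
    · simp only [ZPt.size]; positivity
    · exact_mod_cast h0
    · simp only [ZPt.sub] at h1 h2 h3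
      refine Prod.ext ?_ (Prod.ext ?_ ?_) <;>
        simp only [ZPt.toR, Prod.smul_fst, Prod.smul_snd, Prod.fst_sub, Prod.snd_sub,
          smul_eq_mul, ZPt.sub] <;> exact_mod_cast (by assumption)
  · refine isotopic_triangle ?_
      (((triangleClear_boxes h2).mono hF).union (triangleClear_carrier h1))
    contrapose! h
    simp only [crossR, ZPt.toR, Prod.ext_iff, Prod.fst_sub, Prod.snd_sub, Prod.fst_zero,
      Prod.snd_zero] at h
    simp only [ZPt.cross, ZPt.sub, Prod.ext_iff]
    exact_mod_cast h

theorem carrier_of_sameEdge {e f : ZEdge} (h : sameEdge e f = true) : e.carrier = f.carrier := by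
  simp only [sameEdge, Bool.or_eq_true, Bool.and_eq_true, beq_iff_eq] at h
  rcases h with ⟨h1, h2⟩ | ⟨h1, h2⟩
  · rw [Prod.ext h1 h2]
  · rw [ZEdge.carrier, ZEdge.carrier, h1, h2, segment_symm]

/-- All copies of `e` in the list, in either orientation, have one and the same carrier, so dropping
them all loses exactly what the separate term restores. -/
theorem carrier_removeEdge {e : ZEdge} {L : List ZEdge} (h : L.any (sameEdge e) = true) :
    carrier L = e.carrier ∪ carrier (removeEdge e L) := by
  ext p
  simp only [List.any_eq_true] at h
  obtain ⟨f, hf, hef⟩ := h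
  simp only [carrier, removeEdge, mem_union, mem_ofPred_eq, List.mem_filter, Bool.not_eq_true']
  constructor
  · rintro ⟨g, hg, hp⟩
    by_cases heg : sameEdge e g = true
    · exact Or.inl (carrier_of_sameEdge heg ▸ hp)
    · exact Or.inr ⟨g, ⟨hg, by simpa using heg⟩, hp⟩
  · rintro (hp | ⟨g, ⟨hg, -⟩, hp⟩)
    · exact ⟨f, hf, carrier_of_sameEdge hef ▸ hp⟩
    · exact ⟨g, hg, hp⟩

theorem carrier_removeEdge_removeEdge {e f : ZEdge} {L : List ZEdge}
    (he : L.any (sameEdge e) = true) (hf : L.any (sameEdge f) = true) :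
    carrier L = e.carrier ∪ (f.carrier ∪ carrier (removeEdge e (removeEdge f L))) := by
  rw [carrier_removeEdge hf]
  by_cases h : (removeEdge f L).any (sameEdge e) = true
  · rw [carrier_removeEdge h, ← union_assoc, ← union_assoc, union_comm f.carrier]
  · have h1 : removeEdge e (removeEdge f L) = removeEdge f L := by
      rw [removeEdge, List.filter_eq_self]
      simp only [List.any_eq_true, not_exists, not_and] at h
      intro g hg
      simpa using h g hg
    have h2 : e.carrier ⊆ f.carrier ∪ carrier (removeEdge f L) := by
      rw [← carrier_removeEdge hf, carrier_removeEdge he]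
      exact subset_union_left
    rw [h1, union_eq_right.2 h2]

theorem isotopic_of_runMoves {B : List ZEdge} {F : Set R3} (hF : F ⊆ boxes B) :
    ∀ (ms : List Move) (L M : List ZEdge), runMoves B ms L = some M →
      AmbientIsotopic (F ∪ carrier L) (F ∪ carrier M) := by
  intro ms
  induction ms with
  | nil =>
    intro L M h
    simp only [runMoves, Option.some.injEq] at h
    rw [h]
    exact AmbientIsotopic.refl _
  | cons m ms ih =>
    intro L M h
    simp only [runMoves] at h
    cases hm : m.insert with
    | true =>
      rw [hm, cond_true] at h
      cases hc : L.any (sameEdge (m.a, m.c)) && moveOk B m.a m.b m.c (removeEdge (m.a, m.c) L) with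
      | false => rw [hc, cond_false] at h; cases h
      | true =>
        rw [hc, cond_true] at h
        rw [Bool.and_eq_true] at hc
        refine AmbientIsotopic.trans ?_ (ih _ _ h)
        rw [carrier_removeEdge hc.1, carrier_cons, carrier_cons]
        exact isotopic_of_moveOk hc.2 hF
    | false =>
      rw [hm, cond_false] at h
      cases hc : L.any (sameEdge (m.a, m.b)) && (L.any (sameEdge (m.b, m.c)) &&
        moveOk B m.a m.b m.c (removeEdge (m.a, m.b) (removeEdge (m.b, m.c) L))) with
      | false => rw [hc, cond_false] at h; cases h
      | true =>
        rw [hc, cond_true] at h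
        rw [Bool.and_eq_true, Bool.and_eq_true] at hc
        refine AmbientIsotopic.trans ?_ (ih _ _ h)
        rw [carrier_removeEdge_removeEdge hc.1 hc.2.1, carrier_cons]
        -- Removing a vertex is the reverse of inserting it.
        exact (isotopic_of_moveOk hc.2.2 hF).symm

theorem carrier_subset_of_all {L M : List ZEdge}
    (h : (L.all fun e => M.any (sameEdge e)) = true) : carrier L ⊆ carrier M := by
  rintro p ⟨e, he, hp⟩
  simp only [List.all_eq_true, List.any_eq_true] at h
  obtain ⟨f, hf, hef⟩ := h e he
  exact ⟨f, hf, carrier_of_sameEdge hef ▸ hp⟩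

theorem carrier_eq_of_sameEdges {L M : List ZEdge} (h : sameEdges L M = true) :
    carrier L = carrier M := by
  rw [sameEdges, Bool.and_eq_true] at h
  exact (carrier_subset_of_all h.1).antisymm (carrier_subset_of_all h.2)

/-- This is the passage from kernel evaluation to topology; every polygonal simplification in the
proof goes through it. The list of moves is merely a certificate. -/
theorem isotopic_of_checkMoves {B : List ZEdge} {F : Set R3} (hF : F ⊆ boxes B) {ms : List ℤ}
    {P Q : List (List ZPt)} (h : checkMoves B ms P Q = true) :
    AmbientIsotopic (F ∪ paths P) (F ∪ paths Q) := by
  unfold checkMoves at h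
  cases hr : runMoves B (readMoves ms) (P.flatMap pathEdges) with
  | none => rw [hr] at h; cases h
  | some L =>
    rw [hr] at h
    rw [paths, paths, ← carrier_eq_of_sameEdges h]
    exact isotopic_of_runMoves hF _ _ _ hr

theorem paths_nil : paths [] = ∅ := carrier_nil

theorem paths_cons (l : List ZPt) (P : List (List ZPt)) :
    paths (l :: P) = polygonalPath (l.map ZPt.toR) ∪ paths P := by
  rw [paths, List.flatMap_cons, carrier_append]
  congr 1
  induction l with
  | nil => exact carrier_nil
  | cons a l ih =>
    cases l with
    | nil => exact carrier_nil
    | cons b l =>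
      simp only [pathEdges, carrier_cons, ih, List.map_cons, polygonalPath]
      rfl

/-! ### Isotopies of particular shapes -/

/-- Sliding along the direction `v` by a bounded amount. -/
theorem isotopic_slide (v : R3) {g : R3 → ℝ} (hg : Continuous g) {B : ℝ} (hB : ∀ p, |g p| ≤ B)
    (hmono : ∀ p, StrictMono fun r : ℝ => r + g (p + r • v)) (K : Set R3) :
    AmbientIsotopic K ((fun p => p + g p • v) '' K) := by
  have hm : ∀ t ∈ Icc (0 : ℝ) 1, ∀ p, StrictMono fun r : ℝ => r + t * g (p + r • v) := by
    intro t ht p r r' hr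
    have h := hmono p hr
    simp only at h ⊢
    rcases ht.1.eq_or_lt with h0 | h0
    · simpa [← h0] using hr
    · nlinarith [ht.2, mul_pos h0 (sub_pos.2 h), mul_nonneg (sub_nonneg.2 ht.2) (sub_pos.2 hr).le]
  have := isotopic_image_of_family (F := fun t p => p + (t * g p) • v) (by fun_prop)
    (fun p => by simp) ?_ ?_ K
  · simpa using this
  · intro t ht
    constructor
    · intro p q hpq
      simp only at hpq
      set s := t * g q - t * g p with hs
      have h1 : p = q + s • v := by
        rw [hs, sub_smul, add_sub, ← hpq]; abel
      have h2 : s = 0 := by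
        apply (hm t ht q).injective
        simp only [← h1, zero_smul, add_zero, zero_add]
        rw [hs]; ring
      rw [h1, h2, zero_smul, add_zero]
    · intro q
      have hc : Continuous fun r : ℝ => r + t * g (q + r • v) := by fun_prop
      have hb : ∀ p, |t * g p| ≤ B := fun p => by
        rw [abs_mul, abs_of_nonneg ht.1]
        nlinarith [hB p, abs_nonneg (g p), ht.1, ht.2]
      -- Surjectivity on the line through `q`: the bound on `g` forces opposite signs at `-B` and
      -- `B`, so the intermediate value theorem yields a preimage.
      have hmem : (0 : ℝ) ∈ Icc (-B + t * g (q + (-B) • v)) (B + t * g (q + B • v)) :=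
        ⟨by linarith [(abs_le.1 (hb (q + (-B) • v))).2], by linarith [(abs_le.1 (hb (q + B • v))).1]⟩
      have hB0 : -B ≤ B := by linarith [(abs_nonneg _).trans (hB 0)]
      obtain ⟨r, -, hr⟩ := intermediate_value_Icc hB0 hc.continuousOn hmem
      refine ⟨q + r • v, ?_⟩
      simp only at hr ⊢
      rw [add_assoc, ← add_smul, hr, zero_smul, add_zero]
  · intro t ht
    refine ⟨1, one_pos, B * ‖v‖, fun p => ?_⟩
    have h1 : ‖(t * g p) • v‖ ≤ B * ‖v‖ := by
      rw [norm_smul, Real.norm_eq_abs, abs_mul, abs_of_nonneg ht.1]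
      gcongr
      nlinarith [hB p, abs_nonneg (g p), ht.1, ht.2]
    have h2 := norm_sub_le (p + (t * g p) • v) ((t * g p) • v)
    rw [add_sub_cancel_right] at h2
    linarith

theorem isotopic_translate (v : R3) (K : Set R3) : AmbientIsotopic K ((fun p => p + v) '' K) := by
  simpa using isotopic_slide v (g := fun _ => 1) (by fun_prop) (B := 1) (by simp)
    (fun p r r' h => by simpa using h) K

/-- Rescaling the coordinates and translating. -/
def boxMap (a b p : R3) : R3 := (a.1 * p.1 + b.1, a.2.1 * p.2.1 + b.2.1, a.2.2 * p.2.2 + b.2.2)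

/-- A convex combination of `1` and a positive scale factor never vanishes, so every intermediate
map has an explicit inverse. -/
theorem isotopic_boxMap {a : R3} (h1 : 0 < a.1) (h2 : 0 < a.2.1) (h3 : 0 < a.2.2) (b : R3)
    (K : Set R3) : AmbientIsotopic K (boxMap a b '' K) := by
  set s : ℝ → ℝ → ℝ := fun x t => (1 - t) + t * x
  have hs : ∀ x > 0, ∀ t ∈ Icc (0 : ℝ) 1, s x t ≠ 0 := by
    intro x hx t ht
    simp only [s]
    rcases ht.1.eq_or_lt with h | h
    · simp [← h]
    · have := mul_pos h hx
      linarith [ht.2]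
  have := isotopic_of_inverse_family
    (F := fun t p => boxMap (s a.1 t, s a.2.1 t, s a.2.2 t) (t • b) p)
    (G := fun t p => ((p.1 - t * b.1) / s a.1 t, (p.2.1 - t * b.2.1) / s a.2.1 t,
      (p.2.2 - t * b.2.2) / s a.2.2 t)) (by simp only [boxMap, s]; fun_prop)
    (fun t => by fun_prop) (fun p => by simp [boxMap, s]) ?_ ?_ K
  · simpa [s] using this
  · intro t ht p
    simp [boxMap, hs _ h1 t ht, hs _ h2 t ht, hs _ h3 t ht]
  · intro t ht p
    simp [boxMap, hs _ h1 t ht, hs _ h2 t ht, hs _ h3 t ht, mul_div_cancel₀]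

/-- The cyclic permutation of the coordinates. -/
def cycle (p : R3) : R3 := (p.2.2, p.1, p.2.1)

/-- Since the permutation `P` satisfies `P³ = 1`, the product of `(1 - t) + t P` and `(1 - t)² - t
(1 - t) P + t² P²` is the scalar `(1 - t)³ + t³`, which is nonzero. Straight-line interpolation from
the identity therefore stays invertible. -/
theorem isotopic_cycle (K : Set R3) : AmbientIsotopic K (cycle '' K) := by
  have hs : ∀ t ∈ Icc (0 : ℝ) 1, (1 - t) ^ 3 + t ^ 3 ≠ 0 := by
    intro t _
    nlinarith [sq_nonneg (t - 1 / 2)]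
  have := isotopic_of_inverse_family
    (F := fun t p => (1 - t) • p + t • cycle p)
    (G := fun t p => ((1 - t) ^ 3 + t ^ 3)⁻¹ • ((1 - t) ^ 2 • p - (t * (1 - t)) • cycle p +
      t ^ 2 • cycle (cycle p))) (by simp only [cycle]; fun_prop)
    (fun t => by simp only [cycle]; fun_prop) (fun p => by simp) ?_ ?_ K
  · simpa using this
  · intro t ht p
    have := hs t ht
    refine Prod.ext ?_ (Prod.ext ?_ ?_) <;>
      simp only [cycle, Prod.smul_fst, Prod.smul_snd, Prod.fst_add, Prod.snd_add, Prod.fst_sub,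
        Prod.snd_sub, smul_eq_mul] <;> field_simp <;> ring
  · intro t ht p
    have := hs t ht
    refine Prod.ext ?_ (Prod.ext ?_ ?_) <;>
      simp only [cycle, Prod.smul_fst, Prod.smul_snd, Prod.fst_add, Prod.snd_add, Prod.fst_sub,
        Prod.snd_sub, smul_eq_mul] <;> field_simp <;> ring

/-- The distance from the first coordinate axis. -/
noncomputable def rad (p : R3) : ℝ := √(p.2.1 ^ 2 + p.2.2 ^ 2)

@[fun_prop] theorem continuous_rad : Continuous rad := by unfold rad; fun_prop

theorem abs_le_rad (p : R3) : |p.2.1| ≤ rad p ∧ |p.2.2| ≤ rad p :=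
  ⟨Real.abs_le_sqrt (by nlinarith [sq_nonneg p.2.2]), Real.abs_le_sqrt (by nlinarith [sq_nonneg p.2.1])⟩

theorem rad_le (p : R3) : rad p ≤ |p.2.1| + |p.2.2| := by
  rw [rad, Real.sqrt_le_left (by positivity)]
  nlinarith [sq_abs p.2.1, sq_abs p.2.2, mul_nonneg (abs_nonneg p.2.1) (abs_nonneg p.2.2)]

theorem norm_eq_max (p : R3) : ‖p‖ = max |p.1| (max |p.2.1| |p.2.2|) := rfl

/-- The norm here is the maximum norm, and `rad` is at most the sum of two absolute coordinates;
this accounts for the factor `2`. -/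
theorem norm_le_two_mul {p q : R3} (h1 : p.1 = q.1) (h : rad p ≤ rad q) : ‖p‖ ≤ 2 * ‖q‖ := by
  have h2 := abs_le_rad p
  have h3 := rad_le q
  have h4 : |q.1| ≤ ‖q‖ := norm_fst_le q
  have h5 : |q.2.1| ≤ ‖q‖ := (norm_fst_le q.2).trans (norm_snd_le q)
  have h6 : |q.2.2| ≤ ‖q‖ := (norm_snd_le q.2).trans (norm_snd_le q)
  rw [norm_eq_max p]
  refine max_le ?_ (max_le ?_ ?_)
  · rw [h1]; linarith [abs_nonneg q.1]
  · linarith [h2.1]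
  · linarith [h2.2]

/-- Rotation about the first coordinate axis. -/
noncomputable def rotX (φ : ℝ) (p : R3) : R3 :=
  (p.1, p.2.1 * Real.cos φ - p.2.2 * Real.sin φ, p.2.1 * Real.sin φ + p.2.2 * Real.cos φ)

theorem rad_rotX (φ : ℝ) (p : R3) : rad (rotX φ p) = rad p := by
  simp only [rad, rotX]
  congr 1
  linear_combination (p.2.1 ^ 2 + p.2.2 ^ 2) * Real.sin_sq_add_cos_sq φ

theorem rotX_rotX (φ ψ : ℝ) (p : R3) : rotX φ (rotX ψ p) = rotX (φ + ψ) p := by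
  refine Prod.ext rfl (Prod.ext ?_ ?_) <;> simp only [rotX, Real.cos_add, Real.sin_add] <;> ring

theorem rotX_zero (p : R3) : rotX 0 p = p := by simp [rotX]

/-- Twisting about the first coordinate axis. -/
theorem isotopic_twist {φ : ℝ → ℝ → ℝ} (hφ : Continuous fun p : ℝ × ℝ => φ p.1 p.2) (K : Set R3) :
    AmbientIsotopic K ((fun p => rotX (φ p.1 (rad p)) p) '' K) := by
  have hc : Continuous fun p : R3 => φ p.1 (rad p) :=
    hφ.comp (continuous_fst.prodMk continuous_rad)
  have hF : Continuous fun q : ℝ × R3 => rotX (q.1 * φ q.2.1 (rad q.2)) q.2 := by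
    have h1 : Continuous fun q : ℝ × R3 => φ q.2.1 (rad q.2) := hc.comp continuous_snd
    have h2 : Continuous fun q : ℝ × R3 => q.1 * φ q.2.1 (rad q.2) := continuous_fst.mul h1
    have h3 := Real.continuous_cos.comp h2
    have h4 := Real.continuous_sin.comp h2
    have h5 : Continuous fun q : ℝ × R3 => q.2.2.1 := by fun_prop
    have h6 : Continuous fun q : ℝ × R3 => q.2.2.2 := by fun_prop
    exact continuous_snd.fst.prodMk (((h5.mul h3).sub (h6.mul h4)).prodMk
      ((h5.mul h4).add (h6.mul h3)))
  have := isotopic_of_inverse_family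
    (F := fun t p => rotX (t * φ p.1 (rad p)) p) (G := fun t p => rotX (-(t * φ p.1 (rad p))) p)
    hF (fun t => ?_) (fun p => by simp [rotX_zero]) ?_ ?_ K
  · simpa using this
  · have := hF.comp ((continuous_const (y := -t)).prodMk continuous_id)
    exact this.congr fun p => by simp only [Function.comp, id, neg_mul]
  -- A rotation about the axis preserves both `p.1` and `rad p`, so the opposite angle inverts it.
  · intro t _ p
    simp only [rad_rotX, rotX_rotX]
    simp [rotX]
  · intro t _ p
    simp only [rad_rotX, rotX_rotX]
    simp [rotX]

/-- Radial rescaling about the first coordinate axis. -/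
theorem isotopic_radial {k : ℝ → ℝ → ℝ} (hk : Continuous fun p : ℝ × ℝ => k p.1 p.2) {c : ℝ}
    (hc : 0 < c) (hck : ∀ x r, c ≤ k x r)
    (hmono : ∀ x, StrictMonoOn (fun r => r * k x r) (Ici 0)) (K : Set R3) :
    AmbientIsotopic K
      ((fun p => (p.1, k p.1 (rad p) * p.2.1, k p.1 (rad p) * p.2.2) : R3 → R3) '' K) := by
  set s : ℝ → ℝ → ℝ → ℝ := fun t x r => 1 + t * (k x r - 1)
  set c' := min 1 c
  have hc' : 0 < c' := lt_min one_pos hc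
  have hs : ∀ t ∈ Icc (0 : ℝ) 1, ∀ x r, c' ≤ s t x r := by
    intro t ht x r
    have h1 : c' ≤ k x r := (min_le_right _ _).trans (hck x r)
    have h2 : c' ≤ 1 := min_le_left _ _
    simp only [s]
    nlinarith [mul_nonneg ht.1 (sub_nonneg.2 h1), mul_nonneg (sub_nonneg.2 ht.2) (sub_nonneg.2 h2)]
  have hsm : ∀ t ∈ Icc (0 : ℝ) 1, ∀ x, StrictMonoOn (fun r => r * s t x r) (Ici 0) := by
    intro t ht x r hr r' hr' h
    have := hmono x hr hr' h
    simp only [s] at this ⊢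
    rcases ht.1.eq_or_lt with h0 | h0
    · simpa [← h0] using h
    · nlinarith [mul_pos h0 (sub_pos.2 this), mul_nonneg (sub_nonneg.2 ht.2) (sub_pos.2 h).le]
  have hcont : Continuous fun q : ℝ × R3 => s q.1 q.2.1 (rad q.2) := by
    have h1 := hk.comp (continuous_fst.prodMk continuous_rad)
    have := h1.comp (continuous_snd : Continuous (Prod.snd : ℝ × R3 → R3))
    simp only [s]
    exact continuous_const.add (continuous_fst.mul (this.sub continuous_const))
  set F : ℝ → R3 → R3 := fun t p => (p.1, s t p.1 (rad p) * p.2.1, s t p.1 (rad p) * p.2.2)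
  have hrad : ∀ t ∈ Icc (0 : ℝ) 1, ∀ p, rad (F t p) = rad p * s t p.1 (rad p) := by
    intro t ht p
    have h0 : 0 ≤ s t p.1 (rad p) := hc'.le.trans (hs t ht _ _)
    have h1 : rad (F t p) = √((p.2.1 ^ 2 + p.2.2 ^ 2) * s t p.1 (rad p) ^ 2) := by
      rw [rad]; congr 1; simp only [F]; ring
    rw [h1, Real.sqrt_mul' _ (sq_nonneg _), Real.sqrt_sq h0]
    rfl
  have := isotopic_image_of_family (F := F) ?_ (fun p => by simp [F, s]) ?_ ?_ K
  · simpa [F, s] using this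
  · have h5 : Continuous fun q : ℝ × R3 => q.2.2.1 := by fun_prop
    have h6 : Continuous fun q : ℝ × R3 => q.2.2.2 := by fun_prop
    exact continuous_snd.fst.prodMk ((hcont.mul h5).prodMk (hcont.mul h6))
  · intro t ht
    constructor
    · intro p q hpq
      change F t p = F t q at hpq
      have h1 : p.1 = q.1 := by simpa only [F] using congrArg (fun r : R3 => r.1) hpq
      -- First the radius is recovered by monotonicity, then the coordinates by cancelling the
      -- common scale factor.
      have h2 : rad p = rad q := by
        have := congrArg rad hpq
        rw [hrad t ht, hrad t ht, h1] at this
        exact (hsm t ht q.1).injOn (Real.sqrt_nonneg _) (Real.sqrt_nonneg _) this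
      have h3 : s t p.1 (rad p) ≠ 0 := (hc'.trans_le (hs t ht _ _)).ne'
      have h4 := congrArg (fun r : R3 => r.2.1) hpq
      have h5 := congrArg (fun r : R3 => r.2.2) hpq
      simp only [F, ← h1, ← h2] at h4 h5
      exact Prod.ext h1 (Prod.ext (mul_left_cancel₀ h3 h4) (mul_left_cancel₀ h3 h5))
    · intro q
      have hr0 : 0 ≤ rad q := Real.sqrt_nonneg _
      have hcr : Continuous fun r => r * s t q.1 r := by
        have := hk.comp ((continuous_const (y := q.1)).prodMk continuous_id)
        simp only [s]
        exact continuous_id.mul (continuous_const.add (continuous_const.mul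
          (this.sub continuous_const)))
      -- The lower bound `c'` for the scale factor guarantees that the radius `rad q` is reached by
      -- parameter `rad q / c'`.
      have hle : (0 : ℝ) ≤ rad q / c' := by positivity
      obtain ⟨r, ⟨hr, -⟩, hrq⟩ := intermediate_value_Icc hle hcr.continuousOn
        (show rad q ∈ _ from ⟨by simpa using hr0, by
          have := hs t ht q.1 (rad q / c')
          calc rad q = rad q / c' * c' := by field_simp
            _ ≤ _ := by gcongr⟩)
      simp only at hrq
      have hspos : 0 < s t q.1 r := hc'.trans_le (hs t ht _ _)
      refine ⟨(q.1, q.2.1 / s t q.1 r, q.2.2 / s t q.1 r), ?_⟩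
      have hrr : rad (q.1, q.2.1 / s t q.1 r, q.2.2 / s t q.1 r) = r := by
        have h1 : rad (q.1, q.2.1 / s t q.1 r, q.2.2 / s t q.1 r) =
            √((q.2.1 ^ 2 + q.2.2 ^ 2) / s t q.1 r ^ 2) := by
          rw [rad]; congr 1; simp only; rw [add_div, div_pow, div_pow]
        rw [h1, Real.sqrt_div' _ (sq_nonneg _), Real.sqrt_sq hspos.le, div_eq_iff hspos.ne']
        exact hrq.symm
      simp only [F, hrr]
      refine Prod.ext rfl (Prod.ext ?_ ?_) <;> simp only <;> field_simp
  · intro t ht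
    refine ⟨c' / 2, by positivity, 0, fun p => ?_⟩
    have h1 : ‖((p.1 : ℝ), c' * p.2.1, c' * p.2.2)‖ ≤ 2 * ‖F t p‖ := by
      refine norm_le_two_mul rfl ?_
      rw [hrad t ht]
      have : rad (p.1, c' * p.2.1, c' * p.2.2) = rad p * c' := by
        have h1 : rad (p.1, c' * p.2.1, c' * p.2.2) = √((p.2.1 ^ 2 + p.2.2 ^ 2) * c' ^ 2) := by
          rw [rad]; congr 1; simp only; ring
        rw [h1, Real.sqrt_mul' _ (sq_nonneg _), Real.sqrt_sq hc'.le]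
        rfl
      rw [this]
      exact mul_le_mul_of_nonneg_left (hs t ht _ _) (Real.sqrt_nonneg _)
    have h2 : c' * ‖p‖ ≤ ‖((p.1 : ℝ), c' * p.2.1, c' * p.2.2)‖ := by
      have h3 : c' ≤ 1 := min_le_left _ _
      rw [norm_eq_max, norm_eq_max, mul_max_of_nonneg _ _ hc'.le, mul_max_of_nonneg _ _ hc'.le]
      simp only [abs_mul, abs_of_pos hc']
      gcongr
      nlinarith [abs_nonneg p.1]
    linarith

/-- The map that is linear on each plane `{x = const}`. -/
def levelMap (a b c d : ℝ → ℝ) (p : R3) : R3 :=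
  (p.1, a p.1 * p.2.1 + b p.1 * p.2.2, c p.1 * p.2.1 + d p.1 * p.2.2)

/-- The projection of the line onto the interval `[l, r]`. -/
def clamp (l r x : ℝ) : ℝ := max l (min r x)

theorem clamp_mem {l r : ℝ} (h : l ≤ r) (x : ℝ) : clamp l r x ∈ Icc l r :=
  ⟨le_max_left _ _, max_le h (min_le_left _ _)⟩

theorem clamp_of_mem {l r x : ℝ} (h : x ∈ Icc l r) : clamp l r x = x := by
  rw [clamp, min_eq_right h.2, max_eq_right h.1]

theorem clamp_of_le {l r x : ℝ} (h : x ≤ l) : clamp l r x = l := by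
  rw [clamp, max_eq_left ((min_le_right _ _).trans h)]

theorem clamp_of_ge {l r x : ℝ} (hlr : l ≤ r) (h : r ≤ x) : clamp l r x = r := by
  rw [clamp, min_eq_left h, max_eq_right hlr]

@[fun_prop] theorem continuous_clamp (l r : ℝ) : Continuous (clamp l r) := by
  unfold clamp; fun_prop

theorem monotone_clamp (l r : ℝ) : Monotone (clamp l r) :=
  fun _ _ h => max_le_max_left _ (min_le_min_left _ h)

theorem clamp_sub_le {l r x y : ℝ} (h : x ≤ y) : clamp l r y - clamp l r x ≤ y - x := by
  unfold clamp
  rcases max_cases l (min r y) with ⟨h1, h2⟩ | ⟨h1, h2⟩ <;>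
  rcases max_cases l (min r x) with ⟨h3, h4⟩ | ⟨h3, h4⟩ <;>
  rcases min_cases r y with ⟨h5, h6⟩ | ⟨h5, h6⟩ <;>
  rcases min_cases r x with ⟨h7, h8⟩ | ⟨h7, h8⟩ <;> linarith

/-- A path of invertible matrices depending on the level joins the two maps, neither of which has to
be the identity. Clamping `x` leaves a compact set of matrices, so the entries of the inverses are
bounded and the growth condition holds. -/
theorem isotopic_levelMap {l r : ℝ} (hlr : l ≤ r) {a b c d : ℝ × ℝ → ℝ} (ha : Continuous a)
    (hb : Continuous b) (hc : Continuous c) (hd : Continuous d)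
    (hdet : ∀ t ∈ Icc (0 : ℝ) 1, ∀ x ∈ Icc l r, a (t, x) * d (t, x) - b (t, x) * c (t, x) ≠ 0)
    (K : Set R3) :
    AmbientIsotopic
      (levelMap (fun x => a (0, clamp l r x)) (fun x => b (0, clamp l r x))
        (fun x => c (0, clamp l r x)) (fun x => d (0, clamp l r x)) '' K)
      (levelMap (fun x => a (1, clamp l r x)) (fun x => b (1, clamp l r x))
        (fun x => c (1, clamp l r x)) (fun x => d (1, clamp l r x)) '' K) := by
  set F : ℝ → R3 → R3 := fun t => levelMap (fun x => a (t, clamp l r x))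
    (fun x => b (t, clamp l r x)) (fun x => c (t, clamp l r x)) (fun x => d (t, clamp l r x))
  set Δ : ℝ → ℝ → ℝ := fun t x => a (t, clamp l r x) * d (t, clamp l r x) -
    b (t, clamp l r x) * c (t, clamp l r x)
  have hΔ : ∀ t ∈ Icc (0 : ℝ) 1, ∀ x, Δ t x ≠ 0 := fun t ht x => hdet t ht _ (clamp_mem hlr x)
  have hinv : ∀ t ∈ Icc (0 : ℝ) 1, ∀ p, levelMap (fun x => d (t, clamp l r x) / Δ t x)
    (fun x => -b (t, clamp l r x) / Δ t x) (fun x => -c (t, clamp l r x) / Δ t x)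
    (fun x => a (t, clamp l r x) / Δ t x) (F t p) = p := by
    intro t ht p
    have := hΔ t ht p.1
    refine Prod.ext rfl (Prod.ext ?_ ?_) <;> simp only [F, levelMap] <;> field_simp <;>
      simp only [Δ] <;> ring
  have hinv' : ∀ t ∈ Icc (0 : ℝ) 1, ∀ p, F t (levelMap (fun x => d (t, clamp l r x) / Δ t x)
    (fun x => -b (t, clamp l r x) / Δ t x) (fun x => -c (t, clamp l r x) / Δ t x)
    (fun x => a (t, clamp l r x) / Δ t x) p) = p := by
    intro t ht p
    have := hΔ t ht p.1
    refine Prod.ext rfl (Prod.ext ?_ ?_) <;> simp only [F, levelMap] <;> field_simp <;>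
      simp only [Δ] <;> ring
  refine isotopic_of_family (F := F) ?_ ?_ ?_ K
  · simp only [F, levelMap]; fun_prop
  · exact fun t ht => ⟨Function.LeftInverse.injective (hinv t ht),
      Function.RightInverse.surjective (hinv' t ht)⟩
  · intro t ht
    have hbd : ∀ f : ℝ × ℝ → ℝ, Continuous f → ∃ B, ∀ x, |f (t, clamp l r x) / Δ t x| ≤ B := by
      intro f hf
      have hcont : ContinuousOn (fun x => f (t, x) / (a (t, x) * d (t, x) - b (t, x) * c (t, x)))
          (Icc l r) := by
        refine ContinuousOn.div (by fun_prop) (by fun_prop) fun x hx => hdet t ht x hx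
      obtain ⟨B, hB⟩ := isCompact_Icc.exists_bound_of_continuousOn hcont
      exact ⟨B, fun x => hB _ (clamp_mem hlr x)⟩
    obtain ⟨A', hA⟩ := hbd a ha
    obtain ⟨B', hB⟩ := hbd b hb
    obtain ⟨C', hC⟩ := hbd c hc
    obtain ⟨D', hD⟩ := hbd d hd
    have hA0 := (abs_nonneg _).trans (hA 0)
    have hB0 := (abs_nonneg _).trans (hB 0)
    have hC0 := (abs_nonneg _).trans (hC 0)
    have hD0 := (abs_nonneg _).trans (hD 0)
    set M := 1 + A' + B' + C' + D'
    have hM : 0 < M := by positivity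
    refine ⟨M⁻¹, by positivity, 0, fun p => ?_⟩
    rw [sub_zero, inv_mul_le_iff₀ hM]
    nth_rewrite 1 [← hinv t ht p]
    set q := F t p
    have h4 : |q.1| ≤ ‖q‖ := norm_fst_le q
    have h5 : |q.2.1| ≤ ‖q‖ := (norm_fst_le q.2).trans (norm_snd_le q)
    have h6 : |q.2.2| ≤ ‖q‖ := (norm_snd_le q.2).trans (norm_snd_le q)
    have h7 := norm_nonneg q
    have hlin : ∀ u v U V : ℝ, |u| ≤ U → |v| ≤ V → U + V ≤ M → |u * q.2.1 + v * q.2.2| ≤ M * ‖q‖ := by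
      intro u v U V hu hv hUV
      calc |u * q.2.1 + v * q.2.2| ≤ |u| * |q.2.1| + |v| * |q.2.2| := by
            rw [← abs_mul, ← abs_mul]; exact abs_add_le _ _
        _ ≤ U * ‖q‖ + V * ‖q‖ := by
            have hU := (abs_nonneg _).trans hu
            have hV := (abs_nonneg _).trans hv
            gcongr
        _ ≤ M * ‖q‖ := by rw [← add_mul]; gcongr
    rw [norm_eq_max]
    refine max_le ?_ (max_le ?_ ?_)
    · simp only [levelMap]
      have : 1 ≤ M := by simp only [M]; linarith
      nlinarith
    · exact hlin _ _ D' B' (hD _) (by simpa only [neg_div, abs_neg] using hB q.1) (by simp only [M]; linarith)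
    · exact hlin _ _ C' A' (by simpa only [neg_div, abs_neg] using hC q.1) (hA _) (by simp only [M]; linarith)

/-! ### Half turns -/

/-- A half turn of a helix. -/
noncomputable def halfTurn (A U V W : R3) (s : ℝ) : R3 :=
  A + s • W - Real.cos (Real.pi * s) • U + Real.sin (Real.pi * s) • V

/-- Jordan's inequality on the first half of the interval, reflected to the second half. -/
theorem min_le_sin_pi_mul {s : ℝ} (h0 : 0 ≤ s) (h1 : s ≤ 1) :
    2 * min s (1 - s) ≤ Real.sin (Real.pi * s) := by
  have key : ∀ u : ℝ, 0 ≤ u → u ≤ 1 / 2 → 2 * u ≤ Real.sin (Real.pi * u) := by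
    intro u hu hu'
    have := Real.mul_le_sin (x := Real.pi * u) (by positivity) (by nlinarith [Real.pi_pos])
    refine le_trans (le_of_eq ?_) this
    field_simp
  rcases le_total s (1 - s) with h | h
  · rw [min_eq_left h]; exact key s h0 (by linarith)
  · rw [min_eq_right h]
    have := key (1 - s) (by linarith) (by linarith)
    rwa [mul_sub Real.pi, mul_one, Real.sin_pi_sub] at this

/-- The deviation of a half turn from its tent tends to zero linearly at both ends, as the clearance
condition requires. The constant `6` is generous and rests only on `π ≤ 4`. -/
theorem halfTurn_sub_bounds {s : ℝ} (h0 : 0 ≤ s) (h1 : s ≤ 1) :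
    |(1 - 2 * s) - Real.cos (Real.pi * s)| ≤ 6 * min s (1 - s) ∧
      |2 * min s (1 - s) - Real.sin (Real.pi * s)| ≤ 6 * min s (1 - s) := by
  have key : ∀ u : ℝ, 0 ≤ u → u ≤ 1 / 2 → |(1 - 2 * u) - Real.cos (Real.pi * u)| ≤ 6 * u ∧
      |2 * u - Real.sin (Real.pi * u)| ≤ 6 * u := by
    intro u hu hu'
    have hx : 0 ≤ Real.pi * u := by positivity
    have h2 := Real.one_sub_sq_div_two_le_cos (x := Real.pi * u)
    have h3 := Real.cos_le_one (Real.pi * u)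
    have h4 := Real.sin_le hx
    have h5 : 0 ≤ Real.sin (Real.pi * u) := Real.sin_nonneg_of_nonneg_of_le_pi hx (by nlinarith [Real.pi_pos])
    have h6 : Real.pi * u ≤ 4 * u := by nlinarith [Real.pi_le_four]
    have h7 : (Real.pi * u) ^ 2 ≤ 8 * u := by nlinarith
    constructor <;> rw [abs_le] <;> constructor <;> linarith
  rcases le_total s (1 - s) with h | h
  · rw [min_eq_left h]; exact key s h0 (by linarith)
  · rw [min_eq_right h]
    have := key (1 - s) (by linarith) (by linarith)
    rw [mul_sub Real.pi, mul_one, Real.sin_pi_sub, Real.cos_pi_sub] at this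
    refine ⟨?_, this.2⟩
    rw [← abs_neg]
    convert this.1 using 2
    ring

/-- In this form the tent is the half turn with the cosine replaced by `1 - 2 * x` and the sine by
`2 * min x (1 - x)`, so the two can be compared term by term. -/
theorem tentPath_halfTurn (A U V W : R3) (x : ℝ) :
    tentPath (A - U) (A + (1 / 2 : ℝ) • W + V) (A + W + U) x =
      A + x • W - (1 - 2 * x) • U + (2 * min x (1 - x)) • V := by
  rw [tentPath]; module

section
variable {lam ℓ : R3 →L[ℝ] ℝ} {A U V W : R3} (hW : 0 < lam W)
include hW

/-- A half turn that can be straightened. -/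
theorem isotopic_halfTurn_of_clear (hU : lam U = 0) (hV : lam V = 0) {K : Set R3}
    (hK : Clear lam (lam A) (lam A + lam W) (fun x => halfTurn A U V W ((x - lam A) / lam W))
      (fun x => tentPath (A - U) (A + (1 / 2 : ℝ) • W + V) (A + W + U) ((x - lam A) / lam W)) K) :
    AmbientIsotopic (K ∪ halfTurn A U V W '' Icc 0 1)
      (K ∪ (segment ℝ (A - U) (A + (1 / 2 : ℝ) • W + V) ∪
        segment ℝ (A + (1 / 2 : ℝ) • W + V) (A + W + U))) := by
  set w := lam W with hw
  set s : ℝ → ℝ := fun x => (x - lam A) / w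
  have hI : Icc (lam A) (lam A + w) = (fun x => w * x + lam A) '' Icc 0 1 := by
    rw [image_affine_Icc' hW]; simp [add_comm]
  have hs : ∀ x, s (w * x + lam A) = x := fun x => by simp only [s]; field_simp; ring
  have hls : ∀ x, x = lam A + s x * w := fun x => by simp only [s]; field_simp; ring
  have := isotopic_move (lam := lam) (l := lam A) (r := lam A + w) (by linarith)
    (σ := fun x => halfTurn A U V W (s x))
    (τ := fun x => tentPath (A - U) (A + (1 / 2 : ℝ) • W + V) (A + W + U) (s x)) (K := K)
    (by simp only [halfTurn, s]; fun_prop) (by simp only [tentPath, s]; fun_prop) ?_ ?_ ?_ ?_ hK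
  · rw [hI, image_image, image_image] at this
    simpa only [hs, image_tentPath] using this
  · intro x _
    simp only [halfTurn, map_add, map_sub, map_smul, hU, hV, smul_eq_mul, ← hw]
    linarith [hls x]
  · intro x _
    simp only [tentPath_halfTurn, map_add lam, map_sub lam, map_smul lam, hU, hV, smul_eq_mul, ← hw]
    linarith [hls x]
  · simp only [tentPath_halfTurn, halfTurn, s]; simp
  · simp only [tentPath_halfTurn, halfTurn, s, add_sub_cancel_left, div_self hW.ne']; norm_num

/-- A half turn can be straightened away from the half space `{ℓ ≤ ℓ A}`. -/
theorem clear_halfTurn (hℓU : ℓ U = 0) (hℓW : ℓ W = 0) (hℓV : 0 < ℓ V) {K : Set R3}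
    (hK : ∀ q ∈ K, lam A ≤ lam q → lam q ≤ lam A + lam W → ℓ q ≤ ℓ A) :
    Clear lam (lam A) (lam A + lam W) (fun x => halfTurn A U V W ((x - lam A) / lam W))
      (fun x => tentPath (A - U) (A + (1 / 2 : ℝ) • W + V) (A + W + U) ((x - lam A) / lam W)) K := by
  set s : ℝ → ℝ := fun x => (x - lam A) / lam W
  have hmem : ∀ x ∈ Icc (lam A) (lam A + lam W), 0 ≤ s x ∧ s x ≤ 1 := by
    intro x hx
    exact ⟨div_nonneg (by linarith [hx.1]) hW.le, by rw [div_le_one hW]; linarith [hx.2]⟩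
  have hD : 0 < 6 * (‖U‖ + ‖V‖ + 1) := by positivity
  have hdist : ∀ x ∈ Icc (lam A) (lam A + lam W),
      ‖tentPath (A - U) (A + (1 / 2 : ℝ) • W + V) (A + W + U) (s x) - halfTurn A U V W (s x)‖ ≤
        6 * (‖U‖ + ‖V‖ + 1) * min (s x) (1 - s x) := by
    intro x hx
    obtain ⟨h0, h1⟩ := hmem x hx
    obtain ⟨h2, h3⟩ := halfTurn_sub_bounds h0 h1
    have h4 : 0 ≤ min (s x) (1 - s x) := le_min h0 (by linarith)
    have : tentPath (A - U) (A + (1 / 2 : ℝ) • W + V) (A + W + U) (s x) - halfTurn A U V W (s x) =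
        -((1 - 2 * s x) - Real.cos (Real.pi * s x)) • U +
          (2 * min (s x) (1 - s x) - Real.sin (Real.pi * s x)) • V := by
      rw [tentPath_halfTurn, halfTurn]; module
    rw [this]
    refine (norm_add_le _ _).trans ?_
    rw [norm_smul, norm_smul, Real.norm_eq_abs, Real.norm_eq_abs, abs_neg]
    nlinarith [mul_le_mul_of_nonneg_right h2 (norm_nonneg U),
      mul_le_mul_of_nonneg_right h3 (norm_nonneg V)]
  refine clear_of_wall ℓ (ℓ A) (C := ℓ V / (6 * (‖U‖ + ‖V‖ + 1))) (by positivity)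
    (fun q hq hx => hK q hq hx.1 hx.2) ?_ ?_
  · intro x hx
    obtain ⟨h0, h1⟩ := hmem x hx
    have h2 := mul_le_mul_of_nonneg_left (hdist x hx) (show 0 ≤ ℓ V / (6 * (‖U‖ + ‖V‖ + 1)) by positivity)
    refine h2.trans ?_
    have h4 : 0 ≤ min (s x) (1 - s x) := le_min h0 (by linarith)
    rw [← mul_assoc, div_mul_cancel₀ _ hD.ne']
    change _ ≤ ℓ (halfTurn A U V W (s x)) - ℓ A
    simp only [halfTurn, map_add, map_sub, map_smul, hℓU, hℓW, smul_eq_mul]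
    nlinarith [min_le_sin_pi_mul h0 h1]
  · intro x hx
    obtain ⟨h0, h1⟩ := hmem x hx
    have h2 := mul_le_mul_of_nonneg_left (hdist x hx) (show 0 ≤ ℓ V / (6 * (‖U‖ + ‖V‖ + 1)) by positivity)
    refine h2.trans ?_
    have h4 : 0 ≤ min (s x) (1 - s x) := le_min h0 (by linarith)
    rw [← mul_assoc, div_mul_cancel₀ _ hD.ne']
    change _ ≤ ℓ (tentPath (A - U) (A + (1 / 2 : ℝ) • W + V) (A + W + U) (s x)) - ℓ A
    simp only [tentPath_halfTurn, map_add ℓ, map_sub ℓ, map_smul ℓ, hℓU, hℓW, smul_eq_mul]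
    nlinarith

end

/-- Straightening a half turn, away from the half space `{ℓ ≤ ℓ A}`. -/
theorem isotopic_halfTurn {lam ℓ : R3 →L[ℝ] ℝ} {A U V W : R3} (hU : lam U = 0) (hV : lam V = 0)
    (hW : 0 < lam W) (hℓU : ℓ U = 0) (hℓW : ℓ W = 0) (hℓV : 0 < ℓ V) {K : Set R3}
    (hK : ∀ q ∈ K, lam A ≤ lam q → lam q ≤ lam A + lam W → ℓ q ≤ ℓ A) :
    AmbientIsotopic (K ∪ halfTurn A U V W '' Icc 0 1)
      (K ∪ (segment ℝ (A - U) (A + (1 / 2 : ℝ) • W + V) ∪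
        segment ℝ (A + (1 / 2 : ℝ) • W + V) (A + W + U))) :=
  isotopic_halfTurn_of_clear hW hU hV (clear_halfTurn hW hℓU hℓW hℓV hK)

/-! ### Images of polygonal sets -/

theorem image_segment_of_affine {f : R3 → R3} {a b : R3}
    (h : ∀ x ∈ Icc (0 : ℝ) 1, f (a + x • (b - a)) = f a + x • (f b - f a)) :
    f '' segment ℝ a b = segment ℝ (f a) (f b) := by
  rw [segment_eq_image', segment_eq_image', image_image]
  exact image_congr h

theorem image_polygonalPath {f : R3 → R3} (h : ∀ a b, f '' segment ℝ a b = segment ℝ (f a) (f b)) :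
    ∀ l : List R3, f '' polygonalPath l = polygonalPath (l.map f)
  | [] => by simp [polygonalPath]
  | [_] => by simp [polygonalPath]
  | a :: b :: l => by
    simp only [polygonalPath, image_union, h, List.map_cons]
    rw [image_polygonalPath h (b :: l), List.map_cons]

theorem image_segment_boxMap (a b u v : R3) :
    boxMap a b '' segment ℝ u v = segment ℝ (boxMap a b u) (boxMap a b v) := by
  refine image_segment_of_affine fun x _ => ?_
  refine Prod.ext ?_ (Prod.ext ?_ ?_) <;>
    simp only [boxMap, Prod.fst_add, Prod.snd_add, Prod.smul_fst, Prod.smul_snd, Prod.fst_sub,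
      Prod.snd_sub, smul_eq_mul] <;> ring

theorem pathEdges_map (g : ZPt → ZPt) :
    ∀ l : List ZPt, pathEdges (l.map g) = (pathEdges l).map (Prod.map g g)
  | [] => rfl
  | [_] => rfl
  | a :: b :: l => by
    have := pathEdges_map g (b :: l)
    simp only [List.map_cons, pathEdges] at this ⊢
    rw [this]; rfl

/-- The image of a polygonal set under a map that is affine on each edge. -/
theorem image_paths {f : R3 → R3} {g : ZPt → ZPt} {ok : ZEdge → Bool}
    (h : ∀ e : ZEdge, ok e = true → f '' e.carrier = ZEdge.carrier (g e.1, g e.2))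
    {P : List (List ZPt)} (hP : (P.flatMap pathEdges).all ok = true) :
    f '' paths P = paths (P.map (List.map g)) := by
  have h1 : (P.map (List.map g)).flatMap pathEdges = (P.flatMap pathEdges).map (Prod.map g g) := by
    simp only [List.flatMap_map, List.map_flatMap, pathEdges_map]
  rw [paths, paths, h1]
  generalize P.flatMap pathEdges = L at hP
  induction L with
  | nil => simp [carrier_nil]
  | cons e L ih =>
    rw [List.all_cons, Bool.and_eq_true] at hP
    rw [List.map_cons, carrier_cons, carrier_cons, image_union, ih hP.2, h e hP.1]
    rfl

theorem dotL_le_of_mem_carrier {e : ZEdge} {w : ZPt} {k : ℤ} (h1 : w.dot e.1 ≤ k)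
    (h2 : w.dot e.2 ≤ k) {p : R3} (hp : p ∈ e.carrier) : dotL w.toR p ≤ k :=
  (dotL_le_edgeMax e w p hp).trans (by exact_mod_cast max_le h1 h2)

theorem le_dotL_of_mem_carrier {e : ZEdge} {w : ZPt} {k : ℤ} (h1 : k ≤ w.dot e.1)
    (h2 : k ≤ w.dot e.2) {p : R3} (hp : p ∈ e.carrier) : (k : ℝ) ≤ dotL w.toR p := by
  have := dotL_le_of_mem_carrier (e := e) (w := w.neg) (k := -k)
    (by simp only [ZPt.dot, ZPt.neg] at *; linarith) (by simp only [ZPt.dot, ZPt.neg] at *; linarith) hp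
  simp only [dotL_apply, ZPt.toR, ZPt.neg] at this ⊢
  push_cast at this
  linarith

/-- The integral box spanned by an edge contains it. -/
theorem coord_of_mem_carrier {e : ZEdge} {p : R3} (hp : p ∈ e.carrier) :
    (∀ k : ℤ, e.1.1 ≤ k → e.2.1 ≤ k → p.1 ≤ k) ∧ (∀ k : ℤ, k ≤ e.1.1 → k ≤ e.2.1 → k ≤ p.1) ∧
    (∀ k : ℤ, e.1.2.1 ≤ k → e.2.2.1 ≤ k → p.2.1 ≤ k) ∧
    (∀ k : ℤ, k ≤ e.1.2.1 → k ≤ e.2.2.1 → k ≤ p.2.1) ∧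
    (∀ k : ℤ, e.1.2.2 ≤ k → e.2.2.2 ≤ k → p.2.2 ≤ k) ∧
    (∀ k : ℤ, k ≤ e.1.2.2 → k ≤ e.2.2.2 → k ≤ p.2.2) := by
  refine ⟨fun k h1 h2 => ?_, fun k h1 h2 => ?_, fun k h1 h2 => ?_, fun k h1 h2 => ?_,
    fun k h1 h2 => ?_, fun k h1 h2 => ?_⟩
  · simpa [ZPt.toR] using dotL_le_of_mem_carrier (w := (1, 0, 0)) (by simpa [ZPt.dot] using h1)
      (by simpa [ZPt.dot] using h2) hp
  · simpa [ZPt.toR] using le_dotL_of_mem_carrier (w := (1, 0, 0)) (by simpa [ZPt.dot] using h1)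
      (by simpa [ZPt.dot] using h2) hp
  · simpa [ZPt.toR] using dotL_le_of_mem_carrier (w := (0, 1, 0)) (by simpa [ZPt.dot] using h1)
      (by simpa [ZPt.dot] using h2) hp
  · simpa [ZPt.toR] using le_dotL_of_mem_carrier (w := (0, 1, 0)) (by simpa [ZPt.dot] using h1)
      (by simpa [ZPt.dot] using h2) hp
  · simpa [ZPt.toR] using dotL_le_of_mem_carrier (w := (0, 0, 1)) (by simpa [ZPt.dot] using h1)
      (by simpa [ZPt.dot] using h2) hp
  · simpa [ZPt.toR] using le_dotL_of_mem_carrier (w := (0, 0, 1)) (by simpa [ZPt.dot] using h1)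
      (by simpa [ZPt.dot] using h2) hp

/-- All points of a polygonal set have a property that is checked on edges. -/
theorem forall_mem_paths {P : List (List ZPt)} {ok : ZEdge → Bool} {Q : R3 → Prop}
    (hP : (P.flatMap pathEdges).all ok = true)
    (h : ∀ e : ZEdge, ok e = true → ∀ p ∈ e.carrier, Q p) : ∀ p ∈ paths P, Q p := by
  rintro p ⟨e, he, hp⟩
  exact h e (List.all_eq_true.1 hP e he) p hp

/-! ### Helices -/

/-- The helix of radius `r` about the first coordinate axis, starting over `x₀` at angle `φ` and
making `k` half turns over a length `w`. -/
noncomputable def helixPt (x₀ w r φ k s : ℝ) : R3 :=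
  (x₀ + w * s, r * Real.cos (φ + Real.pi * k * s), r * Real.sin (φ + Real.pi * k * s))

noncomputable def helix (x₀ w r φ k : ℝ) : Set R3 := helixPt x₀ w r φ k '' Icc 0 1

theorem mem_box_of_mem_helix {x₀ w r φ k : ℝ} (hw : 0 ≤ w) (hr : 0 ≤ r) {p : R3}
    (hp : p ∈ helix x₀ w r φ k) :
    (x₀ ≤ p.1 ∧ p.1 ≤ x₀ + w) ∧ (-r ≤ p.2.1 ∧ p.2.1 ≤ r) ∧ (-r ≤ p.2.2 ∧ p.2.2 ≤ r) := by
  obtain ⟨s, hs, rfl⟩ := hp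
  refine ⟨⟨?_, ?_⟩, ⟨?_, ?_⟩, ?_, ?_⟩ <;> simp only [helixPt]
  · nlinarith [mul_nonneg hw hs.1]
  · nlinarith [mul_le_mul_of_nonneg_left hs.2 hw]
  · nlinarith [Real.neg_one_le_cos (φ + Real.pi * k * s)]
  · nlinarith [Real.cos_le_one (φ + Real.pi * k * s)]
  · nlinarith [Real.neg_one_le_sin (φ + Real.pi * k * s)]
  · nlinarith [Real.sin_le_one (φ + Real.pi * k * s)]

theorem image_Icc_eq_segment {f : ℝ → R3} {a b : ℝ} (hab : a < b) {p q : R3}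
    (h : ∀ x ∈ Icc a b, f x = p + ((x - a) / (b - a)) • (q - p)) :
    f '' Icc a b = segment ℝ p q := by
  have hba : 0 < b - a := sub_pos.2 hab
  have hI : Icc (0 : ℝ) 1 = (fun x => (x - a) / (b - a)) '' Icc a b := by
    ext s
    constructor
    · intro hs
      exact ⟨a + s * (b - a), ⟨by nlinarith [hs.1], by nlinarith [hs.2]⟩, by simp only; field_simp; ring⟩
    · rintro ⟨x, hx, rfl⟩
      exact ⟨div_nonneg (by linarith [hx.1]) hba.le, by rw [div_le_one hba]; linarith [hx.2]⟩
  rw [segment_eq_image', hI, image_image]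
  exact image_congr h

theorem image_Icc_eq_helix {f : ℝ → R3} {x₀ w r φ k : ℝ} (hw : 0 < w)
    (h : ∀ s ∈ Icc (0 : ℝ) 1, f (x₀ + w * s) = helixPt x₀ w r φ k s) :
    f '' Icc x₀ (x₀ + w) = helix x₀ w r φ k := by
  have hI : Icc x₀ (x₀ + w) = (fun s => w * s + x₀) '' Icc 0 1 := by
    rw [image_affine_Icc' hw]; simp [add_comm]
  rw [hI, image_image, helix]
  exact image_congr fun s hs => by rw [add_comm, h s hs]

theorem image_Icc_union (f : ℝ → R3) {a b c : ℝ} (h : a ≤ b) (h' : b ≤ c) :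
    f '' Icc a c = f '' Icc a b ∪ f '' Icc b c := by
  rw [← image_union, Icc_union_Icc_eq_Icc h h']

/-! ### The common model -/

/-- The polygonal part of the common model. -/
def commonFrame : List (List ZPt) :=
  [[(80, 24, 0), (76, 0, -24), (48, -27, 0), (0, -24, 0)], [(40, -24, 0), (44, 0, -24), (72, 24,
  0), (120, 27, 0), (120, 24, 0)], [(0, 0, 0), (40, 0, 0), (80, 0, 0), (120, 0, 0), (192, 0, 46),
  (-144, 0, 24), (0, 0, 0)]]

/-- The boxes containing the two helices. -/
def helixBoxes : List ZEdge := [((0, -24, -24), (40, 24, 24)), ((80, -24, -24), (120, 24, 24))]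

/-- The model to which the three links are deformed: two helices around the first coordinate axis,
joined by polygonal paths, together with an unknotted polygon containing the axis. -/
noncomputable def commonModel (m n : ℕ) : Set R3 :=
  (helix 0 40 24 Real.pi (2 * n) ∪ helix 80 40 24 0 (2 * m)) ∪ paths commonFrame

/-- A helix stays within its radius of the axis whatever its starting angle and its number of half
turns. -/
theorem helices_subset_boxes (φ k φ' k' : ℝ) :
    helix 0 40 24 φ k ∪ helix 80 40 24 φ' k' ⊆ boxes helixBoxes := by
  rintro p (hp | hp)
  · refine ⟨_, List.mem_cons_self .., ?_⟩
    have := mem_box_of_mem_helix (by norm_num) (by norm_num) hp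
    simp only [ZEdge.box, mem_ofPred_eq]
    norm_num at this ⊢
    exact this
  · refine ⟨_, List.mem_cons_of_mem _ (List.mem_cons_self ..), ?_⟩
    have := mem_box_of_mem_helix (by norm_num) (by norm_num) hp
    simp only [ZEdge.box, mem_ofPred_eq]
    norm_num at this ⊢
    exact this

/-! ### Conway's normal form -/

/-- The edges of the Conway form that stay fixed while the crossing is straightened. -/
def conwayRest : List (List ZPt) :=
  [[(0, -72, 0), (-40, -72, 0), (-40, -24, 0), (0, -24, 0)], [(0, -72, 0), (40, -72, 0)],
    [(80, -72, 0), (120, -72, 0)], [(120, -72, 0), (160, -72, 0), (160, -24, 0), (120, -24, 0)],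
    [(-40, 24, 0), (-40, 72, 0), (0, 72, 0)], [(0, 72, 0), (40, 72, 0)], [(40, 72, 0), (80, 72, 0)],
    [(80, 72, 0), (120, 72, 0)], [(160, 24, 0), (160, 72, 0), (120, 72, 0)]]

/-- The two strands of the middle crossing. -/
def conwayCrossing : List (List ZPt) :=
  [[(40, -72, 0), (60, -48, 24), (80, -24, 0)], [(40, -24, 0), (60, -48, -24), (80, -72, 0)]]

/-- The third strand after contraction to the axis. -/
def conwayAxis : List (List ZPt) := [[(-40, 24, 0), (0, 0, 0), (40, 0, 0), (80, 0, 0), (120, 0, 0), (160, 24, 0)]]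

/-- The angle along the third strand. -/
noncomputable def conwayAngle (m n : ℕ) (x : ℝ) : ℝ :=
  Real.pi * (2 * n) * clamp 0 1 (x / 40) + Real.pi * (2 * m) * clamp 0 1 ((x - 80) / 40)

noncomputable def conwayStrand (m n : ℕ) (x : ℝ) : R3 :=
  (x, 24 * Real.cos (conwayAngle m n x), 24 * Real.sin (conwayAngle m n x))

noncomputable def conwayStrand' (x : ℝ) : R3 := (x, 24 * max 0 (max (-x / 40) ((x - 120) / 40)), 0)

theorem conwayAngle_left (m n : ℕ) {x : ℝ} (h : x ≤ 0) : conwayAngle m n x = 0 := by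
  rw [conwayAngle, clamp_of_le (by linarith), clamp_of_le (by linarith)]; simp

theorem conwayAngle_helix (m n : ℕ) {s : ℝ} (h : s ∈ Icc (0 : ℝ) 1) :
    conwayAngle m n (40 * s) = Real.pi * (2 * n) * s := by
  rw [conwayAngle, mul_div_cancel_left₀ _ (by norm_num), clamp_of_mem h,
    clamp_of_le (by linarith [h.2])]; ring

theorem conwayAngle_mid (m n : ℕ) {x : ℝ} (h : 40 ≤ x) (h' : x ≤ 80) :
    conwayAngle m n x = n * (2 * Real.pi) := by
  rw [conwayAngle, clamp_of_ge zero_le_one (by linarith), clamp_of_le (by linarith)]; ring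

theorem conwayAngle_helix' (m n : ℕ) {s : ℝ} (h : s ∈ Icc (0 : ℝ) 1) :
    conwayAngle m n (80 + 40 * s) = Real.pi * (2 * m) * s + n * (2 * Real.pi) := by
  rw [conwayAngle, add_sub_cancel_left, mul_div_cancel_left₀ _ (by norm_num), clamp_of_mem h,
    clamp_of_ge zero_le_one (by linarith [h.1])]; ring

theorem conwayAngle_right (m n : ℕ) {x : ℝ} (h : 120 ≤ x) :
    conwayAngle m n x = (n + m : ℕ) * (2 * Real.pi) := by
  rw [conwayAngle, clamp_of_ge zero_le_one (by linarith), clamp_of_ge zero_le_one (by linarith)]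
  push_cast; ring

theorem conwayStrand_straight (m n : ℕ) {x : ℝ} (h : x ≤ 0 ∨ (40 ≤ x ∧ x ≤ 80) ∨ 120 ≤ x) :
    conwayStrand m n x = (x, 24, 0) := by
  rcases h with h | ⟨h, h'⟩ | h
  · simp [conwayStrand, conwayAngle_left m n h]
  · simp only [conwayStrand, conwayAngle_mid m n h h', Real.cos_nat_mul_two_pi]
    rw [← zero_add (n * (2 * Real.pi)), Real.sin_add_nat_mul_two_pi]; simp
  · simp only [conwayStrand, conwayAngle_right m n h, Real.cos_nat_mul_two_pi]
    rw [← zero_add ((n + m : ℕ) * (2 * Real.pi)), Real.sin_add_nat_mul_two_pi]; simp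

/-- Each twist region rotates the strand by a multiple of `2π`, so that it reappears at `y = 24` and
is straight between and beyond the helices. -/
theorem image_conwayStrand (m n : ℕ) : conwayStrand m n '' Icc (-40) 160 =
    segment ℝ (-40, 24, 0) (0, 24, 0) ∪ (helix 0 40 24 0 (2 * n) ∪
      (segment ℝ (40, 24, 0) (80, 24, 0) ∪ (helix 80 40 24 0 (2 * m) ∪
        segment ℝ (120, 24, 0) (160, 24, 0)))) := by
  have hseg : ∀ a b : ℝ, a < b → (∀ x ∈ Icc a b, x ≤ 0 ∨ (40 ≤ x ∧ x ≤ 80) ∨ 120 ≤ x) →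
      conwayStrand m n '' Icc a b = segment ℝ (a, 24, 0) (b, 24, 0) := by
    intro a b hab h
    refine image_Icc_eq_segment hab fun x hx => ?_
    rw [conwayStrand_straight m n (h x hx)]
    have : b - a ≠ 0 := (sub_pos.2 hab).ne'
    ext <;> simp
    field_simp; ring
  rw [image_Icc_union _ (show (-40 : ℝ) ≤ 0 by norm_num) (by norm_num),
    image_Icc_union _ (show (0 : ℝ) ≤ 40 by norm_num) (by norm_num),
    image_Icc_union _ (show (40 : ℝ) ≤ 80 by norm_num) (by norm_num),
    image_Icc_union _ (show (80 : ℝ) ≤ 120 by norm_num) (by norm_num)]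
  rw [hseg (-40) 0 (by norm_num) fun x hx => Or.inl hx.2,
    hseg 40 80 (by norm_num) fun x hx => Or.inr (Or.inl hx),
    hseg 120 160 (by norm_num) fun x hx => Or.inr (Or.inr hx.1)]
  congr 2
  · have := image_Icc_eq_helix (f := conwayStrand m n) (x₀ := 0) (w := 40) (r := 24) (φ := 0)
      (k := 2 * n) (by norm_num) fun s hs => by
        simp only [conwayStrand, helixPt, zero_add, conwayAngle_helix m n hs]
    simpa using this
  · congr 2
    have := image_Icc_eq_helix (f := conwayStrand m n) (x₀ := 80) (w := 40) (r := 24) (φ := 0)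
      (k := 2 * m) (by norm_num) fun s hs => by
        simp only [conwayStrand, helixPt, zero_add, conwayAngle_helix' m n hs,
          Real.cos_add_nat_mul_two_pi, Real.sin_add_nat_mul_two_pi]
    norm_num at this
    exact this

theorem image_conwayStrand' : conwayStrand' '' Icc (-40) 160 = paths conwayAxis := by
  have hseg : ∀ a b u v : ℝ, a < b → (∀ x ∈ Icc a b, 24 * max 0 (max (-x / 40) ((x - 120) / 40)) =
      u + (x - a) / (b - a) * (v - u)) →
      conwayStrand' '' Icc a b = segment ℝ (a, u, 0) (b, v, 0) := by
    intro a b u v hab h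
    refine image_Icc_eq_segment hab fun x hx => ?_
    rw [conwayStrand', h x hx]
    have : b - a ≠ 0 := (sub_pos.2 hab).ne'
    ext <;> simp
    field_simp; ring
  have hmid : ∀ x : ℝ, 0 ≤ x → x ≤ 120 → max 0 (max (-x / 40) ((x - 120) / 40)) = 0 := fun x h h' =>
    max_eq_left (max_le (by linarith) (by linarith))
  rw [image_Icc_union _ (show (-40 : ℝ) ≤ 0 by norm_num) (by norm_num),
    image_Icc_union _ (show (0 : ℝ) ≤ 40 by norm_num) (by norm_num),
    image_Icc_union _ (show (40 : ℝ) ≤ 80 by norm_num) (by norm_num),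
    image_Icc_union _ (show (80 : ℝ) ≤ 120 by norm_num) (by norm_num)]
  rw [hseg (-40) 0 24 0 (by norm_num), hseg 0 40 0 0 (by norm_num), hseg 40 80 0 0 (by norm_num),
    hseg 80 120 0 0 (by norm_num), hseg 120 160 0 24 (by norm_num)]
  · simp [conwayAxis, paths_cons, paths_nil, polygonalPath, ZPt.toR]
  · intro x hx
    rw [max_eq_right (le_max_of_le_right (by linarith [hx.1])), max_eq_right (by linarith [hx.1])]
    ring
  · intro x hx; rw [hmid x (by linarith [hx.1]) (by linarith [hx.2])]; ring
  · intro x hx; rw [hmid x (by linarith [hx.1]) (by linarith [hx.2])]; ring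
  · intro x hx; rw [hmid x (by linarith [hx.1]) (by linarith [hx.2])]; ring
  · intro x hx
    rw [max_eq_right (le_max_of_le_left (by linarith [hx.2])), max_eq_left (by linarith [hx.2])]
    ring

theorem twistRegion_eq (i j : ℕ) (a : ℤ) : boxMap (40, 48, 48) (0, -120, 0) '' twistRegion i j a =
    (fun s : ℝ => ((40 * (i + s), 48 * (j - 2) + 24 * Real.cos (Real.pi * a * s),
      24 * Real.sin (Real.pi * a * s)) : R3)) '' Icc 0 1 ∪
    (fun s : ℝ => ((40 * (i + s), 48 * (j - 2) - 24 * Real.cos (Real.pi * a * s),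
      -(24 * Real.sin (Real.pi * a * s))) : R3)) '' Icc 0 1 := by
  have : twistRegion i j a =
      (fun s : ℝ => ((i + s, j + 1 / 2 + 1 / 2 * Real.cos (Real.pi * a * s),
        1 / 2 * Real.sin (Real.pi * a * s)) : R3)) '' Icc 0 1 ∪
      (fun s : ℝ => ((i + s, j + 1 / 2 + -(1 / 2) * Real.cos (Real.pi * a * s),
        -(1 / 2) * Real.sin (Real.pi * a * s)) : R3)) '' Icc 0 1 := by
    ext p
    simp only [twistRegion, mem_ofPred_eq, mem_union, mem_image]
    constructor
    · rintro ⟨s, hs, r, rfl | rfl, rfl⟩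
      · exact Or.inl ⟨s, hs, rfl⟩
      · exact Or.inr ⟨s, hs, rfl⟩
    · rintro (⟨s, hs, rfl⟩ | ⟨s, hs, rfl⟩)
      · exact ⟨s, hs, _, Or.inl rfl, rfl⟩
      · exact ⟨s, hs, _, Or.inr rfl, rfl⟩
  rw [this, image_union, image_image, image_image]
  congr 1 <;> refine image_congr fun s _ => ?_ <;> ext <;> simp only [boxMap] <;> ring

/-- The halves of the middle crossing. -/
noncomputable def conwayHalf (ε : ℝ) : Set R3 :=
  halfTurn (40, -48, 0) (0, 24 * ε, 0) (0, 0, 24 * ε) (40, 0, 0) '' Icc 0 1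

/-- The rescaling puts the four strands at `y = -72, -24, 24, 72`, so the twist regions of strands
two and three are centred on the first axis. In them the third strand starts at angle `0` and the
second one at angle `π`. -/
theorem image_conwayLink (m n : ℕ) :
    boxMap (40, 48, 48) (0, -120, 0) '' conwayLink [2 * (n : ℤ), 1, 2 * (m : ℤ)] =
      ((helix 0 40 24 Real.pi (2 * n) ∪ helix 80 40 24 Real.pi (2 * m)) ∪ paths conwayRest) ∪
        (conwayHalf 1 ∪ conwayHalf (-1) ∪ conwayStrand m n '' Icc (-40) 160) := by
  have hslab : (⋃ i : Fin ([2 * (n : ℤ), 1, 2 * (m : ℤ)]).length,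
      conwaySlab i (([2 * (n : ℤ), 1, 2 * (m : ℤ)]).get i)) =
      conwaySlab 0 (2 * n) ∪ (conwaySlab 1 1 ∪ conwaySlab 2 (2 * m)) := by
    ext p
    simp [Fin.exists_fin_succ]
  have ha : boxMap (40, 48, 48) (0, -120, 0) '' twistRegion 0 2 (2 * (n : ℤ)) =
      helix 0 40 24 0 (2 * n) ∪ helix 0 40 24 Real.pi (2 * n) := by
    rw [twistRegion_eq, helix, helix]
    congr 1 <;> refine image_congr fun s _ => ?_ <;>
      simp only [helixPt, add_comm Real.pi, Real.cos_add_pi, Real.sin_add_pi] <;> push_cast <;>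
      ext <;> simp
  have hb : boxMap (40, 48, 48) (0, -120, 0) '' twistRegion 2 2 (2 * (m : ℤ)) =
      helix 80 40 24 0 (2 * m) ∪ helix 80 40 24 Real.pi (2 * m) := by
    rw [twistRegion_eq, helix, helix]
    congr 1 <;> refine image_congr fun s _ => ?_ <;>
      simp only [helixPt, add_comm Real.pi, Real.cos_add_pi, Real.sin_add_pi] <;> push_cast <;>
      ext <;> simp <;> ring
  have hc : boxMap (40, 48, 48) (0, -120, 0) '' twistRegion 1 1 (-1) =
      conwayHalf (-1) ∪ conwayHalf 1 := by
    rw [twistRegion_eq, conwayHalf, conwayHalf]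
    congr 1 <;> refine image_congr fun s _ => ?_ <;> simp only [halfTurn] <;> push_cast <;>
      ext <;> simp <;> ring
  rw [image_conwayStrand, conwayLink, hslab]
  simp only [List.length_cons, List.length_nil, conwaySlab, planarCap, straightStrand]
  norm_num
  simp only [image_union, ha, hb, hc, 
    image_segment_boxMap, conwayRest, paths_cons, paths_nil, List.map_cons, List.map_nil,
    polygonalPath, union_empty]
  simp only [boxMap, ZPt.toR]
  norm_num
  rw [segment_symm ℝ ((0 : ℝ), (24 : ℝ), (0 : ℝ)) (-40, 24, 0)]
  ext p; simp only [mem_union]; grind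

/-- Points that keep away from the third strand of the Conway form while it is contracted. -/
def AwayFromStrand (m n : ℕ) (p : R3) : Prop :=
  p.1 ≤ -40 ∨ 160 ≤ p.1 ∨ 72 ≤ |p.2.1| ∨
    (p.2.1 ≤ -24 ∧ (p.1 ≤ 0 ∨ (40 ≤ p.1 ∧ p.1 ≤ 80) ∨ 120 ≤ p.1)) ∨
    ((0 ≤ p.1 ∧ p.1 ≤ 120) ∧ p.2 = -(conwayStrand m n p.1).2)

/-- The third strand shrinks radially towards the axis over the twist regions. The second strand is
antipodal to it there, hence at `2 - t` times the radius from the moving point. Every other piece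
has second coordinate at least `24` away from the swept region, or sits at an end level where
nothing moves. -/
theorem clear_of_awayFromStrand {m n : ℕ} {K : Set R3} (h : ∀ p ∈ K, AwayFromStrand m n p) :
    Clear (dotL (1, 0, 0)) (-40) 160 (conwayStrand m n) conwayStrand' K := by
  refine ⟨1 / 2, by norm_num, fun q hq hx t ht => ?_⟩
  have hq1 : dotL (1, 0, 0) q = q.1 := by simp
  rw [hq1] at hx ⊢
  set θ := conwayAngle m n q.1
  set y := 24 * max 0 (max (-q.1 / 40) ((q.1 - 120) / 40)) with hy
  have hy0 : 0 ≤ y := mul_nonneg (by norm_num) (le_max_left _ _)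
  have hy1 : y ≤ 24 := by
    have : max 0 (max (-q.1 / 40) ((q.1 - 120) / 40)) ≤ 1 :=
      max_le zero_le_one (max_le (by linarith [hx.1]) (by linarith [hx.2]))
    linarith
  have hd : conwayStrand' q.1 - conwayStrand m n q.1 =
      (0, y - 24 * Real.cos θ, -(24 * Real.sin θ)) := by
    ext <;> simp [conwayStrand', conwayStrand, θ, hy]
  have hc := Real.neg_one_le_cos θ
  have hc' := Real.cos_le_one θ
  have hs := Real.neg_one_le_sin θ
  have hs' := Real.sin_le_one θ
  have hnd : ‖conwayStrand' q.1 - conwayStrand m n q.1‖ ≤ 48 := by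
    rw [hd, norm_eq_max]
    simp only [abs_zero, max_le_iff, abs_le]
    refine ⟨by norm_num, ⟨by linarith, by linarith⟩, by linarith, by linarith⟩
  have hw : q - (conwayStrand m n q.1 + t • (conwayStrand' q.1 - conwayStrand m n q.1)) =
      (0, q.2.1 - ((1 - t) * (24 * Real.cos θ) + t * y), q.2.2 - (1 - t) * (24 * Real.sin θ)) := by
    rw [hd]; ext <;> simp [conwayStrand, θ] <;> ring
  rw [hw, norm_eq_max]
  have key : 24 ≤ |q.2.1 - ((1 - t) * (24 * Real.cos θ) + t * y)| →
      1 / 2 * ‖conwayStrand' q.1 - conwayStrand m n q.1‖ ≤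
      max |(0 : ℝ)| (max |q.2.1 - ((1 - t) * (24 * Real.cos θ) + t * y)|
        |q.2.2 - (1 - t) * (24 * Real.sin θ)|) := fun h24 =>
    le_max_of_le_right (le_max_of_le_left (by linarith))
  have hv1 : (1 - t) * (24 * Real.cos θ) + t * y ≤ 24 := by
    nlinarith [mul_nonneg (sub_nonneg.2 ht.2) (sub_nonneg.2 hc'), mul_nonneg ht.1 (sub_nonneg.2 hy1)]
  have hv2 : -24 ≤ (1 - t) * (24 * Real.cos θ) + t * y := by
    nlinarith [mul_nonneg (sub_nonneg.2 ht.2) (by linarith : 0 ≤ Real.cos θ + 1), mul_nonneg ht.1 hy0, ht.1]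
  have hstraight : ∀ x, (x ≤ 0 ∨ (40 ≤ x ∧ x ≤ 80) ∨ 120 ≤ x) →
      24 * Real.cos (conwayAngle m n x) = 24 ∧ 24 * Real.sin (conwayAngle m n x) = 0 := by
    intro x h
    have := conwayStrand_straight m n h
    simp only [conwayStrand, Prod.mk.injEq, true_and] at this
    exact this
  rcases h q hq with h1 | h1 | h1 | ⟨h1, h2⟩ | ⟨h1, h2⟩
  · have h3 : conwayStrand' q.1 - conwayStrand m n q.1 = 0 := by
      obtain ⟨e1, e2⟩ := hstraight q.1 (Or.inl (by linarith))
      have e3 : y = 24 := by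
        rw [hy, le_antisymm h1 hx.1]; norm_num
      simp only [hd, θ, e1, e2, e3]; simp
    rw [h3]; simp
  · have h3 : conwayStrand' q.1 - conwayStrand m n q.1 = 0 := by
      obtain ⟨e1, e2⟩ := hstraight q.1 (Or.inr (Or.inr (by linarith)))
      have e3 : y = 24 := by
        rw [hy, le_antisymm hx.2 h1]; norm_num
      simp only [hd, θ, e1, e2, e3]; simp
    rw [h3]; simp
  · refine key ?_
    rcases le_abs.1 h1 with h | h
    · exact le_abs.2 (Or.inl (by linarith))
    · exact le_abs.2 (Or.inr (by linarith))
  · refine key (le_abs.2 (Or.inr ?_))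
    rw [show 24 * Real.cos θ = 24 from (hstraight q.1 h2).1]
    nlinarith [ht.1, ht.2, mul_nonneg ht.1 hy0]
  · have hy' : y = 0 := by
      rw [hy, max_eq_left (max_le (by linarith [h1.1]) (by linarith [h1.2])), mul_zero]
    rw [h2, hd, norm_eq_max, hy']
    simp only [conwayStrand, Prod.neg_mk, abs_zero]
    have e1 : |-(24 * Real.cos θ) - ((1 - t) * (24 * Real.cos θ) + t * 0)| =
        (2 - t) * |24 * Real.cos θ| := by
      rw [show -(24 * Real.cos θ) - ((1 - t) * (24 * Real.cos θ) + t * 0) =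
        -((2 - t) * (24 * Real.cos θ)) by ring, abs_neg, abs_mul,
        abs_of_nonneg (by linarith [ht.2] : 0 ≤ 2 - t)]
    have e2 : |-(24 * Real.sin θ) - (1 - t) * (24 * Real.sin θ)| =
        (2 - t) * |24 * Real.sin θ| := by
      rw [show -(24 * Real.sin θ) - (1 - t) * (24 * Real.sin θ) =
        -((2 - t) * (24 * Real.sin θ)) by ring, abs_neg, abs_mul,
        abs_of_nonneg (by linarith [ht.2] : 0 ≤ 2 - t)]
    have h3 : ∀ a : ℝ, 0 ≤ a → 1 / 2 * a ≤ (2 - t) * a := fun a ha =>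
      mul_le_mul_of_nonneg_right (by linarith [ht.2]) ha
    rw [e1, e2, zero_sub, abs_neg, abs_neg, mul_max_of_nonneg _ _ (by norm_num),
      mul_max_of_nonneg _ _ (by norm_num), mul_zero]
    exact max_le_max_left _ (max_le_max (h3 _ (abs_nonneg _)) (h3 _ (abs_nonneg _)))

theorem conwayHalf_props {ε : ℝ} {p : R3} (hp : p ∈ conwayHalf ε) :
    (40 ≤ p.1 ∧ p.1 ≤ 80) ∧ 0 ≤ ε * p.2.2 := by
  obtain ⟨s, hs, rfl⟩ := hp
  have h : 0 ≤ Real.sin (Real.pi * s) := Real.sin_nonneg_of_nonneg_of_le_pi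
    (mul_nonneg Real.pi_pos.le hs.1) (by nlinarith [Real.pi_pos, hs.2])
  simp [halfTurn]
  refine ⟨⟨hs.1, by linarith [hs.2]⟩, ?_⟩
  nlinarith [mul_nonneg h (mul_self_nonneg ε)]

/-- The sign of `ε` decides whether this half of the crossing passes above or below the plane `z =
0`; the obstacles have to lie weakly on the other side. -/
theorem isotopic_conwayHalf {ε : ℝ} (hε : 0 < ε * ε) {K : Set R3}
    (hK : ∀ q ∈ K, 40 ≤ q.1 → q.1 ≤ 80 → ε * q.2.2 ≤ 0) :
    AmbientIsotopic (K ∪ conwayHalf ε) (K ∪ (segment ℝ (40, -48 - 24 * ε, 0) (60, -48, 24 * ε) ∪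
      segment ℝ (60, -48, 24 * ε) (80, -48 + 24 * ε, 0))) := by
  have := isotopic_halfTurn (lam := dotL (1, 0, 0)) (ℓ := dotL (0, 0, ε)) (A := (40, -48, 0))
    (U := (0, 24 * ε, 0)) (V := (0, 0, 24 * ε)) (W := (40, 0, 0)) (K := K) (by simp) (by simp)
    (by simp) (by simp) (by simp) (by simp; linarith) (fun q hq h1 h2 => by
      simp at h1 h2 ⊢
      exact hK q hq h1 (by linarith))
  have e : ((40, -48, 0) : R3) + (1 / 2 : ℝ) • (40, 0, 0) + (0, 0, 24 * ε) = (60, -48, 24 * ε) := by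
    ext <;> simp; norm_num
  rw [e] at this
  convert this using 4 <;> ext <;> simp <;> norm_num [conwayHalf]

theorem edge_flat {e : ZEdge} (h : e.1.2.2 = 0 ∧ e.2.2.2 = 0) {p : R3} (hp : p ∈ e.carrier) :
    p.2.2 = 0 := by
  have := coord_of_mem_carrier hp
  have h1 := this.2.2.2.2.1 0 h.1.le h.2.le
  have h2 := this.2.2.2.2.2 0 h.1.ge h.2.ge
  push_cast at h1 h2
  exact le_antisymm h1 h2

theorem conwayRest_flat : ∀ p ∈ paths conwayRest, p.2.2 = 0 :=
  forall_mem_paths (ok := fun e => decide (e.1.2.2 = 0 ∧ e.2.2.2 = 0)) (by decide +kernel)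
    fun e he _ hp => edge_flat (by simpa using he) hp

theorem awayFromStrand_conwayRest (m n : ℕ) :
    ∀ p ∈ paths (conwayRest ++ conwayCrossing), AwayFromStrand m n p := by
  refine forall_mem_paths (ok := fun e => decide ((e.1.1 = -40 ∧ e.2.1 = -40) ∨ (e.1.1 = 160 ∧ e.2.1 = 160) ∨
    (72 ≤ e.1.2.1 ∧ 72 ≤ e.2.2.1) ∨ (e.1.2.1 ≤ -72 ∧ e.2.2.1 ≤ -72) ∨
    ((e.1.2.1 ≤ -24 ∧ e.2.2.1 ≤ -24) ∧ ((e.1.1 ≤ 0 ∧ e.2.1 ≤ 0) ∨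
      ((40 ≤ e.1.1 ∧ 40 ≤ e.2.1) ∧ (e.1.1 ≤ 80 ∧ e.2.1 ≤ 80)) ∨ (120 ≤ e.1.1 ∧ 120 ≤ e.2.1)))))
    (by decide +kernel) fun e he p hp => ?_
  obtain ⟨c1, c2, c3, c4, -, -⟩ := coord_of_mem_carrier hp
  simp only [decide_eq_true_eq] at he
  rcases he with h | h | h | h | ⟨h, h' | h' | h'⟩
  · exact Or.inl (by exact_mod_cast c1 (-40) h.1.le h.2.le)
  · exact Or.inr (Or.inl (by exact_mod_cast c2 160 h.1.ge h.2.ge))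
  · exact Or.inr (Or.inr (Or.inl (le_abs.2 (Or.inl (by exact_mod_cast c4 72 h.1 h.2)))))
  · refine Or.inr (Or.inr (Or.inl (le_abs.2 (Or.inr ?_))))
    have := c3 (-72) h.1 h.2
    push_cast at this
    linarith
  · exact Or.inr (Or.inr (Or.inr (Or.inl ⟨by exact_mod_cast c3 (-24) h.1 h.2,
      Or.inl (by exact_mod_cast c1 0 h'.1 h'.2)⟩)))
  · exact Or.inr (Or.inr (Or.inr (Or.inl ⟨by exact_mod_cast c3 (-24) h.1 h.2,
      Or.inr (Or.inl ⟨by exact_mod_cast c2 40 h'.1.1 h'.1.2, by exact_mod_cast c1 80 h'.2.1 h'.2.2⟩)⟩)))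
  · exact Or.inr (Or.inr (Or.inr (Or.inl ⟨by exact_mod_cast c3 (-24) h.1 h.2,
      Or.inr (Or.inr (by exact_mod_cast c2 120 h'.1 h'.2))⟩)))

theorem awayFromStrand_helices (m n : ℕ) : ∀ p ∈ helix 0 40 24 Real.pi (2 * n) ∪
    helix 80 40 24 Real.pi (2 * m), AwayFromStrand m n p := by
  rintro p (⟨s, hs, rfl⟩ | ⟨s, hs, rfl⟩) <;> refine Or.inr (Or.inr (Or.inr (Or.inr ⟨?_, ?_⟩)))
  · simp only [helixPt]
    exact ⟨by linarith [hs.1], by linarith [hs.2]⟩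
  · simp only [helixPt, conwayStrand, zero_add, conwayAngle_helix m n hs, add_comm Real.pi,
      Real.cos_add_pi, Real.sin_add_pi]
    ext <;> simp
  · simp only [helixPt]
    exact ⟨by linarith [hs.1], by linarith [hs.2]⟩
  · simp only [helixPt, conwayStrand, conwayAngle_helix' m n hs, add_comm Real.pi,
      Real.cos_add_pi, Real.sin_add_pi, Real.cos_add_nat_mul_two_pi, Real.sin_add_nat_mul_two_pi]
    ext <;> simp

theorem paths_append (P Q : List (List ZPt)) : paths (P ++ Q) = paths P ∪ paths Q := by
  rw [paths, List.flatMap_append, carrier_append]; rfl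

/-- The two strands of the middle crossing lie in opposite half spaces, and everything else over `40
≤ x ≤ 80` lies in the plane between them, so they can be straightened one after the other. Then the
third strand is contracted to the axis, and the second one becomes a pair of helices around it. -/
theorem isotopic_conwayLink_frame (m n : ℕ) :
    AmbientIsotopic (conwayLink [2 * (n : ℤ), 1, 2 * (m : ℤ)])
      ((helix 0 40 24 Real.pi (2 * n) ∪ helix 80 40 24 Real.pi (2 * m)) ∪
        paths (conwayRest ++ conwayCrossing ++ conwayAxis)) := by
  refine (isotopic_boxMap (a := (40, 48, 48)) (by norm_num) (by norm_num) (by norm_num)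
    (0, -120, 0) _).trans ?_
  rw [image_conwayLink]
  set F := helix 0 40 24 Real.pi (2 * n) ∪ helix 80 40 24 Real.pi (2 * m)
  set S := conwayStrand m n '' Icc (-40) 160
  have hF : ∀ q ∈ F, 40 ≤ q.1 → q.1 ≤ 80 → q.2.2 = 0 := by
    rintro q (⟨s, hs, rfl⟩ | ⟨s, hs, rfl⟩) h1 h2 <;> simp only [helixPt] at h1 h2 ⊢
    · have : s = 1 := le_antisymm hs.2 (by linarith)
      have := Real.sin_nat_mul_pi (2 * n)
      push_cast at this
      simp [‹s = 1›, add_comm Real.pi, Real.sin_add_pi, mul_comm Real.pi, this]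
    · have : s = 0 := le_antisymm (by linarith) hs.1
      simp [this]
  have hS : ∀ q ∈ S, 40 ≤ q.1 → q.1 ≤ 80 → q.2.2 = 0 := by
    rintro _ ⟨x, hx, rfl⟩ h1 h2
    have := conwayStrand_straight m n (x := x) (Or.inr (Or.inl ⟨h1, h2⟩))
    rw [this]
  have hcr : paths conwayCrossing =
      (segment ℝ (40, -48 - 24 * 1, 0) (60, -48, 24 * 1) ∪
        segment ℝ (60, -48, 24 * 1) (80, -48 + 24 * 1, 0)) ∪
      (segment ℝ (40, -48 - 24 * -1, 0) (60, -48, 24 * -1) ∪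
        segment ℝ (60, -48, 24 * -1) (80, -48 + 24 * -1, 0)) := by
    simp only [conwayCrossing, paths_cons, paths_nil, List.map_cons, List.map_nil, polygonalPath,
      union_empty, ZPt.toR]
    norm_num
  have e1 : F ∪ paths conwayRest ∪ (conwayHalf 1 ∪ conwayHalf (-1) ∪ S) =
      (F ∪ paths conwayRest ∪ S ∪ conwayHalf (-1)) ∪ conwayHalf 1 := by
    ext; simp only [mem_union]; tauto
  rw [e1]
  refine (isotopic_conwayHalf (by norm_num) ?_).trans ?_
  · rintro q (((hq | hq) | hq) | hq) h1 h2
    · rw [hF q hq h1 h2, mul_zero]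
    · rw [conwayRest_flat q hq, mul_zero]
    · rw [hS q hq h1 h2, mul_zero]
    · linarith [(conwayHalf_props hq).2]
  set T := segment ℝ ((40, -48 - 24 * 1, 0) : R3) (60, -48, 24 * 1) ∪
    segment ℝ (60, -48, 24 * 1) (80, -48 + 24 * 1, 0)
  have e2 : F ∪ paths conwayRest ∪ S ∪ conwayHalf (-1) ∪ T =
      (F ∪ paths conwayRest ∪ S ∪ T) ∪ conwayHalf (-1) := by
    ext; simp only [mem_union]; tauto
  rw [e2]
  refine (isotopic_conwayHalf (by norm_num) ?_).trans ?_
  · rintro q (((hq | hq) | hq) | hq) h1 h2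
    · rw [hF q hq h1 h2, mul_zero]
    · rw [conwayRest_flat q hq, mul_zero]
    · rw [hS q hq h1 h2, mul_zero]
    · have : q.2.2 ≥ 0 := by
        have hsub : T ⊆ {q : R3 | 0 ≤ q.2.2} := by
          have hconv : Convex ℝ {q : R3 | 0 ≤ q.2.2} :=
            (convex_Ici (0 : ℝ)).is_linear_preimage
              (f := fun q : R3 => q.2.2) ⟨fun _ _ => rfl, fun _ _ => rfl⟩
          refine union_subset (hconv.segment_subset ?_ ?_) (hconv.segment_subset ?_ ?_) <;> simp
        exact hsub hq
      linarith
  have e3 : ∀ T', F ∪ paths conwayRest ∪ S ∪ T ∪ T' = (F ∪ (paths conwayRest ∪ (T ∪ T'))) ∪ S :=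
    fun T' => by ext; simp only [mem_union]; tauto
  rw [e3, ← hcr, ← paths_append]
  have h1 := isotopic_move (lam := dotL (1, 0, 0)) (l := -40) (r := 160) (by norm_num)
    (σ := conwayStrand m n) (τ := conwayStrand') (K := F ∪ paths (conwayRest ++ conwayCrossing))
    (by unfold conwayStrand conwayAngle; fun_prop) (by unfold conwayStrand'; fun_prop)
    (by simp [conwayStrand]) (by simp [conwayStrand']) ?_ ?_ (clear_of_awayFromStrand ?_)
  · rwa [image_conwayStrand', union_assoc F _ (paths conwayAxis), ← paths_append] at h1
  · rw [conwayStrand_straight m n (Or.inl (by norm_num)), conwayStrand']; norm_num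
  · rw [conwayStrand_straight m n (Or.inr (Or.inr (by norm_num))), conwayStrand']; norm_num
  · rintro q (hq | hq)
    · exact awayFromStrand_helices m n q hq
    · exact awayFromStrand_conwayRest m n q hq

/-- Moves that make all strands straight over `60 ≤ x ≤ 64`. -/
def conwayMoves : List ℤ :=
  [0, -40, -72, 0, 0, -72, 0, 40, -72, 0, 0, 160, -72, 0, 120, -72, 0, 80, -72, 0, 0, 160, 72, 0,
  120, 72, 0, 80, 72, 0, 0, 160, 72, 0, 80, 72, 0, 40, 72, 0, 0, 160, 72, 0, 40, 72, 0, 0, 72, 0,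
  0, 160, 72, 0, 0, 72, 0, -40, 72, 0, 1, 60, -48, 24, 64, -24, 0, 80, -24, 0, 1, 40, -72, 0, 50,
  -48, 24, 60, -48, 24, 0, 50, -48, 24, 60, -48, 24, 64, -24, 0, 1, 50, -48, 24, 60, -24, 0, 64,
  -24, 0, 1, 60, -48, -24, 64, -72, 0, 80, -72, 0, 1, 64, -72, 0, 50, -48, -24, 60, -48, -24, 0,
  50, -48, -24, 60, -48, -24, 40, -24, 0, 1, 50, -48, -24, 60, -72, 0, 64, -72, 0, 1, 40, 0, 0,
  60, 0, 0, 80, 0, 0, 1, 60, 0, 0, 64, 0, 0, 80, 0, 0, 1, 160, 72, 0, 64, 72, 0, -40, 72, 0, 1,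
  64, 72, 0, 60, 72, 0, -40, 72, 0, 1, 60, -24, 0, 62, -24, 0, 64, -24, 0, 1, 64, -72, 0, 62,
  -72, 0, 60, -72, 0, 1, 60, 0, 0, 62, 0, 0, 64, 0, 0, 1, 64, 72, 0, 62, 72, 0, 60, 72, 0]

/-- The Conway form before the flype. -/
def preparedFrame : List (List ZPt) :=
  [[(0, -24, 0), (-40, -24, 0), (-40, -72, 0), (40, -72, 0), (50, -48, 24), (60, -24, 0), (62,
  -24, 0), (64, -24, 0), (80, -24, 0)], [(120, -24, 0), (160, -24, 0), (160, -72, 0), (80, -72,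
  0), (64, -72, 0), (62, -72, 0), (60, -72, 0), (50, -48, -24), (40, -24, 0)], [(0, 0, 0), (40,
  0, 0), (60, 0, 0), (62, 0, 0), (64, 0, 0), (80, 0, 0), (120, 0, 0), (160, 24, 0), (160, 72, 0),
  (64, 72, 0), (62, 72, 0), (60, 72, 0), (-40, 72, 0), (-40, 24, 0), (0, 0, 0)]]

/-- Moves from the flyped Conway form to the common model. -/
def flypedMoves : List ℤ :=
  [0, 0, -24, 0, -40, -24, 0, -40, -72, 0, 0, 0, -24, 0, -40, -72, 0, 40, -72, 0, 0, 0, -24, 0,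
  40, -72, 0, 50, -48, 24, 0, 50, -48, 24, 60, -24, 0, 62, 0, -24, 0, 62, 0, -24, 64, 24, 0, 80,
  24, 0, 0, 120, 24, 0, 160, 24, 0, 160, 72, 0, 0, 120, 24, 0, 160, 72, 0, 80, 72, 0, 0, 120, 24,
  0, 80, 72, 0, 64, 72, 0, 0, 62, 0, -72, 60, -72, 0, 50, -48, -24, 0, 62, 0, -72, 50, -48, -24,
  40, -24, 0, 0, 40, 0, 0, 60, 0, 0, 62, 0, 0, 0, 40, 0, 0, 62, 0, 0, 64, 0, 0, 0, 40, 0, 0, 64,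
  0, 0, 80, 0, 0, 0, 120, 0, 0, 160, -24, 0, 160, -72, 0, 0, 160, -72, 0, 64, -72, 0, 62, 0, 72,
  0, 62, 0, 72, 60, 72, 0, -40, 72, 0, 0, 62, 0, 72, -40, 72, 0, -40, 24, 0, 1, 0, -24, 0, 48,
  -27, 0, 50, -48, 24, 1, 48, -27, 0, 76, 0, -24, 50, -48, 24, 1, 120, 24, 0, 120, 27, 0, 64, 72,
  0, 1, 120, 27, 0, 72, 24, 0, 64, 72, 0, 1, 72, 24, 0, 44, 0, -24, 64, 72, 0, 1, 120, 0, 0, 192,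
  0, 46, 160, -72, 0, 1, 62, 0, 72, -144, 0, 24, -40, 24, 0, 0, 76, 0, -24, 50, -48, 24, 62, 0,
  -24, 0, 76, 0, -24, 62, 0, -24, 80, 24, 0, 0, 44, 0, -24, 64, 72, 0, 62, 0, -72, 0, 44, 0, -24,
  62, 0, -72, 40, -24, 0, 0, 192, 0, 46, 160, -72, 0, 62, 0, 72, 0, 192, 0, 46, 62, 0, 72, -144,
  0, 24, 0, -144, 0, 24, -40, 24, 0, 0, 0, 0]

theorem checkMoves_conway : checkMoves helixBoxes conwayMoves
    (conwayRest ++ conwayCrossing ++ conwayAxis) preparedFrame = true := by decide +kernel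

/-- The entries of the flype, which turns the half space `x ≥ 64` over. -/
noncomputable def flypeCos (q : ℝ × ℝ) : ℝ := 1 - q.1 * (q.2 - 60) / 2

/-- For `q.1 = 1` and `60 ≤ q.2 ≤ 64` the pair of entries runs along the polygon `|c| + |s| = 1`
from `(1, 0)` over `(0, 1)` to `(-1, 0)`. This polygonal substitute for a rotation by `π` sends
segments parallel to the axis, cut at `62`, to integral segments. -/
noncomputable def flypeSin (q : ℝ × ℝ) : ℝ := 1 - |q.1 * (q.2 - 60) - 2| / 2

/-- The flype. -/
noncomputable def flype : R3 → R3 :=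
  levelMap (fun x => flypeCos (1, clamp 60 64 x)) (fun x => -flypeSin (1, clamp 60 64 x))
    (fun x => flypeSin (1, clamp 60 64 x)) (fun x => flypeCos (1, clamp 60 64 x))

theorem isotopic_flype (K : Set R3) : AmbientIsotopic K (flype '' K) := by
  have := isotopic_levelMap (l := 60) (r := 64) (by norm_num) (a := flypeCos)
    (b := fun q => -flypeSin q) (c := flypeSin) (d := flypeCos) (by unfold flypeCos; fun_prop)
    (by unfold flypeSin; fun_prop) (by unfold flypeSin; fun_prop) (by unfold flypeCos; fun_prop)
    ?_ K
  · have h0 : levelMap (fun x => flypeCos (0, clamp 60 64 x)) (fun x => -flypeSin (0, clamp 60 64 x))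
        (fun x => flypeSin (0, clamp 60 64 x)) (fun x => flypeCos (0, clamp 60 64 x)) = id := by
      ext p <;> simp [levelMap, flypeCos, flypeSin]
    rw [h0, image_id] at this
    exact this
  · intro t _ x _ h
    -- The determinant is the sum of the squares of the two entries; where the first vanishes, the
    -- second equals `1`.
    have h1 : flypeCos (t, x) = 0 := by nlinarith [sq_nonneg (flypeCos (t, x)), sq_nonneg (flypeSin (t, x))]
    have h2 : flypeSin (t, x) = 0 := by nlinarith [sq_nonneg (flypeCos (t, x)), sq_nonneg (flypeSin (t, x))]
    simp only [flypeCos, flypeSin] at h1 h2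
    have h3 : t * (x - 60) = 2 := by linarith
    rw [h3] at h2
    norm_num at h2

theorem flype_of_le {p : R3} (h : p.1 ≤ 60) : flype p = p := by
  simp [flype, levelMap, flypeCos, flypeSin, clamp_of_le h]

theorem flype_of_ge {p : R3} (h : 64 ≤ p.1) : flype p = (p.1, -p.2.1, -p.2.2) := by
  simp [flype, levelMap, flypeCos, flypeSin, clamp_of_ge (show (60 : ℝ) ≤ 64 by norm_num) h]
  norm_num

theorem flype_of_mem {p : R3} (h : 60 ≤ p.1) (h' : p.1 ≤ 64) :
    flype p = (p.1, (1 - (p.1 - 60) / 2) * p.2.1 - (1 - |p.1 - 62| / 2) * p.2.2,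
      (1 - |p.1 - 62| / 2) * p.2.1 + (1 - (p.1 - 60) / 2) * p.2.2) := by
  simp only [flype, levelMap, flypeCos, flypeSin, clamp_of_mem (mem_Icc.2 ⟨h, h'⟩)]
  ring_nf

/-- The flype on integral vertices. -/
def flypeZ (p : ZPt) : ZPt :=
  if p.1 ≤ 60 then p else if p.1 = 62 then (62, -p.2.2, p.2.1) else (p.1, -p.2.1, -p.2.2)

def flypeOk (e : ZEdge) : Bool :=
  decide ((e.1.1 ≤ 60 ∧ e.2.1 ≤ 60) ∨ (64 ≤ e.1.1 ∧ 64 ≤ e.2.1) ∨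
    (e.1.2 = e.2.2 ∧ ((e.1.1 = 60 ∧ e.2.1 = 62) ∨ (e.1.1 = 62 ∧ e.2.1 = 64) ∨
      (e.1.1 = 62 ∧ e.2.1 = 60) ∨ (e.1.1 = 64 ∧ e.2.1 = 62))))

theorem image_flype_edge (e : ZEdge) (h : flypeOk e = true) :
    flype '' e.carrier = ZEdge.carrier (flypeZ e.1, flypeZ e.2) := by
  obtain ⟨⟨x, y, z⟩, x', y', z'⟩ := e
  simp only [flypeOk, decide_eq_true_eq, Prod.mk.injEq] at h
  rcases h with ⟨h1, h2⟩ | ⟨h1, h2⟩ | ⟨⟨rfl, rfl⟩, h⟩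
  · have e1 : flypeZ (x, y, z) = (x, y, z) := by simp [flypeZ, h1]
    have e2 : flypeZ (x', y', z') = (x', y', z') := by simp [flypeZ, h2]
    rw [e1, e2]
    trans id '' ZEdge.carrier ((x, y, z), x', y', z')
    · refine image_congr fun p hp => flype_of_le ?_
      exact_mod_cast (coord_of_mem_carrier hp).1 60 h1 h2
    · simp
  · have e1 : flypeZ (x, y, z) = (x, -y, -z) := by
      simp [flypeZ, show ¬ x ≤ 60 by omega, show x ≠ 62 by omega]
    have e2 : flypeZ (x', y', z') = (x', -y', -z') := by
      simp [flypeZ, show ¬ x' ≤ 60 by omega, show x' ≠ 62 by omega]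
    rw [e1, e2]
    trans (fun p : R3 => (p.1, -p.2.1, -p.2.2)) '' ZEdge.carrier ((x, y, z), x', y', z')
    · refine image_congr fun p hp => flype_of_ge ?_
      exact_mod_cast (coord_of_mem_carrier hp).2.1 64 h1 h2
    · rw [ZEdge.carrier, image_segment_of_affine, ZEdge.carrier]
      · simp [ZPt.toR]
      · intro s _
        ext <;> simp <;> ring
  · rw [ZEdge.carrier, image_segment_of_affine, ZEdge.carrier]
    · rcases h with ⟨rfl, rfl⟩ | ⟨rfl, rfl⟩ | ⟨rfl, rfl⟩ | ⟨rfl, rfl⟩ <;>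
        simp only [ZPt.toR] <;> rw [flype_of_mem, flype_of_mem] <;> norm_num [flypeZ]
    · intro s hs
      obtain ⟨h0, h1⟩ := hs
      rcases h with ⟨rfl, rfl⟩ | ⟨rfl, rfl⟩ | ⟨rfl, rfl⟩ | ⟨rfl, rfl⟩ <;>
        simp only [ZPt.toR] <;> rw [flype_of_mem, flype_of_mem, flype_of_mem] <;>
        simp <;> norm_num <;> (try linarith) <;>
        first
        | rw [abs_of_nonpos (by linarith)]; exact ⟨by ring, by ring⟩
        | rw [abs_of_nonneg (by linarith)]; exact ⟨by ring, by ring⟩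

theorem checkMoves_flyped : checkMoves helixBoxes flypedMoves
    (preparedFrame.map (List.map flypeZ)) commonFrame = true := by decide +kernel

/-- The flype fixes the left helix and rotates the right one by `π`, which changes its starting
angle from `π` to `0` and keeps its handedness. The remaining frame is simplified by moves avoiding
both boxes. -/
theorem isotopic_conwayLink_commonModel (m n : ℕ) :
    AmbientIsotopic (conwayLink [2 * (n : ℤ), 1, 2 * (m : ℤ)]) (commonModel m n) := by
  refine (isotopic_conwayLink_frame m n).trans ?_
  refine (isotopic_of_checkMoves (helices_subset_boxes _ _ _ _) checkMoves_conway).trans ?_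
  refine (isotopic_flype _).trans ?_
  rw [image_union, image_union, image_paths image_flype_edge (by decide +kernel)]
  have h1 : flype '' helix 0 40 24 Real.pi (2 * n) = helix 0 40 24 Real.pi (2 * n) := by
    trans id '' helix 0 40 24 Real.pi (2 * n)
    · refine image_congr fun p hp => flype_of_le ?_
      linarith [(mem_box_of_mem_helix (by norm_num) (by norm_num) hp).1.2]
    · simp
  have h2 : flype '' helix 80 40 24 Real.pi (2 * m) = helix 80 40 24 0 (2 * m) := by
    rw [helix, helix, image_image]
    refine image_congr fun s hs => ?_
    rw [flype_of_ge (by simp only [helixPt]; linarith [hs.1])]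
    simp only [helixPt, add_comm Real.pi, Real.cos_add_pi, Real.sin_add_pi]
    simp
  rw [h1, h2]
  exact isotopic_of_checkMoves (helices_subset_boxes _ _ _ _) checkMoves_flyped

/-! ### The generalized Mazur link in cylindrical coordinates -/

/-- Cylindrical coordinates about the first coordinate axis. -/
noncomputable def cyl (x ρ θ : ℝ) : R3 := (x, ρ * Real.cos θ, ρ * Real.sin θ)

theorem rad_cyl {x ρ θ : ℝ} (h : 0 ≤ ρ) : rad (cyl x ρ θ) = ρ := by
  have : (cyl x ρ θ).2.1 ^ 2 + (cyl x ρ θ).2.2 ^ 2 = ρ ^ 2 := by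
    simp only [cyl]
    linear_combination ρ ^ 2 * Real.sin_sq_add_cos_sq θ
  rw [rad, this, Real.sqrt_sq h]

theorem rotX_cyl (φ x ρ θ : ℝ) : rotX φ (cyl x ρ θ) = cyl x ρ (θ + φ) := by
  simp only [rotX, cyl, Real.cos_add, Real.sin_add]
  ext <;> simp <;> ring

theorem polygonalPath_subset {C : Set R3} (hC : Convex ℝ C) :
    ∀ l : List R3, (∀ v ∈ l, v ∈ C) → polygonalPath l ⊆ C
  | [], _ => empty_subset _
  | [_], _ => empty_subset _
  | a :: b :: l, h => union_subset
      (hC.segment_subset (h a (by simp)) (h b (by simp)))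
      (polygonalPath_subset hC (b :: l) fun v hv => h v (List.mem_cons_of_mem _ hv))

theorem mazurPath_bounds (m n : ℕ) {c : R3} (hc : c ∈ mazurPath m n) :
    (0 ≤ c.2.1 ∧ c.2.1 ≤ m + n + 1) ∧ (-1 ≤ c.2.2 ∧ c.2.2 ≤ 1) := by
  have hconv : Convex ℝ {c : R3 | (0 ≤ c.2.1 ∧ c.2.1 ≤ m + n + 1) ∧ (-1 ≤ c.2.2 ∧ c.2.2 ≤ 1)} := by
    intro p hp q hq a b ha hb hab
    obtain ⟨⟨p1, p2⟩, p3, p4⟩ := hp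
    obtain ⟨⟨q1, q2⟩, q3, q4⟩ := hq
    refine ⟨⟨?_, ?_⟩, ?_, ?_⟩ <;> simp only [Prod.snd_add, Prod.fst_add, Prod.smul_snd,
      Prod.smul_fst, smul_eq_mul]
    · positivity
    · nlinarith [mul_le_mul_of_nonneg_left p2 ha, mul_le_mul_of_nonneg_left q2 hb]
    · nlinarith
    · nlinarith
  have hm : (0 : ℝ) ≤ m := Nat.cast_nonneg m
  have hn : (0 : ℝ) ≤ n := Nat.cast_nonneg n
  refine polygonalPath_subset hconv _ ?_ hc
  simp only [List.mem_cons, List.not_mem_nil, or_false, mem_ofPred_eq]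
  rintro v (rfl | rfl | rfl | rfl | rfl | rfl | rfl | rfl) <;> norm_num <;>
    (try constructor) <;> linarith

/-- The pattern in cylindrical coordinates. -/
noncomputable def mazurCurve (m n : ℕ) (c : R3) : R3 :=
  cyl (c.2.2 / 2) (3 / 2 + c.2.1 / (m + n + 1)) (-(2 * Real.pi * c.1))

/-- The meridian circle. -/
def meridianCircle : Set R3 := {p | p.2.1 = 0 ∧ p.1 ^ 2 + (p.2.2 - 2) ^ 2 = 1}

/-- The cyclic permutation makes the axis of rotation of the solid torus the first axis. A point
with disc coordinate `u + iv` then has position `v` along the axis and distance `2 + u` from it; the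
meridian, taken at angle `π / 2`, falls into the plane where the second coordinate vanishes. -/
theorem cycle_patternMeridianLink (m n : ℕ) :
    cycle '' patternMeridianLink (generalizedMazurPattern m n) =
      mazurCurve m n '' mazurPath m n ∪ meridianCircle := by
  rw [patternMeridianLink, image_union, image_union, image_image, image_image]
  congr 1
  · ext p
    constructor
    · rintro ⟨x, ⟨c, hc, h1, h2⟩, rfl⟩
      refine ⟨c, hc, ?_⟩
      have e1 : (x.1 : ℂ).re = Real.cos (-(2 * Real.pi * c.1)) := by
        rw [h1, Circle.coe_exp, Complex.exp_ofReal_mul_I_re]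
      have e2 : (x.1 : ℂ).im = Real.sin (-(2 * Real.pi * c.1)) := by
        rw [h1, Circle.coe_exp, Complex.exp_ofReal_mul_I_im]
      simp only [cycle, standardEmbedding, mazurCurve, cyl, e1, e2, h2]
      refine Prod.ext rfl (Prod.ext ?_ ?_) <;> simp only <;> ring
    · rintro ⟨c, hc, rfl⟩
      obtain ⟨⟨h1, h2⟩, h3, h4⟩ := mazurPath_bounds m n hc
      have hN : (0 : ℝ) < m + n + 1 := by positivity
      set d : ℂ := ⟨c.2.1 / ((m : ℝ) + n + 1) - 1 / 2, c.2.2 / 2⟩ with hd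
      have h5 : 0 ≤ c.2.1 / ((m : ℝ) + n + 1) := by positivity
      have h6 : c.2.1 / ((m : ℝ) + n + 1) ≤ 1 := by rwa [div_le_one hN]
      have hdn : d ∈ Metric.closedBall (0 : ℂ) 1 := by
        rw [mem_closedBall_zero_iff, Complex.norm_eq_sqrt_sq_add_sq, Real.sqrt_le_iff]
        simp only [hd]
        exact ⟨zero_le_one, by nlinarith⟩
      refine ⟨(Circle.exp (-(2 * Real.pi * c.1)), ⟨d, hdn⟩), ⟨c, hc, rfl, rfl⟩, ?_⟩
      simp only [cycle, standardEmbedding, mazurCurve, cyl, Circle.coe_exp,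
        Complex.exp_ofReal_mul_I_re, Complex.exp_ofReal_mul_I_im, hd]
      refine Prod.ext rfl (Prod.ext ?_ ?_) <;> simp only <;> ring
  · ext p
    constructor
    · rintro ⟨x, ⟨h1, h2⟩, rfl⟩
      have e1 : (x.1 : ℂ).re = 0 := by
        rw [h1, Circle.coe_exp, Complex.exp_ofReal_mul_I_re, Real.cos_pi_div_two]
      have e2 : (x.1 : ℂ).im = 1 := by
        rw [h1, Circle.coe_exp, Complex.exp_ofReal_mul_I_im, Real.sin_pi_div_two]
      rw [Complex.norm_eq_sqrt_sq_add_sq, Real.sqrt_eq_one] at h2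
      simp only [meridianCircle, cycle, standardEmbedding, e1, e2, mem_ofPred_eq]
      refine ⟨by ring, ?_⟩
      linear_combination h2
    · rintro ⟨h1, h2⟩
      set d : ℂ := ⟨p.2.2 - 2, p.1⟩ with hd
      have hdn : ‖d‖ = 1 := by
        rw [Complex.norm_eq_sqrt_sq_add_sq, Real.sqrt_eq_one]
        simp only [hd]; linarith
      refine ⟨(Circle.exp (Real.pi / 2), ⟨d, by rw [mem_closedBall_zero_iff, hdn]⟩), ⟨rfl, hdn⟩, ?_⟩
      simp only [cycle, standardEmbedding, Circle.coe_exp, Complex.exp_ofReal_mul_I_re,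
        Complex.exp_ofReal_mul_I_im, Real.cos_pi_div_two, Real.sin_pi_div_two, hd]
      ext <;> simp [h1]

/-! ### The meridian -/

/-- A strand that keeps a positive distance from the region swept. -/
theorem clear_of_dist {lam : R3 →L[ℝ] ℝ} {l r : ℝ} {σ τ : ℝ → R3} {K : Set R3} {δ B : ℝ}
    (hδ : 0 < δ) (hB : ∀ x ∈ Icc l r, ‖τ x - σ x‖ ≤ B)
    (h : ∀ q ∈ K, lam q ∈ Icc l r → ∀ t ∈ Icc (0 : ℝ) 1,
      δ ≤ ‖q - (σ (lam q) + t • (τ (lam q) - σ (lam q)))‖) : Clear lam l r σ τ K := by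
  refine ⟨δ / (|B| + 1), by positivity, fun q hq hx t ht => (le_trans ?_ (h q hq hx t ht))⟩
  rw [div_mul_eq_mul_div, div_le_iff₀ (by positivity)]
  have := (hB _ hx).trans (le_abs_self B)
  nlinarith

theorem continuous_plane {f g : ℝ → ℝ} (hf : Continuous f) (hg : Continuous g) :
    Continuous fun x : ℝ => ((f x, 0, g x) : R3) :=
  hf.prodMk (continuous_const.prodMk hg)

noncomputable def topArc : Set R3 :=
  (fun x : ℝ => ((x, 0, 2 + √(1 - x ^ 2)) : R3)) '' Icc (-(4 / 5)) (4 / 5)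

noncomputable def bottomArc : Set R3 :=
  (fun x : ℝ => ((x, 0, 2 - √(1 - x ^ 2)) : R3)) '' Icc (-(4 / 5)) (4 / 5)

noncomputable def sideArc (ε : ℝ) : Set R3 :=
  (fun z : ℝ => ((ε * √(1 - (z - 2) ^ 2), 0, z) : R3)) '' Icc (7 / 5) (13 / 5)

def topEdge : Set R3 := (fun x : ℝ => ((x, 0, 13 / 5) : R3)) '' Icc (-(4 / 5)) (4 / 5)

/-- The path from `(-4/5, 7/5)` along the axis to `(4/5, 7/5)`. -/
def bottomEdge : Set R3 :=
  (fun x : ℝ => ((x, 0, 14 * max 0 (|x| - 7 / 10)) : R3)) '' Icc (-(4 / 5)) (4 / 5)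

def sideEdge (ε : ℝ) : Set R3 :=
  (fun z : ℝ => ((ε * (4 / 5), 0, z) : R3)) '' Icc (7 / 5) (13 / 5)

/-- The circle is cut at the four points `(±4/5, 2 ± 3/5)` of its plane; the Pythagorean triple
keeps all endpoints rational. -/
theorem meridianCircle_eq :
    meridianCircle = topArc ∪ bottomArc ∪ sideArc 1 ∪ sideArc (-1) := by
  ext ⟨x, y, z⟩
  simp only [meridianCircle, mem_ofPred_eq, topArc, bottomArc, sideArc, mem_union, mem_image,
    Prod.mk.injEq, mem_Icc]
  constructor
  · rintro ⟨rfl, h⟩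
    by_cases hx : -(4 / 5) ≤ x ∧ x ≤ 4 / 5
    · rcases le_total 2 z with hz | hz
      · refine Or.inl (Or.inl (Or.inl ⟨x, hx, rfl, rfl, ?_⟩))
        rw [show 1 - x ^ 2 = (z - 2) ^ 2 by linarith, Real.sqrt_sq (by linarith)]; ring
      · refine Or.inl (Or.inl (Or.inr ⟨x, hx, rfl, rfl, ?_⟩))
        rw [show 1 - x ^ 2 = (2 - z) ^ 2 by linarith, Real.sqrt_sq (by linarith)]; ring
    · have hx2 : (16 / 25 : ℝ) ≤ x ^ 2 := by
        rw [not_and_or, not_le, not_le] at hx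
        rcases hx with hx | hx <;> nlinarith
      have hz : 7 / 5 ≤ z ∧ z ≤ 13 / 5 := by constructor <;> nlinarith
      rcases le_total 0 x with h0 | h0
      · refine Or.inl (Or.inr ⟨z, hz, ?_, rfl, rfl⟩)
        rw [show 1 - (z - 2) ^ 2 = x ^ 2 by linarith, Real.sqrt_sq h0]; ring
      · refine Or.inr ⟨z, hz, ?_, rfl, rfl⟩
        rw [show 1 - (z - 2) ^ 2 = (-x) ^ 2 by linarith, Real.sqrt_sq (by linarith)]; ring
  · rintro (((⟨a, ha, rfl, rfl, rfl⟩ | ⟨a, ha, rfl, rfl, rfl⟩) | ⟨a, ha, rfl, rfl, rfl⟩) | ⟨a, ha, rfl, rfl, rfl⟩)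
    · refine ⟨rfl, ?_⟩
      rw [add_sub_cancel_left, Real.sq_sqrt (by nlinarith)]; ring
    · refine ⟨rfl, ?_⟩
      rw [sub_sub_cancel_left, neg_sq, Real.sq_sqrt (by nlinarith)]; ring
    · refine ⟨rfl, ?_⟩
      rw [mul_pow, Real.sq_sqrt (by nlinarith)]; ring
    · refine ⟨rfl, ?_⟩
      rw [mul_pow, Real.sq_sqrt (by nlinarith)]; ring

theorem sqrt_bounds {x : ℝ} (h : -(4 / 5) ≤ x) (h' : x ≤ 4 / 5) :
    3 / 5 ≤ √(1 - x ^ 2) ∧ √(1 - x ^ 2) ≤ 1 :=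
  ⟨Real.le_sqrt_of_sq_le (by nlinarith), Real.sqrt_le_iff.2 ⟨zero_le_one, by nlinarith⟩⟩

theorem sqrt_bounds' {z : ℝ} (h : 7 / 5 ≤ z) (h' : z ≤ 13 / 5) :
    4 / 5 ≤ √(1 - (z - 2) ^ 2) ∧ √(1 - (z - 2) ^ 2) ≤ 1 :=
  ⟨Real.le_sqrt_of_sq_le (by nlinarith), Real.sqrt_le_iff.2 ⟨zero_le_one, by nlinarith⟩⟩

theorem sqrt_end {x : ℝ} (h : x ^ 2 = 16 / 25) : √(1 - x ^ 2) = 3 / 5 := by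
  rw [h, show (1 : ℝ) - 16 / 25 = (3 / 5) ^ 2 by norm_num, Real.sqrt_sq (by norm_num)]

theorem sqrt_end' {x : ℝ} (h : x ^ 2 = 9 / 25) : √(1 - x ^ 2) = 4 / 5 := by
  rw [h, show (1 : ℝ) - 9 / 25 = (4 / 5) ^ 2 by norm_num, Real.sqrt_sq (by norm_num)]

/-- The arc and its chord lie at height `13/5` or more, above the pattern, which stays below `5/2`.
The adjacent arcs are met only at the end levels. -/
theorem isotopic_topArc {K : Set R3} (hK : ∀ q ∈ K, |q.1| ≤ 4 / 5 → q.2.2 ≤ 5 / 2 ∨ |q.1| = 4 / 5) :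
    AmbientIsotopic (K ∪ topArc) (K ∪ topEdge) := by
  have hd : ∀ x ∈ Icc (-(4 / 5) : ℝ) (4 / 5),
      ‖((x, 0, 13 / 5) : R3) - (x, 0, 2 + √(1 - x ^ 2))‖ ≤ 2 / 5 := by
    intro x hx
    obtain ⟨h1, h2⟩ := sqrt_bounds hx.1 hx.2
    rw [norm_eq_max]
    simp only [Prod.fst_sub, Prod.snd_sub, sub_self, abs_zero, max_le_iff, abs_le]
    refine ⟨by norm_num, by norm_num, by linarith, by linarith⟩
  have e1 : √(1 - (-(4 / 5) : ℝ) ^ 2) = 3 / 5 := sqrt_end (by norm_num)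
  have e2 : √(1 - (4 / 5 : ℝ) ^ 2) = 3 / 5 := sqrt_end (by norm_num)
  refine isotopic_move (lam := dotL (1, 0, 0)) (by norm_num)
    (continuous_plane continuous_id (by fun_prop)).continuousOn
    (continuous_plane continuous_id continuous_const).continuousOn (by simp) (by simp)
    (by rw [e1]; norm_num) (by rw [e2]; norm_num) ?_
  have hsplit : K ⊆ {q ∈ K | q.2.2 ≤ 5 / 2} ∪ {q : R3 | q.1 ≤ -(4 / 5) ∨ 4 / 5 ≤ q.1} := by
    intro q hq
    by_cases h : |q.1| ≤ 4 / 5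
    · rcases hK q hq h with h1 | h1
      · exact Or.inl ⟨hq, h1⟩
      · right
        rcases le_abs.1 h1.ge with h2 | h2
        · exact Or.inr h2
        · exact Or.inl (by linarith)
    · right
      rcases lt_abs.1 (not_le.1 h) with h2 | h2
      · exact Or.inr h2.le
      · exact Or.inl (by linarith)
  refine (Clear.union ?_ ?_).mono hsplit
  · refine clear_of_wall (dotL (0, 0, 1)) (5 / 2) (C := 1 / 4) (by norm_num) ?_ ?_ ?_
    · intro q hq _; simpa using hq.2
    · intro x hx
      have := hd x hx
      obtain ⟨h1, h2⟩ := sqrt_bounds hx.1 hx.2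
      simp only [dotL_apply, id]
      linarith
    · intro x hx
      have := hd x hx
      simp only [dotL_apply, id]
      linarith
  · refine clear_of_outside (by rw [e1]; norm_num) (by rw [e2]; norm_num) ?_
    intro q hq
    simpa using hq

/-- Between the heights `7/5` and `13/5` the wall `ε * x = 1/2` separates the pattern, of axial
extent at most `1/2`, from an arc and chord with `ε * x ≥ 4/5`. -/
theorem isotopic_sideArc {ε : ℝ} (hε : ε ^ 2 = 1) {K : Set R3}
    (hK : ∀ q ∈ K, 7 / 5 < q.2.2 → q.2.2 < 13 / 5 → ε * q.1 ≤ 1 / 2) :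
    AmbientIsotopic (K ∪ sideArc ε) (K ∪ sideEdge ε) := by
  have hε' : |ε| = 1 := by rw [← sq_abs] at hε; nlinarith [abs_nonneg ε]
  have hd : ∀ z ∈ Icc (7 / 5 : ℝ) (13 / 5),
      ‖((ε * (4 / 5), 0, z) : R3) - (ε * √(1 - (z - 2) ^ 2), 0, z)‖ ≤ 1 / 5 := by
    intro z hz
    obtain ⟨h1, h2⟩ := sqrt_bounds' hz.1 hz.2
    rw [norm_eq_max]
    simp only [Prod.fst_sub, Prod.snd_sub, sub_self, max_le_iff, ← mul_sub, abs_mul, hε',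
      one_mul, abs_le]
    refine ⟨⟨by linarith, by linarith⟩, by norm_num, by norm_num⟩
  have e1 : √(1 - (7 / 5 - 2 : ℝ) ^ 2) = 4 / 5 := sqrt_end' (by norm_num)
  have e2 : √(1 - (13 / 5 - 2 : ℝ) ^ 2) = 4 / 5 := sqrt_end' (by norm_num)
  refine isotopic_move (lam := dotL (0, 0, 1)) (by norm_num)
    (continuous_plane (by fun_prop) continuous_id).continuousOn
    (continuous_plane (by fun_prop) continuous_id).continuousOn (by simp) (by simp)
    (by rw [e1]) (by rw [e2]) ?_
  have hsplit : K ⊆ {q : R3 | ε * q.1 ≤ 1 / 2} ∪ {q : R3 | q.2.2 ≤ 7 / 5 ∨ 13 / 5 ≤ q.2.2} := by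
    intro q hq
    by_cases h : 7 / 5 < q.2.2 ∧ q.2.2 < 13 / 5
    · exact Or.inl (hK q hq h.1 h.2)
    · right
      rwa [not_and_or, not_lt, not_lt] at h
  refine (Clear.union ?_ ?_).mono hsplit
  · refine clear_of_wall (dotL (ε, 0, 0)) (1 / 2) (C := 1) (by norm_num) ?_ ?_ ?_
    · intro q hq _; simpa using hq
    · intro x hx
      have := hd x hx
      obtain ⟨h1, h2⟩ := sqrt_bounds' hx.1 hx.2
      simp only [dotL_apply, id]
      nlinarith
    · intro x hx
      have := hd x hx
      simp only [dotL_apply, id]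
      nlinarith
  · refine clear_of_outside (by rw [e1]) (by rw [e2]) ?_
    intro q hq
    simpa using hq

/-- During the motion the arc stays within distance `7/5` of the axis, whereas the pattern is at
distance at least `3/2`. -/
theorem isotopic_bottomArc {K : Set R3}
    (hK : ∀ q ∈ K, |q.1| ≤ 4 / 5 → 3 / 2 ≤ rad q ∨ |q.1| = 4 / 5) :
    AmbientIsotopic (K ∪ bottomArc) (K ∪ bottomEdge) := by
  have hτ : ∀ x ∈ Icc (-(4 / 5) : ℝ) (4 / 5), 0 ≤ 14 * max 0 (|x| - 7 / 10) ∧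
      14 * max 0 (|x| - 7 / 10) ≤ 7 / 5 := by
    intro x hx
    have h1 := abs_le.2 hx
    have h2 : max 0 (|x| - 7 / 10) ≤ 1 / 10 := max_le (by norm_num) (by linarith)
    exact ⟨mul_nonneg (by norm_num) (le_max_left _ _), by linarith⟩
  have e1 : √(1 - (-(4 / 5) : ℝ) ^ 2) = 3 / 5 := sqrt_end (by norm_num)
  have e2 : √(1 - (4 / 5 : ℝ) ^ 2) = 3 / 5 := sqrt_end (by norm_num)
  have f1 : 14 * max 0 (|(-(4 / 5) : ℝ)| - 7 / 10) = 7 / 5 := by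
    rw [abs_neg, abs_of_nonneg (by norm_num)]; norm_num
  have f2 : 14 * max 0 (|(4 / 5 : ℝ)| - 7 / 10) = 7 / 5 := by
    rw [abs_of_nonneg (by norm_num)]; norm_num
  refine isotopic_move (lam := dotL (1, 0, 0)) (by norm_num)
    (continuous_plane continuous_id (by fun_prop)).continuousOn
    (continuous_plane continuous_id (by fun_prop)).continuousOn (by simp) (by simp)
    (by rw [e1, f1]; norm_num) (by rw [e2, f2]; norm_num) ?_
  have hsplit : K ⊆ {q : R3 | 3 / 2 ≤ rad q} ∪ {q : R3 | q.1 ≤ -(4 / 5) ∨ 4 / 5 ≤ q.1} := by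
    intro q hq
    by_cases h : |q.1| ≤ 4 / 5
    · rcases hK q hq h with h1 | h1
      · exact Or.inl h1
      · right
        rcases le_abs.1 h1.ge with h2 | h2
        · exact Or.inr h2
        · exact Or.inl (by linarith)
    · right
      rcases lt_abs.1 (not_le.1 h) with h2 | h2
      · exact Or.inr h2.le
      · exact Or.inl (by linarith)
  refine (Clear.union ?_ ?_).mono hsplit
  · refine clear_of_dist (δ := 1 / 20) (B := 2) (by norm_num) ?_ ?_
    · intro x hx
      obtain ⟨h1, h2⟩ := sqrt_bounds hx.1 hx.2
      obtain ⟨h3, h4⟩ := hτ x hx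
      rw [norm_eq_max]
      simp only [Prod.fst_sub, Prod.snd_sub, sub_self, abs_zero, max_le_iff, abs_le]
      refine ⟨by norm_num, by norm_num, by linarith, by linarith⟩
    · intro q hq hx t ht
      have hx' : q.1 ∈ Icc (-(4 / 5) : ℝ) (4 / 5) := by simpa using hx
      have hl : dotL (1, 0, 0) q = q.1 := by simp
      simp only [hl, id]
      obtain ⟨h1, h2⟩ := sqrt_bounds hx'.1 hx'.2
      obtain ⟨h3, h4⟩ := hτ _ hx'
      set a := 2 - √(1 - q.1 ^ 2)
      set b := 14 * max 0 (|q.1| - 7 / 10)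
      have hw : q - (((q.1, 0, a) : R3) + t • (((q.1, 0, b) : R3) - (q.1, 0, a))) =
          (0, q.2.1, q.2.2 - ((1 - t) * a + t * b)) := by
        ext <;> simp; ring
      rw [hw, norm_eq_max]
      have ha : 1 ≤ a ∧ a ≤ 7 / 5 := ⟨by simp only [a]; linarith, by simp only [a]; linarith⟩
      have hs0 : 0 ≤ (1 - t) * a + t * b := by
        have := sub_nonneg.2 ht.2
        have := ht.1
        have := ha.1
        positivity
      have hs1 : (1 - t) * a + t * b ≤ 7 / 5 := by
        nlinarith [mul_le_mul_of_nonneg_left ha.2 (sub_nonneg.2 ht.2), mul_le_mul_of_nonneg_left h4 ht.1]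
      by_contra hcon
      simp only [not_le, max_lt_iff] at hcon
      have h5 := rad_le q
      have h6 : |q.2.2| ≤ |q.2.2 - ((1 - t) * a + t * b)| + ((1 - t) * a + t * b) := by
        have := abs_add_le (q.2.2 - ((1 - t) * a + t * b)) ((1 - t) * a + t * b)
        rwa [sub_add_cancel, abs_of_nonneg hs0] at this
      have h7 : (3 / 2 : ℝ) ≤ rad q := hq
      linarith [hcon.2.1, hcon.2.2]
  · refine clear_of_outside (by rw [e1, f1]; norm_num) (by rw [e2, f2]; norm_num) ?_
    intro q hq
    simpa using hq

/-- The result is a polygon running along the axis around which the pattern winds. This is the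
segment that the axis component of the common model will contain. -/
theorem isotopic_meridianCircle {Q : Set R3}
    (hQ : ∀ q ∈ Q, |q.1| ≤ 1 / 2 ∧ 3 / 2 ≤ rad q ∧ rad q ≤ 5 / 2) :
    AmbientIsotopic (Q ∪ meridianCircle)
      (Q ∪ (topEdge ∪ sideEdge 1 ∪ sideEdge (-1) ∪ bottomEdge)) := by
  have hQz : ∀ q ∈ Q, q.2.2 ≤ 5 / 2 := fun q hq =>
    (le_abs_self _).trans ((abs_le_rad q).2.trans (hQ q hq).2.2)
  have hside : ∀ ε : ℝ, ε ^ 2 = 1 → ∀ q ∈ sideArc ε, (4 / 5 ≤ ε * q.1 ∧ ε * q.1 ≤ 1) ∧ q.2.1 = 0 := by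
    rintro ε hε _ ⟨z, hz, rfl⟩
    obtain ⟨h1, h2⟩ := sqrt_bounds' hz.1 hz.2
    simp only [← mul_assoc, ← sq, hε, one_mul]
    exact ⟨⟨h1, h2⟩, trivial⟩
  have hsideE : ∀ ε : ℝ, ε ^ 2 = 1 → ∀ q ∈ sideEdge ε, ε * q.1 = 4 / 5 := by
    rintro ε hε _ ⟨z, hz, rfl⟩
    simp only [← mul_assoc, ← sq, hε, one_mul]
  have habs : ∀ ε : ℝ, ε ^ 2 = 1 → ∀ x : ℝ, 4 / 5 ≤ ε * x → |x| ≤ 4 / 5 → |x| = 4 / 5 := by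
    intro ε hε x h h'
    have : |ε| = 1 := by rw [← sq_abs] at hε; nlinarith [abs_nonneg ε]
    refine le_antisymm h' (h.trans ((le_abs_self _).trans ?_))
    rw [abs_mul, this, one_mul]
  have one : (1 : ℝ) ^ 2 = 1 := by norm_num
  have mone : (-1 : ℝ) ^ 2 = 1 := by norm_num
  rw [meridianCircle_eq]
  have e1 : Q ∪ (topArc ∪ bottomArc ∪ sideArc 1 ∪ sideArc (-1)) =
      (Q ∪ bottomArc ∪ sideArc 1 ∪ sideArc (-1)) ∪ topArc := by ext; simp only [mem_union]; tauto
  rw [e1]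
  refine (isotopic_topArc ?_).trans ?_
  · rintro q (((hq | ⟨x, hx, rfl⟩) | hq) | hq) h
    · exact Or.inl (hQz q hq)
    · left
      obtain ⟨h1, h2⟩ := sqrt_bounds hx.1 hx.2
      simp only; linarith
    · exact Or.inr (habs 1 one _ (hside 1 one q hq).1.1 h)
    · exact Or.inr (habs (-1) mone _ (hside (-1) mone q hq).1.1 h)
  have htop : ∀ q ∈ topEdge, q.2.2 = 13 / 5 := by rintro _ ⟨x, hx, rfl⟩; rfl
  have hbot : ∀ q ∈ bottomArc, q.2.2 ≤ 7 / 5 := by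
    rintro _ ⟨x, hx, rfl⟩
    obtain ⟨h1, h2⟩ := sqrt_bounds hx.1 hx.2
    simp only; linarith
  have e2 : (Q ∪ bottomArc ∪ sideArc 1 ∪ sideArc (-1)) ∪ topEdge =
      (Q ∪ bottomArc ∪ topEdge ∪ sideArc (-1)) ∪ sideArc 1 := by ext; simp only [mem_union]; tauto
  rw [e2]
  refine (isotopic_sideArc one ?_).trans ?_
  · rintro q (((hq | hq) | hq) | hq) h h'
    · linarith [(abs_le.1 (hQ q hq).1).2]
    · linarith [hbot q hq]
    · linarith [htop q hq]
    · linarith [(hside (-1) mone q hq).1.1]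
  have e3 : (Q ∪ bottomArc ∪ topEdge ∪ sideArc (-1)) ∪ sideEdge 1 =
      (Q ∪ bottomArc ∪ topEdge ∪ sideEdge 1) ∪ sideArc (-1) := by ext; simp only [mem_union]; tauto
  rw [e3]
  refine (isotopic_sideArc mone ?_).trans ?_
  · rintro q (((hq | hq) | hq) | hq) h h'
    · linarith [(abs_le.1 (hQ q hq).1).1]
    · linarith [hbot q hq]
    · linarith [htop q hq]
    · linarith [hsideE 1 one q hq]
  have e4 : (Q ∪ bottomArc ∪ topEdge ∪ sideEdge 1) ∪ sideEdge (-1) =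
      (Q ∪ (topEdge ∪ sideEdge 1 ∪ sideEdge (-1))) ∪ bottomArc := by ext; simp only [mem_union]; tauto
  have e5 : Q ∪ (topEdge ∪ sideEdge 1 ∪ sideEdge (-1) ∪ bottomEdge) =
      (Q ∪ (topEdge ∪ sideEdge 1 ∪ sideEdge (-1))) ∪ bottomEdge := by
    ext; simp only [mem_union]; tauto
  rw [e4, e5]
  refine isotopic_bottomArc ?_
  rintro q (hq | (hq | hq) | hq) h
  · exact Or.inl (hQ q hq).2.1
  · left
    have h1 := (abs_le_rad q).2
    rw [htop q hq, abs_of_nonneg (by norm_num)] at h1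
    linarith
  · exact Or.inr (habs 1 one _ (hsideE 1 one q hq).ge h)
  · exact Or.inr (habs (-1) mone _ (hsideE (-1) mone q hq).ge h)

/-! ### Straightening the Mazur link -/

/-- The displacement that stretches the legs of the meridian away from the pattern. -/
noncomputable def mazurStretch (x : ℝ) : ℝ :=
  23 / 2 * (clamp 24 (168 / 5) x - 24) + 4 * (clamp (168 / 5) (192 / 5) x - 168 / 5) +
    (23 / 2 * (clamp (-(168 / 5)) (-24) x + 24) + 4 * (clamp (-(192 / 5)) (-(168 / 5)) x + 168 / 5))

/-- The new radial coordinate. -/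
noncomputable def mazurRadius (m n : ℕ) (r : ℝ) : ℝ :=
  r + ((60 / 7 - 1) * (clamp 0 (7 / 5) r - 0) + (60 - 1) * (clamp (7 / 5) (3 / 2) r - 7 / 5) +
    (5 * (m + n + 1) / m - 1) * (clamp (3 / 2) (3 / 2 + m / (m + n + 1)) r - 3 / 2) +
    (2 * (m + n + 1) - 1) * (clamp (3 / 2 + m / (m + n + 1)) (3 / 2 + (m + 1) / (m + n + 1)) r -
      (3 / 2 + m / (m + n + 1))) +
    (5 * (m + n + 1) / n - 1) * (clamp (3 / 2 + (m + 1) / (m + n + 1)) (5 / 2) r -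
      (3 / 2 + (m + 1) / (m + n + 1))) +
    (100 - 1) * (clamp (5 / 2) (13 / 5) r - 5 / 2))

/-- The number of turns by which radius `F` is rotated. -/
noncomputable def mazurTurns (n : ℕ) (F : ℝ) : ℝ :=
  1 / 2 * (clamp 24 25 F - 24) + n / 5 * (clamp 25 30 F - 25) - (n + 1 / 2) / 10 * (clamp 30 40 F - 30)

/-- The displacement that makes the new radius depend on the position along the axis. -/
noncomputable def mazurShift (x : ℝ) : ℝ := -6 + clamp 0 48 x / 8 + (clamp 72 120 x - 72) / 8

theorem monotone_ramp {s l r : ℝ} (hs : 0 ≤ s) (c : ℝ) : Monotone fun x => s * (clamp l r x - c) :=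
  fun _ _ h => mul_le_mul_of_nonneg_left (sub_le_sub_right (monotone_clamp l r h) c) hs

theorem continuous_mazurRadius (m n : ℕ) : Continuous (mazurRadius m n) := by
  unfold mazurRadius; fun_prop

theorem mazurShift_mem (x : ℝ) : mazurShift x ∈ Icc (-6) 6 := by
  have h1 := clamp_mem (show (0 : ℝ) ≤ 48 by norm_num) x
  have h2 := clamp_mem (show (72 : ℝ) ≤ 120 by norm_num) x
  simp only [mazurShift]
  constructor <;> linarith [h1.1, h1.2, h2.1, h2.2]

section
variable {m n : ℕ} (hm : 1 ≤ m) (hn : 1 ≤ n)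
include hm hn

/-- Each coefficient in `mazurRadius` is the slope of one linear piece minus `1`, and no slope is
below `1`. -/
theorem monotone_mazurRadius_sub : Monotone fun r => mazurRadius m n r - r := by
  have hm' : (1 : ℝ) ≤ m := by exact_mod_cast hm
  have hn' : (1 : ℝ) ≤ n := by exact_mod_cast hn
  have s1 : 0 ≤ 5 * ((m : ℝ) + n + 1) / m - 1 := by
    rw [sub_nonneg, le_div_iff₀ (by linarith)]; linarith
  have s2 : 0 ≤ 5 * ((m : ℝ) + n + 1) / n - 1 := by
    rw [sub_nonneg, le_div_iff₀ (by linarith)]; linarith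
  simp only [mazurRadius, add_sub_cancel_left]
  exact ((((((monotone_ramp (by norm_num) _).add (monotone_ramp (by norm_num) _)).add
    (monotone_ramp s1 _)).add (monotone_ramp (by linarith) _)).add (monotone_ramp s2 _)).add
    (monotone_ramp (by norm_num) _))

theorem strictMono_mazurRadius : StrictMono (mazurRadius m n) := by
  intro x y h
  have := monotone_mazurRadius_sub hm hn h.le
  simp only at this
  linarith

/-- The radii between which `mazurRadius` has a kink are in increasing order. -/
theorem mazurRadius_nodes : (3 / 2 : ℝ) ≤ 3 / 2 + m / (m + n + 1) ∧
    3 / 2 + (m : ℝ) / (m + n + 1) ≤ 3 / 2 + (m + 1) / (m + n + 1) ∧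
    3 / 2 + ((m : ℝ) + 1) / (m + n + 1) ≤ 5 / 2 := by
  have hN : (0 : ℝ) < m + n + 1 := by positivity
  refine ⟨by linarith [show (0 : ℝ) ≤ m / (m + n + 1) by positivity], ?_, ?_⟩
  · have : (m : ℝ) / (m + n + 1) ≤ (m + 1) / (m + n + 1) := by gcongr; linarith
    linarith
  · have : ((m : ℝ) + 1) / (m + n + 1) ≤ 1 := by
      rw [div_le_one hN]
      linarith [show (0 : ℝ) ≤ n from Nat.cast_nonneg n]
    linarith

theorem mazurRadius_inner {r : ℝ} (h : 0 ≤ r) (h' : r ≤ 7 / 5) : mazurRadius m n r = 60 / 7 * r := by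
  obtain ⟨h1, h2, h3⟩ := mazurRadius_nodes hm hn
  rw [mazurRadius, clamp_of_mem ⟨h, h'⟩, clamp_of_le h', clamp_of_le (by linarith),
    clamp_of_le (by linarith), clamp_of_le (by linarith), clamp_of_le (by linarith)]
  ring

theorem mazurRadius_fst {u : ℝ} (h : 0 ≤ u) (h' : u ≤ m) :
    mazurRadius m n (3 / 2 + u / (m + n + 1)) = 18 + 5 * u / m := by
  obtain ⟨h1, h2, h3⟩ := mazurRadius_nodes hm hn
  have hm' : (0 : ℝ) < m := by exact_mod_cast hm
  have hN : (0 : ℝ) < m + n + 1 := by positivity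
  have e1 : 0 ≤ u / ((m : ℝ) + n + 1) := by positivity
  have e2 : u / ((m : ℝ) + n + 1) ≤ m / (m + n + 1) := by gcongr
  rw [mazurRadius, clamp_of_ge (by norm_num) (by linarith), clamp_of_ge (by norm_num) (by linarith),
    clamp_of_mem ⟨by linarith, by linarith⟩, clamp_of_le (by linarith), clamp_of_le (by linarith),
    clamp_of_le (by linarith)]
  field_simp
  ring

theorem mazurRadius_mid {u : ℝ} (h : m ≤ u) (h' : u ≤ m + 1) :
    mazurRadius m n (3 / 2 + u / (m + n + 1)) = 23 + 2 * (u - m) := by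
  obtain ⟨h1, h2, h3⟩ := mazurRadius_nodes hm hn
  have hm' : (0 : ℝ) < m := by exact_mod_cast hm
  have hN : (0 : ℝ) < m + n + 1 := by positivity
  have e1 : m / ((m : ℝ) + n + 1) ≤ u / (m + n + 1) := by gcongr
  have e2 : u / ((m : ℝ) + n + 1) ≤ (m + 1) / (m + n + 1) := by gcongr
  rw [mazurRadius, clamp_of_ge (by norm_num) (by linarith), clamp_of_ge (by norm_num) (by linarith),
    clamp_of_ge (by linarith) (by linarith), clamp_of_mem ⟨by linarith, by linarith⟩,
    clamp_of_le (by linarith), clamp_of_le (by linarith)]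
  field_simp
  ring

theorem mazurRadius_snd {u : ℝ} (h : m + 1 ≤ u) (h' : u ≤ m + n + 1) :
    mazurRadius m n (3 / 2 + u / (m + n + 1)) = 25 + 5 * (u - m - 1) / n := by
  obtain ⟨h1, h2, h3⟩ := mazurRadius_nodes hm hn
  have hm' : (0 : ℝ) < m := by exact_mod_cast hm
  have hn' : (0 : ℝ) < n := by exact_mod_cast hn
  have hN : (0 : ℝ) < m + n + 1 := by positivity
  have e1 : (m + 1) / ((m : ℝ) + n + 1) ≤ u / (m + n + 1) := by gcongr
  have e2 : u / ((m : ℝ) + n + 1) ≤ 1 := by rwa [div_le_one hN]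
  rw [mazurRadius, clamp_of_ge (by norm_num) (by linarith), clamp_of_ge (by norm_num) (by linarith),
    clamp_of_ge (by linarith) (by linarith), clamp_of_ge (by linarith) (by linarith),
    clamp_of_mem ⟨by linarith, by linarith⟩, clamp_of_le (by linarith)]
  field_simp
  ring

theorem mazurRadius_outer : mazurRadius m n (13 / 5) = 40 := by
  obtain ⟨h1, h2, h3⟩ := mazurRadius_nodes hm hn
  have hm' : (0 : ℝ) < m := by exact_mod_cast hm
  have hn' : (0 : ℝ) < n := by exact_mod_cast hn
  rw [mazurRadius, clamp_of_ge (by norm_num) (by linarith), clamp_of_ge (by norm_num) (by linarith),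
    clamp_of_ge (by linarith) (by linarith), clamp_of_ge (by linarith) (by linarith),
    clamp_of_ge (by linarith) (by linarith), clamp_of_ge (by norm_num) (by linarith)]
  field_simp
  ring

end

/-- The composition of all deformations that straighten the Mazur link, in cylindrical coordinates. -/
noncomputable def mazurStraight (m n : ℕ) (x r θ : ℝ) : R3 :=
  let X := 48 * x + mazurStretch (48 * x)
  let F := mazurRadius m n r
  let X' := X + (120 - 8 * (clamp 18 30 F - 18))
  cyl X' (F * (1 + mazurShift X' / max F 18))
    (θ - 2 * Real.pi * mazurTurns n F * clamp 0 1 (2 - |X| / 24))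

/-- Six elementary isotopies are composed: scaling along the axis, stretching the meridian legs, the
new radius, the twist, the shear along the axis, and the radial shift. In cylindrical coordinates
each has a one-line effect, so the composition has a closed formula. -/
theorem exists_isotopic_mazurStraight {m n : ℕ} (hm : 1 ≤ m) (hn : 1 ≤ n) (K : Set R3) :
    ∃ T : R3 → R3, AmbientIsotopic K (T '' K) ∧
      ∀ x r θ, 0 ≤ r → T (cyl x r θ) = mazurStraight m n x r θ := by
  set T1 : R3 → R3 := boxMap (48, 1, 1) 0
  set T2 : R3 → R3 := fun p => p + mazurStretch p.1 • (1, 0, 0)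
  -- Below `7/5` the radius map is linear, so freezing the quotient there changes nothing and avoids
  -- dividing by zero on the axis.
  set k : ℝ → ℝ → ℝ := fun _ r => mazurRadius m n (max r (7 / 5)) / max r (7 / 5) with hk
  set T3 : R3 → R3 := fun p => (p.1, k p.1 (rad p) * p.2.1, k p.1 (rad p) * p.2.2)
  set φ : ℝ → ℝ → ℝ := fun x F => -(2 * Real.pi * mazurTurns n F * clamp 0 1 (2 - |x| / 24))
  set T4 : R3 → R3 := fun p => rotX (φ p.1 (rad p)) p
  set T5 : R3 → R3 := fun p => p + (120 - 8 * (clamp 18 30 (rad p) - 18)) • (1, 0, 0)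
  set k' : ℝ → ℝ → ℝ := fun x F => 1 + mazurShift x / max F 18
  set T6 : R3 → R3 := fun p => (p.1, k' p.1 (rad p) * p.2.1, k' p.1 (rad p) * p.2.2)
  have hkr : ∀ r, 0 ≤ r → k 0 r * r = mazurRadius m n r := by
    intro r hr
    simp only [hk]
    rcases le_total r (7 / 5) with h | h
    · rw [max_eq_right h, mazurRadius_inner hm hn (by norm_num) le_rfl, mazurRadius_inner hm hn hr h]
      ring
    · rw [max_eq_left h, div_mul_cancel₀ _ (by linarith)]
  have hpos : ∀ r, 0 ≤ r → r ≤ mazurRadius m n r := by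
    intro r hr
    have := monotone_mazurRadius_sub hm hn hr
    simp only [mazurRadius_inner hm hn (le_refl 0) (by norm_num)] at this
    linarith
  have hk1 : ∀ x r, 1 ≤ k x r := by
    intro x r
    have h : 0 < max r (7 / 5) := lt_max_of_lt_right (by norm_num)
    rw [one_le_div h]
    exact hpos _ h.le
  -- The shift is at least `-6` and is divided by at least `18`.
  have hk' : ∀ x F, 2 / 3 ≤ k' x F := by
    intro x F
    have h1 := (mazurShift_mem x).1
    have h2 : (18 : ℝ) ≤ max F 18 := le_max_right _ _
    have : -(1 / 3) ≤ mazurShift x / max F 18 := by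
      rw [le_div_iff₀ (by linarith)]; linarith
    simp only [k']; linarith
  refine ⟨T6 ∘ T5 ∘ T4 ∘ T3 ∘ T2 ∘ T1, ?_, ?_⟩
  · simp only [image_comp]
    refine (isotopic_boxMap (a := (48, 1, 1)) (by norm_num) (by norm_num) (by norm_num) 0 _).trans ?_
    refine (isotopic_slide (1, 0, 0) (g := fun p => mazurStretch p.1) (B := 1000)
      (by unfold mazurStretch; fun_prop) ?_ ?_ _).trans ?_
    · intro p
      have h1 := clamp_mem (show (24 : ℝ) ≤ 168 / 5 by norm_num) p.1
      have h2 := clamp_mem (show (168 / 5 : ℝ) ≤ 192 / 5 by norm_num) p.1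
      have h3 := clamp_mem (show -(168 / 5 : ℝ) ≤ -24 by norm_num) p.1
      have h4 := clamp_mem (show -(192 / 5 : ℝ) ≤ -(168 / 5) by norm_num) p.1
      rw [abs_le, mazurStretch]
      constructor <;> linarith [h1.1, h1.2, h2.1, h2.2, h3.1, h3.2, h4.1, h4.2]
    · intro p r s h
      have hrs : p.1 + r ≤ p.1 + s := by linarith
      have h1 := monotone_clamp 24 (168 / 5) hrs
      have h2 := monotone_clamp (168 / 5) (192 / 5) hrs
      have h3 := monotone_clamp (-(168 / 5)) (-24) hrs
      have h4 := monotone_clamp (-(192 / 5)) (-(168 / 5)) hrs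
      simp only [mazurStretch, Prod.fst_add, Prod.smul_fst, smul_eq_mul, mul_one]
      linarith
    refine (isotopic_radial (k := k) (c := 1) ?_ one_pos hk1 ?_ _).trans ?_
    · simp only [hk]
      have : Continuous fun p : ℝ × ℝ => max p.2 (7 / 5) := by fun_prop
      refine ((continuous_mazurRadius m n).comp this).div this fun p => ?_
      exact (lt_max_of_lt_right (by norm_num)).ne'
    · intro x r hr s hs h
      have := strictMono_mazurRadius hm hn h
      rw [← hkr r hr, ← hkr s hs] at this
      simp only [mul_comm] at this ⊢
      exact this
    refine (isotopic_twist (φ := φ) (by simp only [φ, mazurTurns]; fun_prop) _).trans ?_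
    refine (isotopic_slide (1, 0, 0) (g := fun p => 120 - 8 * (clamp 18 30 (rad p) - 18)) (B := 1000)
      (by fun_prop) ?_ ?_ _).trans ?_
    · intro p
      have h1 := clamp_mem (show (18 : ℝ) ≤ 30 by norm_num) (rad p)
      rw [abs_le]
      constructor <;> linarith [h1.1, h1.2]
    · intro p r s h
      have : ∀ r : ℝ, rad (p + r • ((1, 0, 0) : R3)) = rad p := fun r => by simp [rad]
      simp only [this]
      linarith
    refine isotopic_radial (k := k') (c := 2 / 3) ?_ (by norm_num) hk' ?_ _
    · simp only [k']
      have h1 : Continuous fun p : ℝ × ℝ => max p.2 18 := by fun_prop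
      have h2 : Continuous fun p : ℝ × ℝ => mazurShift p.1 := by unfold mazurShift; fun_prop
      refine continuous_const.add (h2.div h1 fun p => ?_)
      exact (lt_max_of_lt_right (by norm_num)).ne'
    · intro x r hr s hs h
      have h1 := mazurShift_mem x
      -- In this form monotonicity is visible: the correction has slope at most `1/3` in absolute
      -- value.
      have e : ∀ r : ℝ, r * k' x r = r + mazurShift x / 18 * min r 18 := by
        intro r
        simp only [k']
        rcases le_total r 18 with h | h
        · rw [max_eq_right h, min_eq_left h]; ring
        · rw [max_eq_left h, min_eq_right h]
          field_simp
      simp only [e]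
      have h2 : min r 18 ≤ min s 18 := min_le_min_right _ h.le
      have h3 : min s 18 - min r 18 ≤ s - r := by
        rcases min_cases s 18 with ⟨h5, h6⟩ | ⟨h5, h6⟩ <;>
        rcases min_cases r 18 with ⟨h7, h8⟩ | ⟨h7, h8⟩ <;> linarith
      nlinarith [h1.1, h1.2]
  · intro x r θ hr
    have e1 : T1 (cyl x r θ) = cyl (48 * x) r θ := by simp [T1, boxMap, cyl]
    have e2 : ∀ x r θ a, cyl x r θ + a • ((1, 0, 0) : R3) = cyl (x + a) r θ := by
      intro x r θ a; simp [cyl]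
    have e3 : ∀ x r θ a, (((cyl x r θ).1, a * (cyl x r θ).2.1, a * (cyl x r θ).2.2) : R3) =
        cyl x (a * r) θ := by
      intro x r θ a; simp [cyl, mul_assoc]
    have hF : 0 ≤ mazurRadius m n r := hr.trans (hpos r hr)
    simp only [Function.comp]
    rw [e1]
    simp only [T2, e2]
    simp only [T3, e3, rad_cyl hr]
    have e4 : ∀ x, k x r * r = mazurRadius m n r := fun x => hkr r hr
    simp only [e4]
    simp only [T4, rotX_cyl, rad_cyl hF]
    simp only [T5, e2, rad_cyl hF]
    simp only [T6, e3, rad_cyl hF]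
    simp only [mazurStraight, φ, k', cyl]
    simp only [mul_comm (mazurRadius m n r), sub_eq_add_neg]

theorem image_Icc_eq_image_unit {f g : ℝ → R3} {a b : ℝ} (hab : a < b)
    (h : ∀ x ∈ Icc a b, f x = g ((x - a) / (b - a))) : f '' Icc a b = g '' Icc 0 1 := by
  have hba : 0 < b - a := sub_pos.2 hab
  have hI : Icc (0 : ℝ) 1 = (fun x => (x - a) / (b - a)) '' Icc a b := by
    ext s
    constructor
    · intro hs
      exact ⟨a + s * (b - a), ⟨by nlinarith [hs.1], by nlinarith [hs.2]⟩, by simp only; field_simp; ring⟩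
    · rintro ⟨x, hx, rfl⟩
      exact ⟨div_nonneg (by linarith [hx.1]) hba.le, by rw [div_le_one hba]; linarith [hx.2]⟩
  rw [hI, image_image]
  exact image_congr h

theorem image_one_sub_unit (g : ℝ → R3) : (fun s => g (1 - s)) '' Icc 0 1 = g '' Icc 0 1 := by
  rw [← image_image g (fun s => 1 - s), image_const_sub_Icc]
  simp

/-- Only the end values of a monotone continuous reparametrisation matter for the image, so its
kinks and its dependence on `m` and `n` disappear. -/
theorem image_comp_Icc {φ : ℝ → R3} {f : ℝ → ℝ} (g : ℝ → R3) {a b : ℝ} (hf : Continuous f)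
    (hm : Monotone f) (hab : a ≤ b) (h : ∀ x ∈ Icc a b, φ x = g (f x)) :
    φ '' Icc a b = g '' Icc (f a) (f b) := by
  rw [image_congr h, ← image_image g f]
  congr 1
  refine subset_antisymm ?_ (intermediate_value_Icc hab hf.continuousOn)
  rintro _ ⟨x, hx, rfl⟩
  exact ⟨hm hx.1, hm hx.2⟩

theorem mazurShift_of_le {x : ℝ} (h : x ≤ 0) : mazurShift x = -6 := by
  rw [mazurShift, clamp_of_le h, clamp_of_le (by linarith)]; ring

theorem mazurShift_left {x : ℝ} (h : 0 ≤ x) (h' : x ≤ 48) : mazurShift x = -6 + x / 8 := by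
  rw [mazurShift, clamp_of_mem ⟨h, h'⟩, clamp_of_le (by linarith)]; ring

theorem mazurShift_mid {x : ℝ} (h : 48 ≤ x) (h' : x ≤ 72) : mazurShift x = 0 := by
  rw [mazurShift, clamp_of_ge (by norm_num) h, clamp_of_le h']; ring

theorem mazurShift_right {x : ℝ} (h : 72 ≤ x) (h' : x ≤ 120) : mazurShift x = (x - 72) / 8 := by
  rw [mazurShift, clamp_of_ge (by norm_num) (by linarith), clamp_of_mem ⟨h, h'⟩]; ring

theorem mazurShift_of_ge {x : ℝ} (h : 120 ≤ x) : mazurShift x = 6 := by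
  rw [mazurShift, clamp_of_ge (by norm_num) (by linarith), clamp_of_ge (by norm_num) h]; ring

theorem mazurTurns_of_le (n : ℕ) {F : ℝ} (h : F ≤ 24) : mazurTurns n F = 0 := by
  rw [mazurTurns, clamp_of_le h, clamp_of_le (by linarith), clamp_of_le (by linarith)]; ring

theorem mazurTurns_mid (n : ℕ) {F : ℝ} (h : 24 ≤ F) (h' : F ≤ 25) :
    mazurTurns n F = 1 / 2 * (F - 24) := by
  rw [mazurTurns, clamp_of_mem ⟨h, h'⟩, clamp_of_le h', clamp_of_le (by linarith)]; ring

theorem mazurTurns_right (n : ℕ) {F : ℝ} (h : 25 ≤ F) (h' : F ≤ 30) :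
    mazurTurns n F = 1 / 2 + n / 5 * (F - 25) := by
  rw [mazurTurns, clamp_of_ge (by norm_num) h, clamp_of_mem ⟨h, h'⟩, clamp_of_le h']; ring

theorem mazurTurns_outer (n : ℕ) : mazurTurns n 40 = 0 := by
  rw [mazurTurns, clamp_of_ge (by norm_num) (by norm_num), clamp_of_ge (by norm_num) (by norm_num),
    clamp_of_ge (by norm_num) (by norm_num)]
  ring

theorem mazurStretch_of_abs_le {x : ℝ} (h : |x| ≤ 24) : mazurStretch x = 0 := by
  obtain ⟨h1, h2⟩ := abs_le.1 h
  rw [mazurStretch, clamp_of_le h2, clamp_of_le (by linarith), clamp_of_ge (by norm_num) h1,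
    clamp_of_ge (by norm_num) (by linarith)]
  ring

theorem mazurStretch_right {x : ℝ} (h : 168 / 5 ≤ x) (h' : x ≤ 192 / 5) :
    mazurStretch x = 4 * x - 24 := by
  rw [mazurStretch, clamp_of_ge (by norm_num) h, clamp_of_mem ⟨h, h'⟩, clamp_of_ge (by norm_num)
    (by linarith), clamp_of_ge (by norm_num) (by linarith)]
  ring

theorem mazurStretch_left {x : ℝ} (h : -(192 / 5) ≤ x) (h' : x ≤ -(168 / 5)) :
    mazurStretch x = 4 * x + 24 := by
  rw [mazurStretch, clamp_of_le (by linarith), clamp_of_le (by linarith), clamp_of_le h',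
    clamp_of_mem ⟨h, h'⟩]
  ring

theorem monotone_mazurStretch : Monotone mazurStretch := by
  intro x y h
  have h1 := monotone_clamp 24 (168 / 5) h
  have h2 := monotone_clamp (168 / 5) (192 / 5) h
  have h3 := monotone_clamp (-(168 / 5)) (-24) h
  have h4 := monotone_clamp (-(192 / 5)) (-(168 / 5)) h
  simp only [mazurStretch]
  linarith

theorem cyl_quarter (x r : ℝ) : cyl x r (Real.pi / 2) = (x, 0, r) := by simp [cyl]

/-- On the pattern `|v| ≤ 1`, so after scaling the axial position is at most `24`: the stretch
vanishes and the twist acts fully. From radius `18` on, the radial factor amounts to adding the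
shift. -/
theorem mazurStraight_of_mem (m n : ℕ) {v r F : ℝ} (θ : ℝ) (hv : |v| ≤ 1)
    (hF : mazurRadius m n r = F) (h : 18 ≤ F) (h' : F ≤ 30) :
    mazurStraight m n (v / 2) r θ = cyl (24 * v + 120 - 8 * (F - 18))
      (F + mazurShift (24 * v + 120 - 8 * (F - 18))) (θ - 2 * Real.pi * mazurTurns n F) := by
  have e : 48 * (v / 2) = 24 * v := by ring
  have h1 : |24 * v| ≤ 24 := by rw [abs_mul, abs_of_pos (by norm_num)]; linarith
  have h2 : (1 : ℝ) ≤ 2 - |24 * v| / 24 := by linarith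
  simp only [mazurStraight, e, mazurStretch_of_abs_le h1, hF, clamp_of_mem (mem_Icc.2 ⟨h, h'⟩),
    clamp_of_ge zero_le_one h2, max_eq_left h, add_zero, mul_one]
  have h3 : 24 * v + (120 - 8 * (F - 18)) = 24 * v + 120 - 8 * (F - 18) := by ring
  rw [h3]
  congr 1
  have : F ≠ 0 := by linarith
  field_simp

/-- The straightened Mazur link away from the axis, the helices and the two half turns. -/
def mazurArcs : List (List ZPt) :=
  [[(72, -24, 0), (48, -27, 0), (24, -27, 0), (0, -24, 0)],
    [(48, 24, 0), (72, 24, 0), (96, 27, 0), (120, 27, 0), (144, 24, 0), (120, 24, 0)]]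

/-- The straightened meridian. -/
def mazurMeridian : List (List ZPt) :=
  [[(-24, 0, 0), (264, 0, 0), (288, 0, 16), (288, 0, 24), (192, 0, 36), (192, 0, 46), (120,
  0, 46), (72, 0, 40), (48, 0, 40), (0, 0, 34), (-144, 0, 34), (-144, 0, 24), (-48, 0, 12), (-48,
  0, 8), (-24, 0, 0)]]

/-- The half turns in which the Mazur curve turns back. -/
noncomputable def mazurTurn (x : ℝ) : Set R3 :=
  halfTurn (x, 0, 0) (0, -24, 0) (0, 0, -24) (-8, 0, 0) '' Icc 0 1

theorem halfTurn_mazur (x s : ℝ) : halfTurn (x, 0, 0) (0, -24, 0) (0, 0, -24) (-8, 0, 0) s =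
    cyl (x - 8 * s) 24 (-(Real.pi * s)) := by
  simp only [halfTurn, cyl, Real.cos_neg, Real.sin_neg]
  ext <;> simp <;> ring

theorem cyl_sub_nat (x r θ : ℝ) (k : ℕ) : cyl x r (θ - k * (2 * Real.pi)) = cyl x r θ := by
  simp only [cyl, Real.cos_sub_nat_mul_two_pi, Real.sin_sub_nat_mul_two_pi]

theorem cyl_add_nat (x r θ : ℝ) (k : ℕ) : cyl x r (θ + k * (2 * Real.pi)) = cyl x r θ := by
  simp only [cyl, Real.cos_add_nat_mul_two_pi, Real.sin_add_nat_mul_two_pi]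

theorem helixPt_eq_cyl (x₀ w r φ k s : ℝ) :
    helixPt x₀ w r φ k s = cyl (x₀ + w * s) r (φ + Real.pi * k * s) := rfl

theorem continuous_mazurRadius_strand (m n : ℕ) :
    Continuous fun u : ℝ => mazurRadius m n (3 / 2 + u / (m + n + 1)) :=
  (continuous_mazurRadius m n).comp (by fun_prop)

section
variable {m n : ℕ} (hm : 1 ≤ m) (hn : 1 ≤ n)
include hm hn

/-- The straightening on the part of the curve that winds forwards. -/
theorem mazurStraight_forward : (fun u : ℝ => mazurStraight m n (0 / 2) (3 / 2 + u / (m + n + 1))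
      (-(2 * Real.pi * u))) '' Icc 0 (m + 1 / 2) = helix 80 40 24 0 (2 * m) ∪ mazurTurn 80 := by
  have hm' : (0 : ℝ) < m := by exact_mod_cast hm
  rw [image_Icc_union _ hm'.le (by linarith)]
  congr 1
  · rw [helix, ← image_one_sub_unit]
    refine image_Icc_eq_image_unit hm' fun u hu => ?_
    have h1 : 5 * u / m ≤ 5 := by rw [div_le_iff₀ hm']; linarith [hu.2]
    have h0 : 0 ≤ 5 * u / m := div_nonneg (by linarith [hu.1]) hm'.le
    rw [mazurStraight_of_mem m n _ (by simp) (mazurRadius_fst hm hn hu.1 hu.2) (by linarith)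
      (by linarith), mazurTurns_of_le n (by linarith), mazurShift_right (by linarith) (by linarith),
      helixPt_eq_cyl, ← cyl_sub_nat _ _ (0 + _) m, sub_zero, sub_zero]
    congr 1
    · field_simp; ring
    · field_simp; ring
    · field_simp; ring
  · rw [mazurTurn]
    refine image_Icc_eq_image_unit (by linarith) fun u hu => ?_
    rw [mazurStraight_of_mem m n _ (by simp) (mazurRadius_mid hm hn hu.1 (by linarith [hu.2]))
      (by linarith [hu.1]) (by linarith [hu.2]), mazurTurns_of_le n (by linarith [hu.2]),
      mazurShift_right (by linarith [hu.2]) (by linarith [hu.1]), halfTurn_mazur,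
      ← cyl_sub_nat _ _ (-_) m]
    congr 1 <;> ring

theorem monotone_mazurRadius_strand : Monotone fun u : ℝ => mazurRadius m n (3 / 2 + u / (m + n + 1)) :=
  fun u u' h => (strictMono_mazurRadius hm hn).monotone (by gcongr)

theorem mazurRadius_zero : mazurRadius m n (3 / 2 + 0 / (m + n + 1)) = 18 := by
  rw [mazurRadius_fst hm hn le_rfl (by positivity)]; simp

theorem mazurRadius_half : mazurRadius m n (3 / 2 + (m + 1 / 2) / (m + n + 1)) = 24 := by
  rw [mazurRadius_mid hm hn (by linarith) (by linarith)]; ring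

theorem mazurRadius_last : mazurRadius m n (3 / 2 + (m + n + 1) / (m + n + 1)) = 30 := by
  have hn' : (1 : ℝ) ≤ n := by exact_mod_cast hn
  rw [mazurRadius_snd hm hn (by linarith) (by linarith)]
  field_simp; ring

/-- The turn count is designed so that at radial position `u` it equals the number of turns made
since the pattern turned back at `u = m + 1/2`. The twist therefore cancels the backward winding
exactly. -/
theorem mazurTurns_strand {u : ℝ} (h : m + 1 / 2 ≤ u) (h' : u ≤ m + n + 1) :
    mazurTurns n (mazurRadius m n (3 / 2 + u / (m + n + 1))) = u - m - 1 / 2 := by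
  have hn' : (0 : ℝ) < n := by exact_mod_cast hn
  rcases le_total u (m + 1) with h1 | h1
  · rw [mazurRadius_mid hm hn (by linarith) h1, mazurTurns_mid n (by linarith) (by linarith)]; ring
  · rw [mazurRadius_snd hm hn h1 h', mazurTurns_right]
    · field_simp; ring
    · have : 0 ≤ 5 * (u - m - 1) / n := div_nonneg (by linarith) hn'.le
      linarith
    · have : 5 * (u - m - 1) / n ≤ 5 := by rw [div_le_iff₀ hn']; linarith
      linarith

theorem mazurRadius_strand_mem {a b u : ℝ} (hu : u ∈ Icc a b) :
    mazurRadius m n (3 / 2 + u / (m + n + 1)) ∈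
      Icc (mazurRadius m n (3 / 2 + a / (m + n + 1))) (mazurRadius m n (3 / 2 + b / (m + n + 1))) :=
  ⟨monotone_mazurRadius_strand hm hn hu.1, monotone_mazurRadius_strand hm hn hu.2⟩

/-- The straightening on the part of the curve that winds backwards. -/
theorem mazurStraight_backward :
    (fun u : ℝ => mazurStraight m n (0 / 2) (3 / 2 + u / (m + n + 1))
      (-(2 * Real.pi * (2 * m + 1 - u)))) '' Icc (m + 1 / 2) (m + n + 1) =
      segment ℝ (72, -24, 0) (48, -27, 0) ∪ segment ℝ (48, -27, 0) (24, -27, 0) := by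
  have hn' : (1 : ℝ) ≤ n := by exact_mod_cast hn
  have e : EqOn (fun u : ℝ => mazurStraight m n (0 / 2) (3 / 2 + u / (m + n + 1))
      (-(2 * Real.pi * (2 * m + 1 - u))))
      (fun u => (fun F : ℝ => ((264 - 8 * F, -(F + mazurShift (264 - 8 * F)), 0) : R3))
        (mazurRadius m n (3 / 2 + u / (m + n + 1)))) (Icc (m + 1 / 2) (m + n + 1)) := by
    intro u hu
    have h1 := mazurRadius_strand_mem hm hn hu
    rw [mazurRadius_half hm hn, mazurRadius_last hm hn] at h1
    simp only
    rw [mazurStraight_of_mem m n _ (by simp) rfl (by linarith [h1.1]) h1.2,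
      mazurTurns_strand hm hn hu.1 hu.2]
    -- The dependence on `u` cancels: the whole backward arc now lies at angle `-π`.
    have h2 : -(2 * Real.pi * (2 * m + 1 - u)) - 2 * Real.pi * (u - m - 1 / 2) =
      -Real.pi - m * (2 * Real.pi) := by ring
    have h3 : ∀ F : ℝ, 24 * 0 + 120 - 8 * (F - 18) = 264 - 8 * F := fun F => by ring
    rw [h2, cyl_sub_nat, h3]
    simp [cyl]
  rw [image_comp_Icc (fun F : ℝ => ((264 - 8 * F, -(F + mazurShift (264 - 8 * F)), 0) : R3))
    (continuous_mazurRadius_strand m n) (monotone_mazurRadius_strand hm hn) (by linarith) e,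
    mazurRadius_half hm hn, mazurRadius_last hm hn,
    image_Icc_union _ (show (24 : ℝ) ≤ 27 by norm_num) (by norm_num)]
  congr 1
  · refine image_Icc_eq_segment (by norm_num) fun F hF => ?_
    rw [mazurShift_mid (by linarith [hF.2]) (by linarith [hF.1])]
    ext <;> simp <;> ring
  · refine image_Icc_eq_segment (by norm_num) fun F hF => ?_
    rw [mazurShift_left (by linarith [hF.2]) (by linarith [hF.1])]
    ext <;> simp <;> ring

/-- The straightening on the part of the curve that passes under the backward strands. -/
theorem mazurStraight_under :
    (fun u : ℝ => mazurStraight m n (-1 / 2) (3 / 2 + u / (m + n + 1))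
      (-(2 * Real.pi * (m - n)))) '' Icc (m + 1 / 2) (m + n + 1) =
      mazurTurn 48 ∪ helix 0 40 24 Real.pi (2 * n) := by
  have hn' : (0 : ℝ) < n := by exact_mod_cast hn
  rw [image_Icc_union _ (show (m : ℝ) + 1 / 2 ≤ m + 1 by linarith) (by linarith)]
  congr 1
  · rw [mazurTurn]
    refine image_Icc_eq_image_unit (by linarith) fun u hu => ?_
    have hu1 : (m : ℝ) ≤ u := by linarith [hu.1]
    have hF := mazurRadius_mid hm hn hu1 hu.2
    rw [mazurStraight_of_mem m n _ (by simp) hF (by linarith [hu.1]) (by linarith [hu.2]),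
      mazurTurns_mid n (by linarith [hu.1]) (by linarith [hu.2]),
      mazurShift_left (by linarith [hu.2]) (by linarith [hu.1]), halfTurn_mazur,
      ← cyl_sub_nat _ _ (-_) m,
      ← cyl_add_nat _ _ (-(Real.pi * _) - _) n]
    congr 1 <;> ring
  · rw [helix, ← image_one_sub_unit]
    refine image_Icc_eq_image_unit (by linarith) fun u hu => ?_
    have h1 : 5 * (u - m - 1) / n ≤ 5 := by rw [div_le_iff₀ hn']; linarith [hu.2]
    have h0 : 0 ≤ 5 * (u - m - 1) / n := div_nonneg (by linarith [hu.1]) hn'.le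
    rw [mazurStraight_of_mem m n _ (by simp) (mazurRadius_snd hm hn hu.1 hu.2) (by linarith)
      (by linarith), mazurTurns_right n (by linarith) (by linarith),
      mazurShift_left (by linarith) (by linarith), helixPt_eq_cyl,
      -- The extra full turn accounts for the difference between the angle `-π` arising from the
      -- twist and the starting angle `π` of the helix.
      ← cyl_sub_nat _ _ (Real.pi + _) m, ← cyl_sub_nat _ _ (Real.pi + _ - _) 1]
    have : (m : ℝ) + n + 1 - (m + 1) = n := by ring
    rw [this]
    congr 1
    · field_simp; ring
    · field_simp; ring
    · field_simp; push_cast; ring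

/-- The straightening on the part of the curve that passes over the forward strands. -/
theorem mazurStraight_over :
    (fun u : ℝ => mazurStraight m n (1 / 2) (3 / 2 + u / (m + n + 1))
      (-(2 * Real.pi * (m - n)))) '' Icc 0 (m + 1 / 2) =
      segment ℝ (144, 24, 0) (120, 27, 0) ∪ segment ℝ (120, 27, 0) (96, 27, 0) := by
  have hm' : (1 : ℝ) ≤ m := by exact_mod_cast hm
  have e : EqOn (fun u : ℝ => mazurStraight m n (1 / 2) (3 / 2 + u / (m + n + 1))
      (-(2 * Real.pi * (m - n))))
      (fun u => (fun F : ℝ => ((288 - 8 * F, F + mazurShift (288 - 8 * F), 0) : R3))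
        (mazurRadius m n (3 / 2 + u / (m + n + 1)))) (Icc 0 (m + 1 / 2)) := by
    intro u hu
    have h1 := mazurRadius_strand_mem hm hn hu
    rw [mazurRadius_half hm hn, mazurRadius_zero hm hn] at h1
    simp only
    rw [mazurStraight_of_mem m n _ (by simp) rfl h1.1 (by linarith [h1.2]),
      mazurTurns_of_le n h1.2]
    have h2 : -(2 * Real.pi * (m - n)) - 2 * Real.pi * 0 =
      0 + n * (2 * Real.pi) - m * (2 * Real.pi) := by ring
    have h3 : ∀ F : ℝ, 24 * 1 + 120 - 8 * (F - 18) = 288 - 8 * F := fun F => by ring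
    rw [h2, cyl_sub_nat, cyl_add_nat, h3]
    simp [cyl]
  rw [image_comp_Icc (fun F : ℝ => ((288 - 8 * F, F + mazurShift (288 - 8 * F), 0) : R3))
    (continuous_mazurRadius_strand m n) (monotone_mazurRadius_strand hm hn) (by linarith) e,
    mazurRadius_half hm hn, mazurRadius_zero hm hn,
    image_Icc_union _ (show (18 : ℝ) ≤ 21 by norm_num) (by norm_num)]
  congr 1
  · refine image_Icc_eq_segment (by norm_num) fun F hF => ?_
    rw [mazurShift_of_ge (by linarith [hF.2])]
    ext <;> simp <;> ring
  · refine image_Icc_eq_segment (by norm_num) fun F hF => ?_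
    rw [mazurShift_right (by linarith [hF.2]) (by linarith [hF.1])]
    ext <;> simp <;> ring

/-- The straightening on the vertical segments of the curve. -/
theorem mazurStraight_top : (fun v : ℝ => mazurStraight m n (v / 2)
      (3 / 2 + (m + n + 1) / (m + n + 1)) (-(2 * Real.pi * (m - n)))) '' Icc (-1) 0 =
      segment ℝ (0, -24, 0) (24, -27, 0) := by
  refine image_Icc_eq_segment (by norm_num) fun v hv => ?_
  rw [mazurStraight_of_mem m n _ (abs_le.2 ⟨hv.1, by linarith [hv.2]⟩) (mazurRadius_last hm hn)
    (by norm_num) le_rfl, mazurTurns_right n (by norm_num) le_rfl,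
    mazurShift_left (by linarith [hv.1]) (by linarith [hv.2])]
  have h2 : -(2 * Real.pi * (m - n)) - 2 * Real.pi * (1 / 2 + n / 5 * (30 - 25)) =
    -Real.pi - m * (2 * Real.pi) := by ring
  rw [h2, cyl_sub_nat]
  ext <;> simp [cyl]
  all_goals ring

theorem mazurStraight_clasp : (fun v : ℝ => mazurStraight m n (v / 2)
      (3 / 2 + (m + 1 / 2) / (m + n + 1)) (-(2 * Real.pi * (m - n)))) '' Icc (-1) 1 =
      segment ℝ (48, 24, 0) (72, 24, 0) ∪ segment ℝ (72, 24, 0) (96, 27, 0) := by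
  have h2 : -(2 * Real.pi * (m - n)) - 2 * Real.pi * 0 =
    0 + n * (2 * Real.pi) - m * (2 * Real.pi) := by ring
  rw [image_Icc_union _ (show (-1 : ℝ) ≤ 0 by norm_num) (by norm_num)]
  congr 1
  · refine image_Icc_eq_segment (by norm_num) fun v hv => ?_
    rw [mazurStraight_of_mem m n _ (abs_le.2 ⟨hv.1, by linarith [hv.2]⟩) (mazurRadius_half hm hn)
      (by norm_num) (by norm_num), mazurTurns_of_le n le_rfl,
      mazurShift_mid (by linarith [hv.1]) (by linarith [hv.2]), h2, cyl_sub_nat, cyl_add_nat]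
    ext <;> simp [cyl]
    ring
  · refine image_Icc_eq_segment (by norm_num) fun v hv => ?_
    rw [mazurStraight_of_mem m n _ (abs_le.2 ⟨by linarith [hv.1], hv.2⟩) (mazurRadius_half hm hn)
      (by norm_num) (by norm_num), mazurTurns_of_le n le_rfl,
      mazurShift_right (by linarith [hv.1]) (by linarith [hv.2]), h2, cyl_sub_nat, cyl_add_nat]
    ext <;> simp [cyl] <;> ring

theorem mazurStraight_bottom : (fun v : ℝ => mazurStraight m n (v / 2)
      (3 / 2 + 0 / (m + n + 1)) (-(2 * Real.pi * (m - n)))) '' Icc 0 1 =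
      segment ℝ (120, 24, 0) (144, 24, 0) := by
  have h2 : -(2 * Real.pi * (m - n)) - 2 * Real.pi * 0 =
    0 + n * (2 * Real.pi) - m * (2 * Real.pi) := by ring
  refine image_Icc_eq_segment (by norm_num) fun v hv => ?_
  rw [mazurStraight_of_mem m n _ (abs_le.2 ⟨by linarith [hv.1], hv.2⟩) (mazurRadius_zero hm hn)
    le_rfl (by norm_num), mazurTurns_of_le n (by norm_num),
    mazurShift_of_ge (by linarith [hv.1]), h2, cyl_sub_nat, cyl_add_nat]
  ext <;> simp [cyl]
  all_goals ring

/-- Each of the seven edges of the path has one of its coordinates as parameter, and the preceding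
computations apply edge by edge. The forward edge and the edge below the backward strands carry the
two helices; the five others become straight. -/
theorem image_mazurStraight {T : R3 → R3}
    (hT : ∀ x r θ, 0 ≤ r → T (cyl x r θ) = mazurStraight m n x r θ) :
    T '' (mazurCurve m n '' mazurPath m n) = (helix 0 40 24 Real.pi (2 * n) ∪
      helix 80 40 24 0 (2 * m)) ∪ (mazurTurn 80 ∪ mazurTurn 48 ∪ paths mazurArcs) := by
  have hm' : (1 : ℝ) ≤ m := by exact_mod_cast hm
  have hn' : (1 : ℝ) ≤ n := by exact_mod_cast hn
  have seg : ∀ {a b : ℝ} {p q : R3} (f : ℝ → R3), a < b →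
      (∀ x ∈ Icc a b, 0 ≤ (f x).2.1 ∧ f x = p + ((x - a) / (b - a)) • (q - p)) →
      T '' (mazurCurve m n '' segment ℝ p q) = (fun x => mazurStraight m n ((f x).2.2 / 2)
        (3 / 2 + (f x).2.1 / (m + n + 1)) (-(2 * Real.pi * (f x).1))) '' Icc a b := by
    intro a b p q f hab h
    rw [← image_Icc_eq_segment hab fun x hx => (h x hx).2, image_image, image_image]
    refine image_congr fun x hx => ?_
    have := (h x hx).1
    rw [mazurCurve, hT _ _ _ (by positivity)]
  -- The backward edge and the edge below it span the radial length `n + 1/2`; a single name for it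
  -- keeps the denominators simple.
  obtain ⟨d, hd', hd0⟩ : ∃ d : ℝ, (n : ℝ) = d - 1 / 2 ∧ 0 < d := ⟨n + 1 / 2, by ring, by linarith⟩
  have hd : (m : ℝ) + n + 1 - (m + 1 / 2) = d := by rw [hd']; ring
  have e1 := seg (a := 0) (b := m + 1 / 2) (p := (0, 0, 0)) (q := (m + 1 / 2, m + 1 / 2, 0))
    (fun u => (u, u, 0)) (by linarith) fun u hu => ⟨hu.1, by ext <;> simp <;> field_simp⟩
  have e2 := seg (a := m + 1 / 2) (b := m + n + 1) (p := (m + 1 / 2, m + 1 / 2, 0))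
    (q := (m - n, m + n + 1, 0)) (fun u => (2 * m + 1 - u, u, 0)) (by linarith) fun u hu =>
    ⟨by linarith [hu.1], by
      rw [hd]
      ext <;> simp [hd'] <;> field_simp <;> ring⟩
  have e3 := seg (a := -1) (b := 0) (p := (m - n, m + n + 1, -1)) (q := (m - n, m + n + 1, 0))
    (fun v => (m - n, m + n + 1, v)) (by norm_num) fun v hv => ⟨by simp only; linarith, by ext <;> simp⟩
  have e4 := seg (a := m + 1 / 2) (b := m + n + 1) (p := (m - n, m + 1 / 2, -1))
    (q := (m - n, m + n + 1, -1)) (fun u => (m - n, u, -1)) (by linarith) fun u hu =>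
    ⟨by linarith [hu.1], by
      rw [hd]
      ext <;> simp [hd']
      field_simp; ring⟩
  have e5 := seg (a := -1) (b := 1) (p := (m - n, m + 1 / 2, -1)) (q := (m - n, m + 1 / 2, 1))
    (fun v => (m - n, m + 1 / 2, v)) (by norm_num) fun v hv => ⟨by simp only; linarith, by
      ext <;> simp⟩
  have e6 := seg (a := 0) (b := m + 1 / 2) (p := (m - n, 0, 1)) (q := (m - n, m + 1 / 2, 1))
    (fun u => (m - n, u, 1)) (by linarith) fun u hu => ⟨hu.1, by ext <;> simp; field_simp⟩
  have e7 := seg (a := 0) (b := 1) (p := (m - n, 0, 0)) (q := (m - n, 0, 1))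
    (fun v => (m - n, 0, v)) (by norm_num) fun v hv => ⟨le_rfl, by ext <;> simp⟩
  simp only at e1 e2 e3 e4 e5 e6 e7
  rw [mazurStraight_forward hm hn] at e1
  rw [mazurStraight_backward hm hn] at e2
  rw [mazurStraight_top hm hn, segment_symm, segment_symm ℝ (0, -24, 0)] at e3
  rw [mazurStraight_under hm hn, segment_symm] at e4
  rw [mazurStraight_clasp hm hn] at e5
  rw [mazurStraight_over hm hn, segment_symm] at e6
  rw [mazurStraight_bottom hm hn, segment_symm, segment_symm ℝ (120, 24, 0)] at e7
  simp only [mazurPath, polygonalPath, image_union, union_empty, e1, e2, e3, e4, e5, e6,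
    e7]
  simp only [mazurArcs, paths_cons, paths_nil, polygonalPath, ZPt.toR, List.map_cons, List.map_nil]
  norm_num
  rw [segment_symm ℝ ((96, 27, 0) : R3), segment_symm ℝ ((120, 27, 0) : R3) (144, 24, 0)]
  ext p
  simp only [mem_union]
  tauto

end

/-! ### The meridian after straightening -/

section
variable {m n : ℕ} (hm : 1 ≤ m) (hn : 1 ≤ n)
include hm hn

/-- At radius `40` the twist is zero and the axial shear is constant, so only the radial shift acts.
Its kinks at `0, 48, 72, 120` produce the five segments. -/
theorem mazurStraight_topEdge : (fun x : ℝ => mazurStraight m n x (13 / 5) (Real.pi / 2)) ''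
      Icc (-(4 / 5)) (4 / 5) = segment ℝ (-144, 0, 34) (0, 0, 34) ∪ (segment ℝ (0, 0, 34) (48, 0, 40) ∪
        (segment ℝ (48, 0, 40) (72, 0, 40) ∪ (segment ℝ (72, 0, 40) (120, 0, 46) ∪
          segment ℝ (120, 0, 46) (192, 0, 46)))) := by
  have e : (fun x : ℝ => mazurStraight m n x (13 / 5) (Real.pi / 2)) =
      fun x => (fun X : ℝ => ((X, 0, 40 + mazurShift X) : R3)) (48 * x + mazurStretch (48 * x) + 24) := by
    ext1 x
    simp only [mazurStraight, mazurRadius_outer hm hn, mazurTurns_outer, mul_zero, zero_mul, sub_zero,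
      cyl_quarter, clamp_of_ge (show (18 : ℝ) ≤ 30 by norm_num) (show (30 : ℝ) ≤ 40 by norm_num),
      max_eq_left (show (18 : ℝ) ≤ 40 by norm_num)]
    norm_num
    ring
  have hc : Continuous fun x : ℝ => 48 * x + mazurStretch (48 * x) + 24 := by
    unfold mazurStretch; fun_prop
  have hmono : Monotone fun x : ℝ => 48 * x + mazurStretch (48 * x) + 24 := by
    intro x y h
    have := monotone_mazurStretch (show 48 * x ≤ 48 * y by linarith)
    simp only; linarith
  rw [image_comp_Icc (fun X : ℝ => ((X, 0, 40 + mazurShift X) : R3)) hc hmono (by norm_num)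
      fun x _ => congrFun e x,
    mazurStretch_left (by norm_num) (by norm_num), mazurStretch_right (by norm_num) (by norm_num),
    show (48 * -(4 / 5) + (4 * (48 * -(4 / 5)) + 24) + 24 : ℝ) = -144 by norm_num,
    show (48 * (4 / 5) + (4 * (48 * (4 / 5)) - 24) + 24 : ℝ) = 192 by norm_num,
    image_Icc_union _ (show (-144 : ℝ) ≤ 0 by norm_num) (by norm_num),
    image_Icc_union _ (show (0 : ℝ) ≤ 48 by norm_num) (by norm_num),
    image_Icc_union _ (show (48 : ℝ) ≤ 72 by norm_num) (by norm_num),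
    image_Icc_union _ (show (72 : ℝ) ≤ 120 by norm_num) (by norm_num)]
  have seg : ∀ {a b u v : ℝ}, a < b → (∀ x ∈ Icc a b, mazurShift x = u + (x - a) / (b - a) * (v - u)) →
      (fun X : ℝ => ((X, 0, 40 + mazurShift X) : R3)) '' Icc a b =
        segment ℝ (a, 0, 40 + u) (b, 0, 40 + v) := by
    intro a b u v hab h
    refine image_Icc_eq_segment hab fun x hx => ?_
    have : b - a ≠ 0 := (sub_pos.2 hab).ne'
    rw [h x hx]
    ext <;> simp <;> (try field_simp) <;> ring
  rw [seg (a := -144) (b := 0) (u := -6) (v := -6), seg (a := 0) (b := 48) (u := -6) (v := 0),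
    seg (a := 48) (b := 72) (u := 0) (v := 0), seg (a := 72) (b := 120) (u := 0) (v := 6),
    seg (a := 120) (b := 192) (u := 6) (v := 6)]
  · norm_num
  all_goals (try norm_num)
  · intro x h h'; exact mazurShift_of_ge h
  · intro x h h'; rw [mazurShift_right h h']; ring
  · intro x h h'; exact mazurShift_mid h h'
  · intro x h h'; rw [mazurShift_left h h']; ring
  · intro x h h'; exact mazurShift_of_le h'

/-- The legs lie at axial distance at least `48` before the shear, where the twist is switched off,
and the shift is constant along them. The only kinks come from the shear, at radii `18` and `30`. -/
theorem mazurStraight_sideEdge {x X a b : ℝ} (hx : 48 * x + mazurStretch (48 * x) + 120 = X)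
    (hX : 48 ≤ |X - 120|) (ha : ∀ y ∈ Icc (X - 96) X, mazurShift y = a) (hb : X - 96 = b) :
    (fun r : ℝ => mazurStraight m n x r (Real.pi / 2)) '' Icc (7 / 5) (13 / 5) =
      segment ℝ (X, 0, 12 + 2 / 3 * a) (X, 0, 18 + a) ∪ (segment ℝ (X, 0, 18 + a) (b, 0, 30 + a) ∪
        segment ℝ (b, 0, 30 + a) (b, 0, 40 + a)) := by
  have h1 : 2 - |X - 120| / 24 ≤ 0 := by linarith
  have h2 : 48 * x + mazurStretch (48 * x) = X - 120 := by linarith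
  have e : (fun r : ℝ => mazurStraight m n x r (Real.pi / 2)) = fun r =>
      (fun F : ℝ => ((X - 8 * (clamp 18 30 F - 18), 0, F * (1 + a / max F 18)) : R3))
        (mazurRadius m n r) := by
    ext1 r
    have h3 := clamp_mem (show (18 : ℝ) ≤ 30 by norm_num) (mazurRadius m n r)
    have h4 : X - 120 + (120 - 8 * (clamp 18 30 (mazurRadius m n r) - 18)) =
      X - 8 * (clamp 18 30 (mazurRadius m n r) - 18) := by ring
    simp only [mazurStraight, h2, clamp_of_le h1, mul_zero, sub_zero, cyl_quarter, h4]
    rw [ha _ ⟨by linarith [h3.2], by linarith [h3.1]⟩]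
  rw [image_comp_Icc (fun F : ℝ => ((X - 8 * (clamp 18 30 F - 18), 0, F * (1 + a / max F 18)) : R3))
      (continuous_mazurRadius m n) (strictMono_mazurRadius hm hn).monotone (by norm_num)
      fun x _ => congrFun e x,
    mazurRadius_inner hm hn (by norm_num) le_rfl, mazurRadius_outer hm hn,
    show (60 / 7 * (7 / 5) : ℝ) = 12 by norm_num,
    image_Icc_union _ (show (12 : ℝ) ≤ 18 by norm_num) (by norm_num),
    image_Icc_union _ (show (18 : ℝ) ≤ 30 by norm_num) (by norm_num)]
  congr 1
  · refine image_Icc_eq_segment (by norm_num) fun F hF => ?_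
    rw [clamp_of_le hF.2, max_eq_right hF.2]
    ext <;> simp
    ring
  congr 1
  · refine image_Icc_eq_segment (by norm_num) fun F hF => ?_
    rw [clamp_of_mem hF, max_eq_left hF.1, ← hb]
    have : F ≠ 0 := by linarith [hF.1]
    ext <;> simp
    · ring
    · field_simp; ring
  · refine image_Icc_eq_segment (by norm_num) fun F hF => ?_
    have : F ≠ 0 := by linarith [hF.1]
    rw [clamp_of_ge (by norm_num) hF.1, max_eq_left (by linarith [hF.1]), ← hb]
    ext <;> simp
    · ring
    · field_simp; ring

/-- The part on the axis has radius zero and feels only the axial maps. The two short legs stay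
within radius `12`, where radius map and radial factor are linear and the stretch is affine, so
their images are segments. -/
theorem mazurStraight_bottomEdge :
    (fun x : ℝ => mazurStraight m n x (14 * max 0 (|x| - 7 / 10)) (Real.pi / 2)) ''
      Icc (-(4 / 5)) (4 / 5) = segment ℝ (-48, 0, 8) (-24, 0, 0) ∪
        (segment ℝ (-24, 0, 0) (264, 0, 0) ∪ segment ℝ (264, 0, 0) (288, 0, 16)) := by
  rw [image_Icc_union _ (show -(4 / 5 : ℝ) ≤ -(7 / 10) by norm_num) (by norm_num),
    image_Icc_union _ (show -(7 / 10 : ℝ) ≤ 7 / 10 by norm_num) (by norm_num)]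
  congr 1
  · refine image_Icc_eq_segment (by norm_num) fun x hx => ?_
    have h1 : 14 * max 0 (|x| - 7 / 10) = 14 * (-x - 7 / 10) := by
      rw [abs_of_nonpos (by linarith [hx.2]), max_eq_right (by linarith [hx.2])]
    have h2 : 48 * x + mazurStretch (48 * x) = 240 * x + 24 := by
      rw [mazurStretch_left (by linarith [hx.1]) (by linarith [hx.2])]; ring
    have h3 : 2 - |240 * x + 24| / 24 ≤ 0 := by
      rw [abs_of_nonpos (by linarith [hx.2])]; linarith [hx.2]
    have h4 := mazurRadius_inner hm hn (r := 14 * (-x - 7 / 10)) (by linarith [hx.2]) (by linarith [hx.1])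
    simp only [mazurStraight, h1, h2, h4, clamp_of_le h3, mul_zero, sub_zero, cyl_quarter]
    rw [clamp_of_le (by linarith [hx.1]), max_eq_right (by linarith [hx.1]),
      mazurShift_of_le (by linarith [hx.2])]
    ext <;> simp <;> ring
  congr 1
  · have e : EqOn (fun x : ℝ => mazurStraight m n x (14 * max 0 (|x| - 7 / 10)) (Real.pi / 2))
        (fun x => (fun X : ℝ => ((X, 0, 0) : R3)) (48 * x + mazurStretch (48 * x) + 120))
        (Icc (-(7 / 10)) (7 / 10)) := by
      intro x hx
      have h1 : max 0 (|x| - 7 / 10) = 0 := max_eq_left (by linarith [abs_le.2 hx])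
      have h4 := mazurRadius_inner hm hn (le_refl 0) (by norm_num)
      rw [mul_zero] at h4
      simp only [mazurStraight, h1, mul_zero, h4, clamp_of_le (show (0 : ℝ) ≤ 18 by norm_num), zero_mul]
      simp [cyl]
    have hc : Continuous fun x : ℝ => 48 * x + mazurStretch (48 * x) + 120 := by
      unfold mazurStretch; fun_prop
    have hmono : Monotone fun x : ℝ => 48 * x + mazurStretch (48 * x) + 120 := by
      intro x y h
      have := monotone_mazurStretch (show 48 * x ≤ 48 * y by linarith)
      simp only; linarith
    rw [image_comp_Icc (fun X : ℝ => ((X, 0, 0) : R3)) hc hmono (by norm_num) e,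
      mazurStretch_left (by norm_num) (by norm_num), mazurStretch_right (by norm_num) (by norm_num)]
    refine image_Icc_eq_segment (by norm_num) fun x hx => ?_
    ext <;> simp
    norm_num
  · refine image_Icc_eq_segment (by norm_num) fun x hx => ?_
    have h1 : 14 * max 0 (|x| - 7 / 10) = 14 * (x - 7 / 10) := by
      rw [abs_of_nonneg (by linarith [hx.1]), max_eq_right (by linarith [hx.1])]
    have h2 : 48 * x + mazurStretch (48 * x) = 240 * x - 24 := by
      rw [mazurStretch_right (by linarith [hx.1]) (by linarith [hx.2])]; ring
    have h3 : 2 - |240 * x - 24| / 24 ≤ 0 := by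
      rw [abs_of_nonneg (by linarith [hx.1])]; linarith [hx.1]
    have h4 := mazurRadius_inner hm hn (r := 14 * (x - 7 / 10)) (by linarith [hx.1]) (by linarith [hx.2])
    simp only [mazurStraight, h1, h2, h4, clamp_of_le h3, mul_zero, sub_zero, cyl_quarter]
    rw [clamp_of_le (by linarith [hx.2]), max_eq_right (by linarith [hx.2]),
      mazurShift_of_ge (by linarith [hx.1])]
    ext <;> simp <;> ring

theorem image_meridian {T : R3 → R3}
    (hT : ∀ x r θ, 0 ≤ r → T (cyl x r θ) = mazurStraight m n x r θ) :
    T '' (topEdge ∪ sideEdge 1 ∪ sideEdge (-1) ∪ bottomEdge) = paths mazurMeridian := by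
  have hT' : ∀ x r : ℝ, 0 ≤ r → T (x, 0, r) = mazurStraight m n x r (Real.pi / 2) := by
    intro x r hr
    rw [← cyl_quarter, hT _ _ _ hr]
  have e1 : T '' topEdge = (fun x : ℝ => mazurStraight m n x (13 / 5) (Real.pi / 2)) ''
      Icc (-(4 / 5)) (4 / 5) := by
    rw [topEdge, image_image]
    exact image_congr fun x _ => hT' x _ (by norm_num)
  have e2 : ∀ ε, T '' sideEdge ε =
      (fun r : ℝ => mazurStraight m n (ε * (4 / 5)) r (Real.pi / 2)) '' Icc (7 / 5) (13 / 5) := by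
    intro ε
    rw [sideEdge, image_image]
    exact image_congr fun r hr => hT' _ r (by linarith [hr.1])
  have e3 : T '' bottomEdge = (fun x : ℝ => mazurStraight m n x (14 * max 0 (|x| - 7 / 10))
      (Real.pi / 2)) '' Icc (-(4 / 5)) (4 / 5) := by
    rw [bottomEdge, image_image]
    exact image_congr fun x _ => hT' x _ (mul_nonneg (by norm_num) (le_max_left _ _))
  rw [image_union, image_union, image_union, e1, e2, e2, e3, mazurStraight_topEdge hm hn,
    mazurStraight_bottomEdge hm hn,
    mazurStraight_sideEdge hm hn (X := 288) (a := 6) (b := 192)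
      (by rw [mazurStretch_right (by norm_num) (by norm_num)]; norm_num) (by norm_num [abs_of_pos])
      (fun y hy => mazurShift_of_ge (by linarith [hy.1])) (by norm_num),
    mazurStraight_sideEdge hm hn (X := -48) (a := -6) (b := -144)
      (by rw [mazurStretch_left (by norm_num) (by norm_num)]; norm_num)
      (by rw [abs_of_nonpos (by norm_num)]; norm_num)
      (fun y hy => mazurShift_of_le (by linarith [hy.2])) (by norm_num)]
  simp only [mazurMeridian, paths_cons, paths_nil, polygonalPath, ZPt.toR, List.map_cons, List.map_nil]
  norm_num
  rw [segment_symm ℝ ((192, 0, 46) : R3) (120, 0, 46), segment_symm ℝ ((120, 0, 46) : R3) (72, 0, 40),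
    segment_symm ℝ ((72, 0, 40) : R3) (48, 0, 40), segment_symm ℝ ((48, 0, 40) : R3) (0, 0, 34),
    segment_symm ℝ ((0, 0, 34) : R3) (-144, 0, 34), segment_symm ℝ ((-144, 0, 34) : R3) (-144, 0, 24),
    segment_symm ℝ ((-144, 0, 24) : R3) (-48, 0, 12), segment_symm ℝ ((-48, 0, 12) : R3) (-48, 0, 8)]
  ext p
  simp only [mem_union]
  tauto

end

/-! ### From the straightened Mazur link to the common model -/

/-- The polygonal part of the Mazur link after straightening. -/
def mazurFrame : List (List ZPt) :=
  [[(80, 24, 0), (76, 0, -24), (72, -24, 0), (48, -27, 0), (24, -27, 0), (0, -24, 0)], [(40, -24,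
  0), (44, 0, -24), (48, 24, 0), (72, 24, 0), (96, 27, 0), (120, 27, 0), (144, 24, 0), (120, 24,
  0)], [(-24, 0, 0), (264, 0, 0), (288, 0, 16), (288, 0, 24), (192, 0, 36), (192, 0, 46), (120,
  0, 46), (72, 0, 40), (48, 0, 40), (0, 0, 34), (-144, 0, 34), (-144, 0, 24), (-48, 0, 12), (-48,
  0, 8), (-24, 0, 0)]]

/-- Moves to the common model. -/
def mazurMoves : List ℤ :=
  [1, -24, 0, 0, 0, 0, 0, 264, 0, 0, 1, 0, 0, 0, 40, 0, 0, 264, 0, 0, 1, 40, 0, 0, 80, 0, 0, 264,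
  0, 0, 1, 80, 0, 0, 120, 0, 0, 264, 0, 0, 0, 76, 0, -24, 72, -24, 0, 48, -27, 0, 0, 48, -27, 0,
  24, -27, 0, 0, -24, 0, 0, 44, 0, -24, 48, 24, 0, 72, 24, 0, 0, 72, 24, 0, 96, 27, 0, 120, 27,
  0, 0, 120, 27, 0, 144, 24, 0, 120, 24, 0, 0, -48, 0, 8, -24, 0, 0, 0, 0, 0, 0, 120, 0, 0, 264,
  0, 0, 288, 0, 16, 0, 120, 0, 0, 288, 0, 16, 288, 0, 24, 0, 120, 0, 0, 288, 0, 24, 192, 0, 36,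
  0, 120, 0, 0, 192, 0, 36, 192, 0, 46, 0, 192, 0, 46, 120, 0, 46, 72, 0, 40, 0, 192, 0, 46, 72,
  0, 40, 48, 0, 40, 0, 192, 0, 46, 48, 0, 40, 0, 0, 34, 0, 192, 0, 46, 0, 0, 34, -144, 0, 34, 0,
  192, 0, 46, -144, 0, 34, -144, 0, 24, 0, -144, 0, 24, -48, 0, 12, -48, 0, 8, 0, -144, 0, 24,
  -48, 0, 8, 0, 0, 0]
theorem checkMoves_mazur : checkMoves helixBoxes mazurMoves mazurFrame commonFrame = true := by
  decide +kernel

/-- The half turn dips below the plane `z = 0`, so it can be made polygonal if everything else over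
its interval lies in or above that plane. -/
theorem isotopic_mazurTurn {x : ℝ} {K : Set R3}
    (hK : ∀ q ∈ K, x - 8 ≤ q.1 → q.1 ≤ x → 0 ≤ q.2.2) :
    AmbientIsotopic (K ∪ mazurTurn x) (K ∪ (segment ℝ (x, 24, 0) (x - 4, 0, -24) ∪
      segment ℝ (x - 4, 0, -24) (x - 8, -24, 0))) := by
  have := isotopic_halfTurn (lam := dotL (-1, 0, 0)) (ℓ := dotL (0, 0, -1)) (A := (x, 0, 0))
    (U := (0, -24, 0)) (V := (0, 0, -24)) (W := (-8, 0, 0)) (K := K) (by simp) (by simp) (by simp)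
    (by simp) (by simp) (by simp) (fun q hq h h' => by
      simp at h h' ⊢
      exact hK q hq (by linarith) (by linarith))
  norm_num at this
  rwa [show x + -4 = x - 4 by ring, show x + -8 = x - 8 by ring] at this

theorem helix_start {x₀ w r φ k : ℝ} (hw : 0 < w) {p : R3} (hp : p ∈ helix x₀ w r φ k)
    (h : p.1 ≤ x₀) : p = helixPt x₀ w r φ k 0 := by
  obtain ⟨s, hs, rfl⟩ := hp
  have h1 : w * s ≤ 0 := by simpa [helixPt] using h
  rw [show s = 0 by nlinarith [hs.1]]

theorem helix_end {x₀ w r φ k : ℝ} (hw : 0 < w) {p : R3} (hp : p ∈ helix x₀ w r φ k)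
    (h : x₀ + w ≤ p.1) : p = helixPt x₀ w r φ k 1 := by
  obtain ⟨s, hs, rfl⟩ := hp
  have h1 : w ≤ w * s := by simpa [helixPt] using h
  rw [show s = 1 by nlinarith [hs.2]]

theorem paths_mazurFrame : paths mazurFrame = segment ℝ (80, 24, 0) (80 - 4, 0, -24) ∪
    segment ℝ (80 - 4, 0, -24) (80 - 8, -24, 0) ∪ (segment ℝ (48, 24, 0) (48 - 4, 0, -24) ∪
      segment ℝ (48 - 4, 0, -24) (48 - 8, -24, 0)) ∪ paths mazurArcs ∪ paths mazurMeridian := by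
  have e : mazurFrame = mazurFrame.take 2 ++ mazurMeridian := rfl
  rw [e, paths_append]
  congr 1
  simp only [mazurFrame, mazurArcs, paths_cons, paths_nil, polygonalPath, ZPt.toR,
    List.map_cons, List.map_nil, List.take_succ_cons, List.take_zero]
  norm_num
  rw [segment_symm ℝ ((40, -24, 0) : R3), segment_symm ℝ ((44, 0, -24) : R3) (48, 24, 0)]
  ext p
  simp only [mem_union]
  tauto

theorem mazurArcs_nonneg : ∀ q ∈ paths mazurArcs ∪ paths mazurMeridian, 0 ≤ q.2.2 := by
  rw [← paths_append]
  exact forall_mem_paths (ok := fun e => decide (0 ≤ e.1.2.2 ∧ 0 ≤ e.2.2.2)) (by decide +kernel)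
    fun e he p hp => by
      rw [decide_eq_true_eq] at he
      exact_mod_cast (coord_of_mem_carrier hp).2.2.2.2.2 0 he.1 he.2

/-- The two half turns lie over the disjoint intervals `[72, 80]` and `[40, 48]`, so neither
obstructs the other, and the arcs and the meridian have nonnegative height. -/
theorem isotopic_mazurFrame {H : Set R3} (hH : ∀ q ∈ H, 40 ≤ q.1 → q.1 ≤ 80 → 0 ≤ q.2.2) :
    AmbientIsotopic (H ∪ (mazurTurn 80 ∪ mazurTurn 48 ∪ paths mazurArcs) ∪ paths mazurMeridian)
      (H ∪ paths mazurFrame) := by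
  have hP := mazurArcs_nonneg
  rw [paths_mazurFrame]
  set S : Set R3 := segment ℝ (80, 24, 0) (80 - 4, 0, -24) ∪ segment ℝ (80 - 4, 0, -24) (80 - 8, -24, 0)
    with hS
  have hSx : S ⊆ {p | 72 ≤ p.1} := by
    have hc : Convex ℝ {p : R3 | 72 ≤ p.1} :=
      (convex_Ici (72 : ℝ)).is_linear_preimage (LinearMap.fst ℝ ℝ (ℝ × ℝ)).isLinear
    exact union_subset (hc.segment_subset (by norm_num) (by norm_num))
      (hc.segment_subset (by norm_num) (by norm_num))
  have e1 : H ∪ (mazurTurn 80 ∪ mazurTurn 48 ∪ paths mazurArcs) ∪ paths mazurMeridian =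
      H ∪ mazurTurn 48 ∪ (paths mazurArcs ∪ paths mazurMeridian) ∪ mazurTurn 80 := by
    ext p; simp only [mem_union]; tauto
  have e2 : H ∪ mazurTurn 48 ∪ (paths mazurArcs ∪ paths mazurMeridian) ∪ S =
      H ∪ (paths mazurArcs ∪ paths mazurMeridian) ∪ S ∪ mazurTurn 48 := by
    ext p; simp only [mem_union]; tauto
  rw [e1]
  refine (isotopic_mazurTurn ?_).trans ?_
  · rintro q ((hq | ⟨s, hs, rfl⟩) | hq) h h'
    · exact hH q hq (by linarith) h'
    · rw [halfTurn_mazur] at h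
      simp only [cyl] at h
      linarith [hs.1]
    · exact hP q hq
  rw [← hS, e2]
  refine (isotopic_mazurTurn ?_).trans (.of_eq ?_)
  · rintro q ((hq | hq) | hq) h h'
    · exact hH q hq (by linarith) (by linarith)
    · exact hP q hq
    · linarith [show 72 ≤ q.1 from hSx hq]
  · generalize segment ℝ ((48, 24, 0) : R3) (48 - 4, 0, -24) ∪
      segment ℝ (48 - 4, 0, -24) (48 - 8, -24, 0) = S'
    ext p; simp only [mem_union]; tauto

theorem image_mazurCurve_bounds (m n : ℕ) : ∀ q ∈ mazurCurve m n '' mazurPath m n,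
    |q.1| ≤ 1 / 2 ∧ 3 / 2 ≤ rad q ∧ rad q ≤ 5 / 2 := by
  rintro _ ⟨c, hc, rfl⟩
  obtain ⟨⟨h1, h2⟩, h3, h4⟩ := mazurPath_bounds m n hc
  have hN : (0 : ℝ) < m + n + 1 := by positivity
  have h5 : 0 ≤ c.2.1 / ((m : ℝ) + n + 1) := by positivity
  have h6 : c.2.1 / ((m : ℝ) + n + 1) ≤ 1 := by rwa [div_le_one hN]
  rw [mazurCurve, rad_cyl (by linarith)]
  refine ⟨?_, by linarith, by linarith⟩
  simp only [cyl, abs_le]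
  constructor <;> linarith

theorem isotopic_patternMeridianLink_commonModel {m n : ℕ} (hm : 1 ≤ m) (hn : 1 ≤ n) :
    AmbientIsotopic (patternMeridianLink (generalizedMazurPattern m n)) (commonModel m n) := by
  refine (isotopic_cycle _).trans ?_
  rw [cycle_patternMeridianLink]
  refine (isotopic_meridianCircle (image_mazurCurve_bounds m n)).trans ?_
  obtain ⟨T, hT, hT'⟩ := exists_isotopic_mazurStraight hm hn (mazurCurve m n '' mazurPath m n ∪
    (topEdge ∪ sideEdge 1 ∪ sideEdge (-1) ∪ bottomEdge))
  refine hT.trans ?_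
  rw [image_union, image_mazurStraight hm hn hT', image_meridian hm hn hT']
  refine (isotopic_mazurFrame ?_).trans
    (isotopic_of_checkMoves (helices_subset_boxes _ _ _ _) checkMoves_mazur)
  -- Over `40 ≤ x ≤ 80` the helices contribute only their end points, which have height zero.
  rintro q (hq | hq) h h'
  · rw [helix_end (by norm_num) hq (by linarith)]
    simp only [helixPt, mul_one]
    rw [show Real.pi + Real.pi * (2 * n) = Real.pi + n * (2 * Real.pi) by ring,
      Real.sin_add_nat_mul_two_pi, Real.sin_pi, mul_zero]
  · rw [helix_start (by norm_num) hq h']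
    simp [helixPt]

/-! ### From Schubert's normal form to a pair of helices -/

/-- A compact set that misses the region swept. -/
theorem clear_of_compact {lam : R3 →L[ℝ] ℝ} {l r : ℝ} {σ τ : ℝ → R3} {K : Set R3}
    (hσ : Continuous σ) (hτ : Continuous τ) (hK : IsCompact K)
    (h : ∀ q ∈ K, lam q ∈ Icc l r → ∀ t ∈ Icc (0 : ℝ) 1,
      q ≠ σ (lam q) + t • (τ (lam q) - σ (lam q))) : Clear lam l r σ τ K := by
  obtain ⟨B, hB⟩ := isCompact_Icc.exists_bound_of_continuousOn (s := Icc l r) (hτ.sub hσ).continuousOn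
  set C : Set (R3 × ℝ) := (K ∩ lam ⁻¹' Icc l r) ×ˢ Icc (0 : ℝ) 1
  have hC : IsCompact C := (hK.inter_right (isClosed_Icc.preimage lam.continuous)).prod isCompact_Icc
  rcases C.eq_empty_or_nonempty with h0 | h0
  · refine clear_of_dist one_pos hB fun q hq hx t ht => absurd (show (q, t) ∈ C from ⟨⟨hq, hx⟩, ht⟩) ?_
    simp [h0]
  · obtain ⟨p, hp, hmin⟩ := hC.exists_isMinOn h0
      (f := fun p => ‖p.1 - (σ (lam p.1) + p.2 • (τ (lam p.1) - σ (lam p.1)))‖) (by fun_prop)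
    refine clear_of_dist (norm_pos_iff.2 (sub_ne_zero.2 (h p.1 hp.1.1 hp.1.2 p.2 hp.2))) hB
      fun q hq hx t ht => hmin (show (q, t) ∈ C from ⟨⟨hq, hx⟩, ht⟩)

theorem isCompact_polygonalPath : ∀ L : List R3, IsCompact (polygonalPath L)
  | [] => isCompact_empty
  | [_] => isCompact_empty
  | a :: b :: l => by
    have h : IsCompact (segment ℝ a b) := by
      rw [← image_edgePath]
      exact isCompact_Icc.image (by unfold edgePath; fun_prop)
    exact h.union (isCompact_polygonalPath (b :: l))

theorem isCompact_paths (P : List (List ZPt)) : IsCompact (paths P) := by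
  induction P with
  | nil => rw [paths_nil]; exact isCompact_empty
  | cons l P ih => rw [paths_cons]; exact (isCompact_polygonalPath _).union ih

/-! ### Chebyshev functions -/

/-- The Chebyshev polynomials of the first kind on `[-1, 1]`, extended by constants. -/
noncomputable def cosMul (k : ℕ) (c : ℝ) : ℝ := Real.cos (k * Real.arccos c)

/-- The companion of `cosMul` on the unit circle. -/
noncomputable def sinMul (k : ℕ) (c : ℝ) : ℝ := Real.sin (k * Real.arccos c)

@[fun_prop] theorem continuous_cosMul (k : ℕ) : Continuous (cosMul k) := by
  unfold cosMul; exact Real.continuous_cos.comp (continuous_const.mul Real.continuous_arccos)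

@[fun_prop] theorem continuous_sinMul (k : ℕ) : Continuous (sinMul k) := by
  unfold sinMul; exact Real.continuous_sin.comp (continuous_const.mul Real.continuous_arccos)

theorem cosMul_sq_add_sinMul_sq (k : ℕ) (c : ℝ) : cosMul k c ^ 2 + sinMul k c ^ 2 = 1 :=
  Real.cos_sq_add_sin_sq _

theorem cosMul_of_ge (k : ℕ) {c : ℝ} (h : 1 ≤ c) : cosMul k c = 1 := by
  simp [cosMul, Real.arccos_of_one_le h]

theorem sinMul_of_ge (k : ℕ) {c : ℝ} (h : 1 ≤ c) : sinMul k c = 0 := by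
  simp [sinMul, Real.arccos_of_one_le h]

theorem cosMul_of_le {k : ℕ} (hk : Odd k) {c : ℝ} (h : c ≤ -1) : cosMul k c = -1 := by
  rw [cosMul, Real.arccos_of_le_neg_one h, Real.cos_nat_mul_pi, hk.neg_one_pow]

theorem sinMul_of_le (k : ℕ) {c : ℝ} (h : c ≤ -1) : sinMul k c = 0 := by
  rw [sinMul, Real.arccos_of_le_neg_one h, Real.sin_nat_mul_pi]

theorem cosMul_one {c : ℝ} (h : c ∈ Icc (-1 : ℝ) 1) : cosMul 1 c = c := by
  rw [cosMul, Nat.cast_one, one_mul, Real.cos_arccos h.1 h.2]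

theorem sinMul_one_nonneg (c : ℝ) : 0 ≤ sinMul 1 c := by
  rw [sinMul, Nat.cast_one, one_mul]
  exact Real.sin_nonneg_of_nonneg_of_le_pi (Real.arccos_nonneg c) (Real.arccos_le_pi c)

theorem sinMul_one_le (c : ℝ) : sinMul 1 c ≤ 1 := Real.sin_le_one _

/-- The first sine vanishes only at or beyond `c = ±1`, where the arccosine is a multiple of `π`. -/
theorem sinMul_eq_zero (k : ℕ) {c : ℝ} (h : sinMul 1 c = 0) : sinMul k c = 0 := by
  have h1 : c ^ 2 ≥ 1 := by
    by_contra! h2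
    have h3 : c ∈ Icc (-1 : ℝ) 1 := abs_le.1 (by nlinarith [sq_abs c, abs_nonneg c])
    have := cosMul_sq_add_sinMul_sq 1 c
    rw [h, cosMul_one h3] at this
    linarith
  rcases le_total 0 c with h0 | h0
  · exact sinMul_of_ge k (by nlinarith)
  · exact sinMul_of_le k (by nlinarith)

/-- The Chebyshev polynomials of the second kind. -/
noncomputable def chebyshevU (k : ℕ) (c : ℝ) : ℝ := (Polynomial.Chebyshev.U ℝ ((k : ℤ) - 1)).eval c

@[fun_prop] theorem continuous_chebyshevU (k : ℕ) : Continuous (chebyshevU k) :=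
  (Polynomial.Chebyshev.U ℝ ((k : ℤ) - 1)).continuous

theorem chebyshevU_cos (k : ℕ) (x : ℝ) : chebyshevU k (Real.cos x) * Real.sin x = Real.sin (k * x) := by
  rw [chebyshevU, Polynomial.Chebyshev.U_real_cos]
  push_cast
  ring_nf

theorem chebyshevU_mul (k : ℕ) {c : ℝ} (h : c ∈ Icc (-1 : ℝ) 1) :
    chebyshevU k c * sinMul 1 c = sinMul k c := by
  conv_lhs => rw [← Real.cos_arccos h.1 h.2]
  simp only [sinMul, Nat.cast_one, one_mul]
  rw [Real.arccos_cos (Real.arccos_nonneg c) (Real.arccos_le_pi c), chebyshevU_cos]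

theorem chebyshevU_one (k : ℕ) : chebyshevU k 1 = k := by
  simp [chebyshevU]

/-- The underpasses after the twist along the first axis. -/
noncomputable def underArc (q : ℕ) (e : ℝ) : Set R3 :=
  (fun y : ℝ => ((24 * (e * cosMul q (y / 24)), y, 24 * (e * (sinMul 1 (y / 24) * sinMul q (y / 24)))) : R3)) ''
    Icc (-24) 24

noncomputable def outerPt (k : ℕ) (e : ℝ) (x : ℝ) : R3 :=
  (x, 48 * (e * cosMul k (x / 24)), 48 * (e * (sinMul 1 (x / 24) * sinMul k (x / 24))))

/-- The outer part of a bridge after the twist along the first axis. -/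
noncomputable def outerArc (k : ℕ) (e : ℝ) : Set R3 := outerPt k e '' Icc (-24) 24

theorem cosMul_cos (k : ℕ) (x : ℝ) : cosMul k (Real.cos x) = Real.cos (k * x) := by
  have h : ∀ y : ℝ, (Polynomial.Chebyshev.T ℝ k).eval (Real.cos y) = Real.cos (k * y) := fun y => by
    rw [Polynomial.Chebyshev.T_real_cos]; push_cast; rfl
  rw [cosMul, ← h, Real.cos_arccos (Real.neg_one_le_cos x) (Real.cos_le_one x), h]

/-- `sinMul 1 (cos x)` is `sin x` only up to sign. Writing the other factor as a Chebyshev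
polynomial times the same quantity makes it appear squared, so the sign is irrelevant. -/
theorem sinMul_cos (k : ℕ) (x : ℝ) :
    sinMul 1 (Real.cos x) * sinMul k (Real.cos x) = Real.sin x * Real.sin (k * x) := by
  have h : sinMul 1 (Real.cos x) ^ 2 = Real.sin x ^ 2 := by
    have h1 := cosMul_sq_add_sinMul_sq 1 (Real.cos x)
    rw [cosMul_cos, Nat.cast_one, one_mul] at h1
    linarith [Real.cos_sq_add_sin_sq x]
  rw [← chebyshevU_mul k ⟨Real.neg_one_le_cos x, Real.cos_le_one x⟩, ← chebyshevU_cos]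
  linear_combination chebyshevU k (Real.cos x) * h

/-! ### A shear of the pillowcase -/

/-- The twist along the first axis that unwinds the underpasses. -/
noncomputable def pillowTwist (k : ℕ) : R3 → R3 :=
  levelMap (fun x => cosMul k (clamp (-24) 24 x / 24)) (fun x => -chebyshevU k (clamp (-24) 24 x / 24))
    (fun x => sinMul 1 (clamp (-24) 24 x / 24) * sinMul k (clamp (-24) 24 x / 24))
    (fun x => cosMul k (clamp (-24) 24 x / 24))

/-- With `c = x / 24` the matrix has `T_k(c)` on the diagonal and `-U_{k-1}(c)`, `(1 - c²)
U_{k-1}(c)` off it; its determinant is `1` by the Pell identity `T² + (1 - c²) U² = 1`. Contracting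
`c` to `1` deforms it to a constant shear with entry `-k`, which is then joined to the identity. -/
theorem isotopic_pillowTwist (k : ℕ) (K : Set R3) : AmbientIsotopic K (pillowTwist k '' K) := by
  have h1 := isotopic_levelMap (l := -24) (r := 24) (by norm_num) (a := fun _ => 1)
    (b := fun p => -(p.1 * k)) (c := fun _ => 0) (d := fun _ => 1) (by fun_prop) (by fun_prop)
    (by fun_prop) (by fun_prop) (by simp) K
  have h2 := isotopic_levelMap (l := -24) (r := 24) (by norm_num)
    (a := fun p => cosMul k (1 + p.1 * (p.2 / 24 - 1)))
    (b := fun p => -chebyshevU k (1 + p.1 * (p.2 / 24 - 1)))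
    (c := fun p => sinMul 1 (1 + p.1 * (p.2 / 24 - 1)) * sinMul k (1 + p.1 * (p.2 / 24 - 1)))
    (d := fun p => cosMul k (1 + p.1 * (p.2 / 24 - 1))) (by fun_prop) (by fun_prop)
    (by fun_prop) (by fun_prop) ?_ K
  · simp only [zero_mul, add_zero, cosMul_of_ge k le_rfl, sinMul_of_ge _ le_rfl, chebyshevU_one,
      one_mul, add_sub_cancel, neg_zero] at h1 h2
    refine AmbientIsotopic.trans ?_ h2
    simpa [levelMap] using h1
  · intro t ht x hx
    have hc : 1 + t * (x / 24 - 1) ∈ Icc (-1 : ℝ) 1 :=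
      ⟨by nlinarith [ht.1, ht.2, hx.1, hx.2], by nlinarith [ht.1, ht.2, hx.1, hx.2]⟩
    have e1 := cosMul_sq_add_sinMul_sq k (1 + t * (x / 24 - 1))
    have e2 := chebyshevU_mul k hc
    simp only
    refine ne_of_eq_of_ne (b := (1 : ℝ)) ?_ one_ne_zero
    linear_combination e1 + sinMul k (1 + t * (x / 24 - 1)) * e2

theorem boxMap_pillowMap (v : ℝ × ℝ) : boxMap (24, 24, 24) 0 (pillowMap v) =
    (24 * Real.cos v.1, 24 * Real.cos v.2, -(24 * (Real.sin v.1 * Real.sin v.2))) := by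
  simp [boxMap, pillowMap]

/-- By the addition theorems the level-wise linear map induces the shear `(x, y) ↦ (x, y - k * x)`
on the plane covering the pillowcase. -/
theorem pillowTwist_pillowMap (k : ℕ) (x y : ℝ) : pillowTwist k (boxMap (24, 24, 24) 0 (pillowMap (x, y))) =
    (24 * Real.cos x, 24 * Real.cos (y - k * x), -(24 * (Real.sin x * Real.sin (y - k * x)))) := by
  have hc : clamp (-24) 24 (24 * Real.cos x) / 24 = Real.cos x := by
    rw [clamp_of_mem ⟨by linarith [Real.neg_one_le_cos x], by linarith [Real.cos_le_one x]⟩]; ring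
  rw [boxMap_pillowMap]
  simp only [pillowTwist, levelMap, hc, cosMul_cos, sinMul_cos, Real.cos_sub, Real.sin_sub]
  ext
  · rfl
  · simp only
    linear_combination 24 * Real.sin y * chebyshevU_cos k x
  · simp only
    linear_combination (0 : ℝ) * chebyshevU_cos k x

theorem underArc_cos (q : ℕ) {e : ℝ} (Y : ℝ) :
    (24 * (e * Real.cos (q * Y)), 24 * Real.cos Y, 24 * (e * (Real.sin Y * Real.sin (q * Y)))) ∈
      underArc q e := by
  refine ⟨24 * Real.cos Y, ⟨by linarith [Real.neg_one_le_cos Y], by linarith [Real.cos_le_one Y]⟩, ?_⟩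
  simp only [mul_div_cancel_left₀ _ (show (24 : ℝ) ≠ 0 by norm_num), cosMul_cos, sinMul_cos]

/-- With `Y = y - k * x` and `q * k = p + 1`, the equation `p * x - q * y = j * π` becomes `x = -(q
* Y + j * π)`. The underpasses are thus graphs over `Y`, and the parity of `j` selects the arc. -/
theorem pillowTwist_underpasses {p k q : ℕ} (h : q * k = p + 1) :
    pillowTwist k '' (boxMap (24, 24, 24) 0 '' schubertUnderpasses p q) =
      underArc q 1 ∪ underArc q (-1) := by
  have h' : (q : ℝ) * k = p + 1 := by exact_mod_cast h
  ext w
  simp only [schubertUnderpasses, image_image, mem_image, mem_ofPred_eq]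
  constructor
  · rintro ⟨⟨x, y⟩, ⟨j, hj⟩, rfl⟩
    rw [pillowTwist_pillowMap]
    set Y := y - k * x
    have hx : x = -(q * Y + j * Real.pi) := by
      simp only [Y]; push_cast at hj; linear_combination -hj - x * h'
    rw [hx, Real.cos_neg, Real.sin_neg, Real.cos_add_int_mul_pi, Real.sin_add_int_mul_pi]
    rcases Int.even_or_odd j with hj | hj
    · rw [hj.neg_one_zpow]
      refine Or.inl ?_
      convert underArc_cos q (e := 1) Y using 1
      ext <;> simp only
      ring
    · rw [hj.neg_one_zpow]
      refine Or.inr ?_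
      convert underArc_cos q (e := -1) Y using 1
      ext <;> simp only
      ring
  · have key : ∀ (j : ℤ) (e : ℝ), (-1) ^ j = e → w ∈ underArc q e → ∃ x : ℝ × ℝ,
        (∃ k : ℤ, ((p : ℤ) : ℝ) * x.1 - ((q : ℤ) : ℝ) * x.2 = k * Real.pi) ∧
          pillowTwist k (boxMap (24, 24, 24) 0 (pillowMap x)) = w := by
      rintro j e he ⟨y', hy, rfl⟩
      set Y := Real.arccos (y' / 24)
      have hY : Real.cos Y = y' / 24 := Real.cos_arccos (by linarith [hy.1]) (by linarith [hy.2])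
      set x := -(q * Y + j * Real.pi) with hx
      refine ⟨(x, Y + k * x), ⟨j, ?_⟩, ?_⟩
      · push_cast; linear_combination -x * h' - hx
      · rw [pillowTwist_pillowMap]
        simp only [add_sub_cancel_right, ← hY, cosMul_cos, sinMul_cos]
        rw [hx, Real.cos_neg, Real.sin_neg, Real.cos_add_int_mul_pi, Real.sin_add_int_mul_pi, he, hY]
        ext <;> simp only <;> ring
    rintro (hw | hw)
    · exact key 0 1 (by simp) hw
    · exact key 1 (-1) (by simp) hw

def bridgeFrame : List (List ZPt) :=
  [[(-24, 24, 0), (-24, 48, 0), (24, 48, 0), (24, 24, 0)],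
    [(-24, -24, 0), (-24, -48, 0), (24, -48, 0), (24, -24, 0)]]

/-- The left ends of the bridges after they are stretched. -/
def legFrame : List (List ZPt) :=
  [[(-24, 24, 0), (-88, 24, 0), (-88, 48, 0), (-24, 48, 0)],
    [(-24, -24, 0), (-88, -24, 0), (-88, -48, 0), (-24, -48, 0)]]

/-- The right ends of the bridges. -/
def rightFrame : List (List ZPt) :=
  [[(24, 48, 0), (24, 24, 0)], [(24, -48, 0), (24, -24, 0)]]

def outerFrame : List (List ZPt) := [[(-24, 48, 0), (24, 48, 0)], [(-24, -48, 0), (24, -48, 0)]]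

/-- The left legs of the bridges are drawn out to `x = -88`; the space gained between `-80` and
`-32` will hold their winding. -/
theorem checkMoves_bridge : checkMoves [((-24, -24, -24), (24, 24, 24))]
    [1, -24, 24, 0, -88, 48, 0, -24, 48, 0, 1, -24, 24, 0, -88, 24, 0, -88, 48, 0,
      1, -24, -24, 0, -88, -48, 0, -24, -48, 0, 1, -24, -24, 0, -88, -24, 0, -88, -48, 0]
    bridgeFrame (outerFrame ++ (legFrame ++ rightFrame)) = true := by decide +kernel

theorem boxMap_schubertBridges : boxMap (24, 24, 24) 0 '' schubertBridges = paths bridgeFrame := by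
  rw [schubertBridges, image_union, image_polygonalPath (image_segment_boxMap _ _),
    image_polygonalPath (image_segment_boxMap _ _), bridgeFrame, paths_cons, paths_cons, paths_nil,
    union_empty]
  norm_num [boxMap, ZPt.toR]

/-- At `c = -1` an odd `k` gives `-1` on the diagonal. The entry `-U_{k-1}(-1)` is not zero but
multiplies the third coordinate, which vanishes here. -/
theorem pillowTwist_left {k : ℕ} (hk : Odd k) {p : R3} (h : p.1 ≤ -24) (h' : p.2.2 = 0) :
    pillowTwist k p = (p.1, -p.2.1, 0) := by
  simp only [pillowTwist, levelMap, clamp_of_le h, h']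
  rw [cosMul_of_le hk (by norm_num), sinMul_of_le 1 (by norm_num)]
  simp

theorem pillowTwist_right (k : ℕ) {p : R3} (h : 24 ≤ p.1) (h' : p.2.2 = 0) :
    pillowTwist k p = p := by
  simp only [pillowTwist, levelMap, clamp_of_ge (show (-24 : ℝ) ≤ 24 by norm_num) h, h']
  rw [cosMul_of_ge k (by norm_num), sinMul_of_ge 1 (by norm_num)]
  ext <;> simp [h']

theorem pillowTwist_outer (k : ℕ) (e : ℝ) :
    pillowTwist k '' segment ℝ (-24, 48 * e, 0) (24, 48 * e, 0) = outerArc k e := by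
  have h : segment ℝ ((-24, 48 * e, 0) : R3) (24, 48 * e, 0) = (fun x : ℝ => ((x, 48 * e, 0) : R3)) ''
      Icc (-24) 24 := by
    rw [image_Icc_eq_segment (by norm_num)]
    intro x _
    ext <;> simp
  rw [h, image_image, outerArc]
  refine image_congr fun x hx => ?_
  simp only [pillowTwist, levelMap, clamp_of_mem hx, outerPt]
  ext <;> simp only <;> ring

def reflectY (p : ZPt) : ZPt := (p.1, -p.2.1, p.2.2)

theorem pillowTwist_legFrame {k : ℕ} (hk : Odd k) : pillowTwist k '' paths legFrame = paths legFrame := by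
  rw [image_paths (g := reflectY) (ok := fun e => decide ((e.1.1 ≤ -24 ∧ e.2.1 ≤ -24) ∧
    e.1.2.2 = 0 ∧ e.2.2.2 = 0)) _ (by decide +kernel)]
  · exact carrier_eq_of_sameEdges (by decide +kernel)
  · intro e he
    rw [decide_eq_true_eq] at he
    have key : ∀ p ∈ e.carrier, pillowTwist k p = (p.1, -p.2.1, 0) := fun p hp =>
      pillowTwist_left hk (by simpa using (coord_of_mem_carrier hp).1 (-24) he.1.1 he.1.2)
        (edge_flat he.2 hp)
    rw [image_congr key, ZEdge.carrier, image_segment_of_affine, ZEdge.carrier]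
    · simp [reflectY, ZPt.toR, he.2.1, he.2.2]
    · intro s _
      ext <;> simp [ZPt.toR]
      ring

theorem pillowTwist_rightFrame (k : ℕ) : pillowTwist k '' paths rightFrame = paths rightFrame := by
  rw [image_congr (g := id), image_id]
  refine forall_mem_paths (ok := fun e => decide ((24 ≤ e.1.1 ∧ 24 ≤ e.2.1) ∧
    e.1.2.2 = 0 ∧ e.2.2.2 = 0)) (by decide +kernel) fun e he p hp => ?_
  rw [decide_eq_true_eq] at he
  exact pillowTwist_right k (by simpa using (coord_of_mem_carrier hp).2.1 24 he.1.1 he.1.2)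
    (edge_flat he.2 hp)

theorem isotopic_schubertLink {p k q : ℕ} (hk : Odd k) (h : q * k = p + 1) :
    AmbientIsotopic (schubertLink p q)
      ((underArc q 1 ∪ underArc q (-1)) ∪ (outerArc k 1 ∪ outerArc k (-1) ∪
        (paths legFrame ∪ paths rightFrame))) := by
  refine (isotopic_boxMap (a := (24, 24, 24)) (by norm_num) (by norm_num) (by norm_num) 0 _).trans ?_
  rw [schubertLink, image_union, boxMap_schubertBridges]
  refine (isotopic_of_checkMoves ?_ checkMoves_bridge).trans ((isotopic_pillowTwist k _).trans ?_)
  · rintro _ ⟨_, ⟨v, _, rfl⟩, rfl⟩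
    refine ⟨_, List.mem_singleton_self _, ?_⟩
    rw [boxMap_pillowMap]
    have h1 := abs_le.1 (Real.abs_cos_le_one v.1)
    have h2 := abs_le.1 (Real.abs_cos_le_one v.2)
    have h3 : |Real.sin v.1 * Real.sin v.2| ≤ 1 := by
      rw [abs_mul]
      exact mul_le_one₀ (Real.abs_sin_le_one _) (abs_nonneg _) (Real.abs_sin_le_one _)
    have h3 := abs_le.1 h3
    simp only [ZEdge.box, mem_ofPred_eq]
    push_cast
    refine ⟨⟨?_, ?_⟩, ⟨?_, ?_⟩, ?_, ?_⟩ <;> linarith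
  · rw [image_union, pillowTwist_underpasses h, paths_append, paths_append, image_union, image_union,
      pillowTwist_legFrame hk, pillowTwist_rightFrame, outerFrame, paths_cons, paths_cons, paths_nil,
      union_empty, image_union]
    have h1 := pillowTwist_outer k 1
    have h2 := pillowTwist_outer k (-1)
    norm_num at h1 h2
    simp only [List.map_cons, List.map_nil, polygonalPath, ZPt.toR, union_empty]
    push_cast
    rw [h1, h2]
    exact AmbientIsotopic.refl _

theorem isCompact_underArc (q : ℕ) (e : ℝ) : IsCompact (underArc q e) :=
  isCompact_Icc.image (by fun_prop)

@[fun_prop] theorem continuous_outerPt (k : ℕ) (e : ℝ) : Continuous (outerPt k e) := by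
  unfold outerPt; fun_prop

/-- The strand of `outerPt` on the cylinder of radius `48`. -/
noncomputable def circlePt (k : ℕ) (e : ℝ) (x : ℝ) : R3 :=
  (x, 48 * (e * cosMul k (x / 24)), 48 * (e * sinMul k (x / 24)))

@[fun_prop] theorem continuous_circlePt (k : ℕ) (e : ℝ) : Continuous (circlePt k e) := by
  unfold circlePt; fun_prop

/-- The underpasses stay inside the elliptic cylinder. -/
theorem underArc_bound {q : ℕ} {e : ℝ} (he : e ^ 2 = 1) {p : R3} (hp : p ∈ underArc q e) :
    p.1 ∈ Icc (-24) 24 ∧ p.2.1 ^ 2 + p.2.2 ^ 2 ≤ 24 ^ 2 ∧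
      sinMul 1 (p.1 / 24) ^ 2 * p.2.1 ^ 2 + p.2.2 ^ 2 = 24 ^ 2 * sinMul 1 (p.1 / 24) ^ 2 := by
  obtain ⟨y, hy, rfl⟩ := hp
  have hY : y / 24 ∈ Icc (-1 : ℝ) 1 := ⟨by linarith [hy.1], by linarith [hy.2]⟩
  have h1 := cosMul_sq_add_sinMul_sq q (y / 24)
  have h2 := cosMul_sq_add_sinMul_sq 1 (y / 24)
  rw [cosMul_one hY] at h2
  set C := cosMul q (y / 24)
  set S := sinMul q (y / 24)
  set w := sinMul 1 (y / 24)
  simp only [mul_div_cancel_left₀ _ (show (24 : ℝ) ≠ 0 by norm_num)]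
  have h4 : |e * C| ≤ 1 := by
    rw [← sq_le_one_iff_abs_le_one, mul_pow, he]; nlinarith [sq_nonneg S]
  have h4 := abs_le.1 h4
  have h5 : sinMul 1 (e * C) ^ 2 = S ^ 2 := by
    have := cosMul_sq_add_sinMul_sq 1 (e * C)
    rw [cosMul_one h4] at this
    nlinarith
  refine ⟨⟨by linarith, by linarith⟩, ?_, ?_⟩
  · have : (24 * (e * (w * S))) ^ 2 = 24 ^ 2 * (e ^ 2 * (w ^ 2 * S ^ 2)) := by ring
    rw [this, he, one_mul]
    nlinarith [mul_nonneg (sq_nonneg w) (sq_nonneg C)]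
  · rw [h5]
    linear_combination 24 ^ 2 * S ^ 2 * h2 + 24 ^ 2 * w ^ 2 * S ^ 2 * he

/-- The ellipse at each level, with half axes `48` and `48 * w`, is widened to a circle. The swept
points stay outside the ellipse of half the size that contains the underpasses. The other bridge,
before or after its own rounding, is on the opposite side, and a meeting would force cosine and sine
to vanish together. -/
theorem isotopic_outerArc {k q : ℕ} {e : ℝ} (he : e ^ 2 = 1) {O : Set R3}
    (hO : O = outerArc k (-e) ∨ O = circlePt k (-e) '' Icc (-24) 24) :
    AmbientIsotopic
      ((underArc q 1 ∪ underArc q (-1)) ∪ (O ∪ (paths legFrame ∪ paths rightFrame)) ∪ outerArc k e)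
      ((underArc q 1 ∪ underArc q (-1)) ∪ (O ∪ (paths legFrame ∪ paths rightFrame)) ∪
        circlePt k e '' Icc (-24) 24) := by
  have e1 : outerPt k e (-24) = circlePt k e (-24) := by
    simp [outerPt, circlePt, sinMul_of_le]
  have e2 : outerPt k e 24 = circlePt k e 24 := by
    simp [outerPt, circlePt, sinMul_of_ge]
  have hw := sinMul_one_nonneg
  refine isotopic_move (lam := dotL (1, 0, 0)) (by norm_num) (continuous_outerPt k e).continuousOn
    (continuous_circlePt k e).continuousOn (by simp [outerPt]) (by simp [circlePt]) e1 e2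
    (Clear.union ?_ (Clear.union ?_ (Clear.union ?_ ?_)))
  · refine clear_of_compact (continuous_outerPt k e) (continuous_circlePt k e)
      ((isCompact_underArc q 1).union (isCompact_underArc q (-1))) fun p hp _ t ht h => ?_
    obtain ⟨-, h1, h2⟩ : p.1 ∈ Icc (-24) 24 ∧ p.2.1 ^ 2 + p.2.2 ^ 2 ≤ 24 ^ 2 ∧
        sinMul 1 (p.1 / 24) ^ 2 * p.2.1 ^ 2 + p.2.2 ^ 2 = 24 ^ 2 * sinMul 1 (p.1 / 24) ^ 2 := by
      rcases hp with hp | hp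
      · exact underArc_bound (by norm_num) hp
      · exact underArc_bound (by norm_num) hp
    simp only [outerPt, circlePt, Prod.ext_iff, Prod.fst_add, Prod.snd_add, Prod.smul_fst,
      Prod.smul_snd, Prod.fst_sub, Prod.snd_sub, smul_eq_mul, dotL_apply] at h
    simp only [one_mul, zero_mul, add_zero] at h
    obtain ⟨-, h3, h4⟩ := h
    have h5 := cosMul_sq_add_sinMul_sq k (p.1 / 24)
    have h6 := hw (p.1 / 24)
    have h7 := sinMul_one_le (p.1 / 24)
    have h8 := sinMul_eq_zero k (c := p.1 / 24)
    set C := cosMul k (p.1 / 24)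
    set S := sinMul k (p.1 / 24)
    set w := sinMul 1 (p.1 / 24)
    have h9 : p.2.1 ^ 2 = 48 ^ 2 * C ^ 2 := by
      rw [h3]; linear_combination (48 ^ 2 * C ^ 2) * he
    have h10 : p.2.2 ^ 2 = 48 ^ 2 * (w + t * (1 - w)) ^ 2 * S ^ 2 := by
      rw [h4]; linear_combination (48 ^ 2 * (w + t * (1 - w)) ^ 2 * S ^ 2) * he
    have h11 : w ^ 2 ≤ (w + t * (1 - w)) ^ 2 :=
      pow_le_pow_left₀ h6 (by nlinarith [ht.1]) 2
    -- A common point would satisfy `w² y² + z² ≥ 48² w²` by the sweep and `= 24² w²` by the bound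
    -- on the underpasses, so it can only lie at an end level; there `y² = 48²` exceeds the bound
    -- `24²`.
    have h12 : w ^ 2 = 0 := by
      nlinarith [mul_le_mul_of_nonneg_right h11 (sq_nonneg S), sq_nonneg w]
    have h13 := h8 (by simpa using h12)
    rw [h13] at h5
    nlinarith
  · have h : ∀ p ∈ O, dotL (1, 0, 0) p ∈ Icc (-24) 24 → ∀ t ∈ Icc (0 : ℝ) 1,
        p ≠ outerPt k e (dotL (1, 0, 0) p) + t • (circlePt k e (dotL (1, 0, 0) p) - outerPt k e (dotL (1, 0, 0) p)) := by
      intro p hp _ t ht h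
      obtain ⟨s, hs, h1, h2⟩ : ∃ s ∈ Icc (0 : ℝ) 1, p.2.1 = 48 * (-e * cosMul k (p.1 / 24)) ∧
          p.2.2 = 48 * (-e * ((sinMul 1 (p.1 / 24) + s * (1 - sinMul 1 (p.1 / 24))) * sinMul k (p.1 / 24))) := by
        rcases hO with rfl | rfl
        · obtain ⟨x, -, rfl⟩ := hp
          exact ⟨0, by norm_num, by simp [outerPt], by simp [outerPt]⟩
        · obtain ⟨x, -, rfl⟩ := hp
          exact ⟨1, by norm_num, by simp [circlePt], by simp [circlePt]⟩
      simp only [outerPt, circlePt, Prod.ext_iff, Prod.fst_add, Prod.snd_add, Prod.smul_fst,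
        Prod.smul_snd, Prod.fst_sub, Prod.snd_sub, smul_eq_mul, dotL_apply] at h
      simp only [one_mul, zero_mul, add_zero] at h
      obtain ⟨-, h3, h4⟩ := h
      have h5 := cosMul_sq_add_sinMul_sq k (p.1 / 24)
      have h6 := hw (p.1 / 24)
      have h7 := sinMul_one_le (p.1 / 24)
      have h8 := sinMul_eq_zero k (c := p.1 / 24)
      rw [h1] at h3
      rw [h2] at h4
      set C := cosMul k (p.1 / 24)
      set S := sinMul k (p.1 / 24)
      set w := sinMul 1 (p.1 / 24)
      have h9 : C = 0 := by linear_combination (-(1 / 96) * e) * h3 - C * he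
      have h10 : ((w + s * (1 - w)) + (w + t * (1 - w))) * S = 0 := by
        linear_combination (-(1 / 48) * e) * h4 - ((w + s * (1 - w)) + (w + t * (1 - w))) * S * he
      have h11 : S ≠ 0 := by rintro h0; rw [h9, h0] at h5; norm_num at h5
      have h12 := (mul_eq_zero.1 h10).resolve_right h11
      exact h11 (h8 (by nlinarith [hs.1, ht.1]))
    refine clear_of_compact (continuous_outerPt k e) (continuous_circlePt k e) ?_ h
    rcases hO with rfl | rfl
    · exact isCompact_Icc.image (by fun_prop)
    · exact isCompact_Icc.image (by fun_prop)
  · refine clear_of_outside e1 e2 fun p hp => Or.inl ?_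
    revert p
    refine forall_mem_paths (ok := fun e => decide (e.1.1 ≤ -24 ∧ e.2.1 ≤ -24)) (by decide +kernel)
      fun e he p hp => ?_
    rw [decide_eq_true_eq] at he
    simpa using (coord_of_mem_carrier hp).1 (-24) he.1 he.2
  · refine clear_of_outside e1 e2 fun p hp => Or.inr ?_
    revert p
    refine forall_mem_paths (ok := fun e => decide (24 ≤ e.1.1 ∧ 24 ≤ e.2.1)) (by decide +kernel)
      fun e he p hp => ?_
    rw [decide_eq_true_eq] at he
    simpa using (coord_of_mem_carrier hp).2.1 24 he.1 he.2

theorem isotopic_outerArcs (k q : ℕ) :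
    AmbientIsotopic
      ((underArc q 1 ∪ underArc q (-1)) ∪ (outerArc k 1 ∪ outerArc k (-1) ∪
        (paths legFrame ∪ paths rightFrame)))
      ((underArc q 1 ∪ underArc q (-1)) ∪ (circlePt k 1 '' Icc (-24) 24 ∪ circlePt k (-1) '' Icc (-24) 24 ∪
        (paths legFrame ∪ paths rightFrame))) := by
  have h1 := isotopic_outerArc (k := k) (q := q) (e := 1) (by norm_num) (Or.inl rfl)
  have h2 := isotopic_outerArc (k := k) (q := q) (e := -1) (by norm_num) (O := circlePt k 1 '' Icc (-24) 24)
    (Or.inr (by rw [neg_neg]))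
  have comm : ∀ A B C D : Set R3, A ∪ (B ∪ C) ∪ D = A ∪ (B ∪ D ∪ C) := fun A B C D => by
    ext p; simp only [mem_union]; tauto
  rw [comm, comm] at h1 h2
  rw [union_comm (outerArc k 1)]
  refine h1.trans ?_
  rw [union_comm (outerArc k (-1))]
  exact h2

/-! ### Transferring the winding of the bridges to their legs -/

/-- The angle of the band of two parallel strands. -/
noncomputable def bandAngle (n : ℕ) (x : ℝ) : ℝ :=
  Real.pi * clamp 0 1 ((-32 - x) / 8) + 2 * n * Real.pi * clamp 0 1 ((-40 - x) / 40)

@[fun_prop] theorem continuous_bandAngle (n : ℕ) : Continuous (bandAngle n) := by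
  unfold bandAngle; fun_prop

theorem bandAngle_of_ge (n : ℕ) {x : ℝ} (h : -32 ≤ x) : bandAngle n x = 0 := by
  rw [bandAngle, clamp_of_le (by linarith), clamp_of_le (by linarith)]; simp

theorem bandAngle_first (n : ℕ) {x : ℝ} (h : -40 ≤ x) (h' : x ≤ -32) :
    bandAngle n x = Real.pi * ((-32 - x) / 8) := by
  rw [bandAngle, clamp_of_mem ⟨by linarith, by linarith⟩, clamp_of_le (by linarith)]; simp

theorem bandAngle_second (n : ℕ) {x : ℝ} (h : -80 ≤ x) (h' : x ≤ -40) :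
    bandAngle n x = Real.pi + 2 * n * Real.pi * ((-40 - x) / 40) := by
  rw [bandAngle, clamp_of_ge zero_le_one (by linarith), clamp_of_mem ⟨by linarith, by linarith⟩, mul_one]

theorem bandAngle_of_le (n : ℕ) {x : ℝ} (h : x ≤ -80) : bandAngle n x = (2 * n + 1 : ℕ) * Real.pi := by
  rw [bandAngle, clamp_of_ge zero_le_one (by linarith), clamp_of_ge zero_le_one (by linarith)]
  push_cast; ring

/-- A strand of the band. -/
noncomputable def bandPt (n : ℕ) (e : ℝ) (x : ℝ) : R3 :=
  (x, 24 * (e * Real.cos (bandAngle n x)), -(24 * (e * Real.sin (bandAngle n x))))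

@[fun_prop] theorem continuous_bandPt (n : ℕ) (e : ℝ) : Continuous (bandPt n e) := by
  have h1 := Real.continuous_cos.comp (continuous_bandAngle n)
  have h2 := Real.continuous_sin.comp (continuous_bandAngle n)
  exact continuous_id.prodMk ((continuous_const.mul (continuous_const.mul h1)).prodMk
    (continuous_const.mul (continuous_const.mul h2)).neg)

theorem bandPt_of_ge (n : ℕ) (e : ℝ) {x : ℝ} (h : -32 ≤ x) : bandPt n e x = (x, 24 * e, 0) := by
  simp [bandPt, bandAngle_of_ge n h]

theorem odd_cos (n : ℕ) : Real.cos ((2 * n + 1 : ℕ) * Real.pi) = -1 := by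
  rw [Real.cos_nat_mul_pi, (odd_two_mul_add_one n).neg_one_pow]

theorem bandPt_of_le (n : ℕ) (e : ℝ) {x : ℝ} (h : x ≤ -80) : bandPt n e x = (x, -(24 * e), 0) := by
  simp only [bandPt, bandAngle_of_le n h, odd_cos, Real.sin_nat_mul_pi]
  simp

/-- The angle by which the circle of radius `r` is turned to straighten the outer strands. -/
noncomputable def unwindAngle (n : ℕ) (x r : ℝ) : ℝ :=
  -((1 - clamp 0 1 ((r - 24) / 24)) * bandAngle n x +
    clamp 0 1 ((r - 24) / 24) * ((2 * n + 1 : ℕ) * Real.arccos (x / 24)))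

/-- The twist that straightens the outer strands. -/
noncomputable def unwind (n : ℕ) (p : R3) : R3 := rotX (unwindAngle n p.1 (rad p)) p

theorem isotopic_unwind (n : ℕ) (K : Set R3) : AmbientIsotopic K (unwind n '' K) := by
  refine isotopic_twist (φ := unwindAngle n) ?_ K
  unfold unwindAngle
  have h : Continuous fun p : ℝ × ℝ => Real.arccos (p.1 / 24) :=
    Real.continuous_arccos.comp (by fun_prop)
  fun_prop

theorem unwindAngle_inner (n : ℕ) (x : ℝ) {r : ℝ} (h : r ≤ 24) : unwindAngle n x r = -bandAngle n x := by
  rw [unwindAngle, clamp_of_le (by linarith)]; simp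

theorem unwindAngle_outer (n : ℕ) (x : ℝ) {r : ℝ} (h : 48 ≤ r) :
    unwindAngle n x r = -((2 * n + 1 : ℕ) * Real.arccos (x / 24)) := by
  rw [unwindAngle, clamp_of_ge zero_le_one (by linarith)]; simp

theorem unwindAngle_left (n : ℕ) {x : ℝ} (h : x ≤ -80) (r : ℝ) :
    unwindAngle n x r = -((2 * n + 1 : ℕ) * Real.pi) := by
  rw [unwindAngle, bandAngle_of_le n h, Real.arccos_of_le_neg_one (by linarith)]; ring

theorem unwind_of_fixed {n : ℕ} {p : R3} (h : unwindAngle n p.1 (rad p) = 0) : unwind n p = p := by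
  rw [unwind, h, rotX_zero]

theorem unwind_of_flip {n : ℕ} {p : R3} (h' : p.2.2 = 0)
    (h : unwindAngle n p.1 (rad p) = -((2 * n + 1 : ℕ) * Real.pi)) : unwind n p = (p.1, -p.2.1, 0) := by
  rw [unwind, h, rotX, Real.cos_neg, Real.sin_neg, odd_cos, Real.sin_nat_mul_pi, h']
  simp

theorem rad_cyl_abs (x ρ θ : ℝ) : rad (cyl x ρ θ) = |ρ| := by
  rw [← Real.sqrt_sq_eq_abs, rad]
  congr 1
  simp only [cyl]
  linear_combination ρ ^ 2 * Real.sin_sq_add_cos_sq θ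

theorem unwind_circle (n : ℕ) {e : ℝ} (he : |e| = 1) :
    unwind n '' (circlePt (2 * n + 1) e '' Icc (-24) 24) = segment ℝ (-24, 48 * e, 0) (24, 48 * e, 0) := by
  rw [image_image]
  refine image_Icc_eq_segment (by norm_num) fun x _ => ?_
  have h : circlePt (2 * n + 1) e x = cyl x (48 * e) ((2 * n + 1 : ℕ) * Real.arccos (x / 24)) := by
    simp only [circlePt, cyl, cosMul, sinMul]
    ext <;> simp only <;> ring
  rw [unwind, h, rad_cyl_abs, abs_mul, he, unwindAngle_outer n _ (by norm_num), rotX_cyl]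
  simp only [cyl, add_neg_cancel, Real.cos_zero, Real.sin_zero]
  ext <;> simp

theorem unwind_band (n : ℕ) {e : ℝ} (he : |e| = 1) :
    unwind n '' segment ℝ (-24, 24 * e, 0) (-88, 24 * e, 0) = bandPt n e '' Icc (-88) (-24) := by
  have h : segment ℝ ((-24, 24 * e, 0) : R3) (-88, 24 * e, 0) = (fun x => cyl x (24 * e) 0) '' Icc (-88) (-24) := by
    rw [segment_symm, image_Icc_eq_segment (by norm_num)]
    intro x _
    ext <;> simp [cyl]
    ring
  rw [h, image_image]
  refine image_congr fun x _ => ?_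
  rw [unwind, rad_cyl_abs, abs_mul, he, unwindAngle_inner n _ (by norm_num), rotX_cyl]
  simp only [cyl, zero_add, Real.cos_neg, Real.sin_neg, bandPt]
  ext <;> simp only <;> ring

def legRest : List (List ZPt) :=
  [[(-88, 24, 0), (-88, 48, 0), (-24, 48, 0)], [(-88, -24, 0), (-88, -48, 0), (-24, -48, 0)]]

/-- Left of `-80` the inner and the outer angle agree, and outside radius `48` only the outer one
counts. In both cases the frame is rotated by an odd multiple of `π`, which exchanges its two
halves. -/
theorem unwind_legRest (n : ℕ) : unwind n '' paths legRest = paths legRest := by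
  rw [image_paths (g := reflectY) (ok := fun e => decide (((e.1.1 ≤ -24 ∧ e.2.1 ≤ -24) ∧
    ((e.1.1 ≤ -80 ∧ e.2.1 ≤ -80) ∨ (48 ≤ e.1.2.1 ∧ 48 ≤ e.2.2.1) ∨ (e.1.2.1 ≤ -48 ∧ e.2.2.1 ≤ -48))) ∧
    e.1.2.2 = 0 ∧ e.2.2.2 = 0)) _ (by decide +kernel)]
  · exact carrier_eq_of_sameEdges (by decide +kernel)
  · intro e he
    rw [decide_eq_true_eq] at he
    have key : ∀ p ∈ e.carrier, unwind n p = (p.1, -p.2.1, 0) := by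
      intro p hp
      have hc := coord_of_mem_carrier hp
      have hx := hc.1 (-24) he.1.1.1 he.1.1.2
      have hr := (abs_le_rad p).1
      push_cast at hx
      refine unwind_of_flip (edge_flat he.2 hp) ?_
      have outer : 48 ≤ rad p → unwindAngle n p.1 (rad p) = -((2 * n + 1 : ℕ) * Real.pi) := fun h => by
        rw [unwindAngle_outer n _ h, Real.arccos_of_le_neg_one (by linarith)]
      rcases he.1.2 with h | h | h
      · exact unwindAngle_left n (by simpa using hc.1 (-80) h.1 h.2) _
      · have := hc.2.2.2.1 48 h.1 h.2
        push_cast at this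
        exact outer (by linarith [le_abs_self p.2.1])
      · have := hc.2.2.1 (-48) h.1 h.2
        push_cast at this
        exact outer (by linarith [neg_abs_le p.2.1])
    rw [image_congr key, ZEdge.carrier, image_segment_of_affine, ZEdge.carrier]
    · simp [reflectY, ZPt.toR, he.2.1, he.2.2]
    · intro s _
      ext <;> simp [ZPt.toR]
      ring

theorem unwind_underArc (n q : ℕ) {e : ℝ} (he : e ^ 2 = 1) : unwind n '' underArc q e = underArc q e := by
  rw [image_congr (g := id), image_id]
  intro p hp
  obtain ⟨h1, h2, -⟩ := underArc_bound he hp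
  refine unwind_of_fixed ?_
  rw [unwindAngle_inner n _ (show rad p ≤ 24 from Real.sqrt_le_iff.2 ⟨by norm_num, h2⟩),
    bandAngle_of_ge n (by linarith [h1.1]), neg_zero]

theorem unwind_rightFrame (n : ℕ) : unwind n '' paths rightFrame = paths rightFrame := by
  rw [image_congr (g := id), image_id]
  refine forall_mem_paths (ok := fun e => decide (24 ≤ e.1.1 ∧ 24 ≤ e.2.1)) (by decide +kernel)
    fun e he p hp => ?_
  rw [decide_eq_true_eq] at he
  have hx := (coord_of_mem_carrier hp).2.1 24 he.1 he.2
  push_cast at hx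
  refine unwind_of_fixed ?_
  rw [unwindAngle, bandAngle_of_ge n (by linarith), Real.arccos_of_one_le (by linarith)]
  simp

/-- Rotating each outer circle back straightens the bridges and turns the far left end by `(2 * n +
1) * π`. The legs at radius `24` have to connect this end to the unmoved pillowcase, and so become a
band with that many half turns. -/
theorem isotopic_unwound (n q : ℕ) :
    AmbientIsotopic
      ((underArc q 1 ∪ underArc q (-1)) ∪ (circlePt (2 * n + 1) 1 '' Icc (-24) 24 ∪
        circlePt (2 * n + 1) (-1) '' Icc (-24) 24 ∪ (paths legFrame ∪ paths rightFrame)))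
      (((underArc q 1 ∪ underArc q (-1)) ∪ (bandPt n 1 '' Icc (-88) (-24) ∪
        bandPt n (-1) '' Icc (-88) (-24))) ∪ paths (outerFrame ++ (legRest ++ rightFrame))) := by
  have hleg : paths legFrame = segment ℝ (-24, 24 * 1, 0) (-88, 24 * 1, 0) ∪
      segment ℝ (-24, 24 * (-1), 0) (-88, 24 * (-1), 0) ∪ paths legRest := by
    rw [legFrame, legRest, paths_cons, paths_cons, paths_nil, paths_cons, paths_cons, paths_nil]
    simp only [List.map_cons, List.map_nil, polygonalPath, ZPt.toR]
    norm_num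
    ext p; simp only [mem_union]; tauto
  have hout : paths outerFrame = segment ℝ (-24, 48 * 1, 0) (24, 48 * 1, 0) ∪
      segment ℝ (-24, 48 * (-1), 0) (24, 48 * (-1), 0) := by
    rw [outerFrame, paths_cons, paths_cons, paths_nil]
    simp only [List.map_cons, List.map_nil, polygonalPath, ZPt.toR]
    norm_num
  refine (isotopic_unwind n _).trans ?_
  rw [hleg]
  simp only [image_union]
  rw [unwind_underArc n q (by norm_num), unwind_underArc n q (by norm_num), unwind_circle n (by simp),
    unwind_circle n (by simp), unwind_band n (by simp), unwind_band n (by simp), unwind_legRest,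
    unwind_rightFrame, paths_append, paths_append, hout]
  refine AmbientIsotopic.of_eq ?_
  ext p; simp only [mem_union]; tauto

/-! ### From the pair of bands to the clasped model -/

def unwoundFrame : List (List ZPt) :=
  [[(-28, 24, 0), (-24, 24, 0)], [(-32, -24, 0), (-24, -24, 0)],
    [(-88, 24, 0), (-88, 48, 0), (-24, 48, 0), (24, 48, 0), (24, 24, 0)],
    [(-88, -24, 0), (-88, -48, 0), (-24, -48, 0), (24, -48, 0), (24, -24, 0)]]

/-- The two strands of the band. -/
noncomputable def bands (n : ℕ) : Set R3 :=
  bandPt n 1 '' Icc (-88) (-28) ∪ bandPt n (-1) '' Icc (-88) (-32)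

theorem isCompact_bands (n : ℕ) : IsCompact (bands n) :=
  (isCompact_Icc.image (by fun_prop)).union (isCompact_Icc.image (by fun_prop))

theorem bands_bound {n : ℕ} {p : R3} (hp : p ∈ bands n) :
    (-88 ≤ p.1 ∧ p.1 ≤ -28) ∧ (-24 ≤ p.2.1 ∧ p.2.1 ≤ 24) ∧ -24 ≤ p.2.2 ∧ p.2.2 ≤ 24 := by
  have key : ∀ (e x : ℝ), |e| = 1 → (-24 ≤ (bandPt n e x).2.1 ∧ (bandPt n e x).2.1 ≤ 24) ∧
      -24 ≤ (bandPt n e x).2.2 ∧ (bandPt n e x).2.2 ≤ 24 := by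
    intro e x he
    have h1 : |e * Real.cos (bandAngle n x)| ≤ 1 := by rw [abs_mul, he, one_mul]; exact Real.abs_cos_le_one _
    have h2 : |e * Real.sin (bandAngle n x)| ≤ 1 := by rw [abs_mul, he, one_mul]; exact Real.abs_sin_le_one _
    have h1 := abs_le.1 h1
    have h2 := abs_le.1 h2
    simp only [bandPt]
    refine ⟨⟨?_, ?_⟩, ?_, ?_⟩ <;> linarith
  rcases hp with ⟨x, hx, rfl⟩ | ⟨x, hx, rfl⟩
  · exact ⟨⟨hx.1, hx.2⟩, key _ _ (by simp)⟩
  · exact ⟨⟨hx.1, by simp only [bandPt]; linarith [hx.2]⟩, key _ _ (by simp)⟩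

theorem bandPt_segment (n : ℕ) (e : ℝ) {a b : ℝ} (ha : -32 ≤ a) (hab : a < b) :
    bandPt n e '' Icc a b = segment ℝ (a, 24 * e, 0) (b, 24 * e, 0) := by
  refine image_Icc_eq_segment hab fun x hx => ?_
  rw [bandPt_of_ge n e (ha.trans hx.1)]
  have := sub_pos.2 hab
  ext <;> simp
  field_simp
  ring

theorem unwound_eq (n : ℕ) :
    (bandPt n 1 '' Icc (-88) (-24) ∪ bandPt n (-1) '' Icc (-88) (-24)) ∪
      paths (outerFrame ++ (legRest ++ rightFrame)) = bands n ∪ paths unwoundFrame := by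
  have h1 := bandPt_segment n 1 (a := -28) (b := -24) (by norm_num) (by norm_num)
  have h2 := bandPt_segment n (-1) (a := -32) (b := -24) (by norm_num) (by norm_num)
  rw [image_Icc_union (bandPt n 1) (a := -88) (b := -28) (c := -24) (by norm_num) (by norm_num),
    image_Icc_union (bandPt n (-1)) (a := -88) (b := -32) (c := -24) (by norm_num) (by norm_num), h1, h2, bands]
  have h3 : paths unwoundFrame = paths [[(-28, 24, 0), (-24, 24, 0)], [(-32, -24, 0), (-24, -24, 0)]] ∪
      paths (outerFrame ++ (legRest ++ rightFrame)) := by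
    rw [← paths_append]; exact carrier_eq_of_sameEdges (by decide +kernel)
  rw [h3, paths_cons, paths_cons, paths_nil]
  simp only [List.map_cons, List.map_nil, polygonalPath, ZPt.toR]
  norm_num
  ext p; simp only [mem_union]; tauto

/-! ### The underpass to be pulled straight -/

/-- The point over `y` of an underpass. -/
noncomputable def underPt (q : ℕ) (e y : ℝ) : R3 :=
  (24 * (e * cosMul q (y / 24)), y, 24 * (e * (sinMul 1 (y / 24) * sinMul q (y / 24))))

@[fun_prop] theorem continuous_underPt (q : ℕ) (e : ℝ) : Continuous (underPt q e) := by
  unfold underPt; fun_prop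

theorem underPt_of_ge (q : ℕ) (e : ℝ) {y : ℝ} (h : 24 ≤ y) : underPt q e y = (24 * e, y, 0) := by
  simp [underPt, cosMul_of_ge q (show 1 ≤ y / 24 by linarith), sinMul_of_ge q (show 1 ≤ y / 24 by linarith)]

theorem underPt_of_le {q : ℕ} (hq : Odd q) (e : ℝ) {y : ℝ} (h : y ≤ -24) :
    underPt q e y = (-(24 * e), y, 0) := by
  simp [underPt, cosMul_of_le hq (show y / 24 ≤ -1 by linarith), sinMul_of_le q (show y / 24 ≤ -1 by linarith)]

/-- The strand along the second axis. -/
noncomputable def axisPt (y : ℝ) : R3 :=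
  (-2 * (clamp 24 36 y - 24) - 2 * (clamp (-36) (-24) y + 24), y, 0)

@[fun_prop] theorem continuous_axisPt : Continuous axisPt := by
  unfold axisPt; fun_prop

theorem axisPt_top {y : ℝ} (h : 24 ≤ y) (h' : y ≤ 36) : axisPt y = (-2 * (y - 24), y, 0) := by
  rw [axisPt, clamp_of_mem ⟨h, h'⟩, clamp_of_ge (by norm_num) (by linarith)]; norm_num

theorem axisPt_mid {y : ℝ} (h : -24 ≤ y) (h' : y ≤ 24) : axisPt y = (0, y, 0) := by
  rw [axisPt, clamp_of_le h', clamp_of_ge (by norm_num) h]; norm_num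

theorem axisPt_bottom {y : ℝ} (h : -36 ≤ y) (h' : y ≤ -24) : axisPt y = (-2 * (y + 24), y, 0) := by
  rw [axisPt, clamp_of_le (by linarith), clamp_of_mem ⟨h, h'⟩]; norm_num

theorem axisPt_image : axisPt '' Icc (-36) 36 = paths [[(24, -36, 0), (0, -24, 0), (0, 24, 0), (-24, 36, 0)]] := by
  rw [image_Icc_union axisPt (a := -36) (b := -24) (c := 36) (by norm_num) (by norm_num),
    image_Icc_union axisPt (a := -24) (b := 24) (c := 36) (by norm_num) (by norm_num),
    image_Icc_eq_segment (p := (24, -36, 0)) (q := (0, -24, 0)) (by norm_num),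
    image_Icc_eq_segment (p := (0, -24, 0)) (q := (0, 24, 0)) (by norm_num),
    image_Icc_eq_segment (p := (0, 24, 0)) (q := (-24, 36, 0)) (by norm_num), paths_cons, paths_nil, union_empty]
  · simp [polygonalPath, ZPt.toR]
  · intro x hx
    rw [axisPt_top hx.1 hx.2]; ext <;> simp <;> ring
  · intro x hx
    rw [axisPt_mid hx.1 hx.2]; ext <;> simp
  · intro x hx
    rw [axisPt_bottom hx.1 hx.2]; ext <;> simp <;> ring

theorem underPt_neg_image {q : ℕ} (hq : Odd q) : underPt q (-1) '' Icc (-36) 36 =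
    underArc q (-1) ∪ paths [[(24, -36, 0), (24, -24, 0)], [(-24, 24, 0), (-24, 36, 0)]] := by
  rw [image_Icc_union (underPt q (-1)) (a := -36) (b := -24) (c := 36) (by norm_num) (by norm_num),
    image_Icc_union (underPt q (-1)) (a := -24) (b := 24) (c := 36) (by norm_num) (by norm_num),
    image_Icc_eq_segment (a := -36) (p := (24, -36, 0)) (q := (24, -24, 0)) (by norm_num),
    image_Icc_eq_segment (b := 36) (p := (-24, 24, 0)) (q := (-24, 36, 0)) (by norm_num), paths_cons, paths_cons,
    paths_nil, union_empty]
  · simp only [List.map_cons, List.map_nil, polygonalPath, ZPt.toR, union_empty]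
    norm_num
    rw [show underPt q (-1) '' Icc (-24) 24 = underArc q (-1) from rfl]
    ext p; simp only [mem_union]; tauto
  · intro x hx
    rw [underPt_of_ge q _ hx.1]; ext <;> simp
    ring
  · intro x hx
    rw [underPt_of_le hq _ hx.2]; ext <;> simp
    ring

def hookFrame : List (List ZPt) := [[(-28, 24, 0), (-24, 36, 0)]]

def footFrame : List (List ZPt) := [[(24, -48, 0), (24, -36, 0)]]

def restFrame : List (List ZPt) :=
  [[(-32, -24, 0), (-24, -24, 0)], [(-88, 24, 0), (-88, 48, 0), (-24, 48, 0), (24, 48, 0), (24, 24, 0)],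
    [(-88, -24, 0), (-88, -48, 0), (-24, -48, 0), (24, -48, 0)]]

theorem checkMoves_unwound : checkMoves [((-24, -24, -24), (24, 24, 24)), ((-88, -24, -24), (-28, 24, 24))]
    [1, -28, 24, 0, -24, 36, 0, -24, 24, 0, 1, 24, -48, 0, 24, -36, 0, 24, -24, 0]
    unwoundFrame ([[(24, -36, 0), (24, -24, 0)], [(-24, 24, 0), (-24, 36, 0)]] ++
      (hookFrame ++ (footFrame ++ restFrame))) = true := by decide +kernel

/-- The second underpass is prolonged by straight legs to `|y| = 36`. Its contraction to the axis
can then be tapered off along these legs, with ends fixed away from the other underpass. -/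
theorem isotopic_unwound_hook {q : ℕ} (hq : Odd q) (n : ℕ) :
    AmbientIsotopic
      (((underArc q 1 ∪ underArc q (-1)) ∪ (bandPt n 1 '' Icc (-88) (-24) ∪
        bandPt n (-1) '' Icc (-88) (-24))) ∪ paths (outerFrame ++ (legRest ++ rightFrame)))
      ((underArc q 1 ∪ (bands n ∪ paths restFrame) ∪ paths hookFrame ∪ paths footFrame) ∪
        underPt q (-1) '' Icc (-36) 36) := by
  rw [union_assoc, unwound_eq, ← union_assoc]
  refine (isotopic_of_checkMoves ?_ checkMoves_unwound).trans ?_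
  · have key : ∀ {e : ℝ}, e ^ 2 = 1 → underArc q e ⊆ boxes [((-24, -24, -24), (24, 24, 24)), ((-88, -24, -24), (-28, 24, 24))] := by
      intro e he p hp
      obtain ⟨h1, h2, -⟩ := underArc_bound he hp
      refine ⟨_, List.mem_cons_self, ?_⟩
      have h3 : |p.2.1| ≤ 24 := abs_le_of_sq_le_sq (by nlinarith [sq_nonneg p.2.2]) (by norm_num)
      have h4 : |p.2.2| ≤ 24 := abs_le_of_sq_le_sq (by nlinarith [sq_nonneg p.2.1]) (by norm_num)
      simpa [ZEdge.box] using ⟨h1, abs_le.1 h3, abs_le.1 h4⟩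
    rintro p ((hp | hp) | hp)
    · exact key (by norm_num) hp
    · exact key (by norm_num) hp
    · refine ⟨_, List.mem_cons_of_mem _ List.mem_cons_self, ?_⟩
      simpa [ZEdge.box] using bands_bound hp
  · rw [underPt_neg_image hq, paths_append, paths_append, paths_append]
    refine AmbientIsotopic.of_eq ?_
    ext p; simp only [mem_union]; tauto

/-! ### Piecewise linear shears -/

/-- The piecewise linear function with value `a` up to `l` and `b` from `r` on. -/
noncomputable def ramp (l r a b : ℤ) (t : ℝ) : ℝ := a + (b - a) * (clamp l r t - l) / (r - l)

/-- The values of a ramp at integers. -/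
def rampZ (l r a b t : ℤ) : ℤ :=
  if t ≤ l then a else if r ≤ t then b else a + (b - a) * (t - l) / (r - l)

/-- The two points lie in a common interval on which the ramp is affine. -/
def rampOk (l r a b t u : ℤ) : Bool :=
  decide ((t ≤ l ∧ u ≤ l) ∨ (r ≤ t ∧ r ≤ u) ∨ ((l ≤ t ∧ t ≤ r) ∧ (l ≤ u ∧ u ≤ r) ∧
    r - l ∣ (b - a) * (t - l) ∧ r - l ∣ (b - a) * (u - l)))

theorem continuous_ramp (l r a b : ℤ) : Continuous (ramp l r a b) := by
  unfold ramp; fun_prop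

theorem ramp_of_le {l r a b : ℤ} {t : ℝ} (h : t ≤ l) : ramp l r a b t = a := by
  rw [ramp, clamp_of_le h]; simp

theorem ramp_of_ge {l r a b : ℤ} (hlr : l < r) {t : ℝ} (h : r ≤ t) : ramp l r a b t = b := by
  have h1 : (l : ℝ) < r := by exact_mod_cast hlr
  have h2 : (r : ℝ) - l ≠ 0 := (sub_pos.2 h1).ne'
  rw [ramp, clamp_of_ge h1.le h]; field_simp; ring

theorem ramp_of_mem {l r a b : ℤ} {t : ℝ} (h : t ∈ Icc (l : ℝ) r) :
    ramp l r a b t = a + (b - a) * (t - l) / (r - l) := by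
  rw [ramp, clamp_of_mem h]

theorem rampZ_of_mem {l r a b t : ℤ} (hlr : l < r) (h : l ≤ t) (h' : t ≤ r)
    (hd : r - l ∣ (b - a) * (t - l)) : (rampZ l r a b t : ℝ) = a + (b - a) * (t - l) / (r - l) := by
  have h1 : (l : ℝ) < r := by exact_mod_cast hlr
  have h2 : (r : ℝ) - l ≠ 0 := (sub_pos.2 h1).ne'
  rw [rampZ]
  split_ifs with h3 h4
  · rw [le_antisymm h3 h]; simp
  · rw [le_antisymm h' h4]; field_simp; ring
  · push_cast [Int.cast_div hd (by push_cast; exact h2)]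
    rfl

theorem abs_ramp_le {l r a b : ℤ} (hlr : l < r) (t : ℝ) : |ramp l r a b t| ≤ |(a : ℝ)| + |(b : ℝ) - a| := by
  have h1 : (l : ℝ) < r := by exact_mod_cast hlr
  have h2 := clamp_mem h1.le t
  have h3 : |(clamp l r t - l) / (r - l)| ≤ 1 := by
    rw [abs_of_nonneg (div_nonneg (by linarith [h2.1]) (by linarith)), div_le_one (by linarith)]
    linarith [h2.2]
  rw [ramp, mul_div_assoc]
  refine (abs_add_le _ _).trans (add_le_add_right ?_ _)
  rw [abs_mul]
  exact mul_le_of_le_one_right (abs_nonneg _) h3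

theorem ramp_affine {l r a b t u : ℤ} (hlr : l < r) (h : rampOk l r a b t u = true) {s : ℝ}
    (hs : s ∈ Icc (0 : ℝ) 1) : ramp l r a b (t + s * (u - t)) =
      rampZ l r a b t + s * (rampZ l r a b u - rampZ l r a b t) := by
  have hconv : ∀ x y : ℝ, (1 - s) * x + s * y = x + s * (y - x) := fun x y => by ring
  have h0 := sub_nonneg.2 hs.2
  rw [rampOk, decide_eq_true_eq] at h
  rcases h with ⟨h1, h2⟩ | ⟨h1, h2⟩ | ⟨⟨h1, h2⟩, ⟨h3, h4⟩, h5, h6⟩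
  · have h1' : (t : ℝ) ≤ l := by exact_mod_cast h1
    have h2' : (u : ℝ) ≤ l := by exact_mod_cast h2
    rw [ramp_of_le (by nlinarith [hs.1]), rampZ, rampZ, if_pos h1, if_pos h2]; simp
  · have h1' : (r : ℝ) ≤ t := by exact_mod_cast h1
    have h2' : (r : ℝ) ≤ u := by exact_mod_cast h2
    rw [ramp_of_ge hlr (by nlinarith [hs.1]), rampZ, rampZ, if_neg (show ¬t ≤ l by omega), if_neg (show ¬u ≤ l by omega),
      if_pos h1, if_pos h2]
    simp
  · have h1' : (l : ℝ) ≤ t := by exact_mod_cast h1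
    have h2' : (t : ℝ) ≤ r := by exact_mod_cast h2
    have h3' : (l : ℝ) ≤ u := by exact_mod_cast h3
    have h4' : (u : ℝ) ≤ r := by exact_mod_cast h4
    rw [rampZ_of_mem hlr h1 h2 h5, rampZ_of_mem hlr h3 h4 h6,
      ramp_of_mem ⟨by nlinarith [hs.1], by nlinarith [hs.1]⟩]
    ring

/-- The shear in the direction of the first axis. -/
noncomputable def shearX (l r a b : ℤ) (p : R3) : R3 := p + ramp l r a b p.2.1 • (1, 0, 0)

/-- The shear in the direction of the second axis. -/
noncomputable def shearY (l r a b : ℤ) (p : R3) : R3 := p + ramp l r a b p.1 • (0, 1, 0)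

def shearXZ (l r a b : ℤ) (p : ZPt) : ZPt := (p.1 + rampZ l r a b p.2.1, p.2)

def shearYZ (l r a b : ℤ) (p : ZPt) : ZPt := (p.1, p.2.1 + rampZ l r a b p.1, p.2.2)

theorem isotopic_shearX {l r : ℤ} (hlr : l < r) (a b : ℤ) (K : Set R3) :
    AmbientIsotopic K (shearX l r a b '' K) :=
  isotopic_slide (1, 0, 0) (g := fun p => ramp l r a b p.2.1)
    ((continuous_ramp l r a b).comp (by fun_prop)) (fun p => abs_ramp_le hlr p.2.1)
    (fun p x y h => by simpa using h) K

theorem isotopic_shearY {l r : ℤ} (hlr : l < r) (a b : ℤ) (K : Set R3) :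
    AmbientIsotopic K (shearY l r a b '' K) :=
  isotopic_slide (0, 1, 0) (g := fun p => ramp l r a b p.1)
    ((continuous_ramp l r a b).comp (by fun_prop)) (fun p => abs_ramp_le hlr p.1)
    (fun p x y h => by simpa using h) K

theorem image_shearX_edge {l r a b : ℤ} (hlr : l < r) (e : ZEdge)
    (h : rampOk l r a b e.1.2.1 e.2.2.1 = true) :
    shearX l r a b '' e.carrier = ZEdge.carrier (shearXZ l r a b e.1, shearXZ l r a b e.2) := by
  have e0 := ramp_affine hlr h (s := 0) (by norm_num)
  have e1 := ramp_affine hlr h (s := 1) (by norm_num)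
  simp only [zero_mul, add_zero, one_mul, add_sub_cancel] at e0 e1
  rw [ZEdge.carrier, image_segment_of_affine, ZEdge.carrier]
  · simp [shearX, shearXZ, ZPt.toR, e0, e1]
  · intro s hs
    have e2 := ramp_affine hlr h hs
    ext <;> simp [shearX, ZPt.toR, e0, e1, e2]
    ring

theorem image_shearY_edge {l r a b : ℤ} (hlr : l < r) (e : ZEdge)
    (h : rampOk l r a b e.1.1 e.2.1 = true) :
    shearY l r a b '' e.carrier = ZEdge.carrier (shearYZ l r a b e.1, shearYZ l r a b e.2) := by
  have e0 := ramp_affine hlr h (s := 0) (by norm_num)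
  have e1 := ramp_affine hlr h (s := 1) (by norm_num)
  simp only [zero_mul, add_zero, one_mul, add_sub_cancel] at e0 e1
  rw [ZEdge.carrier, image_segment_of_affine, ZEdge.carrier]
  · simp [shearY, shearYZ, ZPt.toR, e0, e1]
  · intro s hs
    have e2 := ramp_affine hlr h hs
    ext <;> simp [shearY, ZPt.toR, e0, e1, e2]
    ring

theorem image_shearX_paths {l r a b : ℤ} (hlr : l < r) {P : List (List ZPt)}
    (h : ((P.flatMap pathEdges).all fun e => rampOk l r a b e.1.2.1 e.2.2.1) = true) :
    shearX l r a b '' paths P = paths (P.map (List.map (shearXZ l r a b))) :=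
  image_paths (image_shearX_edge hlr) h

theorem image_shearY_paths {l r a b : ℤ} (hlr : l < r) {P : List (List ZPt)}
    (h : ((P.flatMap pathEdges).all fun e => rampOk l r a b e.1.1 e.2.1) = true) :
    shearY l r a b '' paths P = paths (P.map (List.map (shearYZ l r a b))) :=
  image_paths (image_shearY_edge hlr) h

/-! ### From the clasped model to the common model -/

/-- The polygonal part of the clasped model. -/
def claspFrame : List (List ZPt) :=
  [[(-24, -24, 0), (-32, -24, 0), (-36, 0, 24), (-40, 24, 0)], [(-80, 24, 0), (-88, 24, 0), (-88,
  48, 0), (24, 48, 0), (24, 24, 0), (0, 20, 24), (-24, 16, 0)], [(0, -24, 0), (0, 16, 0), (0, 24,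
  0), (-24, 36, 0), (-28, 24, 0), (-32, 0, 0), (-40, 0, 0), (-80, 0, 0), (-88, -24, 0), (-88,
  -48, 0), (24, -48, 0), (24, -36, 0), (0, -24, 0)]]

/-- Moves that make the legs of the clasped model steep or flat. -/
def prepareMoves : List ℤ :=
  [0, -24, -24, 0, -32, -24, 0, -36, 0, 24, 0, -80, 24, 0, -88, 24, 0, -88, 48, 0, 0, -80, 24, 0,
  -88, 48, 0, 24, 48, 0, 0, 24, 48, 0, 24, 24, 0, 0, 20, 24, 0, -28, 24, 0, -32, 0, 0, -40, 0, 0,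
  0, -80, 0, 0, -88, -24, 0, -88, -48, 0, 0, 24, -48, 0, 24, -36, 0, 0, -24, 0, 1, -80, 24, 0,
  -80, 60, 0, 24, 48, 0, 1, -80, 60, 0, 24, 60, 0, 24, 48, 0, 0, 24, 60, 0, 24, 48, 0, 0, 20, 24,
  1, -88, -48, 0, 0, -72, 0, 24, -48, 0, 0, 0, -72, 0, 24, -48, 0, 0, -24, 0, 1, -88, -48, 0,
  -88, -72, 0, 0, -72, 0, 0, -80, 0, 0, -88, -48, 0, -88, -72, 0, 1, -24, -24, 0, -32, -8, 16,
  -36, 0, 24, 1, -80, 60, 0, -32, 60, 0, 24, 60, 0, 1, -28, 24, 0, -32, 16, 0, -40, 0, 0, 1, -88,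
  -72, 0, -32, -72, 0, 0, -72, 0, 1, -24, -24, 0, -28, -16, 8, -32, -8, 16, 1, -32, 60, 0, -28,
  60, 0, 24, 60, 0, 1, -32, -72, 0, -28, -72, 0, 0, -72, 0]

/-- The clasped model before the horizontal box is lifted. -/
def preparedClasp : List (List ZPt) :=
  [[(-24, -24, 0), (-28, -16, 8), (-32, -8, 16), (-36, 0, 24), (-40, 24, 0)], [(-80, 24, 0),
  (-80, 60, 0), (-32, 60, 0), (-28, 60, 0), (24, 60, 0), (0, 20, 24), (-24, 16, 0)], [(0, -24,
  0), (0, 16, 0), (0, 24, 0), (-24, 36, 0), (-28, 24, 0), (-32, 16, 0), (-40, 0, 0), (-80, 0, 0),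
  (-88, -72, 0), (-32, -72, 0), (-28, -72, 0), (0, -72, 0), (0, -24, 0)]]

/-- Moves before the vertical box is turned. -/
def bendMoves : List ℤ :=
  [1, -32, 128, 0, -100, -80, 0, -28, -72, 0, 1, 24, 60, 0, 24, 264, 0, 0, 20, 24, 1, -28, -16,
  8, -60, -48, 0, -32, 192, 16, 0, -24, -24, 0, -28, -16, 8, -60, -48, 0, 0, 0, 24, 0, -24, 36,
  0, -28, 24, 0, 1, -32, 128, 0, -100, 120, 0, -100, -80, 0, 0, -28, 60, 0, 24, 60, 0, 24, 264,
  0, 0, -32, 260, 0, -28, 60, 0, 24, 264, 0, 1, -24, -24, 0, -24, -48, 0, -60, -48, 0, 0, 0, 24,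
  0, -28, 24, 0, -32, 216, 0, 1, 0, 24, 0, 0, 72, 0, -32, 216, 0, 0, -100, -80, 0, -28, -72, 0,
  0, -72, 0, 0, -80, 260, 0, -32, 260, 0, 24, 264, 0, 1, 0, 72, 0, -20, 216, 0, -32, 216, 0, 0,
  -88, 128, 0, -32, 128, 0, -100, 120, 0, 1, -60, -48, 0, -60, 72, 0, -32, 192, 16, 1, 24, 264,
  0, 24, 24, 0, 0, 20, 24, 0, -24, -48, 0, -60, -48, 0, -60, 72, 0, 1, -60, 72, 0, -32, 160, 0,
  -32, 192, 16, 0, -24, -48, 0, -60, 72, 0, -32, 160, 0, 1, -80, 200, 0, -140, 200, 0, -88, 128,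
  0, 0, 0, 72, 0, -20, 216, 0, -32, 216, 0, 1, -100, 120, 0, -140, -72, 0, -100, -80, 0, 0, -140,
  -72, 0, -100, -80, 0, 0, -72, 0, 0, -88, 128, 0, -100, 120, 0, -140, -72, 0, 0, 0, 24, 0, 0,
  72, 0, -32, 216, 0, 1, 24, 264, 0, 24, 260, 0, 24, 24, 0, 1, 0, 24, 0, 0, 192, 0, -32, 216, 0,
  0, -80, 260, 0, 24, 264, 0, 24, 260, 0, 0, -32, 160, 0, -32, 192, 16, -36, 200, 24, 1, -24,
  -48, 0, -100, -48, 0, -32, 160, 0, 0, -140, 200, 0, -88, 128, 0, -140, -72, 0, 1, -100, -48, 0,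
  -100, 120, 0, -32, 160, 0, 1, -100, -48, 0, -100, -24, 0, -100, 120, 0, 1, -140, 200, 0, -140,
  -24, 0, -140, -72, 0, 1, -100, -24, 0, -100, 24, 0, -100, 120, 0, 1, -140, 200, 0, -140, 24, 0,
  -140, -24, 0, 1, -24, -48, 0, -72, -48, 0, -100, -48, 0, 1, -80, 260, 0, -24, 260, 0, 24, 260,
  0, 1, 0, 192, 0, -24, 210, 0, -32, 216, 0, 1, -140, -72, 0, -72, -72, 0, 0, -72, 0, 1, 0, -72,
  0, 0, -48, 0, 0, -24, 0, 1, -100, 24, 0, -100, 72, 0, -100, 120, 0, 1, 0, 24, 0, 0, 48, 0, 0,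
  192, 0, 1, -140, 200, 0, -140, 72, 0, -140, 24, 0, 1, -100, 72, 0, -100, 88, 0, -100, 120, 0,
  1, 24, 260, 0, 24, 40, 0, 24, 24, 0, 1, 0, 48, 0, 0, 64, 0, 0, 192, 0, 1, -140, 200, 0, -140,
  88, 0, -140, 72, 0]

/-- The clasped model before the vertical box is turned. -/
def bentClasp : List (List ZPt) :=
  [[(-24, -24, 0), (-24, -48, 0), (-72, -48, 0), (-100, -48, 0), (-100, -24, 0), (-100, 24, 0),
  (-100, 72, 0), (-100, 88, 0), (-100, 120, 0), (-32, 160, 0), (-36, 200, 24), (-40, 224, 0)],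
  [(-80, 224, 0), (-80, 260, 0), (-24, 260, 0), (24, 260, 0), (24, 40, 0), (24, 24, 0), (0, 20,
  24), (-24, 16, 0)], [(0, -24, 0), (0, 16, 0), (0, 24, 0), (0, 48, 0), (0, 64, 0), (0, 192, 0),
  (-24, 210, 0), (-32, 216, 0), (-40, 200, 0), (-80, 200, 0), (-140, 200, 0), (-140, 88, 0),
  (-140, 72, 0), (-140, 24, 0), (-140, -24, 0), (-140, -72, 0), (-72, -72, 0), (0, -72, 0), (0,
  -48, 0), (0, -24, 0)]]

/-- Moves after the vertical box is turned. -/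
def unfoldMoves : List ℤ :=
  [0, 120, 24, 0, 120, 48, 0, 72, 96, 0, 0, 120, 24, 0, 72, 96, 0, 44, 96, 0, 0, 120, 24, 0, 44,
  96, 0, 44, 72, 0, 0, 44, 72, 0, -4, 24, 0, -52, -24, 0, 0, 44, 72, 0, -52, -24, 0, -20, -40, 0,
  0, 44, 72, 0, -20, -40, 0, -20, -72, 0, 0, 44, 72, 0, -20, -72, 0, 48, -112, 0, 0, 44, 72, 0,
  48, -112, 0, 44, -152, -24, 0, 0, -176, 0, 0, -212, 0, 56, -212, 0, 0, 0, -176, 0, 56, -212, 0,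
  104, -260, 0, 0, 80, 0, 0, 72, 0, 0, 48, -24, 0, 0, 48, -24, 0, 80, -40, 0, 80, -168, 0, 0, 48,
  -24, 0, 80, -168, 0, 56, -162, 0, 0, 48, -24, 0, 56, -162, 0, 48, -168, 0, 0, 48, -24, 0, 48,
  -168, 0, 40, -152, 0, 0, 0, -152, 0, -60, -152, 0, -60, -40, 0, 0, 0, -152, 0, -60, -40, 0,
  -92, -24, 0, 0, 0, -152, 0, -92, -24, 0, -44, 24, 0, 0, -44, 24, 0, 4, 72, 0, 4, 120, 0, 0,
  -44, 24, 0, 4, 120, 0, 72, 120, 0, 0, 72, 120, 0, 144, 48, 0, 144, 24, 0, 0, 104, -260, 0, 104,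
  -40, 0, 72, -24, 0, 0, 104, -260, 0, 72, -24, 0, 76, 0, -24, 0, 80, 0, 0, 48, -24, 0, 40, -152,
  0, 1, 120, 24, 0, 64, 96, 0, 44, 72, 0, 1, 64, 96, 0, 48, 96, 0, 44, 72, 0, 0, 48, 96, 0, 44,
  72, 0, 44, -152, -24, 1, 80, 0, 0, 48, -152, 0, 40, -152, 0, 1, -44, 24, 0, 48, 120, 0, 72,
  120, 0, 1, 48, 96, 0, 48, -130, 0, 44, -152, -24, 1, -44, 24, 0, -60, 72, 0, 48, 120, 0, 1, 72,
  120, 0, 144, 48, 0, 144, 24, 0, 0, 144, 48, 0, 144, 24, 0, 120, 0, 0, 1, -44, 24, 0, -60, -152,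
  0, -60, 72, 0, 1, 0, -176, 0, 48, -212, 0, 104, -260, 0, 1, 0, -176, 0, 0, -212, 0, 48, -212,
  0, 1, 48, 96, 0, -20, 24, 0, 48, -130, 0, 0, 48, 120, 0, 72, 120, 0, 144, 48, 0, 1, 48, 120, 0,
  64, 120, 0, 144, 48, 0, 0, 0, -152, 0, -44, 24, 0, -60, -152, 0, 1, 80, 0, 0, 64, 0, 0, 48,
  -152, 0, 1, 104, -260, 0, 72, -24, 0, 76, 0, -24, 1, -20, 24, 0, -20, -110, 0, 48, -130, 0, 1,
  104, -260, 0, 64, -60, 0, 72, -24, 0, 0, 48, -212, 0, 104, -260, 0, 64, -60, 0]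

/-- The clasped model before the boxes are aligned. -/
def unfoldedClasp : List (List ZPt) :=
  [[(120, 24, 0), (64, 96, 0), (48, 96, 0), (-20, 24, 0), (-20, -110, 0), (48, -130, 0), (44,
  -152, -24), (40, -176, 0)], [(0, -176, 0), (0, -212, 0), (48, -212, 0), (64, -60, 0), (72, -24,
  0), (76, 0, -24), (80, 24, 0)], [(120, 0, 0), (80, 0, 0), (64, 0, 0), (48, -152, 0), (40, -152,
  0), (0, -152, 0), (-60, -152, 0), (-60, 72, 0), (48, 120, 0), (64, 120, 0), (144, 48, 0), (120,
  0, 0)]]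

/-- Moves from the aligned boxes to the common model. -/
def alignMoves : List ℤ :=
  [0, 64, 96, 0, 48, 248, 0, -20, 176, 0, 0, 64, 96, 0, -20, 176, 0, -20, 42, 0, 0, 64, 96, 0,
  -20, 42, 0, 48, 22, 0, 0, 64, 96, 0, 48, 22, 0, 44, 0, -24, 0, 0, -24, 0, 0, -60, 0, 48, -60,
  0, 0, 0, -24, 0, 48, -60, 0, 64, -60, 0, 0, 64, -60, 0, 72, -24, 0, 76, 0, -24, 0, 80, 0, 0,
  64, 0, 0, 48, 0, 0, 0, 80, 0, 0, 48, 0, 0, 40, 0, 0, 0, 0, 0, 0, -60, 0, 0, -60, 224, 0, 0,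
  -60, 224, 0, 48, 272, 0, 64, 120, 0, 0, -60, 224, 0, 64, 120, 0, 144, 48, 0, 1, -60, 224, 0,
  400, 48, 100, 144, 48, 0, 0, 400, 48, 100, 144, 48, 0, 120, 0, 0, 1, 0, 0, 0, -300, 224, 100,
  -60, 224, 0, 0, -300, 224, 100, -60, 224, 0, 400, 48, 100, 1, -300, 224, 100, 400, 0, 100, 400,
  48, 100, 0, 400, 0, 100, 400, 48, 100, 120, 0, 0, 1, 0, 0, 0, -300, 0, 100, -300, 224, 100, 0,
  -300, 0, 100, -300, 224, 100, 400, 0, 100, 1, -300, 0, 100, 192, 0, 46, 400, 0, 100, 0, 192, 0,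
  46, 400, 0, 100, 120, 0, 0, 1, 0, 0, 0, -144, 0, 24, -300, 0, 100, 0, -144, 0, 24, -300, 0,
  100, 192, 0, 46, 1, 64, 96, 0, 72, 24, 0, 44, 0, -24, 1, 0, -24, 0, 48, -27, 0, 64, -60, 0, 0,
  48, -27, 0, 64, -60, 0, 76, 0, -24, 1, 120, 24, 0, 120, 27, 0, 64, 96, 0, 0, 120, 27, 0, 64,
  96, 0, 72, 24, 0]

/-- The half turn about the first axis, followed by a translation. -/
def turnOver (p : R3) : R3 := (p.1 + 48, -p.2.1, -p.2.2)

def turnOverZ (p : ZPt) : ZPt := (p.1 + 48, -p.2.1, -p.2.2)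

theorem isotopic_turnOver (K : Set R3) : AmbientIsotopic K (turnOver '' K) := by
  have h1 := isotopic_twist (φ := fun _ _ => Real.pi) continuous_const K
  have h2 := h1.trans (isotopic_translate (48, 0, 0) _)
  rw [image_image] at h2
  convert h2 using 2
  ext <;> simp [turnOver, rotX]

theorem image_turnOver_paths (P : List (List ZPt)) :
    turnOver '' paths P = paths (P.map (List.map turnOverZ)) := by
  refine image_paths (ok := fun _ => true) (fun e _ => ?_) (by simp)
  rw [ZEdge.carrier, image_segment_of_affine, ZEdge.carrier]
  · simp [turnOver, turnOverZ, ZPt.toR]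
  · intro s _
    ext <;> simp [turnOver] <;> ring

/-- The helix around the second coordinate axis. -/
noncomputable def uprightHelix (m : ℕ) : Set R3 :=
  (fun s : ℝ => ((-(24 * Real.cos (Real.pi * (2 * m) * s)), 16 - 40 * s,
    -(24 * Real.sin (Real.pi * (2 * m) * s))) : R3)) '' Icc 0 1

/-- Two clasped twist regions, one around each of the first two coordinate axes. -/
noncomputable def claspModel (m n : ℕ) : Set R3 :=
  (helix (-80) 40 24 0 (2 * n) ∪ uprightHelix m) ∪ paths claspFrame

def claspBoxes (y : ℤ) : List ZEdge :=
  [((-80, y - 24, -24), (-40, y + 24, 24)), ((-24, -24, -24), (24, 16, 24))]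

/-- A helix over `x₀ ≤ x ≤ x₀ + 40` around the axis `y = y₀`. -/
noncomputable def shiftedHelix (x₀ y₀ φ k : ℝ) : Set R3 :=
  (fun s => helixPt x₀ 40 24 φ k s + (0, y₀, 0)) '' Icc 0 1

theorem shiftedHelix_zero (x₀ φ k : ℝ) : shiftedHelix x₀ 0 φ k = helix x₀ 40 24 φ k := by
  rw [shiftedHelix, helix]
  exact image_congr fun s _ => by simp

theorem mem_box_of_mem_shiftedHelix {x₀ y₀ : ℤ} {φ k : ℝ} {p : R3} (hp : p ∈ shiftedHelix x₀ y₀ φ k) :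
    p ∈ ZEdge.box ((x₀, y₀ - 24, -24), (x₀ + 40, y₀ + 24, 24)) := by
  obtain ⟨s, hs, rfl⟩ := hp
  have := mem_box_of_mem_helix (by norm_num) (by norm_num)
    (mem_image_of_mem (helixPt x₀ 40 24 φ k) hs)
  simp only [ZEdge.box, mem_ofPred_eq, Prod.fst_add, Prod.snd_add]
  push_cast
  simp only [add_zero]
  refine ⟨⟨this.1.1, this.1.2⟩, ⟨?_, ?_⟩, ⟨?_, ?_⟩⟩ <;> linarith [this.2.1.1, this.2.1.2, this.2.2.1, this.2.2.2]

theorem mem_box_of_mem_uprightHelix {m : ℕ} {p : R3} (hp : p ∈ uprightHelix m) :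
    p ∈ ZEdge.box ((-24, -24, -24), (24, 16, 24)) := by
  obtain ⟨s, hs, rfl⟩ := hp
  simp only [ZEdge.box, mem_ofPred_eq]
  push_cast
  set θ := Real.pi * (2 * m) * s
  refine ⟨⟨?_, ?_⟩, ⟨?_, ?_⟩, ⟨?_, ?_⟩⟩ <;>
    linarith [Real.cos_le_one θ, Real.neg_one_le_cos θ, Real.sin_le_one θ, Real.neg_one_le_sin θ, hs.1, hs.2]

theorem clasp_subset_boxes (y : ℤ) (φ k : ℝ) (m : ℕ) :
    shiftedHelix ((-80 : ℤ) : ℝ) y φ k ∪ uprightHelix m ⊆ boxes (claspBoxes y) := by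
  rintro p (hp | hp)
  · exact ⟨_, List.mem_cons_self .., mem_box_of_mem_shiftedHelix hp⟩
  · exact ⟨_, List.mem_cons_of_mem _ (List.mem_cons_self ..), mem_box_of_mem_uprightHelix hp⟩

theorem unfolded_subset_boxes (φ k φ' k' : ℝ) :
    shiftedHelix ((0 : ℤ) : ℝ) ((-152 : ℤ) : ℝ) φ k ∪ shiftedHelix ((80 : ℤ) : ℝ) ((0 : ℤ) : ℝ) φ' k' ⊆
      boxes [((0, -152 - 24, -24), (0 + 40, -152 + 24, 24)),
        ((80, 0 - 24, -24), (80 + 40, 0 + 24, 24))] := by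
  rintro p (hp | hp)
  · exact ⟨_, List.mem_cons_self .., mem_box_of_mem_shiftedHelix hp⟩
  · exact ⟨_, List.mem_cons_of_mem _ (List.mem_cons_self ..), mem_box_of_mem_shiftedHelix hp⟩

theorem checkMoves_prepare :
    checkMoves (claspBoxes 0) prepareMoves claspFrame preparedClasp = true := by decide +kernel

theorem checkMoves_bend : checkMoves (claspBoxes 200) bendMoves
    (preparedClasp.map (List.map (shearYZ (-32) (-28) 200 0))) bentClasp = true := by decide +kernel

/-- The vertices of the clasped model after the vertical box is turned. -/
def turnBoxZ (p : ZPt) : ZPt :=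
  turnOverZ (shearXZ 24 40 0 32 (shearXZ (-24) 24 48 0 (shearYZ (-24) 72 (-48) 48
    (shearXZ (-24) 24 48 0 p))))

/-- On the box of the vertical helix the first three shears compose to the quarter turn `(x, y) ↦
(48 - y, x)`. The fourth moves only points with second coordinate above `24` and makes up the
horizontal position of the other helix. -/
noncomputable def turnBox (p : R3) : R3 :=
  turnOver (shearX 24 40 0 32 (shearX (-24) 24 48 0 (shearY (-24) 72 (-48) 48
    (shearX (-24) 24 48 0 p))))

theorem checkMoves_unfold : checkMoves [((0, -152 - 24, -24), (0 + 40, -152 + 24, 24)),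
    ((80, 0 - 24, -24), (80 + 40, 0 + 24, 24))] unfoldMoves
    (bentClasp.map (List.map turnBoxZ)) unfoldedClasp = true := by decide +kernel

theorem checkMoves_align : checkMoves helixBoxes alignMoves
    (unfoldedClasp.map (List.map (shearYZ 48 64 152 0))) commonFrame = true := by decide +kernel

theorem isotopic_turnBox (K : Set R3) : AmbientIsotopic K (turnBox '' K) := by
  have := (isotopic_shearX (show (-24 : ℤ) < 24 by norm_num) 48 0 K).trans
    ((isotopic_shearY (show (-24 : ℤ) < 72 by norm_num) (-48) 48 _).trans
    ((isotopic_shearX (show (-24 : ℤ) < 24 by norm_num) 48 0 _).trans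
    ((isotopic_shearX (show (24 : ℤ) < 40 by norm_num) 0 32 _).trans (isotopic_turnOver _))))
  simp only [image_image] at this
  exact this

theorem image_turnBox_bentClasp :
    turnBox '' paths bentClasp = paths (bentClasp.map (List.map turnBoxZ)) := by
  have e : turnBox '' paths bentClasp = turnOver '' (shearX 24 40 0 32 '' (shearX (-24) 24 48 0 ''
      (shearY (-24) 72 (-48) 48 '' (shearX (-24) 24 48 0 '' paths bentClasp)))) := by
    simp only [image_image]
    rfl
  rw [e, image_shearX_paths (by norm_num) (by decide +kernel),
    image_shearY_paths (by norm_num) (by decide +kernel),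
    image_shearX_paths (by norm_num) (by decide +kernel),
    image_shearX_paths (by norm_num) (by decide +kernel), image_turnOver_paths]
  simp only [List.map_map, Function.comp_def]
  rfl

theorem image_turnBox_upright (m : ℕ) :
    turnBox '' uprightHelix m = shiftedHelix ((80 : ℤ) : ℝ) ((0 : ℤ) : ℝ) 0 (2 * m) := by
  rw [uprightHelix, shiftedHelix, image_image]
  refine image_congr fun s hs => ?_
  set θ := Real.pi * (2 * m) * s
  have c1 := Real.cos_le_one θ
  have c2 := Real.neg_one_le_cos θ
  have hx1 : shearX (-24) 24 48 0 (-(24 * Real.cos θ), 16 - 40 * s, -(24 * Real.sin θ)) =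
      (8 + 40 * s - 24 * Real.cos θ, 16 - 40 * s, -(24 * Real.sin θ)) := by
    simp only [shearX]
    rw [ramp_of_mem ⟨by push_cast; linarith [hs.2], by push_cast; linarith [hs.1]⟩]
    ext <;> simp
    ring
  have hx2 : shearY (-24) 72 (-48) 48 (8 + 40 * s - 24 * Real.cos θ, 16 - 40 * s, -(24 * Real.sin θ)) =
      (8 + 40 * s - 24 * Real.cos θ, -(24 * Real.cos θ), -(24 * Real.sin θ)) := by
    simp only [shearY]
    rw [ramp_of_mem ⟨by push_cast; linarith [hs.1], by push_cast; linarith [hs.2]⟩]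
    ext <;> simp
    ring
  have hx3 : shearX (-24) 24 48 0 (8 + 40 * s - 24 * Real.cos θ, -(24 * Real.cos θ), -(24 * Real.sin θ)) =
      (32 + 40 * s, -(24 * Real.cos θ), -(24 * Real.sin θ)) := by
    simp only [shearX]
    rw [ramp_of_mem ⟨by push_cast; linarith, by push_cast; linarith⟩]
    ext <;> simp
    ring
  have hx4 : shearX 24 40 0 32 (32 + 40 * s, -(24 * Real.cos θ), -(24 * Real.sin θ)) =
      (32 + 40 * s, -(24 * Real.cos θ), -(24 * Real.sin θ)) := by
    simp only [shearX]
    rw [ramp_of_le (by push_cast; linarith)]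
    simp
  simp only [turnBox, hx1, hx2, hx3, hx4, turnOver, helixPt]
  ext <;> simp
  · ring
  · rfl
  · rfl

theorem image_turnBox_shifted (k : ℝ) :
    turnBox '' shiftedHelix ((-80 : ℤ) : ℝ) ((200 : ℤ) : ℝ) 0 k =
      shiftedHelix ((0 : ℤ) : ℝ) ((-152 : ℤ) : ℝ) Real.pi k := by
  rw [shiftedHelix, shiftedHelix, image_image]
  refine image_congr fun s hs => ?_
  simp only [helixPt, zero_add, Prod.mk_add_mk, add_zero]
  set θ := Real.pi * k * s
  have c1 := Real.cos_le_one θ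
  have c2 := Real.neg_one_le_cos θ
  have hx1 : shearX (-24) 24 48 0 (((-80 : ℤ) : ℝ) + 40 * s, 24 * Real.cos θ + ((200 : ℤ) : ℝ),
      24 * Real.sin θ) = (-80 + 40 * s, 24 * Real.cos θ + 200, 24 * Real.sin θ) := by
    simp only [shearX]
    rw [ramp_of_ge (by norm_num) (by push_cast; linarith)]
    simp
  have hx2 : shearY (-24) 72 (-48) 48 (-80 + 40 * s, 24 * Real.cos θ + 200, 24 * Real.sin θ) =
      (-80 + 40 * s, 24 * Real.cos θ + 152, 24 * Real.sin θ) := by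
    simp only [shearY]
    rw [ramp_of_le (by push_cast; linarith [hs.2])]
    ext <;> simp
    ring
  have hx3 : shearX (-24) 24 48 0 (-80 + 40 * s, 24 * Real.cos θ + 152, 24 * Real.sin θ) =
      (-80 + 40 * s, 24 * Real.cos θ + 152, 24 * Real.sin θ) := by
    simp only [shearX]
    rw [ramp_of_ge (by norm_num) (by push_cast; linarith)]
    simp
  have hx4 : shearX 24 40 0 32 (-80 + 40 * s, 24 * Real.cos θ + 152, 24 * Real.sin θ) =
      (-48 + 40 * s, 24 * Real.cos θ + 152, 24 * Real.sin θ) := by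
    simp only [shearX]
    rw [ramp_of_ge (by norm_num) (by push_cast; linarith)]
    ext <;> simp
    ring
  simp only [turnBox, hx1, hx2, hx3, hx4, turnOver]
  rw [add_comm Real.pi, Real.cos_add_pi, Real.sin_add_pi]
  ext <;> simp
  ring

theorem image_shearY_shifted {l r a b : ℤ} {x₀ y₀ y₁ φ k : ℝ}
    (h : ∀ s ∈ Icc (0 : ℝ) 1, y₀ + ramp l r a b (x₀ + 40 * s) = y₁) :
    shearY l r a b '' shiftedHelix x₀ y₀ φ k = shiftedHelix x₀ y₁ φ k := by
  rw [shiftedHelix, shiftedHelix, image_image]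
  refine image_congr fun s hs => ?_
  rw [← h s hs]
  ext <;> simp [shearY, helixPt]
  ring

/-- The box of the horizontal helix is lifted by `200` so that the vertical one has room to turn.
After the quarter turn both helices run in the first direction, and a last shear brings their axes
into line. All frames between these maps are adjusted by checked moves. -/
theorem isotopic_claspModel_commonModel (m n : ℕ) :
    AmbientIsotopic (claspModel m n) (commonModel m n) := by
  have e0 : claspModel m n =
      (shiftedHelix ((-80 : ℤ) : ℝ) ((0 : ℤ) : ℝ) 0 (2 * n) ∪ uprightHelix m) ∪ paths claspFrame := by
    rw [claspModel, ← shiftedHelix_zero]; norm_num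
  rw [e0]
  refine (isotopic_of_checkMoves (clasp_subset_boxes 0 _ _ _) checkMoves_prepare).trans ?_
  refine (isotopic_shearY (show (-32 : ℤ) < -28 by norm_num) 200 0 _).trans ?_
  have e1 : shearY (-32) (-28) 200 0 '' uprightHelix m = uprightHelix m := by
    rw [uprightHelix, image_image]
    refine image_congr fun s hs => ?_
    simp only [shearY]
    rw [ramp_of_ge (by norm_num) (by
      push_cast; linarith [Real.cos_le_one (Real.pi * (2 * m) * s)])]
    simp
  rw [image_union, image_union, image_shearY_paths (by norm_num) (by decide +kernel), e1,
    image_shearY_shifted (y₁ := ((200 : ℤ) : ℝ)) (fun s hs => by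
      rw [ramp_of_le (by push_cast; linarith [hs.2])]; norm_num)]
  refine (isotopic_of_checkMoves (clasp_subset_boxes 200 _ _ _) checkMoves_bend).trans ?_
  refine (isotopic_turnBox _).trans ?_
  rw [image_union, image_union, image_turnBox_bentClasp, image_turnBox_upright, image_turnBox_shifted]
  refine (isotopic_of_checkMoves (unfolded_subset_boxes _ _ _ _) checkMoves_unfold).trans ?_
  refine (isotopic_shearY (show (48 : ℤ) < 64 by norm_num) 152 0 _).trans ?_
  rw [image_union, image_union, image_shearY_paths (by norm_num) (by decide +kernel),
    image_shearY_shifted (y₁ := 0) (fun s hs => by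
      rw [ramp_of_le (by push_cast; linarith [hs.2])]; norm_num),
    image_shearY_shifted (y₁ := 0) (fun s hs => by
      rw [ramp_of_ge (by norm_num) (by push_cast; linarith [hs.1])]; norm_num),
    shiftedHelix_zero, shiftedHelix_zero]
  push_cast
  exact isotopic_of_checkMoves (helices_subset_boxes _ _ _ _) checkMoves_align

/-! ### Pulling one underpass to the second axis -/

theorem underPt_swept (q : ℕ) {y t : ℝ} (ht : t ∈ Icc (0 : ℝ) 1) (hy : y ∈ Icc (-36 : ℝ) 36) :
    (underPt q (-1) y + t • (axisPt y - underPt q (-1) y)).1 ∈ Icc (-24) 24 ∧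
      (24 ≤ y → (underPt q (-1) y + t • (axisPt y - underPt q (-1) y)).1 ≤ 0) := by
  have h := cosMul_sq_add_sinMul_sq q (y / 24)
  have hC : |cosMul q (y / 24)| ≤ 1 := by
    rw [← sq_le_one_iff_abs_le_one]; nlinarith [sq_nonneg (sinMul q (y / 24))]
  have hC := abs_le.1 hC
  have hτ : -24 ≤ (axisPt y).1 ∧ (axisPt y).1 ≤ 24 := by
    rcases le_total 24 y with h | h
    · rw [axisPt_top h hy.2]; simp only; constructor <;> linarith [hy.2]
    · rcases le_total y (-24) with h' | h'
      · rw [axisPt_bottom hy.1 h']; simp only; constructor <;> linarith [hy.1]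
      · rw [axisPt_mid h' h]; norm_num
  have hσ : (underPt q (-1) y).1 = -24 * cosMul q (y / 24) := by simp [underPt]
  simp only [Prod.fst_add, Prod.smul_fst, Prod.fst_sub, smul_eq_mul]
  refine ⟨⟨?_, ?_⟩, fun h => ?_⟩
  · rw [hσ]; nlinarith [ht.1, ht.2]
  · rw [hσ]; nlinarith [ht.1, ht.2]
  · rw [underPt_of_ge q _ h, axisPt_top h hy.2]; simp only; nlinarith [ht.1, ht.2]

/-- The bound is adapted to the hook at the upper end: the displacement has to vanish linearly at `y
= 36`, where the hook meets the strand. -/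
theorem norm_axisPt_sub {q : ℕ} (hq : Odd q) {y : ℝ} (hy : y ∈ Icc (-36 : ℝ) 36) :
    ‖axisPt y - underPt q (-1) y‖ ≤ 2 * (36 - y) := by
  rcases le_total 24 y with h | h
  · rw [underPt_of_ge q _ h, axisPt_top h hy.2, norm_eq_max]
    simp only [Prod.fst_sub, Prod.snd_sub, max_le_iff, abs_le]
    refine ⟨⟨?_, ?_⟩, ⟨?_, ?_⟩, ?_, ?_⟩ <;> linarith [hy.2]
  · rcases le_total y (-24) with h' | h'
    · rw [underPt_of_le hq _ h', axisPt_bottom hy.1 h', norm_eq_max]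
      simp only [Prod.fst_sub, Prod.snd_sub, max_le_iff, abs_le]
      refine ⟨⟨?_, ?_⟩, ⟨?_, ?_⟩, ?_, ?_⟩ <;> linarith [hy.1]
    · have h1 : |cosMul q (y / 24)| ≤ 1 := Real.abs_cos_le_one _
      have h2 : |sinMul 1 (y / 24) * sinMul q (y / 24)| ≤ 1 := by
        rw [abs_mul]
        exact mul_le_one₀ (Real.abs_sin_le_one _) (abs_nonneg _) (Real.abs_sin_le_one _)
      have h1 := abs_le.1 h1
      have h2 := abs_le.1 h2
      rw [axisPt_mid h' h, underPt, norm_eq_max]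
      simp only [Prod.fst_sub, Prod.snd_sub, max_le_iff, abs_le]
      refine ⟨⟨?_, ?_⟩, ⟨?_, ?_⟩, ?_, ?_⟩ <;> linarith

/-- The other underpass is antipodal to the moving one about the second axis, so contraction cannot
make them meet. The bands and the frame lie outside the swept region. The hook meets the strand at
an end and is handled by a wall. -/
theorem isotopic_axisPt {q : ℕ} (hq : Odd q) (n : ℕ) :
    AmbientIsotopic
      ((underArc q 1 ∪ (bands n ∪ paths restFrame) ∪ paths hookFrame ∪ paths footFrame) ∪
        underPt q (-1) '' Icc (-36) 36)
      ((underArc q 1 ∪ (bands n ∪ paths restFrame) ∪ paths hookFrame ∪ paths footFrame) ∪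
        axisPt '' Icc (-36) 36) := by
  have e1 : underPt q (-1) (-36) = axisPt (-36) := by
    rw [underPt_of_le hq _ (by norm_num), axisPt_bottom (by norm_num) (by norm_num)]; norm_num
  have e2 : underPt q (-1) 36 = axisPt 36 := by
    rw [underPt_of_ge q _ (by norm_num), axisPt_top (by norm_num) (by norm_num)]; norm_num
  have hlam : ∀ p : R3, dotL (0, 1, 0) p = p.2.1 := by simp
  refine isotopic_move (lam := dotL (0, 1, 0)) (by norm_num) (by fun_prop) (by fun_prop)
    (by simp [underPt]) (by simp [axisPt]) e1 e2 (((Clear.union ?_ ?_).union ?_).union ?_)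
  · refine clear_of_compact (by fun_prop) (by fun_prop) (isCompact_underArc q 1) ?_
    rintro _ ⟨y, hy, rfl⟩ - t ht h
    rw [hlam] at h
    simp only at h
    rw [axisPt_mid hy.1 hy.2] at h
    simp only [underPt, Prod.ext_iff, Prod.fst_add, Prod.snd_add, Prod.smul_fst,
      Prod.smul_snd, Prod.fst_sub, Prod.snd_sub, smul_eq_mul] at h
    obtain ⟨h1, -, h3⟩ := h
    have h5 := cosMul_sq_add_sinMul_sq q (y / 24)
    have h8 := sinMul_eq_zero q (c := y / 24)
    set C := cosMul q (y / 24)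
    set S := sinMul q (y / 24)
    set w := sinMul 1 (y / 24)
    have h9 : (2 - t) ≠ 0 := by linarith [ht.2]
    have h10 : C = 0 := (mul_eq_zero.1 (show (2 - t) * C = 0 by linear_combination (1 / 24) * h1)).resolve_left h9
    have h11 : w * S = 0 :=
      (mul_eq_zero.1 (show (2 - t) * (w * S) = 0 by linear_combination (1 / 24) * h3)).resolve_left h9
    have h12 : S = 0 := (mul_eq_zero.1 h11).elim h8 id
    rw [h10, h12] at h5
    norm_num at h5
  · refine clear_of_compact (by fun_prop) (by fun_prop) ((isCompact_bands n).union (isCompact_paths _)) ?_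
    have key : ∀ p ∈ bands n ∪ paths restFrame, p.1 ≤ -28 ∨ (p.2.1 < -36 ∨ 36 < p.2.1) ∨
        (24 ≤ p.1 ∧ 24 ≤ p.2.1) ∨ (p.1 ≤ -24 ∧ p.2.1 = -24) := by
      rintro p (hp | hp)
      · exact Or.inl (bands_bound hp).1.2
      · revert p
        refine forall_mem_paths (ok := fun e => decide ((e.1.1 ≤ -28 ∧ e.2.1 ≤ -28) ∨
          (e.1.2.1 ≤ -37 ∧ e.2.2.1 ≤ -37) ∨ (37 ≤ e.1.2.1 ∧ 37 ≤ e.2.2.1) ∨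
          ((24 ≤ e.1.1 ∧ 24 ≤ e.2.1) ∧ (24 ≤ e.1.2.1 ∧ 24 ≤ e.2.2.1)) ∨
          ((e.1.1 ≤ -24 ∧ e.2.1 ≤ -24) ∧ (e.1.2.1 ≤ -24 ∧ e.2.2.1 ≤ -24) ∧
            (-24 ≤ e.1.2.1 ∧ -24 ≤ e.2.2.1)))) (by decide +kernel) fun e he p hp => ?_
        rw [decide_eq_true_eq] at he
        obtain ⟨c1, c2, c3, c4, -⟩ := coord_of_mem_carrier hp
        rcases he with h | h | h | ⟨h, h'⟩ | ⟨h, h', h''⟩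
        · left; simpa using c1 (-28) h.1 h.2
        · have := c3 (-37) h.1 h.2
          push_cast at this
          right; left; left; linarith
        · have := c4 37 h.1 h.2
          push_cast at this
          right; left; right; linarith
        · right; right; left
          exact ⟨by simpa using c2 24 h.1 h.2, by simpa using c4 24 h'.1 h'.2⟩
        · right; right; right
          exact ⟨by simpa using c1 (-24) h.1 h.2,
            le_antisymm (by simpa using c3 (-24) h'.1 h'.2) (by simpa using c4 (-24) h''.1 h''.2)⟩
    intro p hp hy t ht h
    rw [hlam] at hy h
    obtain ⟨h1, h2⟩ := underPt_swept q ht hy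
    rcases key p hp with h3 | h3 | h3 | h3
    · rw [← h] at h1; linarith [h1.1]
    · rcases h3 with h3 | h3
      · linarith [hy.1]
      · linarith [hy.2]
    · have := h2 h3.2
      rw [← h] at this
      linarith
    · rw [h3.2, underPt_of_le hq _ (by norm_num), axisPt_mid (by norm_num) (by norm_num)] at h
      have := congrArg Prod.fst h
      simp at this
      linarith [ht.2]
  -- The wall contains the hook itself; the strand has `x ≥ -24`, so its height above the wall is at
  -- least `36 - y`, half of the displacement bound.
  · refine clear_of_wall (dotL (3, -1, 0)) (-108) (C := 1 / 2) (by norm_num) ?_ ?_ ?_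
    · intro p hp _
      revert p
      refine forall_mem_paths (ok := fun e => decide (3 * e.1.1 - e.1.2.1 ≤ -108 ∧ 3 * e.2.1 - e.2.2.1 ≤ -108))
        (by decide +kernel) fun e he p hp _ => ?_
      rw [decide_eq_true_eq] at he
      simpa [ZPt.toR] using dotL_le_of_mem_carrier (w := (3, -1, 0)) (k := -108)
        (by simp only [ZPt.dot]; linarith) (by simp only [ZPt.dot]; linarith) hp
    · intro y hy
      refine (mul_le_mul_of_nonneg_left (norm_axisPt_sub hq hy) (by norm_num)).trans ?_
      have h1 := (underPt_swept q (t := 0) (by norm_num) hy).1.1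
      have h2 : (underPt q (-1) y).2.1 = y := rfl
      have h3 : (underPt q (-1) y).1 ≥ -24 := by simpa using h1
      simp only [dotL_apply, h2]
      linarith
    · intro y hy
      refine (mul_le_mul_of_nonneg_left (norm_axisPt_sub hq hy) (by norm_num)).trans ?_
      have h1 := (underPt_swept q (t := 1) (by norm_num) hy).1.1
      have h2 : (axisPt y).2.1 = y := rfl
      have h3 : (axisPt y).1 ≥ -24 := by simpa using h1
      simp only [dotL_apply, h2]
      linarith
  · refine clear_of_outside e1 e2 fun p hp => Or.inl ?_
    revert p
    refine forall_mem_paths (ok := fun e => decide (e.1.2.1 ≤ -36 ∧ e.2.2.1 ≤ -36)) (by decide +kernel)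
      fun e he p hp => ?_
    rw [decide_eq_true_eq] at he
    simpa using (coord_of_mem_carrier hp).2.2.1 (-36) he.1 he.2

/-! ### Rounding the other underpass to a coil -/

/-- The strand of `underPt` on the cylinder about the second axis. -/
noncomputable def coilPt (q : ℕ) (y : ℝ) : R3 :=
  (24 * cosMul q (y / 24), y, 24 * sinMul q (y / 24))

@[fun_prop] theorem continuous_coilPt (q : ℕ) : Continuous (coilPt q) := by
  unfold coilPt; fun_prop

def axisFrame : List (List ZPt) := [[(0, -24, 0), (0, 24, 0)]]

def axisEnds : List (List ZPt) := [[(24, -36, 0), (0, -24, 0)], [(0, 24, 0), (-24, 36, 0)]]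

theorem axisPt_image' : axisPt '' Icc (-36) 36 = paths axisFrame ∪ paths axisEnds := by
  rw [axisPt_image, ← paths_append]
  exact carrier_eq_of_sameEdges (by decide +kernel)

/-- Widening the cross sections to circles never crosses the axis, since cosine and sine do not
vanish together. The bands lie beyond `x = -28`, outside the cylinder of radius `24`. -/
theorem isotopic_coilPt (q n : ℕ) :
    AmbientIsotopic
      ((bands n ∪ paths axisFrame ∪ paths (axisEnds ++ (hookFrame ++ (footFrame ++ restFrame)))) ∪ underArc q 1)
      ((bands n ∪ paths axisFrame ∪ paths (axisEnds ++ (hookFrame ++ (footFrame ++ restFrame)))) ∪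
        coilPt q '' Icc (-24) 24) := by
  have e1 : underPt q 1 (-24) = coilPt q (-24) := by
    simp [underPt, coilPt, sinMul_of_le]
  have e2 : underPt q 1 24 = coilPt q 24 := by
    simp [underPt, coilPt, sinMul_of_ge]
  have hlam : ∀ p : R3, dotL (0, 1, 0) p = p.2.1 := by simp
  refine isotopic_move (σ := underPt q 1) (lam := dotL (0, 1, 0)) (by norm_num) (by fun_prop) (by fun_prop)
    (by simp [underPt]) (by simp [coilPt]) e1 e2 ((Clear.union ?_ ?_).union ?_)
  · refine clear_of_compact (by fun_prop) (by fun_prop) (isCompact_bands n) fun p hp _ t ht h => ?_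
    have h1 := (bands_bound hp).1.2
    rw [h] at h1
    have h2 : |cosMul q (dotL (0, 1, 0) p / 24)| ≤ 1 := Real.abs_cos_le_one _
    simp [underPt, coilPt] at h1 h2
    linarith [abs_le.1 h2]
  · refine clear_of_compact (by fun_prop) (by fun_prop) (isCompact_paths _) ?_
    refine forall_mem_paths (ok := fun e => decide (((e.1.1 ≤ 0 ∧ e.2.1 ≤ 0) ∧ (0 ≤ e.1.1 ∧ 0 ≤ e.2.1)) ∧
      e.1.2.2 = 0 ∧ e.2.2.2 = 0)) (by decide +kernel) fun e he p hp _ t ht h => ?_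
    rw [decide_eq_true_eq] at he
    obtain ⟨c1, c2, -⟩ := coord_of_mem_carrier hp
    have hx : p.1 = 0 := le_antisymm (by simpa using c1 0 he.1.1.1 he.1.1.2) (by simpa using c2 0 he.1.2.1 he.1.2.2)
    have hz := edge_flat he.2 hp
    rw [hlam] at h
    simp only [underPt, coilPt, Prod.ext_iff, Prod.fst_add, Prod.snd_add, Prod.smul_fst,
      Prod.smul_snd, Prod.fst_sub, Prod.snd_sub, smul_eq_mul, hx, hz] at h
    obtain ⟨h1, -, h3⟩ := h
    have h5 := cosMul_sq_add_sinMul_sq q (p.2.1 / 24)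
    have h6 := sinMul_one_nonneg (p.2.1 / 24)
    have h7 := sinMul_one_le (p.2.1 / 24)
    have h8 := sinMul_eq_zero q (c := p.2.1 / 24)
    set C := cosMul q (p.2.1 / 24)
    set S := sinMul q (p.2.1 / 24)
    set w := sinMul 1 (p.2.1 / 24)
    have h9 : C = 0 := by linarith
    have h10 : (w + t * (1 - w)) * S = 0 := by linear_combination -(1 / 24) * h3
    have h11 : S ≠ 0 := by rintro h0; rw [h9, h0] at h5; norm_num at h5
    have h12 := (mul_eq_zero.1 h10).resolve_right h11
    exact h11 (h8 (by nlinarith [ht.1]))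
  · refine clear_of_outside e1 e2 ?_
    refine forall_mem_paths (ok := fun e => decide ((e.1.2.1 ≤ -24 ∧ e.2.2.1 ≤ -24) ∨
      (24 ≤ e.1.2.1 ∧ 24 ≤ e.2.2.1))) (by decide +kernel) fun e he p hp => ?_
    rw [decide_eq_true_eq] at he
    obtain ⟨-, -, c3, c4, -⟩ := coord_of_mem_carrier hp
    rcases he with h | h
    · left; simpa using c3 (-24) h.1 h.2
    · right; simpa using c4 24 h.1 h.2

/-! ### Evening out the coil -/

/-- The height of the point at angle `a` of the evened coil. -/
noncomputable def coilHeight (m : ℕ) (a : ℝ) : ℝ :=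
  24 - 8 / Real.pi * clamp 0 Real.pi a -
    20 / (Real.pi * m) * (clamp Real.pi ((2 * m + 1 : ℕ) * Real.pi) a - Real.pi)

theorem pi_le_odd_mul_pi (m : ℕ) : Real.pi ≤ (2 * m + 1 : ℕ) * Real.pi :=
  le_mul_of_one_le_left Real.pi_pos.le (by exact_mod_cast Nat.le_add_left 1 (2 * m))

theorem coilHeight_first (m : ℕ) {a : ℝ} (h : 0 ≤ a) (h' : a ≤ Real.pi) :
    coilHeight m a = 24 - 8 / Real.pi * a := by
  rw [coilHeight, clamp_of_mem ⟨h, h'⟩, clamp_of_le h']; simp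

theorem coilHeight_second (m : ℕ) {a : ℝ} (h : Real.pi ≤ a) (h' : a ≤ (2 * m + 1 : ℕ) * Real.pi) :
    coilHeight m a = 16 - 20 / (Real.pi * m) * (a - Real.pi) := by
  rw [coilHeight, clamp_of_ge Real.pi_pos.le h, clamp_of_mem ⟨h, h'⟩]
  field_simp
  ring

theorem antitone_coilHeight (m : ℕ) : Antitone (coilHeight m) := by
  intro a b h
  have h1 := mul_le_mul_of_nonneg_left (monotone_clamp 0 Real.pi h) (show 0 ≤ 8 / Real.pi by positivity)
  have h2 := mul_le_mul_of_nonneg_left (monotone_clamp Real.pi ((2 * m + 1 : ℕ) * Real.pi) h)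
    (show 0 ≤ 20 / (Real.pi * m) by positivity)
  simp only [coilHeight]
  linarith

theorem coilHeight_lt {m : ℕ} (hm : 1 ≤ m) {a b : ℝ} (ha : 0 ≤ a) (hab : a < b)
    (hb : b ≤ (2 * m + 1 : ℕ) * Real.pi) : coilHeight m b < coilHeight m a := by
  have hm' : (0 : ℝ) < m := by exact_mod_cast hm
  rcases le_total Real.pi a with h | h
  · rw [coilHeight_second m h (hab.le.trans hb), coilHeight_second m (h.trans hab.le) hb]
    have := mul_lt_mul_of_pos_left hab (show 0 < 20 / (Real.pi * m) by positivity)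
    linarith
  · have h1 : coilHeight m b ≤ coilHeight m (min b Real.pi) := antitone_coilHeight m (min_le_left _ _)
    have h2 : a < Real.pi → coilHeight m (min b Real.pi) < coilHeight m a := fun h' => by
      rw [coilHeight_first m ha h, coilHeight_first m (le_min (ha.trans hab.le) Real.pi_pos.le) (min_le_right _ _)]
      have := mul_lt_mul_of_pos_left (lt_min hab h') (show 0 < 8 / Real.pi by positivity)
      linarith
    rcases h.lt_or_eq with h3 | h3
    · exact h1.trans_lt (h2 h3)
    · rw [coilHeight_second m h3.ge (hab.le.trans hb), coilHeight_second m (h3.ge.trans hab.le) hb]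
      have := mul_lt_mul_of_pos_left hab (show 0 < 20 / (Real.pi * m) by positivity)
      linarith

theorem coilHeight_last {m : ℕ} (hm : 1 ≤ m) : coilHeight m ((2 * m + 1 : ℕ) * Real.pi) = -24 := by
  have hm' : (m : ℝ) ≠ 0 := by exact_mod_cast (show m ≠ 0 by omega)
  rw [coilHeight_second m (pi_le_odd_mul_pi m) le_rfl]
  push_cast
  field_simp
  ring

/-- The heights of the points of the coil after it is evened out. -/
noncomputable def coilMap (m : ℕ) (y : ℝ) : ℝ := coilHeight m ((2 * m + 1 : ℕ) * Real.arccos (y / 24))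

theorem continuous_coilMap (m : ℕ) : Continuous (coilMap m) := by
  have h : Continuous fun y : ℝ => Real.arccos (y / 24) := Real.continuous_arccos.comp (by fun_prop)
  unfold coilMap coilHeight
  fun_prop

theorem monotone_coilMap (m : ℕ) : Monotone (coilMap m) := by
  intro y z h
  refine antitone_coilHeight m (mul_le_mul_of_nonneg_left (Real.antitone_arccos ?_) (by positivity))
  linarith

theorem coilMap_top (m : ℕ) : coilMap m 24 = 24 := by
  rw [coilMap, Real.arccos_of_one_le (by norm_num), mul_zero, coilHeight_first m le_rfl Real.pi_pos.le]; simp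

theorem coilMap_bottom {m : ℕ} (hm : 1 ≤ m) : coilMap m (-24) = -24 := by
  rw [coilMap, Real.arccos_of_le_neg_one (by norm_num), coilHeight_last hm]

theorem coilMap_lt {m : ℕ} (hm : 1 ≤ m) {y z : ℝ} (hy : -24 ≤ y) (h : y < z) (hz : z ≤ 24) :
    coilMap m y < coilMap m z := by
  have h1 : Real.arccos (z / 24) < Real.arccos (y / 24) :=
    Real.strictAntiOn_arccos ⟨by linarith, by linarith⟩ ⟨by linarith, by linarith⟩ (by linarith)
  refine coilHeight_lt hm (mul_nonneg (by positivity) (Real.arccos_nonneg _))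
    (mul_lt_mul_of_pos_left h1 (by positivity))
    (mul_le_mul_of_nonneg_left (Real.arccos_le_pi _) (by positivity))

/-- The slide that evens out the coil and fixes the band. -/
noncomputable def coilShift (m : ℕ) (p : R3) : ℝ :=
  clamp 0 1 ((p.1 + 28) / 4) * (coilMap m (clamp (-24) 24 p.2.1) - clamp (-24) 24 p.2.1)

noncomputable def coilSlide (m : ℕ) (p : R3) : R3 := p + coilShift m p • (0, 1, 0)

theorem isotopic_coilSlide {m : ℕ} (hm : 1 ≤ m) (K : Set R3) : AmbientIsotopic K (coilSlide m '' K) := by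
  have hc := continuous_coilMap m
  have hI : (-24 : ℝ) ≤ 24 := by norm_num
  refine isotopic_slide (0, 1, 0) (g := coilShift m) (B := 48) ?_ ?_ ?_ K
  · unfold coilShift
    fun_prop
  · intro p
    have h1 := clamp_mem zero_le_one ((p.1 + 28) / 4)
    have h2 := clamp_mem hI p.2.1
    have h3 := monotone_coilMap m h2.1
    have h4 := monotone_coilMap m h2.2
    rw [coilMap_bottom hm] at h3
    rw [coilMap_top] at h4
    have h5 : |coilMap m (clamp (-24) 24 p.2.1) - clamp (-24) 24 p.2.1| ≤ 48 :=
      abs_le.2 ⟨by linarith [h2.2], by linarith [h2.1]⟩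
    rw [coilShift, abs_mul, abs_of_nonneg h1.1]
    exact (mul_le_of_le_one_left (abs_nonneg _) h1.2).trans h5
  · intro p r r' h
    simp only [coilShift, Prod.fst_add, Prod.snd_add, Prod.smul_fst, Prod.smul_snd, smul_eq_mul,
      mul_zero, mul_one, add_zero]
    have h1 := clamp_mem zero_le_one ((p.1 + 28) / 4)
    set χ := clamp 0 1 ((p.1 + 28) / 4)
    have h' : p.2.1 + r < p.2.1 + r' := by linarith
    -- With the full cutoff the slide replaces the height by a strictly increasing function of it;
    -- with a partial cutoff it is a convex combination of that function and the identity.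
    have key : r + (coilMap m (clamp (-24) 24 (p.2.1 + r)) - clamp (-24) 24 (p.2.1 + r)) <
        r' + (coilMap m (clamp (-24) 24 (p.2.1 + r')) - clamp (-24) 24 (p.2.1 + r')) := by
      rcases (monotone_clamp (-24) 24 h'.le).lt_or_eq with h2 | h2
      · have h3 := coilMap_lt hm (clamp_mem hI _).1 h2 (clamp_mem hI _).2
        have h4 := clamp_sub_le (l := -24) (r := 24) h'.le
        linarith
      · rw [h2]; linarith
    rcases h1.1.lt_or_eq with h2 | h2
    · nlinarith [mul_pos h2 (sub_pos.2 key), mul_nonneg (sub_nonneg.2 h1.2) (sub_pos.2 h).le]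
    · rw [← h2]; linarith

theorem coilSlide_of_le (m : ℕ) {p : R3} (h : p.1 ≤ -28) : coilSlide m p = p := by
  rw [coilSlide, coilShift, clamp_of_le (by linarith)]; simp

theorem coilSlide_of_far {m : ℕ} (hm : 1 ≤ m) {p : R3} (h : p.2.1 ≤ -24 ∨ 24 ≤ p.2.1) : coilSlide m p = p := by
  rw [coilSlide, coilShift]
  rcases h with h | h
  · rw [clamp_of_le h, coilMap_bottom hm]; simp
  · rw [clamp_of_ge (by norm_num) h, coilMap_top]; simp

theorem coilSlide_of_mem (m : ℕ) {x y z : ℝ} (hx : -24 ≤ x) (hy : y ∈ Icc (-24 : ℝ) 24) :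
    coilSlide m (x, y, z) = (x, coilMap m y, z) := by
  rw [coilSlide, coilShift, clamp_of_ge zero_le_one (by simp only; linarith), clamp_of_mem hy]
  ext <;> simp

theorem coilSlide_axis {m : ℕ} (hm : 1 ≤ m) : coilSlide m '' paths axisFrame = paths axisFrame := by
  have h : paths axisFrame = (fun y : ℝ => ((0, y, 0) : R3)) '' Icc (-24) 24 := by
    rw [image_Icc_eq_segment (p := (0, -24, 0)) (q := (0, 24, 0)) (by norm_num), axisFrame, paths_cons, paths_nil]
    · simp [polygonalPath, ZPt.toR]
    · intro y _
      ext <;> simp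
  rw [h, image_image, image_comp_Icc (fun y : ℝ => ((0, y, 0) : R3)) (continuous_coilMap m) (monotone_coilMap m)
    (by norm_num) (fun y hy => coilSlide_of_mem m (by norm_num) hy), coilMap_bottom hm, coilMap_top]

/-- The half turn of the coil in the clasp. -/
noncomputable def claspTurn : Set R3 := halfTurn (0, 24, 0) (-24, 0, 0) (0, 0, 24) (0, -8, 0) '' Icc 0 1

/-- The first half turn of the coil is given the height interval from `24` to `16` and becomes part
of the clasp; the other `2 * m` half turns are spread uniformly down to `-24`. The negated angle
serves as parameter because it increases with the height. -/
theorem coilSlide_coil {m : ℕ} (hm : 1 ≤ m) :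
    coilSlide m '' (coilPt (2 * m + 1) '' Icc (-24) 24) = uprightHelix m ∪ claspTurn := by
  have hm' : (m : ℝ) ≠ 0 := by exact_mod_cast (show m ≠ 0 by omega)
  set q : ℕ := 2 * m + 1 with hq
  set g : ℝ → R3 := fun u => (24 * Real.cos (-u), coilHeight m (-u), 24 * Real.sin (-u))
  have h1 : (fun y => coilSlide m (coilPt q y)) '' Icc (-24) 24 =
      g '' Icc (-((2 * m + 1 : ℕ) * Real.pi)) 0 := by
    have hf : Continuous fun y : ℝ => -((q : ℝ) * Real.arccos (y / 24)) :=
      (continuous_const.mul (Real.continuous_arccos.comp (by fun_prop))).neg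
    have hmono : Monotone fun y : ℝ => -((q : ℝ) * Real.arccos (y / 24)) := fun y z h =>
      neg_le_neg (mul_le_mul_of_nonneg_left (Real.antitone_arccos (by linarith)) (by positivity))
    rw [image_comp_Icc g hf hmono (by norm_num)]
    · rw [Real.arccos_of_le_neg_one (by norm_num), Real.arccos_of_one_le (by norm_num)]; simp [hq]
    · intro y hy
      have hC := abs_le.1 (Real.abs_cos_le_one (q * Real.arccos (y / 24)))
      rw [coilPt, coilSlide_of_mem m (by simp only [cosMul]; linarith) hy]
      simp only [g, neg_neg, cosMul, sinMul, coilMap, hq]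
  rw [image_image, h1, image_Icc_union g (neg_le_neg (pi_le_odd_mul_pi m)) (neg_nonpos.2 Real.pi_pos.le)]
  congr 1
  · let h : ℝ → R3 := fun s =>
      (-(24 * Real.cos (Real.pi * (2 * m) * s)), 16 - 40 * s, -(24 * Real.sin (Real.pi * (2 * m) * s)))
    refine (image_Icc_eq_image_unit (g := fun s => h (1 - s)) ?_ ?_).trans (image_one_sub_unit h)
    · rw [neg_lt_neg_iff]; push_cast
      have : (0 : ℝ) < m := by positivity
      nlinarith [Real.pi_pos, mul_pos this Real.pi_pos]
    · intro u hu
      simp only [g, h]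
      rw [coilHeight_second m (by linarith [hu.2]) (by linarith [hu.1])]
      have e : -u = Real.pi * (2 * m) * (1 - (u - -((2 * m + 1 : ℕ) * Real.pi)) /
          (-Real.pi - -((2 * m + 1 : ℕ) * Real.pi))) + Real.pi := by
        push_cast; field_simp; ring
      have e2 : (1 - (u - -((2 * m + 1 : ℕ) * Real.pi)) /
          (-Real.pi - -((2 * m + 1 : ℕ) * Real.pi))) = (-u - Real.pi) / (2 * m * Real.pi) := by
        push_cast; field_simp; ring
      rw [e2] at e ⊢
      ext
      · simp only
        conv_lhs => rw [e, Real.cos_add_pi]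
        ring
      · simp only
        field_simp
        ring
      · simp only
        conv_lhs => rw [e, Real.sin_add_pi]
        ring
  · rw [image_Icc_eq_image_unit (g := fun s => halfTurn (0, 24, 0) (-24, 0, 0) (0, 0, 24) (0, -8, 0) (1 - s)),
      image_one_sub_unit (halfTurn (0, 24, 0) (-24, 0, 0) (0, 0, 24) (0, -8, 0)), claspTurn]
    · linarith [Real.pi_pos]
    · intro u hu
      simp only [g]
      rw [coilHeight_first m (by linarith [hu.2]) (by linarith [hu.1])]
      have e2 : 1 - (u - -Real.pi) / (0 - -Real.pi) = -u / Real.pi := by field_simp; ring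
      rw [e2, halfTurn, mul_div_cancel₀ _ Real.pi_pos.ne']
      ext
      · simp; ring
      · simp; ring
      · simp; ring

/-- The polygonal strands away from the band and the coil. -/
def sideFrame : List (List ZPt) := axisEnds ++ (hookFrame ++ (footFrame ++ restFrame))

/-- The slide has bounded support in height and is cut off between `x = -28` and `x = -24`, so bands
and side strands are fixed pointwise; the axis is only reparametrised. -/
theorem isotopic_claspTurn {m : ℕ} (hm : 1 ≤ m) (n : ℕ) :
    AmbientIsotopic
      ((bands n ∪ paths axisFrame ∪ paths sideFrame) ∪ coilPt (2 * m + 1) '' Icc (-24) 24)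
      ((bands n ∪ paths axisFrame ∪ paths sideFrame) ∪ (uprightHelix m ∪ claspTurn)) := by
  refine (isotopic_coilSlide hm _).trans ?_
  rw [image_union, image_union, image_union, coilSlide_axis hm, coilSlide_coil hm]
  have h1 : coilSlide m '' bands n = bands n := by
    rw [image_congr (g := id), image_id]
    exact fun p hp => coilSlide_of_le m (bands_bound hp).1.2
  have h2 : coilSlide m '' paths sideFrame = paths sideFrame := by
    rw [image_congr (g := id), image_id]
    refine forall_mem_paths (ok := fun e => decide ((e.1.2.1 ≤ -24 ∧ e.2.2.1 ≤ -24) ∨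
      (24 ≤ e.1.2.1 ∧ 24 ≤ e.2.2.1))) (by decide +kernel) fun e he p hp => coilSlide_of_far hm ?_
    rw [decide_eq_true_eq] at he
    obtain ⟨-, -, c3, c4, -⟩ := coord_of_mem_carrier hp
    rcases he with h | h
    · left; simpa using c3 (-24) h.1 h.2
    · right; simpa using c4 24 h.1 h.2
  rw [h1, h2]
  exact AmbientIsotopic.refl _

theorem flatFrame_flat : ∀ p ∈ paths (axisFrame ++ sideFrame), p.2.2 = 0 :=
  forall_mem_paths (ok := fun e => decide (e.1.2.2 = 0 ∧ e.2.2.2 = 0)) (by decide +kernel)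
    fun _ he _ hp => edge_flat (of_decide_eq_true he) hp

def turnFrame : List (List ZPt) := [[(24, 24, 0), (0, 20, 24), (-24, 16, 0)]]

/-- The split-off half turn lies above the plane `z = 0`. The frame lies in that plane and the
vertical helix enters these levels only with its end point. The bands are excluded by their first
coordinate. -/
theorem isotopic_turnFrame (m n : ℕ) :
    AmbientIsotopic
      (bands n ∪ (paths (axisFrame ++ sideFrame) ∪ uprightHelix m) ∪ claspTurn)
      (bands n ∪ (paths (axisFrame ++ sideFrame) ∪ uprightHelix m) ∪ paths turnFrame) := by
  have h : paths turnFrame = segment ℝ ((0, 24, 0) - (-24, 0, 0)) ((0, 24, 0) + (1 / 2 : ℝ) • (0, -8, 0) + (0, 0, 24)) ∪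
      segment ℝ ((0, 24, 0) + (1 / 2 : ℝ) • (0, -8, 0) + (0, 0, 24)) ((0, 24, 0) + (0, -8, 0) + (-24, 0, 0)) := by
    rw [turnFrame, paths_cons, paths_nil]
    simp only [List.map_cons, List.map_nil, polygonalPath, ZPt.toR, union_empty]
    norm_num
  rw [h]
  have hlam : ∀ p : R3, dotL (0, -1, 0) p = -p.2.1 := by simp
  refine isotopic_halfTurn_of_clear (lam := dotL (0, -1, 0)) (by simp) (by simp) (by simp)
    (Clear.union ?_ (clear_halfTurn (ℓ := dotL (0, 0, 1)) (by simp) (by simp) (by simp) (by simp) ?_))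
  · refine clear_of_compact (by simp only [halfTurn]; fun_prop) (by simp only [tentPath]; fun_prop)
      (isCompact_bands n) fun p hp hx t ht h => ?_
    have h1 := (bands_bound hp).1.2
    set s := (dotL (0, -1, 0) p - dotL (0, -1, 0) (0, 24, 0)) / dotL (0, -1, 0) (0, -8, 0) with hs
    have hs01 : 0 ≤ s ∧ s ≤ 1 := by
      simp at hx hs
      rw [hs]; constructor <;> linarith
    have h2 := abs_le.1 (Real.abs_cos_le_one (Real.pi * s))
    rw [h, tentPath_halfTurn, halfTurn] at h1
    simp at h1
    nlinarith [ht.1, ht.2]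
  · rintro p (hp | ⟨s, hs, rfl⟩) - hx
    · simp [flatFrame_flat p hp]
    · simp at hx
      have : s = 0 := by linarith [hs.1]
      simp [this]

/-! ### Straightening one strand of the band -/

/-- The strand of the band along its core. -/
noncomputable def corePt (x : ℝ) : R3 :=
  (x, 6 * (clamp (-32) (-28) x + 32) + 3 * (clamp (-88) (-80) x + 80), 0)

@[fun_prop] theorem continuous_corePt : Continuous corePt := by
  unfold corePt; fun_prop

theorem corePt_right {x : ℝ} (h : -32 ≤ x) (h' : x ≤ -28) : corePt x = (x, 6 * (x + 32), 0) := by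
  rw [corePt, clamp_of_mem ⟨h, h'⟩, clamp_of_ge (by norm_num) (by linarith)]; norm_num

theorem corePt_mid {x : ℝ} (h : -80 ≤ x) (h' : x ≤ -32) : corePt x = (x, 0, 0) := by
  rw [corePt, clamp_of_le h', clamp_of_ge (by norm_num) h]; norm_num

theorem corePt_left {x : ℝ} (h : -88 ≤ x) (h' : x ≤ -80) : corePt x = (x, 3 * (x + 80), 0) := by
  rw [corePt, clamp_of_le (by linarith), clamp_of_mem ⟨h, h'⟩]; norm_num

def coreFrame : List (List ZPt) := [[(-28, 24, 0), (-32, 0, 0), (-80, 0, 0), (-88, -24, 0)]]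

theorem corePt_image : corePt '' Icc (-88) (-28) = paths coreFrame := by
  have h : paths coreFrame = paths [[(-88, -24, 0), (-80, 0, 0), (-32, 0, 0), (-28, 24, 0)]] :=
    carrier_eq_of_sameEdges (by decide +kernel)
  rw [h, image_Icc_union corePt (a := -88) (b := -80) (c := -28) (by norm_num) (by norm_num),
    image_Icc_union corePt (a := -80) (b := -32) (c := -28) (by norm_num) (by norm_num),
    image_Icc_eq_segment (p := (-88, -24, 0)) (q := (-80, 0, 0)) (by norm_num),
    image_Icc_eq_segment (p := (-80, 0, 0)) (q := (-32, 0, 0)) (by norm_num),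
    image_Icc_eq_segment (p := (-32, 0, 0)) (q := (-28, 24, 0)) (by norm_num), paths_cons, paths_nil, union_empty]
  · simp [polygonalPath, ZPt.toR]
  · intro x hx
    rw [corePt_right hx.1 hx.2]; ext <;> simp <;> ring
  · intro x hx
    rw [corePt_mid hx.1 hx.2]; ext <;> simp
    ring
  · intro x hx
    rw [corePt_left hx.1 hx.2]; ext <;> simp <;> ring

/-- The part of the frame beside the band. -/
def farFrame : List (List ZPt) :=
  [[(-32, -24, 0), (-24, -24, 0)], [(-88, 48, 0), (-24, 48, 0), (24, 48, 0)],
    [(-88, -48, 0), (-24, -48, 0), (24, -48, 0)]]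

/-- The part of the frame at the ends of the band. -/
def nearFrame : List (List ZPt) :=
  axisFrame ++ (axisEnds ++ (hookFrame ++ (footFrame ++ (turnFrame ++
    [[(-88, 24, 0), (-88, 48, 0)], [(24, 48, 0), (24, 24, 0)], [(-88, -24, 0), (-88, -48, 0)]]))))

theorem corePt_swept (n : ℕ) {x t : ℝ} (ht : t ∈ Icc (0 : ℝ) 1) (hx : x ∈ Icc (-88 : ℝ) (-28)) :
    |(bandPt n 1 x + t • (corePt x - bandPt n 1 x)).2.1| ≤ 24 ∧
      (-32 ≤ x → 0 ≤ (bandPt n 1 x + t • (corePt x - bandPt n 1 x)).2.1) := by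
  have hC := abs_le.1 (Real.abs_cos_le_one (bandAngle n x))
  have hτ : -24 ≤ (corePt x).2.1 ∧ (corePt x).2.1 ≤ 24 := by
    rcases le_total (-32) x with h | h
    · rw [corePt_right h hx.2]; simp only; constructor <;> linarith [hx.2]
    · rcases le_total x (-80) with h' | h'
      · rw [corePt_left hx.1 h']; simp only; constructor <;> linarith [hx.1]
      · rw [corePt_mid h' h]; norm_num
  have hσ : (bandPt n 1 x).2.1 = 24 * Real.cos (bandAngle n x) := by simp [bandPt]
  simp only [Prod.snd_add, Prod.fst_add, Prod.smul_fst, Prod.smul_snd, Prod.fst_sub, Prod.snd_sub, smul_eq_mul]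
  refine ⟨abs_le.2 ⟨?_, ?_⟩, fun h => ?_⟩
  · rw [hσ]; nlinarith [ht.1, ht.2]
  · rw [hσ]; nlinarith [ht.1, ht.2]
  · rw [bandPt_of_ge n _ h, corePt_right h hx.2]; simp only; nlinarith [ht.1, ht.2]

/-- The other strand of the band is opposite to the moving one, so pulling the latter to the core
never crosses it. The two ends of the core path slope back to the fixed end points. -/
theorem isotopic_corePt (m n : ℕ) :
    AmbientIsotopic
      (((bandPt n (-1) '' Icc (-88) (-32) ∪ paths farFrame) ∪ (paths nearFrame ∪ uprightHelix m)) ∪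
        bandPt n 1 '' Icc (-88) (-28))
      (((bandPt n (-1) '' Icc (-88) (-32) ∪ paths farFrame) ∪ (paths nearFrame ∪ uprightHelix m)) ∪
        corePt '' Icc (-88) (-28)) := by
  have e1 : bandPt n 1 (-88) = corePt (-88) := by
    rw [bandPt_of_le n _ (by norm_num), corePt_left (by norm_num) (by norm_num)]; norm_num
  have e2 : bandPt n 1 (-28) = corePt (-28) := by
    rw [bandPt_of_ge n _ (by norm_num), corePt_right (by norm_num) (by norm_num)]; norm_num
  have hlam : ∀ p : R3, dotL (1, 0, 0) p = p.1 := by simp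
  refine isotopic_move (lam := dotL (1, 0, 0)) (by norm_num) (by fun_prop) (by fun_prop)
    (by simp [bandPt]) (by simp [corePt]) e1 e2 ((Clear.union ?_ ?_).union ?_)
  · refine clear_of_compact (by fun_prop) (by fun_prop) (isCompact_Icc.image (by fun_prop)) ?_
    rintro _ ⟨x, hx, rfl⟩ - t ht h
    rw [hlam] at h
    -- At the left end the core path deviates towards the side where the moving strand already lies,
    -- hence away from the opposite one.
    have hτ : 0 ≤ Real.cos (bandAngle n x) * (corePt x).2.1 := by
      rcases le_total x (-80) with h' | h'
      · rw [corePt_left hx.1 h', bandAngle_of_le n h', odd_cos]; simp only; linarith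
      · rw [corePt_mid h' hx.2]; simp
    have hz : (corePt x).2.2 = 0 := rfl
    have h0 := Real.cos_sq_add_sin_sq (bandAngle n x)
    simp only [bandPt, Prod.ext_iff, Prod.fst_add, Prod.snd_add, Prod.smul_fst,
      Prod.smul_snd, Prod.fst_sub, Prod.snd_sub, smul_eq_mul, hz] at h
    obtain ⟨-, h1, h2⟩ := h
    set C := Real.cos (bandAngle n x)
    set S := Real.sin (bandAngle n x)
    have h9 : (2 - t) ≠ 0 := by linarith [ht.2]
    have h10 : S = 0 := (mul_eq_zero.1 (show (2 - t) * S = 0 by linear_combination (1 / 24) * h2)).resolve_left h9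
    have h11 : C ^ 2 = 1 := by rw [h10] at h0; linarith
    have h12 : (2 - t) * 24 + t * (C * (corePt x).2.1) = 0 := by
      linear_combination -C * h1 - (2 - t) * 24 * h11
    nlinarith [ht.1, ht.2, mul_nonneg ht.1 hτ]
  · refine clear_of_compact (by fun_prop) (by fun_prop) (isCompact_paths _) ?_
    refine forall_mem_paths (ok := fun e => decide ((48 ≤ e.1.2.1 ∧ 48 ≤ e.2.2.1) ∨
      (e.1.2.1 ≤ -48 ∧ e.2.2.1 ≤ -48) ∨ ((-32 ≤ e.1.1 ∧ -32 ≤ e.2.1) ∧ (e.1.2.1 ≤ -24 ∧ e.2.2.1 ≤ -24))))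
      (by decide +kernel) fun e he p hp hx t ht h => ?_
    rw [decide_eq_true_eq] at he
    obtain ⟨c1, c2, c3, c4, -⟩ := coord_of_mem_carrier hp
    rw [hlam] at hx h
    obtain ⟨h1, h2⟩ := corePt_swept n ht hx
    rw [← h] at h1 h2
    have h1 := abs_le.1 h1
    rcases he with h' | h' | ⟨h', h''⟩
    · have := c4 48 h'.1 h'.2
      push_cast at this
      linarith [h1.2]
    · have := c3 (-48) h'.1 h'.2
      push_cast at this
      linarith [h1.1]
    · have h3 := c2 (-32) h'.1 h'.2
      have h4 := c3 (-24) h''.1 h''.2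
      push_cast at h3 h4
      linarith [h2 h3]
  · refine clear_of_outside e1 e2 ?_
    rintro p (hp | ⟨s, -, rfl⟩)
    · revert p
      refine forall_mem_paths (ok := fun e => decide ((e.1.1 ≤ -88 ∧ e.2.1 ≤ -88) ∨
        (-28 ≤ e.1.1 ∧ -28 ≤ e.2.1))) (by decide +kernel) fun e he p hp => ?_
      rw [decide_eq_true_eq] at he
      obtain ⟨c1, c2, -⟩ := coord_of_mem_carrier hp
      rcases he with h | h
      · left; simpa using c1 (-88) h.1 h.2
      · right; simpa using c2 (-28) h.1 h.2
    · right
      rw [hlam]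
      linarith [Real.cos_le_one (Real.pi * (2 * m) * s)]

/-- The first half turn of the other strand of the band. -/
noncomputable def bandTurn : Set R3 := halfTurn (-32, 0, 0) (0, 24, 0) (0, 0, 24) (-8, 0, 0) '' Icc 0 1

/-- One half turn next to the pillowcase is split off, so that the remaining helix makes an even
number of half turns. -/
theorem bandPt_neg_image (n : ℕ) : bandPt n (-1) '' Icc (-88) (-32) =
    segment ℝ (-88, 24, 0) (-80, 24, 0) ∪ (helix (-80) 40 24 0 (2 * n) ∪ bandTurn) := by
  rw [image_Icc_union (bandPt n (-1)) (a := -88) (b := -80) (c := -32) (by norm_num) (by norm_num),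
    image_Icc_union (bandPt n (-1)) (a := -80) (b := -40) (c := -32) (by norm_num) (by norm_num)]
  congr 1
  · refine image_Icc_eq_segment (by norm_num) fun x hx => ?_
    rw [bandPt_of_le n _ hx.2]
    ext <;> simp
    ring
  congr 1
  · rw [show (-40 : ℝ) = -80 + 40 by norm_num]
    refine image_Icc_eq_helix (by norm_num) fun s hs => ?_
    have e : bandAngle n (-80 + 40 * s) = n * (2 * Real.pi) - (0 + Real.pi * (2 * n) * s) + Real.pi := by
      rw [bandAngle_second n (by linarith [hs.1]) (by linarith [hs.2])]; ring
    rw [bandPt, e, Real.cos_add_pi, Real.sin_add_pi, Real.cos_nat_mul_two_pi_sub, Real.sin_nat_mul_two_pi_sub,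
      helixPt]
    ext <;> simp
  · refine (image_Icc_eq_image_unit (g := fun s => halfTurn (-32, 0, 0) (0, 24, 0) (0, 0, 24) (-8, 0, 0) (1 - s))
      (by norm_num) ?_).trans (image_one_sub_unit _)
    intro x hx
    have e : 1 - (x - -40) / (-32 - -40) = (-32 - x) / 8 := by ring
    rw [e, bandPt, bandAngle_first n hx.1 hx.2, halfTurn]
    ext <;> simp <;> ring

def bandTurnFrame : List (List ZPt) := [[(-32, -24, 0), (-36, 0, 24), (-40, 24, 0)]]

def bandEndFrame : List (List ZPt) := [[(-88, 24, 0), (-80, 24, 0)]]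

/-- The remaining half turn lies above the plane `z = 0`, and over its interval everything else lies
in that plane; the pieces of the clasp leaving the plane have `x ≥ -24`. -/
theorem isotopic_bandTurn (m n : ℕ) :
    AmbientIsotopic
      ((helix (-80) 40 24 0 (2 * n) ∪ uprightHelix m) ∪
        paths (bandEndFrame ++ (coreFrame ++ (farFrame ++ nearFrame))) ∪ bandTurn)
      ((helix (-80) 40 24 0 (2 * n) ∪ uprightHelix m) ∪
        paths (bandEndFrame ++ (coreFrame ++ (farFrame ++ nearFrame))) ∪ paths bandTurnFrame) := by
  have h : paths bandTurnFrame = segment ℝ ((-32, 0, 0) - (0, 24, 0)) ((-32, 0, 0) + (1 / 2 : ℝ) • (-8, 0, 0) + (0, 0, 24)) ∪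
      segment ℝ ((-32, 0, 0) + (1 / 2 : ℝ) • (-8, 0, 0) + (0, 0, 24)) ((-32, 0, 0) + (-8, 0, 0) + (0, 24, 0)) := by
    rw [bandTurnFrame, paths_cons, paths_nil]
    simp only [List.map_cons, List.map_nil, polygonalPath, ZPt.toR, union_empty]
    norm_num
  rw [h]
  refine isotopic_halfTurn (lam := dotL (-1, 0, 0)) (ℓ := dotL (0, 0, 1)) (by simp) (by simp) (by simp)
    (by simp) (by simp) (by simp) ?_
  rintro p ((hp | ⟨s, -, rfl⟩) | hp) hx hx'
  · simp at hx'
    rw [helix_end (by norm_num) hp (by linarith)]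
    have := Real.sin_nat_mul_two_pi_sub 0 n
    simp only [sub_zero, Real.sin_zero, neg_zero] at this
    simp [helixPt, show Real.pi * (2 * n) = n * (2 * Real.pi) by ring, this]
  · simp at hx
    linarith [Real.cos_le_one (Real.pi * (2 * m) * s)]
  · rw [dotL_apply] at hx hx'
    simp at hx
    suffices h : p.2.2 = 0 ∨ -24 ≤ p.1 by
      rcases h with h | h
      · simp [h]
      · linarith
    clear hx hx'
    revert p
    refine forall_mem_paths (ok := fun e => decide ((e.1.2.2 = 0 ∧ e.2.2.2 = 0) ∨
      (-24 ≤ e.1.1 ∧ -24 ≤ e.2.1))) (by decide +kernel) fun e he p hp => ?_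
    rw [decide_eq_true_eq] at he
    rcases he with h | h
    · exact Or.inl (edge_flat h hp)
    · exact Or.inr (by simpa using (coord_of_mem_carrier hp).2.1 (-24) h.1 h.2)

theorem checkMoves_clasp : checkMoves [((-100, -100, -100), (100, 100, 100))]
    [0, -88, 48, 0, -24, 48, 0, 24, 48, 0, 0, -88, -48, 0, -24, -48, 0, 24, -48, 0,
      1, 0, -24, 0, 0, 16, 0, 0, 24, 0, 1, -32, 0, 0, -40, 0, 0, -80, 0, 0]
    (bandEndFrame ++ (coreFrame ++ (farFrame ++ nearFrame)) ++ bandTurnFrame) claspFrame = true := by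
  decide +kernel

theorem isotopic_coreFrame (m n : ℕ) :
    AmbientIsotopic (bands n ∪ (paths (axisFrame ++ sideFrame) ∪ uprightHelix m) ∪ paths turnFrame)
      (claspModel m n) := by
  have h1 : paths (axisFrame ++ sideFrame) ∪ paths turnFrame = paths farFrame ∪ paths nearFrame := by
    rw [← paths_append, ← paths_append]
    exact carrier_eq_of_sameEdges (by decide +kernel)
  have h2 : bands n ∪ (paths (axisFrame ++ sideFrame) ∪ uprightHelix m) ∪ paths turnFrame =
      ((bandPt n (-1) '' Icc (-88) (-32) ∪ paths farFrame) ∪ (paths nearFrame ∪ uprightHelix m)) ∪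
        bandPt n 1 '' Icc (-88) (-28) := by
    rw [show ∀ A B C D : Set R3, A ∪ (B ∪ C) ∪ D = A ∪ ((B ∪ D) ∪ C) from fun A B C D => by
      ext p; simp only [mem_union]; tauto, h1, bands]
    ext p; simp only [mem_union]; tauto
  have h3 : ((bandPt n (-1) '' Icc (-88) (-32) ∪ paths farFrame) ∪ (paths nearFrame ∪ uprightHelix m)) ∪
        corePt '' Icc (-88) (-28) = (helix (-80) 40 24 0 (2 * n) ∪ uprightHelix m) ∪
        paths (bandEndFrame ++ (coreFrame ++ (farFrame ++ nearFrame))) ∪ bandTurn := by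
    have h4 : paths bandEndFrame = segment ℝ (-88, 24, 0) (-80, 24, 0) := by
      rw [bandEndFrame, paths_cons, paths_nil]
      simp [polygonalPath, ZPt.toR]
    rw [corePt_image, bandPt_neg_image, paths_append, paths_append, paths_append, h4]
    ext p; simp only [mem_union]; tauto
  rw [h2]
  refine (isotopic_corePt m n).trans ?_
  rw [h3]
  refine (isotopic_bandTurn m n).trans ?_
  rw [union_assoc, ← paths_append]
  refine isotopic_of_checkMoves ?_ checkMoves_clasp
  rintro p (hp | ⟨s, hs, rfl⟩)
  · obtain ⟨h5, h6, h7⟩ := mem_box_of_mem_helix (by norm_num) (by norm_num) hp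
    refine ⟨_, List.mem_singleton_self _, ?_⟩
    simp only [ZEdge.box, mem_ofPred_eq]
    push_cast
    refine ⟨⟨?_, ?_⟩, ⟨?_, ?_⟩, ?_, ?_⟩ <;> linarith [h5.1, h5.2, h6.1, h6.2, h7.1, h7.2]
  · have h5 := abs_le.1 (Real.abs_cos_le_one (Real.pi * (2 * m) * s))
    have h6 := abs_le.1 (Real.abs_sin_le_one (Real.pi * (2 * m) * s))
    refine ⟨_, List.mem_singleton_self _, ?_⟩
    simp only [ZEdge.box, mem_ofPred_eq]
    push_cast
    refine ⟨⟨?_, ?_⟩, ⟨?_, ?_⟩, ?_, ?_⟩ <;> linarith [hs.1, hs.2, h5.1, h5.2, h6.1, h6.2]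

theorem isotopic_schubertLink_claspModel {m n p : ℕ} (hm : 1 ≤ m)
    (h : (2 * m + 1) * (2 * n + 1) = p + 1) :
    AmbientIsotopic (schubertLink p (2 * m + 1 : ℕ)) (claspModel m n) := by
  have hk := odd_two_mul_add_one n
  have hq := odd_two_mul_add_one m
  refine (isotopic_schubertLink hk h).trans ((isotopic_outerArcs _ _).trans ((isotopic_unwound n _).trans
    ((isotopic_unwound_hook hq n).trans ((isotopic_axisPt hq n).trans ?_))))
  have h1 : (underArc (2 * m + 1) 1 ∪ (bands n ∪ paths restFrame) ∪ paths hookFrame ∪ paths footFrame) ∪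
      axisPt '' Icc (-36) 36 = (bands n ∪ paths axisFrame ∪
        paths (axisEnds ++ (hookFrame ++ (footFrame ++ restFrame)))) ∪ underArc (2 * m + 1) 1 := by
    rw [axisPt_image', paths_append, paths_append, paths_append]
    ext p; simp only [mem_union]; tauto
  rw [h1]
  refine (isotopic_coilPt _ n).trans ((isotopic_claspTurn hm n).trans ?_)
  have h2 : (bands n ∪ paths axisFrame ∪ paths sideFrame) ∪ (uprightHelix m ∪ claspTurn) =
      bands n ∪ (paths (axisFrame ++ sideFrame) ∪ uprightHelix m) ∪ claspTurn := by
    rw [paths_append]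
    ext p; simp only [mem_union]; tauto
  rw [h2]
  exact (isotopic_turnFrame m n).trans (isotopic_coreFrame m n)

/-! ### Conclusion -/

theorem mainTheorem5 (m n : ℕ) (hm : 1 ≤ m) (hn : 1 ≤ n) :
    AmbientIsotopic
      (patternMeridianLink (generalizedMazurPattern m n))
      (conwayLink [2 * (n : ℤ), 1, 2 * (m : ℤ)]) ∧
    HasSchubertNormalForm
      (patternMeridianLink (generalizedMazurPattern m n))
      (4 * (m : ℤ) * n + 2 * n + 2 * m) (2 * (m : ℤ) + 1) := by
  have hm' : (1 : ℤ) ≤ m := by exact_mod_cast hm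
  have hn' : (1 : ℤ) ≤ n := by exact_mod_cast hn
  have hpat := isotopic_patternMeridianLink_commonModel hm hn
  refine ⟨hpat.trans (isotopic_conwayLink_commonModel m n).symm, by positivity,
    -- The Bézout relation `(2 * n + 1) * (2 * m + 1) - p = 1` gives coprimality, and is the same
    -- identity that drives the shear of the pillowcase.
    ⟨-1, 2 * n + 1, by ring⟩, by positivity, ?_, ?_⟩
  · rw [abs_of_nonneg (by positivity)]
    nlinarith
  · refine hpat.trans ((isotopic_claspModel_commonModel m n).symm.trans ?_)
    have h := isotopic_schubertLink_claspModel (n := n) (p := 4 * m * n + 2 * n + 2 * m) hm (by ring)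
    push_cast at h
    exact h.symm
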